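/- Let $M$ be a smooth oriented surface, $r\ge 5$, and $\alpha:M\to\mathbb R^3$ a $C^r$ immersion with Gauss map $N$, $I=\langle D\alpha,D\alpha\rangle$. The principal curvatures at $q\in M$ are the $\kappa$ with $DN(w)+\kappa D\alpha(w)=0$ for some $w\in T_qM\setminus 0$; $q$ is umbilic if there is only one. Elsewhere, the eigenspaces of the smaller and the larger one are the minimal and maximal principal line fields, whose integral curves form the two principal foliations. Let $\mathbb L_\alpha=\{\tau_g=0\}$ in the projective tangent bundle $\Pi:\mathbb PM\to M$, where $\tau_g([w])=\langle DN(w)\wedge D\alpha(w),N\rangle/I(w,w)$ is the geodesic torsion. Let $p\in M$, and suppose that in a $C^r$ chart $(u,v)$ with $p=(0,0)$ and up to an isometry of $\mathbb R^3$ the immersion is $(u,v)\mapsto(u,v,h(u,v))$ with $$h=\tfrac k2(u^2+v^2)+\tfrac a6u^3+\tfrac b2uv^2+\tfrac c6v^3+\tfrac A{24}u^4+\tfrac B6u^3v+\tfrac C4u^2v^2+\tfrac D6uv^3+\tfrac E{24}v^4+O((u^2+v^2)^{5/2})$$ (so $p$ is umbilic), where $a=b\neq0$ and $b(C-A+2k^3)-cB\neq0$.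 Put $\mathcal T(u,v,m)=\lambda m^2+\mu m+\nu$ with $m=dv/du$, $\lambda=h_uh_vh_{vv}-(1+h_v^2)h_{uv}$, $\mu=(1+h_u^2)h_{vv}-(1+h_v^2)h_{uu}$, $\nu=(1+h_u^2)h_{uv}-h_uh_vh_{uu}$, so that $\mathbb L_\alpha=\{\mathcal T=0\}$ in the affine chart $(u,v,m)$ of $\mathbb PM$, and let $X=(\mathcal T_m,\,m\mathcal T_m,\,-(\mathcal T_u+m\mathcal T_v))$ be the Lie–Cartan vector field. Then: 1. The umbilic $p$ is of type $D^1_{2,3}$: the derivative of $\tau_g$ vanishes at exactly two points of the projective line $\Pi^{-1}(p)$, and these are nondegenerate (Morse) critical points of $\tau_g$. Moreover, their Hessians are indefinite, so that these are two Morse cone points of $\mathbb L_\alpha$. 2. At $p_0=(0,0,0)$ the surface $\{\mathcal T=0\}$ is regular and $X$ restricted to it has a quadratic saddle-node: $X(p_0)=0$; the linear part of the restriction has the eigenvalue $0$ and a nonzero real eigenvalue; there is a $C^1$ center manifold; and on each $C^1$ center manifold (a regular, locally invariant $C^1$ curve through $p_0$ tangent to the kernel), parametrized by $s$ with $s=0$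 at $p_0$, $X$ has the form $\dot s=\kappa s^2+o(s^2)$, $\kappa\ne0$. Each center manifold is transversal at $p_0$ to the projective line $\{u=v=0\}$. 3. There is a homeomorphism $\Phi$ from an open neighbourhood $U$ of $p$, in which $p$ is the only umbilic, onto the square $(-1,1)^2$, with $\Phi(p)=0$, which maps the leaves in $U\setminus\{p\}$ of one of the two principal foliations onto the leaves of the model $\mathcal S$ and, simultaneously, those of the other one onto the leaves of the model $\mathcal P$. Here $\mathcal P$ and $\mathcal S$ are the foliations of $(-1,1)^2\setminus\{0\}$ with the following leaves: for $\mathcal P$, the vertical lines $x=\text{const}\ne0$ and the two half-lines $\{x=0,y>0\}$, $\{x=0,y<0\}$ (two hyperbolic sectors); for $\mathcal S$, the half-line $\{y=0,x>0\}$, the rays $\{y=sx,\ x<0\}$ with $-1\le s\le1$ (one parabolic sector), and the curves $y=\pm(\tau+\max(-x,0))$, $\tau>0$ (two hyperbolic sectors). In particular, calling separatrices the leaves in $U\setminus\{p\}$ that tend to $p$ and are accumulated by leaves not tending to $p$, the first foliation has exactly three separatrices and the second exactly two. -/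

import Mathlib

open Set Filter Topology Asymptotics
open scoped Manifold ContDiff

/-- The Euclidean plane, with coordinates `(u, v) = (x 0, x 1)`. -/
abbrev E2 : Type := EuclideanSpace ℝ (Fin 2)

/-- Euclidean three-space, with its standard orientation. -/
abbrev E3 : Type := EuclideanSpace ℝ (Fin 3)

noncomputable section

/-- The wedge (cross) product of oriented Euclidean three-space. -/
def wedge (x y : E3) : E3 :=
  WithLp.toLp 2 (crossProduct (WithLp.ofLp x) (WithLp.ofLp y))

section Surface

variable {M : Type*} [TopologicalSpace M] [ChartedSpace E2 M]

/-- The atlas is oriented: all changes of charts have positive Jacobian determinant. -/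
def OrientedAtlas (M : Type*) [TopologicalSpace M] [ChartedSpace E2 M] : Prop :=
  ∀ e ∈ atlas E2 M, ∀ e' ∈ atlas E2 M, ∀ q ∈ e.source ∩ e'.source,
    0 < (fderiv ℝ (fun x => e' (e.symm x)) (e q)).det

/-- Immersions of class `C^r` of a surface into three-space. -/
structure IsSurfaceImmersion (r : ℕ∞) (α : M → E3) : Prop where
  contMDiff : ContMDiff (𝓡 2) (𝓡 3) r α
  injective : ∀ q : M, Function.Injective (mfderiv (𝓡 2) (𝓡 3) α q)

/-- The differential `Dα(q)`.  The tangent space at `q` is coordinatized by the preferred chart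
at `q`. -/
def dImm (α : M → E3) (q : M) : TangentSpace (𝓡 2) q → E3 := fun w =>
  mfderiv (𝓡 2) (𝓡 3) α q w

/-- The Gaussian normal map `|α_u ∧ α_v|⁻¹ α_u ∧ α_v`, the partial derivatives at `q` being taken
in the preferred chart at `q`, which belongs to the oriented atlas. -/
def gaussMap (α : M → E3) (q : M) : E3 :=
  let n := wedge (dImm α q (!₂[1, 0] : E2)) (dImm α q (!₂[0, 1] : E2))
  ‖n‖⁻¹ • n

/-- The differential `DN_α(q)` of the Gaussian normal map. -/
def dGauss (α : M → E3) (q : M) : TangentSpace (𝓡 2) q → E3 := fun w =>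
  mfderiv (𝓡 2) (𝓡 3) (gaussMap α) q w

/-- The principal curvatures at `q`: the eigenvalues of `-ω_α`, where `Dα ∘ ω_α = DN_α`. -/
def principalCurvatures (α : M → E3) (q : M) : Set ℝ :=
  {κ | ∃ w : TangentSpace (𝓡 2) q, w ≠ 0 ∧ dGauss α q w + κ • dImm α q w = 0}

/-- Umbilic points: the two principal curvatures coincide. -/
def IsUmbilic (α : M → E3) (q : M) : Prop := ∃ κ, principalCurvatures α q = {κ}

/-- The minimal principal line field (eigenspace of the smallest principal curvature). -/
def minimalField (α : M → E3) (q : M) : Set (TangentSpace (𝓡 2) q) :=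
  {w | ∃ κ, IsLeast (principalCurvatures α q) κ ∧ dGauss α q w + κ • dImm α q w = 0}

/-- The maximal principal line field (eigenspace of the largest principal curvature). -/
def maximalField (α : M → E3) (q : M) : Set (TangentSpace (𝓡 2) q) :=
  {w | ∃ κ, IsGreatest (principalCurvatures α q) κ ∧ dGauss α q w + κ • dImm α q w = 0}

/-- The geodesic torsion `⟨DN(w) ∧ Dα(w), N⟩ / I(w, w)` in the direction of `w`. -/
def geodesicTorsion (α : M → E3) (q : M) (w : TangentSpace (𝓡 2) q) : ℝ :=
  inner ℝ (wedge (dGauss α q w) (dImm α q w)) (gaussMap α q) /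
    inner ℝ (dImm α q w) (dImm α q w)

/-! ### The surface of principal directions in the projective tangent bundle

In a chart `ψ = (u, v)`, the lines tangent at a point are given by their slope
`p = dv/du ∈ ℝ ∪ {∞}`. -/

/-- The affine coordinate, centred at the line of slope `ℓ`, on the projective line of directions:
`s ↦ [1 : p + s]` around a finite slope `p` (chart `p = dv/du`), and `s ↦ [s : 1]` around the
infinite slope (chart `q = du/dv`). -/
def affineDirection (ℓ : OnePoint ℝ) : ℝ → E2 :=
  ℓ.elim (fun s => !₂[s, 1]) (fun p s => !₂[1, p + s])

/-- The geodesic torsion in the affine chart `(u, v; p)` or `(u, v; q)` of the projective tangent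
bundle associated with `ψ`, recentred so that the line of slope `ℓ` over `ψ.symm x` has
coordinates `(x, 0)`.  Its zero set is the surface `𝕃_α`. -/
def torsionInChart (α : M → E3) (ψ : OpenPartialHomeomorph M E2) (ℓ : OnePoint ℝ) :
    E2 × ℝ → ℝ := fun y =>
  geodesicTorsion α (ψ.symm y.1)
    (mfderiv (𝓡 2) (𝓡 2) ψ.symm y.1 (affineDirection ℓ y.2 : E2))

/-- The points `ℓ` of the projective line over `q` where the transversality condition `T` fails:
the derivative of the geodesic torsion vanishes there. -/
def transversalityFailure (α : M → E3) (ψ : OpenPartialHomeomorph M E2) (q : M) :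
    Set (OnePoint ℝ) :=
  {ℓ | fderiv ℝ (torsionInChart α ψ ℓ) (ψ q, 0) = 0}

/-- `z` is a nondegenerate (Morse) critical point of `f`, lying on `f = 0`. -/
structure IsMorseZero {V : Type*} [NormedAddCommGroup V] [NormedSpace ℝ V]
    (f : V → ℝ) (z : V) : Prop where
  contDiffAt : ContDiffAt ℝ 2 f z
  eq_zero : f z = 0
  critical : fderiv ℝ f z = 0
  nondegenerate : ∀ x : V, (∀ y : V, fderiv ℝ (fderiv ℝ f) z x y = 0) → x = 0

/-- A Morse point of the surface `f = 0` is a cone if the Hessian is indefinite, i.e. (in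
dimension three) if its index is `1` or `2`. -/
structure IsMorseCone {V : Type*} [NormedAddCommGroup V] [NormedSpace ℝ V]
    (f : V → ℝ) (z : V) : Prop extends IsMorseZero f z where
  exists_pos : ∃ x : V, 0 < fderiv ℝ (fderiv ℝ f) z x x
  exists_neg : ∃ x : V, fderiv ℝ (fderiv ℝ f) z x x < 0

/-- The umbilic `q` is of type `D¹₂,₃`: the transversality condition fails at exactly two points
over `q`, at which `𝕃_α` is nondegenerate of Morse type.  (The condition is read in the chart `ψ`
around `q`; it is invariant under changes of charts.) -/
structure IsTypeD23 (α : M → E3) (ψ : OpenPartialHomeomorph M E2) (q : M) : Prop where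
  umbilic : IsUmbilic α q
  two_points : (transversalityFailure α ψ q).ncard = 2
  morse : ∀ ℓ ∈ transversalityFailure α ψ q, IsMorseZero (torsionInChart α ψ ℓ) (ψ q, 0)

/-! ### Leaves and separatrices of a line field -/

/-- `x` and `y` lie on a common integral curve, contained in `W`, of the line field `𝓛`. -/
def OnCommonLine (𝓛 : ∀ q : M, Set (TangentSpace (𝓡 2) q)) (W : Set M) (x y : M) : Prop :=
  ∃ γ : ℝ → M, ContMDiff 𝓘(ℝ, ℝ) (𝓡 2) 1 γ ∧
    (∀ t, γ t ∈ W ∧ mfderiv 𝓘(ℝ, ℝ) (𝓡 2) γ t (1 : ℝ) ≠ 0 ∧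
      mfderiv 𝓘(ℝ, ℝ) (𝓡 2) γ t (1 : ℝ) ∈ 𝓛 (γ t)) ∧
    x ∈ range γ ∧ y ∈ range γ

/-- The leaf through `x` of the foliation of `W` by integral curves of `𝓛`. -/
def leafThrough (𝓛 : ∀ q : M, Set (TangentSpace (𝓡 2) q)) (W : Set M) (x : M) : Set M :=
  {y | OnCommonLine 𝓛 W x y}

/-- The separatrices at `p` of the foliation of `W` by integral curves of `𝓛`: the leaves which
tend to `p` and are accumulated by leaves that do not tend to `p`. -/
def separatrices (𝓛 : ∀ q : M, Set (TangentSpace (𝓡 2) q)) (W : Set M) (p : M) : Set (Set M) :=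
  {S | (∃ x ∈ W, S = leafThrough 𝓛 W x) ∧ p ∈ closure S ∧
    ∀ y ∈ S, ∀ U ∈ 𝓝 y, ∃ z ∈ U ∩ W, p ∉ closure (leafThrough 𝓛 W z)}

end Surface

/-! ### The topological model of the principal configuration

Two foliations of the punctured plane.  The *parallel* one consists of the vertical lines, the one
through the origin being cut there into two separatrices; it has two hyperbolic sectors.  The
*saddle-node* one has the three separatrices `{y = 0 < x}`, `{y = x < 0}`, `{y = -x > 0}`; these
bound one parabolic sector `|y| ≤ -x`, filled by rays, and two hyperbolic sectors, filled by the
curves `|y| = τ + max (-x) 0`. -/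

/-- Two points of the punctured plane lie on the same leaf of the parallel model. -/
def SameParallelLeaf (z w : ℝ × ℝ) : Prop :=
  z.1 = w.1 ∧ (z.1 = 0 → 0 < z.2 * w.2)

/-- Leaves of the saddle-node model.  The alternatives are, in order: the hyperbolic separatrix,
the rays of the closed parabolic sector, and the leaves inside the upper and the lower hyperbolic
sector. -/
def SameSaddleNodeLeaf (z w : ℝ × ℝ) : Prop :=
  (0 < z.1 ∧ 0 < w.1 ∧ z.2 = 0 ∧ w.2 = 0) ∨
  (∃ s ∈ Icc (-1 : ℝ) 1, z.1 < 0 ∧ w.1 < 0 ∧ z.2 = s * z.1 ∧ w.2 = s * w.1) ∨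
  (∃ τ > 0, z.2 = τ + max (-z.1) 0 ∧ w.2 = τ + max (-w.1) 0) ∨
  (∃ τ > 0, z.2 = -(τ + max (-z.1) 0) ∧ w.2 = -(τ + max (-w.1) 0))

/-- The local principal configuration at `p` is that of `D¹₂,₃`, with `𝓛s` the line field of the
saddle-node sheet and `𝓛p` that of the parallel sheet: some homeomorphism `Φ` of a neighbourhood of
`p` onto a square, taking `p` to the centre, maps the leaves of `𝓛s` and of `𝓛p` onto those of the
two model foliations, and `p` is the only umbilic in this neighbourhood.  Moreover the foliations
have three and two separatrices respectively. -/
def HasD23Configuration {M : Type*} [TopologicalSpace M] [ChartedSpace E2 M]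
    (α : M → E3) (p : M) (𝓛s 𝓛p : ∀ q : M, Set (TangentSpace (𝓡 2) q)) : Prop :=
  ∃ Φ : OpenPartialHomeomorph M (ℝ × ℝ),
    p ∈ Φ.source ∧ Φ p = (0, 0) ∧ Φ.target = Ioo (-1 : ℝ) 1 ×ˢ Ioo (-1 : ℝ) 1 ∧
    (∀ q ∈ Φ.source, IsUmbilic α q ↔ q = p) ∧
    (∀ x ∈ Φ.source \ {p}, ∀ y ∈ Φ.source \ {p},
      (OnCommonLine 𝓛s (Φ.source \ {p}) x y ↔ SameSaddleNodeLeaf (Φ x) (Φ y)) ∧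
      (OnCommonLine 𝓛p (Φ.source \ {p}) x y ↔ SameParallelLeaf (Φ x) (Φ y))) ∧
    (separatrices 𝓛s (Φ.source \ {p}) p).ncard = 3 ∧
    (separatrices 𝓛p (Φ.source \ {p}) p).ncard = 2

/-! ### The Lie–Cartan vector field of a graph `(u, v, h(u, v))` -/

/-- Partial derivative in `u`. -/
def du (f : E2 → ℝ) : E2 → ℝ := fun x => fderiv ℝ f x !₂[1, 0]

/-- Partial derivative in `v`. -/
def dv (f : E2 → ℝ) : E2 → ℝ := fun x => fderiv ℝ f x !₂[0, 1]

def coeffL (h : E2 → ℝ) (x : E2) : ℝ :=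
  du h x * dv h x * dv (dv h) x - (1 + dv h x ^ 2) * dv (du h) x

def coeffM (h : E2 → ℝ) (x : E2) : ℝ :=
  (1 + du h x ^ 2) * dv (dv h) x - (1 + dv h x ^ 2) * du (du h) x

def coeffN (h : E2 → ℝ) (x : E2) : ℝ :=
  (1 + du h x ^ 2) * dv (du h) x - du h x * dv h x * du (du h) x

/-- `𝒯(u, v, p) = L p² + M p + N`; its zero set is `𝕃_α` in the affine chart `(u, v; p = dv/du)`. -/
def curvT (h : E2 → ℝ) (y : E2 × ℝ) : ℝ :=
  coeffL h y.1 * y.2 ^ 2 + coeffM h y.1 * y.2 + coeffN h y.1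

/-- The Lie–Cartan field `(𝒯_p, p 𝒯_p, -(𝒯_u + p 𝒯_v))`. -/
def lieCartan (h : E2 → ℝ) (y : E2 × ℝ) : E2 × ℝ :=
  let Tu := fderiv ℝ (curvT h) y (!₂[1, 0], 0)
  let Tv := fderiv ℝ (curvT h) y (!₂[0, 1], 0)
  let Tp := fderiv ℝ (curvT h) y (0, 1)
  (!₂[Tp, y.2 * Tp], -(Tu + y.2 * Tv))

section SaddleNode

variable {V : Type*} [NormedAddCommGroup V] [NormedSpace ℝ V]

/-- The curve `γ`, defined near `0`, parametrizes a center manifold at the singularity `z` of the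
restriction of `X` to the surface `T = 0`: it is a regular `C¹` curve in the surface, tangent at
`z` to the kernel of the linear part, and locally invariant; in the parameter `s` the restriction
of `X` to it reads `ṡ = g(s)`. -/
structure IsCenterCurve (X : V → V) (T : V → ℝ) (z : V) (γ : ℝ → V) (g : ℝ → ℝ) : Prop where
  base : γ 0 = z
  contDiffAt : ContDiffAt ℝ 1 γ 0
  regular : deriv γ 0 ≠ 0
  tangent : fderiv ℝ X z (deriv γ 0) = 0
  invariant : ∀ᶠ s in 𝓝 (0 : ℝ), T (γ s) = 0 ∧ X (γ s) = g s • deriv γ s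

/-- The restriction of the vector field `X` to the surface `T = 0` (regular at `z`, and to which
`X` is tangent) has a (quadratic) saddle-node at `z`: the linear part has one nonzero real
eigenvalue, there are center manifolds, and on every center manifold the field is
`ṡ = κ s² + o(s²)` with `κ ≠ 0`.  (The surface is meant to be two-dimensional, i.e. `dim V = 3`,
so that these are the eigenvalues `0` and `μ`.) -/
structure IsSaddleNode (X : V → V) (T : V → ℝ) (z : V) : Prop where
  contDiffAt_surface : ContDiffAt ℝ 2 T z
  mem_surface : T z = 0
  regular_surface : fderiv ℝ T z ≠ 0
  contDiffAt_field : ContDiffAt ℝ 2 X z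
  tangent_field : ∀ᶠ y in 𝓝 z, T y = 0 → fderiv ℝ T y (X y) = 0
  singular : X z = 0
  hyperbolic : ∃ μ : ℝ, μ ≠ 0 ∧ ∃ w : V, w ≠ 0 ∧ fderiv ℝ T z w = 0 ∧ fderiv ℝ X z w = μ • w
  center : ∃ γ g, IsCenterCurve X T z γ g
  quadratic : ∀ γ g, IsCenterCurve X T z γ g →
    ∃ κ : ℝ, κ ≠ 0 ∧ (fun s => g s - κ * s ^ 2) =o[𝓝 0] (fun s : ℝ => s ^ 2)

end SaddleNode

end

/-! ### Scalar differential equations singular at one point -/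

lemma le_of_deriv_nonpos_off_point {g g' : ℝ → ℝ} {a b c : ℝ} (hab : a ≤ b)
    (hg : ContinuousOn g (Icc a b)) (hd : ∀ t ∈ Ioo a b, t ≠ c → HasDerivAt g (g' t) t)
    (h : ∀ t ∈ Ioo a b, t ≠ c → g' t ≤ 0) : g b ≤ g a := by
  have key : ∀ x y, a ≤ x → x ≤ y → y ≤ b → c ∉ Ioo x y → g y ≤ g x := by
    intro x y hx hxy hy hc
    refine antitoneOn_of_hasDerivWithinAt_nonpos (f' := g') (convex_Icc x y)
      (hg.mono (Icc_subset_Icc hx hy)) ?_ ?_ (left_mem_Icc.2 hxy) (right_mem_Icc.2 hxy) hxy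
    · intro t ht
      rw [interior_Icc] at ht
      exact (hd t ⟨hx.trans_lt ht.1, ht.2.trans_le hy⟩
        (fun e => hc (e ▸ ht))).hasDerivWithinAt
    · intro t ht
      rw [interior_Icc] at ht
      exact h t ⟨hx.trans_lt ht.1, ht.2.trans_le hy⟩ (fun e => hc (e ▸ ht))
  by_cases hc : c ∈ Ioo a b
  · exact (key c b hc.1.le hc.2.le le_rfl (fun h => lt_irrefl _ h.1)).trans
      (key a c le_rfl hc.1.le hc.2.le (fun h => lt_irrefl _ h.2))
  · exact key a b le_rfl hab le_rfl hc

/-- A weighted form of Grönwall's inequality, with one exceptional point. -/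
lemma sq_le_sq_mul_exp_of_deriv {φ φ' k k' : ℝ → ℝ} {a b c : ℝ} (hab : a ≤ b)
    (hφ : ContinuousOn φ (Icc a b)) (hk : ContinuousOn k (Icc a b))
    (hφd : ∀ t ∈ Ioo a b, t ≠ c → HasDerivAt φ (φ' t) t)
    (hkd : ∀ t ∈ Ioo a b, t ≠ c → HasDerivAt k (k' t) t)
    (h : ∀ t ∈ Ioo a b, t ≠ c → φ' t * φ t ≤ k' t * φ t ^ 2) :
    φ b ^ 2 ≤ φ a ^ 2 * Real.exp (2 * (k b - k a)) := by
  have := le_of_deriv_nonpos_off_point (g := fun t => φ t ^ 2 * Real.exp (-2 * k t))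
    (g' := fun t => (2 * φ t * φ' t) * Real.exp (-2 * k t) +
      φ t ^ 2 * (Real.exp (-2 * k t) * (-2 * k' t))) (c := c) hab
    ((hφ.pow 2).mul (Real.continuous_exp.comp_continuousOn (continuousOn_const.mul hk)))
    (fun t ht htc => by
      have h1 := (hφd t ht htc).fun_pow 2
      have h2 := ((hkd t ht htc).const_mul (-2)).exp
      exact (h1.mul h2).congr_deriv (by norm_num)) (fun t ht htc => by
      have := h t ht htc
      have he := Real.exp_pos (-2 * k t)
      nlinarith)
  beta_reduce at this
  have e : Real.exp (2 * (k b - k a)) = Real.exp (-2 * k a) / Real.exp (-2 * k b) := by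
    rw [← Real.exp_sub]; ring_nf
  rw [e, ← mul_div_assoc, le_div_iff₀ (Real.exp_pos _)]
  exact this

lemma hasDerivAt_of_eventually_ne {f g : ℝ → ℝ} {x : ℝ}
    (hd : ∀ᶠ y in 𝓝 x, y ≠ x → HasDerivAt f (g y) y) (hf : ContinuousAt f x)
    (hg : ContinuousAt g x) : HasDerivAt f (g x) x := by
  obtain ⟨ε, hε, hb⟩ := Metric.eventually_nhds_iff_ball.1 hd
  have hR : ∀ y ∈ Ioo x (x + ε), HasDerivAt f (g y) y := fun y hy =>
    hb y (by rw [Metric.mem_ball, Real.dist_eq, abs_lt]; constructor <;> linarith [hy.1, hy.2])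
      hy.1.ne'
  have hL : ∀ y ∈ Ioo (x - ε) x, HasDerivAt f (g y) y := fun y hy =>
    hb y (by rw [Metric.mem_ball, Real.dist_eq, abs_lt]; constructor <;> linarith [hy.1, hy.2])
      hy.2.ne
  have A : HasDerivWithinAt f (g x) (Ici x) x := by
    refine hasDerivWithinAt_Ici_of_tendsto_deriv (s := Ioo x (x + ε))
      (fun y hy => (hR y hy).differentiableAt.differentiableWithinAt) hf.continuousWithinAt
      (Ioo_mem_nhdsGT (by linarith)) ?_
    have : Tendsto g (𝓝[>] x) (𝓝 (g x)) := tendsto_inf_left hg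
    refine this.congr' ?_
    filter_upwards [Ioo_mem_nhdsGT (show x < x + ε by linarith)] with y hy
    exact (hR y hy).deriv.symm
  have B : HasDerivWithinAt f (g x) (Iic x) x := by
    refine hasDerivWithinAt_Iic_of_tendsto_deriv (s := Ioo (x - ε) x)
      (fun y hy => (hL y hy).differentiableAt.differentiableWithinAt) hf.continuousWithinAt
      (Ioo_mem_nhdsLT (by linarith)) ?_
    have : Tendsto g (𝓝[<] x) (𝓝 (g x)) := tendsto_inf_left hg
    refine this.congr' ?_
    filter_upwards [Ioo_mem_nhdsLT (show x - ε < x by linarith)] with y hy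
    exact (hL y hy).deriv.symm
  simpa using B.union A

/-- A bounded scalar field `y' = F t y`, supported in `|t| ≤ 1`, which is continuous off the
origin, Lipschitz in `y` away from `t = 0` and satisfies a one-sided Lipschitz condition with
weight `k'`. -/
structure IsSingularField (F : ℝ → ℝ → ℝ) (L : ℝ) (k k' : ℝ → ℝ) : Prop where
  bound : ∀ t y, |F t y| ≤ L
  zero : ∀ t y, 1 ≤ |t| → F t y = 0
  cont : ∀ t y, (t ≠ 0 ∨ y ≠ 0) → ContinuousAt (Function.uncurry F) (t, y)
  lip : ∀ ε > 0, ∃ K : NNReal, ∀ t, ε ≤ |t| → LipschitzWith K (F t)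
  weight_cont : Continuous k
  weight_deriv : ∀ t ≠ 0, HasDerivAt k (k' t) t
  one_sided : ∀ t ≠ 0, ∀ y₁ y₂, (F t y₁ - F t y₂) * (y₁ - y₂) ≤ k' t * (y₁ - y₂) ^ 2

/-- A global solution, which may pass through the singular point. -/
structure IsSol (F : ℝ → ℝ → ℝ) (f : ℝ → ℝ) : Prop where
  cont : Continuous f
  deriv : ∀ t, (t ≠ 0 ∨ f t ≠ 0) → HasDerivAt f (F t (f t)) t

lemma exists_sol_of_lipschitz {G : ℝ → ℝ → ℝ} {L : ℝ} {K : NNReal} (hb : ∀ t y, |G t y| ≤ L)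
    (hl : ∀ t, LipschitzWith K (G t)) (hc : ∀ y, Continuous fun t => G t y) (c : ℝ) :
    ∃ y : ℝ → ℝ, y (-1) = c ∧ ContinuousOn y (Icc (-1) 1) ∧
      ∀ t ∈ Ioo (-1 : ℝ) 1, HasDerivAt y (G t (y t)) t := by
  have hL : 0 ≤ L := (abs_nonneg _).trans (hb 0 0)
  have hP : IsPicardLindelof G (tmin := -1) (tmax := 1) ⟨-1, by simp⟩ c
      (⟨L * 2, by positivity⟩) 0 ⟨L, hL⟩ K :=
    { lipschitzOnWith := fun t _ => (hl t).lipschitzOnWith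
      continuousOn := fun x _ => (hc x).continuousOn
      norm_le := fun t _ x _ => hb t x
      mul_max_le := by
        change L * max ((1 : ℝ) - -1) (-1 - -1) ≤ L * 2 - 0
        norm_num }
  obtain ⟨y, hy0, hy⟩ := hP.exists_eq_forall_mem_Icc_hasDerivWithinAt₀
  exact ⟨y, hy0, fun t ht => (hy t ht).continuousWithinAt, fun t ht =>
    (hy t (Ioo_subset_Icc_self ht)).hasDerivAt (Icc_mem_nhds ht.1 ht.2)⟩

/-- A cutoff vanishing for `|t| ≤ ε` and equal to `1` for `|t| ≥ 2ε`. -/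
noncomputable def gapCutoff (ε t : ℝ) : ℝ := max 0 (min 1 (|t| / ε - 1))

lemma gapCutoff_continuous (ε : ℝ) : Continuous (gapCutoff ε) := by
  unfold gapCutoff; fun_prop

lemma gapCutoff_nonneg (ε t : ℝ) : 0 ≤ gapCutoff ε t := le_max_left _ _

lemma gapCutoff_le_one (ε t : ℝ) : gapCutoff ε t ≤ 1 := max_le zero_le_one (min_le_left _ _)

lemma gapCutoff_eq_zero {ε t : ℝ} (hε : 0 < ε) (h : |t| ≤ ε) : gapCutoff ε t = 0 := by
  have : |t| / ε ≤ 1 := (div_le_one hε).2 h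
  exact max_eq_left ((min_le_right _ _).trans (by linarith))

lemma gapCutoff_eq_one {ε t : ℝ} (hε : 0 < ε) (h : 2 * ε ≤ |t|) : gapCutoff ε t = 1 := by
  have : 2 ≤ |t| / ε := (le_div_iff₀ hε).2 h
  unfold gapCutoff
  rw [min_eq_left (by linarith), max_eq_right zero_le_one]

namespace IsSingularField

variable {F : ℝ → ℝ → ℝ} {L : ℝ} {k k' : ℝ → ℝ}

lemma bound_nonneg (hF : IsSingularField F L k k') : 0 ≤ L := (abs_nonneg _).trans (hF.bound 0 0)

lemma exists_weight_bound (hF : IsSingularField F L k k') :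
    ∃ M, 0 ≤ M ∧ ∀ s ∈ Icc (-1 : ℝ) 1, ∀ t ∈ Icc (-1 : ℝ) 1, k t - k s ≤ M := by
  obtain ⟨C, hC⟩ := isCompact_Icc.exists_bound_of_continuousOn
    (hF.weight_cont.continuousOn (s := Icc (-1 : ℝ) 1))
  refine ⟨2 * C, by have := (norm_nonneg _).trans (hC 0 (by simp)); linarith, fun s hs t ht => ?_⟩
  have h1 := abs_le.1 (hC s hs)
  have h2 := abs_le.1 (hC t ht)
  linarith [h1.1, h2.2]

lemma exists_approx (hF : IsSingularField F L k k') {ε : ℝ} (hε : 0 < ε) (c : ℝ) :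
    ∃ y : ℝ → ℝ, y (-1) = c ∧ ContinuousOn y (Icc (-1) 1) ∧
      ∀ t ∈ Ioo (-1 : ℝ) 1, HasDerivAt y (gapCutoff ε t * F t (y t)) t := by
  obtain ⟨K, hK⟩ := hF.lip ε hε
  refine exists_sol_of_lipschitz (G := fun t y => gapCutoff ε t * F t y) (L := L) (K := K)
    ?_ ?_ ?_ c
  · intro t y
    rw [abs_mul, abs_of_nonneg (gapCutoff_nonneg ε t)]
    nlinarith [gapCutoff_nonneg ε t, gapCutoff_le_one ε t, hF.bound t y, abs_nonneg (F t y)]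
  · intro t
    rcases le_total |t| ε with h | h
    · simp only [gapCutoff_eq_zero hε h, zero_mul]
      exact (LipschitzWith.const 0).weaken zero_le
    · refine LipschitzWith.of_dist_le_mul fun x y => ?_
      have h1 := (hK t h).dist_le_mul x y
      rw [Real.dist_eq] at h1 ⊢
      rw [← mul_sub, abs_mul, abs_of_nonneg (gapCutoff_nonneg ε t)]
      nlinarith [gapCutoff_nonneg ε t, gapCutoff_le_one ε t, abs_nonneg (F t x - F t y)]
  · intro y
    rw [continuous_iff_continuousAt]
    intro t
    rcases eq_or_ne t 0 with rfl | ht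
    · have : (fun t => gapCutoff ε t * F t y) =ᶠ[𝓝 0] fun _ => 0 := by
        filter_upwards [Metric.ball_mem_nhds (0 : ℝ) hε] with s hs
        rw [gapCutoff_eq_zero hε (by simpa using (Metric.mem_ball.1 hs).le), zero_mul]
      exact continuousAt_const.congr this.symm
    · exact (gapCutoff_continuous ε).continuousAt.mul
        ((hF.cont t y (Or.inl ht)).comp (f := fun t => (t, y)) (by fun_prop))

lemma approx_close (hF : IsSingularField F L k k') {M : ℝ} (hM0 : 0 ≤ M)
    (hM : ∀ s ∈ Icc (-1 : ℝ) 1, ∀ t ∈ Icc (-1 : ℝ) 1, k t - k s ≤ M)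
    {ε ε' : ℝ} (hε' : 0 < ε') (hle : ε' ≤ ε) (hε : 2 * ε < 1) {y z : ℝ → ℝ}
    (hyz : y (-1) = z (-1)) (hyc : ContinuousOn y (Icc (-1) 1))
    (hy : ∀ t ∈ Ioo (-1 : ℝ) 1, HasDerivAt y (gapCutoff ε t * F t (y t)) t)
    (hzc : ContinuousOn z (Icc (-1) 1))
    (hz : ∀ t ∈ Ioo (-1 : ℝ) 1, HasDerivAt z (gapCutoff ε' t * F t (z t)) t) :
    ∀ t ∈ Icc (-1 : ℝ) 1, |y t - z t| ≤ 8 * L * Real.exp M * ε := by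
  have hε0 : 0 < ε := hε'.trans_le hle
  have hL := hF.bound_nonneg
  have gron : ∀ a b, -1 ≤ a → a ≤ b → b ≤ 1 → (∀ t ∈ Ioo a b, 2 * ε ≤ |t|) →
      (y b - z b) ^ 2 ≤ (y a - z a) ^ 2 * Real.exp (2 * M) := by
    intro a b ha hab hb hab'
    have := sq_le_sq_mul_exp_of_deriv (φ := fun t => y t - z t)
      (φ' := fun t => F t (y t) - F t (z t)) (k := k) (k' := k') (c := 0) hab
      ((hyc.sub hzc).mono (Icc_subset_Icc ha hb)) hF.weight_cont.continuousOn
      (fun t ht _ => by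
        have ht' : t ∈ Ioo (-1 : ℝ) 1 := ⟨ha.trans_lt ht.1, ht.2.trans_le hb⟩
        have h1 := hy t ht'
        have h2 := hz t ht'
        rw [gapCutoff_eq_one hε0 (hab' t ht), one_mul] at h1
        rw [gapCutoff_eq_one hε' (by linarith [hab' t ht]), one_mul] at h2
        exact h1.sub h2)
      (fun t _ h0 => hF.weight_deriv t h0)
      (fun t _ h0 => hF.one_sided t h0 _ _)
    refine this.trans (mul_le_mul_of_nonneg_left (Real.exp_le_exp.2 ?_) (sq_nonneg _))
    linarith [hM a ⟨ha, hab.trans hb⟩ b ⟨ha.trans hab, hb⟩]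
  have hleft : ∀ t ∈ Icc (-1 : ℝ) 1, t ≤ -(2 * ε) → y t - z t = 0 := by
    intro t ht hte
    have := gron (-1) t le_rfl ht.1 ht.2 (fun s hs => by
      rw [abs_of_neg (by linarith [hs.2])]; linarith [hs.2])
    rw [hyz, sub_self] at this
    nlinarith [sq_nonneg (y t - z t)]
  have one : ∀ η > 0, ∀ x : ℝ → ℝ, ContinuousOn x (Icc (-1) 1) →
      (∀ t ∈ Ioo (-1 : ℝ) 1, HasDerivAt x (gapCutoff η t * F t (x t)) t) →
      ∀ a b, -1 ≤ a → a ≤ b → b ≤ 1 → |x b - x a| ≤ L * (b - a) := by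
    intro η hη x hxc hx a b ha hab hb
    have hbd : ∀ t, |gapCutoff η t * F t (x t)| ≤ L := fun t => by
      rw [abs_mul, abs_of_nonneg (gapCutoff_nonneg η t)]
      nlinarith [gapCutoff_nonneg η t, gapCutoff_le_one η t, hF.bound t (x t),
        abs_nonneg (F t (x t))]
    have hs : Icc a b ⊆ Icc (-1 : ℝ) 1 := Icc_subset_Icc ha hb
    have ho : ∀ t ∈ Ioo a b, t ∈ Ioo (-1 : ℝ) 1 := fun t ht =>
      ⟨ha.trans_lt ht.1, ht.2.trans_le hb⟩
    have h1 := le_of_deriv_nonpos_off_point (g := fun t => x t - L * t)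
      (g' := fun t => gapCutoff η t * F t (x t) - L * 1) (c := 0) hab
      ((hxc.mono hs).sub (by fun_prop))
      (fun t ht _ => (hx t (ho t ht)).sub ((hasDerivAt_id t).const_mul L))
      (fun t ht _ => by linarith [(abs_le.1 (hbd t)).2])
    have h2 := le_of_deriv_nonpos_off_point (g := fun t => -x t - L * t)
      (g' := fun t => -(gapCutoff η t * F t (x t)) - L * 1) (c := 0) hab
      ((hxc.mono hs).neg.sub (by fun_prop))
      (fun t ht _ => (hx t (ho t ht)).neg.sub ((hasDerivAt_id t).const_mul L))
      (fun t ht _ => by linarith [(abs_le.1 (hbd t)).1])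
    rw [abs_le]
    constructor <;> linarith
  have hmid : ∀ t ∈ Icc (-1 : ℝ) 1, t ≤ 2 * ε → |y t - z t| ≤ 8 * L * ε := by
    intro t ht hte
    rcases le_total t (-(2 * ε)) with h | h
    · rw [hleft t ht h, abs_zero]; positivity
    · have h0 := hleft (-(2 * ε)) ⟨by linarith, by linarith⟩ le_rfl
      have h1 := abs_le.1 (one ε hε0 y hyc hy (-(2 * ε)) t (by linarith) h ht.2)
      have h2 := abs_le.1 (one ε' hε' z hzc hz (-(2 * ε)) t (by linarith) h ht.2)
      rw [abs_le]
      constructor <;> nlinarith [h1.1, h1.2, h2.1, h2.2]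
  intro t ht
  have hexp : 1 ≤ Real.exp M := Real.one_le_exp hM0
  rcases le_total t (2 * ε) with h | h
  · refine (hmid t ht h).trans ?_
    nlinarith [mul_nonneg hL hε0.le]
  · have h1 := gron (2 * ε) t (by linarith) h ht.2 (fun s hs => by
      rw [abs_of_pos (by linarith [hs.1])]; exact hs.1.le)
    have h2 := hmid (2 * ε) ⟨by linarith, hε.le⟩ le_rfl
    refine abs_le_of_sq_le_sq ?_ (by positivity)
    have h3 : (y (2 * ε) - z (2 * ε)) ^ 2 ≤ (8 * L * ε) ^ 2 := by
      rw [← sq_abs]; exact pow_le_pow_left₀ (abs_nonneg _) h2 2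
    calc (y t - z t) ^ 2 ≤ (8 * L * ε) ^ 2 * Real.exp (2 * M) :=
          h1.trans (mul_le_mul_of_nonneg_right h3 (Real.exp_pos _).le)
      _ = (8 * L * Real.exp M * ε) ^ 2 := by
          rw [two_mul, Real.exp_add]; ring

theorem exists_sol (hF : IsSingularField F L k k') (c : ℝ) :
    ∃ f, IsSol F f ∧ f (-1) = c := by
  obtain ⟨M, hM0, hM⟩ := hF.exists_weight_bound
  set e : ℕ → ℝ := fun j => 1 / ((j : ℝ) + 3) with he
  have hepos : ∀ j, 0 < e j := fun j => by simp only [he]; positivity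
  have hele : ∀ i j, i ≤ j → e j ≤ e i := fun i j hij => by
    simp only [he]
    apply one_div_le_one_div_of_le (by positivity)
    have : (i : ℝ) ≤ j := by exact_mod_cast hij
    linarith
  have he2 : ∀ j, 2 * e j < 1 := fun j => by
    have : e j ≤ 1 / 3 := by
      have := hele 0 j (Nat.zero_le _)
      simpa [he] using this
    linarith
  have he0 : Tendsto e atTop (𝓝 0) := by
    have := tendsto_one_div_add_atTop_nhds_zero_nat (𝕜 := ℝ)
    have h2 := (tendsto_add_atTop_iff_nat 2).2 this
    refine h2.congr fun j => ?_
    simp only [he]; push_cast; ring_nf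
  choose y hy0 hyc hyd using fun j => hF.exists_approx (hepos j) c
  set A := 8 * L * Real.exp M with hA
  have hclose : ∀ i j, i ≤ j → ∀ t ∈ Icc (-1 : ℝ) 1, |y i t - y j t| ≤ A * e i :=
    fun i j hij => hF.approx_close hM0 hM (hepos j) (hele i j hij) (he2 i)
      ((hy0 i).trans (hy0 j).symm) (hyc i) (hyd i) (hyc j) (hyd j)
  have hcs : ∀ t ∈ Icc (-1 : ℝ) 1, ∃ l, Tendsto (fun j => y j t) atTop (𝓝 l) := by
    intro t ht
    refine cauchySeq_tendsto_of_complete (cauchySeq_of_le_tendsto_0 (fun i => 2 * (A * e i)) ?_ ?_)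
    · intro n m N hn hm
      have h1 := hclose N n hn t ht
      have h2 := hclose N m hm t ht
      rw [abs_sub_comm] at h1
      exact (abs_sub_le _ (y N t) _).trans (by linarith)
    · simpa using (he0.const_mul A).const_mul 2
  choose! g hg using hcs
  have hgu : TendstoUniformlyOn y g atTop (Icc (-1) 1) := by
    rw [Metric.tendstoUniformlyOn_iff]
    intro δ hδ
    have h1 : Tendsto (fun i => A * e i) atTop (𝓝 0) := by simpa using he0.const_mul A
    filter_upwards [h1.eventually (gt_mem_nhds hδ)] with i hi t ht
    refine lt_of_le_of_lt ?_ hi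
    rw [dist_comm, Real.dist_eq]
    refine le_of_tendsto ((tendsto_const_nhds.sub (hg t ht)).abs) ?_
    filter_upwards [eventually_ge_atTop i] with j hj
    exact hclose i j hj t ht
  have hgc : ContinuousOn g (Icc (-1) 1) :=
    hgu.continuousOn (Frequently.of_forall hyc)
  have hgd : ∀ t ∈ Ioo (-1 : ℝ) 1, t ≠ 0 → HasDerivAt g (F t (g t)) t := by
    intro t ht h0
    set η := |t| / 2 with hη
    have hηpos : 0 < η := by have := abs_pos.2 h0; positivity
    obtain ⟨K, hK⟩ := hF.lip η hηpos
    have hopen : IsOpen (Ioo (-1 : ℝ) 1 ∩ {s | η < |s|}) :=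
      isOpen_Ioo.inter (isOpen_lt continuous_const continuous_abs)
    refine hasDerivAt_of_tendstoUniformlyOn (f := y) (f' := fun j s => gapCutoff (e j) s * F s (y j s))
      (g' := fun s => F s (g s)) (l := atTop) hopen ?_ ?_ ?_ (x := t) ⟨ht, by
        show η < |t|; linarith [abs_pos.2 h0]⟩
    · rw [Metric.tendstoUniformlyOn_iff]
      intro δ hδ
      have hu := Metric.tendstoUniformlyOn_iff.1 hgu (δ / (K + 1)) (by positivity)
      filter_upwards [hu, (he0.const_mul 2).eventually (gt_mem_nhds (by simpa using hηpos))]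
        with j hj hj2 s hs
      rw [gapCutoff_eq_one (hepos j) (hj2.le.trans (le_of_lt hs.2)), one_mul]
      refine lt_of_le_of_lt ((hK s (le_of_lt hs.2)).dist_le_mul _ _) ?_
      have := hj s (Ioo_subset_Icc_self hs.1)
      rw [lt_div_iff₀ (by positivity)] at this
      nlinarith [dist_nonneg (x := g s) (y := y j s)]
    · filter_upwards with j s hs
      exact hyd j s hs.1
    · intro s hs
      exact hg s (Ioo_subset_Icc_self hs.1)
  have hext : ∀ t ∈ Icc (-1 : ℝ) 1, IccExtend (by norm_num : (-1 : ℝ) ≤ 1) ((Icc (-1) 1).domRestrict g) t = g t :=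
    fun t ht => by rw [IccExtend_of_mem _ _ ht]; rfl
  set f := IccExtend (by norm_num : (-1 : ℝ) ≤ 1) ((Icc (-1) 1).domRestrict g) with hf
  have hfc : Continuous f := hgc.domRestrict.Icc_extend'
  have hd : ∀ t, t ≠ 0 → t ≠ -1 → t ≠ 1 → HasDerivAt f (F t (f t)) t := by
    intro t h0 hm hp
    rcases lt_or_gt_of_ne hm with h | h
    · rw [hF.zero _ _ (by rw [abs_of_neg (by linarith)]; linarith)]
      refine (hasDerivAt_const t (g (-1))).congr_of_eventuallyEq ?_
      filter_upwards [Iio_mem_nhds h] with s hs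
      exact IccExtend_of_le_left _ _ (le_of_lt hs)
    · rcases lt_or_gt_of_ne hp with h' | h'
      · rw [hext t ⟨h.le, h'.le⟩]
        refine (hgd t ⟨h, h'⟩ h0).congr_of_eventuallyEq ?_
        filter_upwards [Icc_mem_nhds h h'] with s hs
        exact hext s hs
      · rw [hF.zero _ _ (by rw [abs_of_pos (by linarith)]; linarith)]
        refine (hasDerivAt_const t (g 1)).congr_of_eventuallyEq ?_
        filter_upwards [Ioi_mem_nhds h'] with s hs
        exact IccExtend_of_right_le _ _ (le_of_lt hs)
  refine ⟨f, ⟨hfc, fun t ht => ?_⟩, ?_⟩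
  · refine hasDerivAt_of_eventually_ne (g := fun s => F s (f s)) ?_ hfc.continuousAt ?_
    · have : ({-1, 0, 1} \ {t} : Set ℝ)ᶜ ∈ 𝓝 t :=
        ((Set.toFinite ({-1, 0, 1} \ {t} : Set ℝ)).isClosed.isOpen_compl).mem_nhds (by simp)
      filter_upwards [this] with s hs hst
      simp only [mem_compl_iff, Set.mem_sdiff, mem_insert_iff, mem_singleton_iff] at hs
      apply hd <;> intro hh <;> exact hs ⟨by simp [hh], hst⟩
    · exact (hF.cont t (f t) ht).comp (f := fun s => (s, f s)) (by fun_prop)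
  · rw [hext _ (by simp)]
    refine tendsto_nhds_unique (hg (-1) (by simp)) ?_
    simp [hy0]

end IsSingularField

namespace IsSingularField

variable {F : ℝ → ℝ → ℝ} {L : ℝ} {k k' : ℝ → ℝ} {f g : ℝ → ℝ}

lemma abs_sub_le (hF : IsSingularField F L k k') (hf : IsSol F f) {a b : ℝ} (hab : a ≤ b) :
    |f b - f a| ≤ L * (b - a) := by
  have hfd : ∀ t ∈ Ioo a b, t ≠ 0 → HasDerivAt f (F t (f t)) t :=
    fun t _ h0 => hf.deriv t (Or.inl h0)
  have h1 := le_of_deriv_nonpos_off_point (g := fun t => f t - L * t)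
    (g' := fun t => F t (f t) - L * 1) (c := 0) hab
    (hf.cont.continuousOn.sub (by fun_prop))
    (fun t ht h0 => (hfd t ht h0).sub ((hasDerivAt_id t).const_mul L))
    (fun t ht _ => by linarith [(abs_le.1 (hF.bound t (f t))).2])
  have h2 := le_of_deriv_nonpos_off_point (g := fun t => -f t - L * t)
    (g' := fun t => -F t (f t) - L * 1) (c := 0) hab
    (hf.cont.continuousOn.neg.sub (by fun_prop))
    (fun t ht h0 => (hfd t ht h0).neg.sub ((hasDerivAt_id t).const_mul L))
    (fun t ht _ => by linarith [(abs_le.1 (hF.bound t (f t))).1])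
  rw [abs_le]
  constructor <;> linarith

lemma sq_sub_le (hF : IsSingularField F L k k') (hf : IsSol F f) (hg : IsSol F g) {a b : ℝ}
    (hab : a ≤ b) : (f b - g b) ^ 2 ≤ (f a - g a) ^ 2 * Real.exp (2 * (k b - k a)) :=
  sq_le_sq_mul_exp_of_deriv (φ := fun t => f t - g t) (φ' := fun t => F t (f t) - F t (g t))
    (k' := k') (c := 0) hab (hf.cont.sub hg.cont).continuousOn hF.weight_cont.continuousOn
    (fun t _ h0 => (hf.deriv t (Or.inl h0)).sub (hg.deriv t (Or.inl h0)))
    (fun t _ h0 => hF.weight_deriv t h0) (fun t _ h0 => hF.one_sided t h0 _ _)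

lemma eq_of_eq (hF : IsSingularField F L k k') (hf : IsSol F f) (hg : IsSol F g) {a b : ℝ}
    (hab : a ≤ b) (h : f a = g a) : f b = g b := by
  have := hF.sq_sub_le hf hg hab
  rw [h, sub_self] at this
  nlinarith [sq_nonneg (f b - g b)]

lemma le_of_le (hF : IsSingularField F L k k') (hf : IsSol F f) (hg : IsSol F g) {a b : ℝ}
    (hab : a ≤ b) (h : f a ≤ g a) : f b ≤ g b := by
  by_contra! hlt
  obtain ⟨r, hr, hr0⟩ := intermediate_value_Icc hab (hf.cont.sub hg.cont).continuousOn
    (show (0 : ℝ) ∈ Icc (f a - g a) (f b - g b) from ⟨by linarith, by linarith⟩)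
  exact hlt.ne' (hF.eq_of_eq hf hg hr.2 (sub_eq_zero.1 hr0))

lemma eq_of_forall_zero (hF : IsSingularField F L k k') (hf : IsSol F f) {a b : ℝ}
    (hab : a ≤ b) (h : ∀ t ∈ Ioo a b, 1 ≤ |t|) : f b = f a := by
  have hfd : ∀ t ∈ Ioo a b, t ≠ 0 → HasDerivAt f 0 t := fun t ht h0 => by
    have := hf.deriv t (Or.inl h0)
    rwa [hF.zero t _ (h t ht)] at this
  have h1 := le_of_deriv_nonpos_off_point (g' := fun t => 0) (c := 0) hab hf.cont.continuousOn hfd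
    (fun _ _ _ => le_rfl)
  have h2 := le_of_deriv_nonpos_off_point (g := fun t => -f t) (g' := fun t => -0) (c := 0) hab
    hf.cont.neg.continuousOn (fun t ht h0 => (hfd t ht h0).neg) (fun _ _ _ => by simp)
  linarith

lemma eq_left (hF : IsSingularField F L k k') (hf : IsSol F f) {t : ℝ} (ht : t ≤ -1) :
    f t = f (-1) :=
  (hF.eq_of_forall_zero hf ht fun s hs => by rw [abs_of_neg (by linarith [hs.2])]; linarith [hs.2]).symm

lemma eq_right (hF : IsSingularField F L k k') (hf : IsSol F f) {t : ℝ} (ht : 1 ≤ t) :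
    f t = f 1 :=
  hF.eq_of_forall_zero hf ht fun s hs => by rw [abs_of_pos (by linarith [hs.1])]; linarith [hs.1]

/-- The solution with value `c` at `t = -1`. -/
noncomputable def sol (hF : IsSingularField F L k k') (c : ℝ) : ℝ → ℝ := (hF.exists_sol c).choose

lemma isSol_sol (hF : IsSingularField F L k k') (c : ℝ) : IsSol F (hF.sol c) :=
  (hF.exists_sol c).choose_spec.1

lemma sol_neg_one (hF : IsSingularField F L k k') (c : ℝ) : hF.sol c (-1) = c :=
  (hF.exists_sol c).choose_spec.2

lemma sol_left (hF : IsSingularField F L k k') (c : ℝ) {t : ℝ} (ht : t ≤ -1) : hF.sol c t = c :=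
  (hF.eq_left (hF.isSol_sol c) ht).trans (hF.sol_neg_one c)

lemma eq_sol (hF : IsSingularField F L k k') (hf : IsSol F f) : f = hF.sol (f (-1)) := by
  funext t
  rcases le_total t (-1) with h | h
  · rw [hF.eq_left hf h, hF.sol_left _ h]
  · exact hF.eq_of_eq hf (hF.isSol_sol _) h (hF.sol_neg_one _).symm

lemma sol_mono (hF : IsSingularField F L k k') (t : ℝ) : Monotone fun c => hF.sol c t := by
  intro c d hcd
  rcases le_total t (-1) with h | h
  · simpa only [hF.sol_left _ h] using hcd
  · exact hF.le_of_le (hF.isSol_sol _) (hF.isSol_sol _) h (by simpa only [hF.sol_neg_one] using hcd)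

lemma sol_abs_sub_le (hF : IsSingularField F L k k') (c t : ℝ) : |hF.sol c t - c| ≤ 2 * L := by
  have hL := hF.bound_nonneg
  have key : ∀ t, -1 ≤ t → t ≤ 1 → |hF.sol c t - c| ≤ 2 * L := fun t h h' => by
    have := hF.abs_sub_le (hF.isSol_sol c) h
    rw [hF.sol_neg_one] at this
    nlinarith
  rcases le_total t (-1) with h | h
  · rw [hF.sol_left _ h]; simpa using hL
  · rcases le_total t 1 with h' | h'
    · exact key t h h'
    · rw [hF.eq_right (hF.isSol_sol c) h']; exact key 1 (by norm_num) le_rfl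

lemma exists_sol_lipschitz (hF : IsSingularField F L k k') :
    ∃ A, 0 ≤ A ∧ ∀ c d t, |hF.sol c t - hF.sol d t| ≤ A * |c - d| := by
  obtain ⟨M, hM0, hM⟩ := hF.exists_weight_bound
  have key : ∀ c d t, -1 ≤ t → t ≤ 1 → |hF.sol c t - hF.sol d t| ≤ Real.exp M * |c - d| := by
    intro c d t h h'
    have h1 := hF.sq_sub_le (hF.isSol_sol c) (hF.isSol_sol d) h
    rw [hF.sol_neg_one, hF.sol_neg_one] at h1
    refine abs_le_of_sq_le_sq (h1.trans ?_) (by positivity)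
    rw [mul_pow, sq_abs, ← Real.exp_nat_mul, mul_comm]
    refine mul_le_mul_of_nonneg_right (Real.exp_le_exp.2 ?_) (sq_nonneg _)
    push_cast
    linarith [hM (-1) (by norm_num) t ⟨h, h'⟩]
  have h1 : 1 ≤ Real.exp M := Real.one_le_exp hM0
  refine ⟨Real.exp M, (Real.exp_pos _).le, fun c d t => ?_⟩
  rcases le_total t (-1) with h | h
  · rw [hF.sol_left _ h, hF.sol_left _ h]
    nlinarith [abs_nonneg (c - d)]
  · rcases le_total t 1 with h' | h'
    · exact key c d t h h'
    · rw [hF.eq_right (hF.isSol_sol c) h', hF.eq_right (hF.isSol_sol d) h']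
      exact key c d 1 (by norm_num) le_rfl

lemma continuous_sol (hF : IsSingularField F L k k') :
    Continuous fun z : ℝ × ℝ => hF.sol z.1 z.2 := by
  obtain ⟨A, hA0, hA⟩ := hF.exists_sol_lipschitz
  have hL := hF.bound_nonneg
  rw [continuous_iff_continuousAt]
  rintro ⟨c, t⟩
  have h : Tendsto (fun z : ℝ × ℝ => A * |z.1 - c| + |hF.sol c z.2 - hF.sol c t|) (𝓝 (c, t))
      (𝓝 0) := by
    have : Continuous fun z : ℝ × ℝ => A * |z.1 - c| + |hF.sol c z.2 - hF.sol c t| := by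
      have := (hF.isSol_sol c).cont
      fun_prop
    simpa using this.tendsto (c, t)
  rw [ContinuousAt, tendsto_iff_dist_tendsto_zero]
  refine squeeze_zero (fun _ => dist_nonneg) (fun z => ?_) h
  rw [Real.dist_eq]
  exact (_root_.abs_sub_le _ (hF.sol c z.2) _).trans (add_le_add (hA _ _ _) le_rfl)

lemma sol_surjective (hF : IsSingularField F L k k') (t y : ℝ) : ∃ c, hF.sol c t = y := by
  have hc : Continuous fun c => hF.sol c t :=
    hF.continuous_sol.comp (f := fun c => (c, t)) (by fun_prop)
  have h1 := abs_le.1 (hF.sol_abs_sub_le (y - 2 * L) t)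
  have h2 := abs_le.1 (hF.sol_abs_sub_le (y + 2 * L) t)
  obtain ⟨c, -, hc⟩ := intermediate_value_Icc (by linarith [hF.bound_nonneg])
    hc.continuousOn (show y ∈ Icc (hF.sol (y - 2 * L) t) (hF.sol (y + 2 * L) t) from
      ⟨by linarith [h1.2], by linarith [h2.1]⟩)
  exact ⟨c, hc⟩

end IsSingularField

/-! ### Elementary one-variable lemmas -/

lemma sq_le_sq_mul_exp_of_deriv_rev {φ φ' k k' : ℝ → ℝ} {a b c : ℝ} (hab : a ≤ b)
    (hφ : ContinuousOn φ (Icc a b)) (hk : ContinuousOn k (Icc a b))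
    (hφd : ∀ t ∈ Ioo a b, t ≠ c → HasDerivAt φ (φ' t) t)
    (hkd : ∀ t ∈ Ioo a b, t ≠ c → HasDerivAt k (k' t) t)
    (h : ∀ t ∈ Ioo a b, t ≠ c → -(k' t * φ t ^ 2) ≤ φ' t * φ t) :
    φ a ^ 2 ≤ φ b ^ 2 * Real.exp (2 * (k b - k a)) := by
  have hn : MapsTo (fun t : ℝ => -t) (Icc (-b) (-a)) (Icc a b) := fun t ht =>
    ⟨by linarith [ht.2], by linarith [ht.1]⟩
  have hno : ∀ t ∈ Ioo (-b) (-a), -t ∈ Ioo a b := fun t ht =>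
    ⟨by linarith [ht.2], by linarith [ht.1]⟩
  have := sq_le_sq_mul_exp_of_deriv (φ := fun t => φ (-t)) (φ' := fun t => -φ' (-t))
    (k := fun t => -k (-t)) (k' := fun t => k' (-t)) (c := -c) (neg_le_neg hab)
    (hφ.comp continuousOn_neg hn) (hk.comp continuousOn_neg hn).neg
    (fun t ht htc => by
      have := (hφd (-t) (hno t ht) (fun e => htc (by linarith))).comp t (hasDerivAt_neg t)
      exact this.congr_deriv (by ring))
    (fun t ht htc => by
      have := ((hkd (-t) (hno t ht) (fun e => htc (by linarith))).comp t (hasDerivAt_neg t)).neg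
      exact this.congr_deriv (by ring))
    (fun t ht htc => by
      have := h (-t) (hno t ht) (fun e => htc (by linarith))
      linarith)
  simp only [neg_neg] at this
  refine this.trans_eq ?_
  ring_nf

lemma neg_mul_sq_le_mul {A B K : ℝ} (h : |A| ≤ K * |B|) : -(K * B ^ 2) ≤ A * B := by
  have h2 := neg_abs_le (A * B)
  rw [abs_mul] at h2
  have := mul_le_mul_of_nonneg_right h (abs_nonneg B)
  rw [mul_assoc, ← sq, sq_abs] at this
  linarith

lemma nonpos_of_barrier {w w' : ℝ → ℝ} {a b : ℝ} (hab : a ≤ b) (hw : ContinuousOn w (Icc a b))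
    (ha : w a ≤ 0) (hd : ∀ t ∈ Ioo a b, 0 < w t → HasDerivAt w (w' t) t ∧ w' t ≤ 0) :
    w b ≤ 0 := by
  set S := {t ∈ Icc a b | w t ≤ 0} with hS
  have hSc : IsClosed S := hw.preimage_isClosed_of_isClosed isClosed_Icc isClosed_Iic
  have hne : S.Nonempty := ⟨a, left_mem_Icc.2 hab, ha⟩
  have hbd : BddAbove S := ⟨b, fun t ht => ht.1.2⟩
  have hs : sSup S ∈ S := hSc.csSup_mem hne hbd
  have hgt : ∀ t ∈ Ioo (sSup S) b, 0 < w t := fun t ht => by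
    by_contra! hle
    exact absurd (le_csSup hbd (show t ∈ S from ⟨⟨hs.1.1.trans ht.1.le, ht.2.le⟩, hle⟩))
      (not_le.2 ht.1)
  have hI : ∀ t ∈ Ioo (sSup S) b, t ∈ Ioo a b := fun t ht => ⟨hs.1.1.trans_lt ht.1, ht.2⟩
  exact (le_of_deriv_nonpos_off_point (c := a) hs.1.2
    (hw.mono (Icc_subset_Icc hs.1.1 le_rfl)) (fun t ht _ => (hd t (hI t ht) (hgt t ht)).1)
    (fun t ht _ => (hd t (hI t ht) (hgt t ht)).2)).trans hs.2

/-- A continuous function all of whose zeros are crossed upwards is positive to the right of any of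
its zeros. -/
lemma pos_of_upcrossing {g : ℝ → ℝ} (hg : Continuous g)
    (hr : ∀ t, g t = 0 → ∀ᶠ s in 𝓝[>] t, 0 < g s) (hl : ∀ t, g t = 0 → ∀ᶠ s in 𝓝[<] t, g s < 0)
    {a b : ℝ} (ha : g a = 0) (hab : a < b) : 0 < g b := by
  by_contra! hle
  obtain ⟨ε, hε, hε'⟩ := (mem_nhdsGT_iff_exists_Ioo_subset).1 (hr a ha)
  set S := {t ∈ Icc (min b ((a + ε) / 2)) b | g t ≤ 0} with hS
  have hε0 : a < ε := hε
  have hmin : a < min b ((a + ε) / 2) := lt_min hab (by linarith)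
  have hSc : IsClosed S :=
    hg.continuousOn.preimage_isClosed_of_isClosed isClosed_Icc isClosed_Iic
  have hne : S.Nonempty := ⟨b, ⟨min_le_left _ _, le_rfl⟩, hle⟩
  have hbd : BddBelow S := ⟨_, fun t ht => ht.1.1⟩
  have hs : sInf S ∈ S := hSc.csInf_mem hne hbd
  have has : a < sInf S := hmin.trans_le hs.1.1
  have hlt : ∀ t ∈ Ioo a (sInf S), 0 < g t := fun t ht => by
    rcases lt_or_ge t ((a + ε) / 2) with h | h
    · exact hε' ⟨ht.1, by linarith⟩
    · by_contra! hle'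
      exact absurd (csInf_le hbd (show t ∈ S from
        ⟨⟨(min_le_right _ _).trans h, ht.2.le.trans hs.1.2⟩, hle'⟩)) (not_le.2 ht.2)
  have h0 : g (sInf S) = 0 := by
    refine le_antisymm hs.2 ?_
    have : Tendsto g (𝓝[<] (sInf S)) (𝓝 (g (sInf S))) := hg.continuousAt.tendsto.mono_left inf_le_left
    refine ge_of_tendsto this ?_
    filter_upwards [Ioo_mem_nhdsLT has] with t ht using (hlt t ht).le
  obtain ⟨t, ht1, ht2⟩ := ((hl _ h0).and (Ioo_mem_nhdsLT has)).exists
  exact absurd (hlt t ht2) (not_lt.2 ht1.le)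

lemma upcrossing_of_deriv {g : ℝ → ℝ} {d t : ℝ} (hd : HasDerivAt g d t) (hd0 : 0 < d)
    (h0 : g t = 0) : (∀ᶠ s in 𝓝[>] t, 0 < g s) ∧ ∀ᶠ s in 𝓝[<] t, g s < 0 := by
  have h := (hasDerivAt_iff_tendsto_slope.1 hd).eventually (lt_mem_nhds hd0)
  rw [eventually_nhdsWithin_iff] at h
  constructor
  · rw [eventually_nhdsWithin_iff]
    filter_upwards [h] with s hs hts
    have h1 := hs (ne_of_gt hts)
    rw [slope_def_field, h0, sub_zero] at h1
    exact (div_pos_iff_of_pos_right (sub_pos.2 hts)).1 h1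
  · rw [eventually_nhdsWithin_iff]
    filter_upwards [h] with s hs hts
    have h1 := hs (ne_of_lt hts)
    rw [slope_def_field, h0, sub_zero] at h1
    by_contra! hge
    exact absurd h1 (not_lt.2 (div_nonpos_of_nonneg_of_nonpos hge (sub_nonpos.2 (le_of_lt hts))))

/-! ### Pairs of transversal foliations -/

/-- The slopes `dv/du = m` and `du/dv = n` of a pair of transversal line fields on the punctured
plane, the first of which has one parabolic and two hyperbolic sectors. -/
structure IsPrincipalPair (m n : ℝ → ℝ → ℝ) (L : ℝ) (k k' l l' : ℝ → ℝ) : Prop where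
  fieldS : IsSingularField m L k k'
  fieldP : IsSingularField (fun v u => n u v) L l l'
  lipS : ∀ r > 0, ∃ K : ℝ, ∀ u ≠ 0, ∀ v₁ v₂, ((r ≤ v₁ ∧ r ≤ v₂) ∨ (v₁ ≤ -r ∧ v₂ ≤ -r)) →
    |m u v₁ - m u v₂| ≤ K * |v₁ - v₂|
  two_sided : ∀ v ≠ 0, ∀ u₁ u₂, |n u₁ v - n u₂ v| ≤ l' v * |u₁ - u₂|
  transversal : ∀ u v, (u ≠ 0 ∨ v ≠ 0) → m u v * n u v < 1
  barrier : ∃ C > 0, ∃ c > 0, ∃ r > 0, ∀ u v, |u| ≤ r → |v| ≤ r → (u ≠ 0 ∨ v ≠ 0) →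
    (C * u ^ 2 ≤ v → m u v ≤ -c ∧ 0 ≤ n u v) ∧ (v ≤ -(C * u ^ 2) → c ≤ m u v ∧ n u v ≤ 0)

namespace IsPrincipalPair

variable {m n : ℝ → ℝ → ℝ} {L : ℝ} {k k' l l' : ℝ → ℝ} {f g p q : ℝ → ℝ}

lemma S_back_strip (H : IsPrincipalPair m n L k k' l l') (hf : IsSol m f) (hg : IsSol m g)
    {ε s t : ℝ} (hε : 0 < ε) (hst : s ≤ t) (h : ∀ x ∈ Ioo s t, ε ≤ |x|) (heq : f t = g t) :
    f s = g s := by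
  obtain ⟨K, hK⟩ := H.fieldS.lip ε hε
  have := sq_le_sq_mul_exp_of_deriv_rev (φ := fun t => f t - g t)
    (φ' := fun t => m t (f t) - m t (g t)) (k := fun t => K * t) (k' := fun _ => K * 1) (c := 0) hst
    (hf.cont.sub hg.cont).continuousOn (by fun_prop)
    (fun t _ h0 => (hf.deriv t (Or.inl h0)).sub (hg.deriv t (Or.inl h0)))
    (fun t _ _ => (hasDerivAt_id t).const_mul _)
    (fun t ht _ => by
      have h1 := (hK t (h t ht)).dist_le_mul (f t) (g t)
      rw [Real.dist_eq, Real.dist_eq] at h1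
      simpa using neg_mul_sq_le_mul h1)
  simp only [heq, sub_self] at this
  nlinarith [sq_nonneg (f s - g s)]

lemma S_back_zero (H : IsPrincipalPair m n L k k' l l') (hf : IsSol m f) (hg : IsSol m g)
    {t : ℝ} (ht : 0 ≤ t) (heq : f t = g t) : ∀ s ∈ Icc 0 t, f s = g s := by
  intro s hs
  rcases hs.1.eq_or_lt with h | h
  · rcases ht.eq_or_lt with h' | h'
    · rw [← h, h', heq]
    · rw [← h]
      have h1 : ∀ᶠ x in 𝓝[>] (0 : ℝ), f x = g x := by
        filter_upwards [Ioo_mem_nhdsGT h'] with x hx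
        exact H.S_back_strip hf hg hx.1 hx.2.le (fun y hy => hy.1.le.trans (le_abs_self y)) heq
      have h2 : Tendsto f (𝓝[>] 0) (𝓝 (f 0)) := hf.cont.continuousAt.tendsto.mono_left inf_le_left
      have h3 : Tendsto g (𝓝[>] 0) (𝓝 (g 0)) := hg.cont.continuousAt.tendsto.mono_left inf_le_left
      exact tendsto_nhds_unique (h2.congr' h1) h3
  · exact H.S_back_strip hf hg h hs.2 (fun y hy => hy.1.le.trans (le_abs_self y)) heq

/-- Leaves of the first foliation can only merge at the origin. -/
lemma S_merge (H : IsPrincipalPair m n L k k' l l') (hf : IsSol m f) (hg : IsSol m g)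
    {s t : ℝ} (hst : s ≤ t) (heq : f t = g t) (hne : f s ≠ g s) :
    s < 0 ∧ 0 ≤ t ∧ f 0 = 0 ∧ g 0 = 0 := by
  have ht : 0 ≤ t := by
    by_contra! h
    exact hne (H.S_back_strip hf hg (ε := -t) (by linarith) hst
      (fun x hx => by rw [abs_of_neg (hx.2.trans h)]; linarith [hx.2]) heq)
  have hs : s < 0 := by
    by_contra! h
    exact hne (H.S_back_zero hf hg ht heq s ⟨h, hst⟩)
  have h0 := H.S_back_zero hf hg ht heq 0 ⟨le_rfl, ht⟩
  refine ⟨hs, ht, ?_⟩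
  by_contra hz
  have hf0 : f 0 ≠ 0 := fun e => hz ⟨e, h0 ▸ e⟩
  set r := |f 0| / 2 with hr
  have hrpos : 0 < r := by have := abs_pos.2 hf0; positivity
  obtain ⟨K, hK⟩ := H.lipS r hrpos
  have hev : ∀ᶠ x in 𝓝 (0 : ℝ), |f x - f 0| < r ∧ |g x - f 0| < r := by
    have h1 := Metric.tendsto_nhds.1 (hf.cont.tendsto 0) r hrpos
    have h2 := Metric.tendsto_nhds.1 (hg.cont.tendsto 0) r hrpos
    rw [← h0] at h2
    exact h1.and h2
  obtain ⟨η, hη, hb⟩ := Metric.eventually_nhds_iff_ball.1 hev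
  set a := max s (-η / 2) with ha
  have ha0 : a < 0 := max_lt hs (by linarith)
  have hside : ∀ x ∈ Icc a 0, (r ≤ f x ∧ r ≤ g x) ∨ (f x ≤ -r ∧ g x ≤ -r) := by
    intro x hx
    have hxa : -η / 2 ≤ x := (le_max_right _ _).trans hx.1
    have := hb x (by rw [Metric.mem_ball, Real.dist_eq, abs_lt]; constructor <;> linarith [hx.2])
    have h1 := abs_lt.1 this.1
    have h2 := abs_lt.1 this.2
    rcases le_total 0 (f 0) with hp | hp
    · rw [abs_of_nonneg hp] at hr
      left; constructor <;> linarith [h1.1, h2.1]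
    · rw [abs_of_nonpos hp] at hr
      right; constructor <;> linarith [h1.2, h2.2]
  have hfa : f a = g a := by
    have := sq_le_sq_mul_exp_of_deriv_rev (φ := fun t => f t - g t)
      (φ' := fun t => m t (f t) - m t (g t)) (k := fun t => K * t) (k' := fun _ => K * 1) (c := 0)
      ha0.le (hf.cont.sub hg.cont).continuousOn (by fun_prop)
      (fun t _ h0 => (hf.deriv t (Or.inl h0)).sub (hg.deriv t (Or.inl h0)))
      (fun t _ _ => (hasDerivAt_id t).const_mul _)
      (fun t ht h0 => by
        simpa using neg_mul_sq_le_mul (hK t h0 (f t) (g t) (hside t (Ioo_subset_Icc_self ht))))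
    simp only [h0, sub_self] at this
    nlinarith [sq_nonneg (f a - g a)]
  exact hne (H.S_back_strip hf hg (ε := -a) (by linarith) (le_max_left _ _)
      (fun x hx => by rw [abs_of_neg (hx.2.trans ha0)]; linarith [hx.2]) hfa)

lemma P_unique (H : IsPrincipalPair m n L k k' l l') (hp : IsSol (fun v u => n u v) p)
    (hq : IsSol (fun v u => n u v) q) {t : ℝ} (heq : p t = q t) : p = q := by
  funext s
  rcases le_total t s with h | h
  · exact H.fieldP.eq_of_eq hp hq h heq
  · have := sq_le_sq_mul_exp_of_deriv_rev (φ := fun t => p t - q t)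
      (φ' := fun t => n (p t) t - n (q t) t) (k := l) (k' := l') (c := 0) h
      (hp.cont.sub hq.cont).continuousOn H.fieldP.weight_cont.continuousOn
      (fun t _ h0 => (hp.deriv t (Or.inl h0)).sub (hq.deriv t (Or.inl h0)))
      (fun t _ h0 => H.fieldP.weight_deriv t h0)
      (fun t ht h0 => by
        exact neg_mul_sq_le_mul (H.two_sided t h0 (p t) (q t)))
    simp only [heq, sub_self] at this
    nlinarith [sq_nonneg (p s - q s)]

/-- Uniform barrier estimates near the origin. -/
lemma exists_barrier (H : IsPrincipalPair m n L k k' l l') : ∃ C > 0, ∃ r > 0,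
    (∀ f, IsSol m f → ∀ a b, -r ≤ a → a ≤ b → b ≤ r → |f a| ≤ C * a ^ 2 → (b ≤ 0 ∨ a = 0) →
      |f b| ≤ C * b ^ 2) ∧
    ∀ p, IsSol (fun v u => n u v) p → p 0 = 0 → ∀ v, |v| ≤ r → 0 ≤ p v := by
  obtain ⟨C, hC, c, hc, r, hr, hb⟩ := H.barrier
  have hL := H.fieldS.bound_nonneg
  obtain ⟨ρ, hρ, h1, h2, h3, h4, h5⟩ : ∃ ρ > 0, ρ ≤ r ∧ C * ρ ^ 2 + 2 * L * ρ ≤ r ∧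
      2 * C * ρ ≤ c ∧ C * L ^ 2 * ρ ≤ 1 ∧ L * ρ ≤ r := by
    have e : ∀ g : ℝ → ℝ, Continuous g → ∀ d, g 0 < d → ∀ᶠ ρ in 𝓝[>] (0 : ℝ), g ρ ≤ d := by
      intro g hg d hd
      exact ((hg.tendsto 0).mono_left inf_le_left).eventually (ge_mem_nhds hd)
    obtain ⟨ρ, h⟩ := ((e (fun ρ => ρ) (by fun_prop) r (by simpa)).and
      ((e (fun ρ => C * ρ ^ 2 + 2 * L * ρ) (by fun_prop) r (by simpa)).and
      ((e (fun ρ => 2 * C * ρ) (by fun_prop) c (by simpa)).and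
      ((e (fun ρ => C * L ^ 2 * ρ) (by fun_prop) 1 (by simp)).and
      ((e (fun ρ => L * ρ) (by fun_prop) r (by simpa)).and
      self_mem_nhdsWithin))))).exists
    exact ⟨ρ, h.2.2.2.2.2, h.1, h.2.1, h.2.2.1, h.2.2.2.1, h.2.2.2.2.1⟩
  refine ⟨C, hC, ρ, hρ, ?_, ?_⟩
  · intro f hf a b ha hab hb' hfa hside
    have hfa' := abs_le.1 hfa
    have hsmall : ∀ t ∈ Ioo a b, |f t| ≤ r := by
      intro t ht
      have e1 := abs_le.1 (H.fieldS.abs_sub_le hf ht.1.le)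
      have e2 : a ^ 2 ≤ ρ ^ 2 := sq_le_sq' ha (hab.trans hb')
      have e3 : L * (t - a) ≤ L * (2 * ρ) :=
        mul_le_mul_of_nonneg_left (by linarith [ht.2]) hL
      rw [abs_le]
      constructor <;> nlinarith [e1.1, e1.2, hfa'.1, hfa'.2]
    have hu : ∀ t ∈ Ioo a b, |t| ≤ r := fun t ht => by
      rw [abs_le]; constructor <;> linarith [ht.1, ht.2]
    have htC : ∀ t ∈ Ioo a b, -(2 * C * t) ≤ c := by
      intro t ht
      nlinarith [ht.1]
    have ht0 : ∀ t ∈ Ioo a b, t ≠ 0 := by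
      intro t ht
      rcases hside with h | h
      · exact (ht.2.trans_le h).ne
      · rw [h] at ht; exact ht.1.ne'
    have hsq : ∀ t : ℝ, HasDerivAt (fun t => C * t ^ 2) (2 * C * t) t := fun t => by
      have := ((hasDerivAt_id t).pow 2).const_mul C
      exact this.congr_deriv (by simp; ring)
    have up := nonpos_of_barrier (w := fun t => f t - C * t ^ 2) (w' := fun t => m t (f t) - 2 * C * t)
      hab (hf.cont.continuousOn.sub (by fun_prop)) (by linarith [hfa'.2]) (fun t ht hw =>
        ⟨(hf.deriv t (Or.inl (ht0 t ht))).sub (hsq t), by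
          have := ((hb t (f t) (hu t ht) (hsmall t ht) (Or.inl (ht0 t ht))).1 (by linarith)).1
          linarith [htC t ht]⟩)
    have down := nonpos_of_barrier (w := fun t => -f t - C * t ^ 2)
      (w' := fun t => -m t (f t) - 2 * C * t)
      hab (hf.cont.continuousOn.neg.sub (by fun_prop)) (by linarith [hfa'.1]) (fun t ht hw =>
        ⟨(hf.deriv t (Or.inl (ht0 t ht))).neg.sub (hsq t), by
          have := ((hb t (f t) (hu t ht) (hsmall t ht) (Or.inl (ht0 t ht))).2 (by linarith)).1
          linarith [htC t ht]⟩)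
    rw [abs_le]
    constructor <;> linarith
  · intro p hp hp0 v hv
    have hpv : ∀ t, |t| ≤ ρ → |p t| ≤ L * |t| := by
      intro t ht
      rcases le_total 0 t with h | h
      · have := H.fieldP.abs_sub_le hp h
        rw [hp0, sub_zero, sub_zero] at this
        rwa [abs_of_nonneg h]
      · have := H.fieldP.abs_sub_le hp h
        rw [hp0, zero_sub, abs_neg, zero_sub] at this
        rwa [abs_of_nonpos h]
    have hpr : ∀ t, |t| ≤ ρ → |p t| ≤ r ∧ C * p t ^ 2 ≤ |t| := by
      intro t ht
      have h := hpv t ht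
      have e1 : p t ^ 2 ≤ (L * |t|) ^ 2 := by
        rw [← sq_abs]; exact pow_le_pow_left₀ (abs_nonneg _) h 2
      refine ⟨h.trans ((mul_le_mul_of_nonneg_left ht hL).trans h5), ?_⟩
      calc C * p t ^ 2 ≤ C * (L * |t|) ^ 2 := mul_le_mul_of_nonneg_left e1 hC.le
        _ = (C * L ^ 2 * |t|) * |t| := by ring
        _ ≤ 1 * |t| := by
            refine mul_le_mul_of_nonneg_right (le_trans ?_ h4) (abs_nonneg _)
            exact mul_le_mul_of_nonneg_left ht (by positivity)
        _ = |t| := one_mul _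
    rcases le_total 0 v with h | h
    · have := le_of_deriv_nonpos_off_point (g := fun t => -p t) (g' := fun t => -n (p t) t) (c := 0)
        h hp.cont.neg.continuousOn (fun t _ h0 => (hp.deriv t (Or.inl h0)).neg) (fun t ht h0 => by
          have htρ : |t| ≤ ρ := by
            rw [abs_of_pos ht.1]; rw [abs_of_nonneg h] at hv; linarith [ht.2]
          have h6 := hpr t htρ
          rw [abs_of_pos ht.1] at h6
          have := ((hb (p t) t h6.1 (htρ.trans h1) (Or.inr h0)).1 h6.2).2
          linarith)
      simp only [hp0] at this
      linarith
    · have := le_of_deriv_nonpos_off_point (g := fun t => p t) (g' := fun t => n (p t) t) (c := 0)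
        h hp.cont.continuousOn (fun t _ h0 => (hp.deriv t (Or.inl h0))) (fun t ht h0 => by
          have htρ : |t| ≤ ρ := by
            rw [abs_of_neg ht.2]; rw [abs_of_nonpos h] at hv; linarith [ht.1]
          have h6 := hpr t htρ
          rw [abs_of_neg ht.2] at h6
          exact ((hb (p t) t h6.1 (htρ.trans h1) (Or.inr h0)).2 (by linarith [h6.2])).2)
      simp only [hp0] at this
      linarith

end IsPrincipalPair

lemma continuous_of_comp_family {a : ℝ → ℝ → ℝ} (ha : Continuous fun z : ℝ × ℝ => a z.1 z.2)
    {M : ℝ} (hM : ∀ c t, |a c t - c| ≤ M) (hs : ∀ t y, ∃ c, a c t = y) {G : ℝ × ℝ → ℝ}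
    (hG : Continuous fun z : ℝ × ℝ => G (z.2, a z.1 z.2)) : Continuous G := by
  have hQ : Continuous fun z : ℝ × ℝ => ((z.2, a z.1 z.2) : ℝ × ℝ) := by fun_prop
  have hP : IsProperMap fun z : ℝ × ℝ => ((z.2, a z.1 z.2) : ℝ × ℝ) := by
    rw [isProperMap_iff_tendsto_cocompact]
    refine ⟨hQ, ?_⟩
    rw [← Metric.cobounded_eq_cocompact,
      ← tendsto_norm_atTop_iff_cobounded]
    have h1 : Tendsto (fun z : ℝ × ℝ => ‖z‖ + -M) (Bornology.cobounded _) atTop :=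
      tendsto_atTop_add_const_right _ _ tendsto_norm_cobounded_atTop
    refine tendsto_atTop_mono (fun z => ?_) h1
    have h2 := abs_le.1 (hM z.1 z.2)
    simp only [Prod.norm_def, Real.norm_eq_abs]
    have h3 : |z.1| ≤ |a z.1 z.2| + M := by
      rw [abs_le]
      constructor <;> linarith [neg_abs_le (a z.1 z.2), le_abs_self (a z.1 z.2), h2.1, h2.2]
    have hM0 : 0 ≤ M := (abs_nonneg _).trans (hM 0 0)
    rw [← sub_eq_add_neg, sub_le_iff_le_add]
    refine max_le (h3.trans ?_) ?_
    · linarith [le_max_right |z.2| |a z.1 z.2|]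
    · linarith [le_max_left |z.2| |a z.1 z.2|]
  have hq := hP.isClosedMap.isQuotientMap hQ (fun z => by
    obtain ⟨c, hc⟩ := hs z.1 z.2
    exact ⟨(c, z.1), by simp [hc]⟩)
  exact hq.continuous_iff.2 hG

lemma isOpenMap_of_fiberwise_strictMono {y : ℝ × ℝ → ℝ} (hy : Continuous y)
    (hm : ∀ x, StrictMono fun v => y (x, v)) : IsOpenMap fun z : ℝ × ℝ => (z.1, y z) := by
  rw [isOpenMap_iff_nhds_le]
  rintro ⟨x, v⟩ s hs
  rw [mem_map, nhds_prod_eq] at hs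
  obtain ⟨A, hA, B, hB, hAB⟩ := Filter.mem_prod_iff.1 hs
  obtain ⟨ε, hε, hball⟩ := Metric.mem_nhds_iff.1 hB
  have hI : Icc (v - ε / 2) (v + ε / 2) ⊆ B := fun t ht => hball (by
    rw [Metric.mem_ball, Real.dist_eq, abs_lt]; constructor <;> linarith [ht.1, ht.2])
  have h1 : ∀ᶠ w : ℝ × ℝ in 𝓝 (x, y (x, v)), y (w.1, v - ε / 2) < w.2 := by
    have hc1 : Continuous fun w : ℝ × ℝ => y (w.1, v - ε / 2) := by fun_prop
    exact hc1.continuousAt.eventually_lt continuousAt_snd (hm x (by linarith))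
  have h2 : ∀ᶠ w : ℝ × ℝ in 𝓝 (x, y (x, v)), w.2 < y (w.1, v + ε / 2) := by
    have hc1 : Continuous fun w : ℝ × ℝ => y (w.1, v + ε / 2) := by fun_prop
    exact continuousAt_snd.eventually_lt hc1.continuousAt (hm x (by linarith))
  have h3 : ∀ᶠ w : ℝ × ℝ in 𝓝 (x, y (x, v)), w.1 ∈ A := continuousAt_fst.eventually hA
  filter_upwards [h1, h2, h3] with w hw1 hw2 hw3
  have hc : Continuous fun t => y (w.1, t) := by fun_prop
  obtain ⟨t, ht, hte⟩ := intermediate_value_Icc (by linarith) hc.continuousOn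
    (show w.2 ∈ Icc (y (w.1, v - ε / 2)) (y (w.1, v + ε / 2)) from ⟨hw1.le, hw2.le⟩)
  have := hAB (show (w.1, t) ∈ A ×ˢ B from ⟨hw3, hI ht⟩)
  simpa [hte] using this

namespace IsPrincipalPair

variable {m n : ℝ → ℝ → ℝ} {L : ℝ} {k k' l l' : ℝ → ℝ} {f g p q : ℝ → ℝ}

lemma upcrossing (H : IsPrincipalPair m n L k k' l l') (hf : IsSol m f)
    (hp : IsSol (fun v u => n u v) p) (t : ℝ) (ht : t - f (p t) = 0) :
    (∀ᶠ s in 𝓝[>] t, 0 < s - f (p s)) ∧ ∀ᶠ s in 𝓝[<] t, s - f (p s) < 0 := by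
  have hft : f (p t) = t := by linarith
  by_cases h0 : p t ≠ 0 ∨ t ≠ 0
  · have hdf := hf.deriv (p t) (by rwa [hft])
    have hdp := hp.deriv t h0.symm
    rw [hft] at hdf
    have := (hasDerivAt_id t).sub (hdf.comp t hdp)
    exact upcrossing_of_deriv this (by linarith [H.transversal (p t) t h0]) ht
  · push Not at h0
    obtain ⟨hpt, rfl⟩ := h0
    rw [hpt] at hft
    obtain ⟨C, hC, r, hr, hbS, hbP⟩ := H.exists_barrier
    have hL := H.fieldP.bound_nonneg
    have hpc : ∀ᶠ s in 𝓝 (0 : ℝ), |p s| < r := by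
      have := hp.cont.abs.tendsto 0
      rw [hpt, abs_zero] at this
      exact this.eventually (gt_mem_nhds hr)
    have hsm : ∀ᶠ s in 𝓝 (0 : ℝ), |s| < r := by
      have := continuous_abs.tendsto (0 : ℝ)
      rw [abs_zero] at this
      exact this.eventually (gt_mem_nhds hr)
    have hC2 : ∀ᶠ s in 𝓝 (0 : ℝ), C * L ^ 2 * |s| < 1 := by
      have : Continuous fun s : ℝ => C * L ^ 2 * |s| := by fun_prop
      have := this.tendsto 0
      rw [abs_zero, mul_zero] at this
      exact this.eventually (gt_mem_nhds one_pos)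
    have key : ∀ᶠ s in 𝓝 (0 : ℝ), s ≠ 0 → |f (p s)| < |s| := by
      filter_upwards [hpc, hsm, hC2] with s h1 h2 h3 hs
      have hp0 := hbP p hp hpt s h2.le
      rw [abs_of_nonneg hp0] at h1
      have h4 := hbS f hf 0 (p s) (by linarith) hp0 h1.le (by simp [hft]) (Or.inr rfl)
      have h5 : |p s| ≤ L * |s| := by
        rcases le_total 0 s with h | h
        · have := H.fieldP.abs_sub_le hp h
          rw [hpt, sub_zero, sub_zero] at this
          rwa [abs_of_nonneg h]
        · have := H.fieldP.abs_sub_le hp h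
          rw [hpt, zero_sub, abs_neg, zero_sub] at this
          rwa [abs_of_nonpos h]
      have h6 : p s ^ 2 ≤ (L * |s|) ^ 2 := by
        rw [← sq_abs]; exact pow_le_pow_left₀ (abs_nonneg _) h5 2
      have hs' := abs_pos.2 hs
      calc |f (p s)| ≤ C * (L * |s|) ^ 2 := h4.trans (mul_le_mul_of_nonneg_left h6 hC.le)
        _ = (C * L ^ 2 * |s|) * |s| := by ring
        _ < 1 * |s| := mul_lt_mul_of_pos_right h3 hs'
        _ = |s| := one_mul _
    constructor
    · filter_upwards [nhdsWithin_le_nhds key, self_mem_nhdsWithin] with s hs hs0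
      have hs0' : 0 < s := hs0
      have := hs hs0'.ne'
      rw [abs_of_pos hs0'] at this
      linarith [(abs_lt.1 this).2]
    · filter_upwards [nhdsWithin_le_nhds key, self_mem_nhdsWithin] with s hs hs0
      have hs0' : s < 0 := hs0
      have := hs hs0'.ne
      rw [abs_of_neg hs0'] at this
      linarith [(abs_lt.1 this).1]

lemma lt_of_cross (H : IsPrincipalPair m n L k k' l l') (hf : IsSol m f)
    (hp : IsSol (fun v u => n u v) p) {s t : ℝ} (ht : f (p t) = t) (hts : t < s) :
    f (p s) < s := by
  have := pos_of_upcrossing (g := fun t => t - f (p t))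
    (continuous_id.sub (hf.cont.comp hp.cont)) (fun t ht => (H.upcrossing hf hp t ht).1)
    (fun t ht => (H.upcrossing hf hp t ht).2) (a := t) (b := s) (by simp [ht]) hts
  linarith

lemma cross_unique (H : IsPrincipalPair m n L k k' l l') (hf : IsSol m f)
    (hp : IsSol (fun v u => n u v) p) {s t : ℝ} (ht : f (p t) = t) (hs : f (p s) = s) : s = t := by
  rcases lt_trichotomy s t with h | h | h
  · exact absurd (H.lt_of_cross hf hp hs h) (by simp [ht])
  · exact h
  · exact absurd (H.lt_of_cross hf hp ht h) (by simp [hs])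

/-! #### Labels of the leaves of the second foliation -/

/-- The label of the leaf of the second foliation through the origin. -/
noncomputable def base (H : IsPrincipalPair m n L k k' l l') : ℝ :=
  (H.fieldP.sol_surjective 0 0).choose

/-- The leaf of the second foliation with label `x`, as a graph over the second axis. -/
noncomputable def leafP (H : IsPrincipalPair m n L k k' l l') (x : ℝ) : ℝ → ℝ :=
  H.fieldP.sol (x + H.base)

lemma isSol_leafP (H : IsPrincipalPair m n L k k' l l') (x : ℝ) :
    IsSol (fun v u => n u v) (H.leafP x) := H.fieldP.isSol_sol _

lemma leafP_strictMono (H : IsPrincipalPair m n L k k' l l') (v : ℝ) :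
    StrictMono fun x => H.leafP x v := by
  refine Monotone.strictMono_of_injective (fun x y h => H.fieldP.sol_mono v (by linarith)) ?_
  intro x y hxy
  have := congrFun (H.P_unique (H.isSol_leafP x) (H.isSol_leafP y) hxy) (-1)
  simp only [leafP, H.fieldP.sol_neg_one] at this
  linarith

lemma leafP_surjective (H : IsPrincipalPair m n L k k' l l') (v u : ℝ) : ∃ x, H.leafP x v = u := by
  obtain ⟨c, hc⟩ := H.fieldP.sol_surjective v u
  exact ⟨c - H.base, by simpa [leafP] using hc⟩

lemma leafP_zero (H : IsPrincipalPair m n L k k' l l') : H.leafP 0 0 = 0 := by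
  rw [leafP, zero_add]
  exact (H.fieldP.sol_surjective 0 0).choose_spec

lemma eq_leafP (H : IsPrincipalPair m n L k k' l l') (hp : IsSol (fun v u => n u v) p) :
    ∃ x, p = H.leafP x :=
  ⟨p (-1) - H.base, by simpa [leafP] using H.fieldP.eq_sol hp⟩

lemma continuous_leafP (H : IsPrincipalPair m n L k k' l l') :
    Continuous fun z : ℝ × ℝ => H.leafP z.1 z.2 :=
  H.fieldP.continuous_sol.comp (f := fun z : ℝ × ℝ => (z.1 + H.base, z.2)) (by fun_prop)

lemma leafP_abs_sub_le (H : IsPrincipalPair m n L k k' l l') (x v : ℝ) :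
    |H.leafP x v - x| ≤ 2 * L + |H.base| := by
  have h := H.fieldP.sol_abs_sub_le (x + H.base) v
  calc |H.leafP x v - x| = |(H.fieldP.sol (x + H.base) v - (x + H.base)) + H.base| := by
        simp only [leafP]; ring_nf
    _ ≤ _ := (abs_add_le _ _).trans (by linarith)

/-- The label of the leaf of the second foliation through a point. -/
noncomputable def X (H : IsPrincipalPair m n L k k' l l') (z : ℝ × ℝ) : ℝ :=
  (H.leafP_surjective z.2 z.1).choose

lemma leafP_X (H : IsPrincipalPair m n L k k' l l') (z : ℝ × ℝ) : H.leafP (H.X z) z.2 = z.1 :=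
  (H.leafP_surjective z.2 z.1).choose_spec

lemma X_leafP (H : IsPrincipalPair m n L k k' l l') (x v : ℝ) : H.X (H.leafP x v, v) = x :=
  (H.leafP_strictMono v).injective (H.leafP_X (H.leafP x v, v))

lemma X_zero (H : IsPrincipalPair m n L k k' l l') : H.X (0, 0) = 0 := by
  have := H.X_leafP 0 0
  rwa [H.leafP_zero] at this

lemma continuous_X (H : IsPrincipalPair m n L k k' l l') : Continuous H.X := by
  have : Continuous fun z : ℝ × ℝ => H.X (z.2, z.1) := by
    refine continuous_of_comp_family (a := H.leafP) H.continuous_leafP H.leafP_abs_sub_le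
      H.leafP_surjective ?_
    simp only [H.X_leafP]
    exact continuous_fst
  exact this.comp continuous_swap

/-- The label of the second foliation increases along the leaves of the first one. -/
lemma X_strictMono (H : IsPrincipalPair m n L k k' l l') (hf : IsSol m f) :
    StrictMono fun u => H.X (u, f u) := by
  intro u u' huu
  set x := H.X (u, f u) with hx
  have hxu : H.leafP x (f u) = u := H.leafP_X (u, f u)
  have hz : ∀ t, H.leafP x (f t) = t → t = u := by
    intro t ht
    have := H.cross_unique hf (H.isSol_leafP x) (s := f t) (t := f u) (by rw [hxu]) (by rw [ht])
    rw [← ht, this, hxu]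
  have hlt : H.leafP x (f u') < u' := by
    by_contra! hle
    set B := x + 2 * L + |H.base| + 1
    have hbig : ∀ t, H.leafP x t < B := fun t => by
      have := (abs_le.1 (H.leafP_abs_sub_le x t)).2
      linarith
    have hc : Continuous fun t => H.leafP x (f t) - t :=
      ((H.isSol_leafP x).cont.comp hf.cont).sub continuous_id
    have h1 := hbig (f B)
    obtain ⟨t, ht, ht0⟩ := intermediate_value_Icc' (a := u') (b := B)
      (hle.trans (hbig _).le) hc.continuousOn
      (show (0 : ℝ) ∈ Icc _ _ from ⟨by linarith, by linarith⟩)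
    have := hz t (by linarith)
    linarith [ht.1]
  have h2 : H.leafP (H.X (u', f u')) (f u') = u' := H.leafP_X (u', f u')
  rw [← h2] at hlt
  exact (H.leafP_strictMono (f u')).lt_iff_lt.1 (by simpa [h2] using hlt)

/-! #### Labels of the leaves of the first foliation -/

lemma exists_two_through_origin (H : IsPrincipalPair m n L k k' l l') :
    ∃ c d, c ≠ d ∧ H.fieldS.sol c 0 = 0 ∧ H.fieldS.sol d 0 = 0 := by
  obtain ⟨C, hC, r, hr, hb, -⟩ := H.exists_barrier
  obtain ⟨c, hc⟩ := H.fieldS.sol_surjective (-r) 0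
  obtain ⟨d, hd⟩ := H.fieldS.sol_surjective (-r) (C * r ^ 2)
  have h0 : ∀ e, |H.fieldS.sol e (-r)| ≤ C * (-r) ^ 2 → H.fieldS.sol e 0 = 0 := fun e he => by
    simpa using hb _ (H.fieldS.isSol_sol e) (-r) 0 le_rfl (by linarith) hr.le he (Or.inl le_rfl)
  refine ⟨c, d, ?_, h0 c (by rw [hc]; simp; positivity), h0 d ?_⟩
  · rintro rfl
    have : 0 < C * r ^ 2 := by positivity
    linarith
  · rw [hd, abs_of_nonneg (by positivity), neg_sq]

/-- The lower end of the parabolic sector. -/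
noncomputable def lo (H : IsPrincipalPair m n L k k' l l') : ℝ :=
  sInf {c | H.fieldS.sol c 0 = 0}

/-- The upper end of the parabolic sector. -/
noncomputable def hi (H : IsPrincipalPair m n L k k' l l') : ℝ :=
  sSup {c | H.fieldS.sol c 0 = 0}

lemma sol_zero_iff (H : IsPrincipalPair m n L k k' l l') (c : ℝ) :
    H.fieldS.sol c 0 = 0 ↔ H.lo ≤ c ∧ c ≤ H.hi := by
  have hbd : ∀ c ∈ {c | H.fieldS.sol c 0 = 0}, |c| ≤ 2 * L := fun c hc => by
    have := H.fieldS.sol_abs_sub_le c 0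
    rw [show H.fieldS.sol c 0 = 0 from hc, zero_sub, abs_neg] at this
    exact this
  have hB : BddBelow {c | H.fieldS.sol c 0 = 0} := ⟨-(2 * L), fun c hc => (abs_le.1 (hbd c hc)).1⟩
  have hA : BddAbove {c | H.fieldS.sol c 0 = 0} := ⟨2 * L, fun c hc => (abs_le.1 (hbd c hc)).2⟩
  have hne : {c | H.fieldS.sol c 0 = 0}.Nonempty := H.fieldS.sol_surjective 0 0
  have hc : Continuous fun c => H.fieldS.sol c 0 :=
    H.fieldS.continuous_sol.comp (f := fun c => (c, (0 : ℝ))) (by fun_prop)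
  have hcl : IsClosed {c | H.fieldS.sol c 0 = 0} := isClosed_eq hc continuous_const
  constructor
  · intro h
    exact ⟨csInf_le hB h, le_csSup hA h⟩
  · rintro ⟨h1, h2⟩
    have e1 : H.fieldS.sol H.lo 0 = 0 := hcl.csInf_mem hne hB
    have e2 : H.fieldS.sol H.hi 0 = 0 := hcl.csSup_mem hne hA
    have e3 := H.fieldS.sol_mono 0 h2
    have e4 := H.fieldS.sol_mono 0 h1
    beta_reduce at e3 e4
    exact le_antisymm (e3.trans_eq e2) (e1.symm.trans_le e4)

lemma lo_lt_hi (H : IsPrincipalPair m n L k k' l l') : H.lo < H.hi := by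
  obtain ⟨c, d, hne, hc, hd⟩ := H.exists_two_through_origin
  have hc := (H.sol_zero_iff c).1 hc
  have hd := (H.sol_zero_iff d).1 hd
  rcases lt_or_gt_of_ne hne with h | h <;> linarith [hc.1, hc.2, hd.1, hd.2]

/-- A first integral of the first foliation, constant on the parabolic sector. -/
noncomputable def tau (H : IsPrincipalPair m n L k k' l l') (c : ℝ) : ℝ :=
  H.fieldS.sol c 1 - H.fieldS.sol H.lo 1

/-- The label of a leaf of the parabolic sector. -/
noncomputable def lab (H : IsPrincipalPair m n L k k' l l') (c : ℝ) : ℝ :=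
  max (-1) (min 1 ((2 * c - H.lo - H.hi) / (H.hi - H.lo)))

lemma tau_eq_zero_iff (H : IsPrincipalPair m n L k k' l l') (c : ℝ) :
    H.tau c = 0 ↔ H.lo ≤ c ∧ c ≤ H.hi := by
  have hlo : H.fieldS.sol H.lo 0 = 0 := (H.sol_zero_iff _).2 ⟨le_rfl, H.lo_lt_hi.le⟩
  rw [← sol_zero_iff]
  constructor
  · intro h
    by_contra hne
    have hm := H.S_merge (H.fieldS.isSol_sol c) (H.fieldS.isSol_sol H.lo) (s := -1) (t := 1)
      (by norm_num) (by simpa [tau, sub_eq_zero] using h) (by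
        rw [H.fieldS.sol_neg_one, H.fieldS.sol_neg_one]
        rintro rfl
        exact hne hlo)
    exact hne hm.2.2.1
  · intro h
    exact sub_eq_zero.2 (H.fieldS.eq_of_eq (H.fieldS.isSol_sol c) (H.fieldS.isSol_sol _)
      zero_le_one (h.trans hlo.symm))

lemma tau_mono (H : IsPrincipalPair m n L k k' l l') : Monotone H.tau := fun c d h => by
  have := H.fieldS.sol_mono 1 h
  simp only [tau]
  linarith

lemma lab_mono (H : IsPrincipalPair m n L k k' l l') : Monotone H.lab := fun c d h => by
  have := H.lo_lt_hi
  unfold lab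
  gcongr

lemma tau_injOn (H : IsPrincipalPair m n L k k' l l') {c d : ℝ} (hc : H.tau c ≠ 0)
    (h : H.tau c = H.tau d) : c = d := by
  by_contra hne
  have hm := H.S_merge (H.fieldS.isSol_sol c) (H.fieldS.isSol_sol d) (s := -1) (t := 1)
      (by norm_num) (by simpa [tau] using h) (by
        rwa [H.fieldS.sol_neg_one, H.fieldS.sol_neg_one])
  exact hc ((H.tau_eq_zero_iff c).2 ((H.sol_zero_iff c).1 hm.2.2.1))

lemma tau_pos_iff (H : IsPrincipalPair m n L k k' l l') (c : ℝ) : 0 < H.tau c ↔ H.hi < c := by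
  have hhi : H.tau H.hi = 0 := (H.tau_eq_zero_iff _).2 ⟨H.lo_lt_hi.le, le_rfl⟩
  constructor
  · intro h
    by_contra! hle
    linarith [H.tau_mono hle]
  · intro h
    refine lt_of_le_of_ne (hhi ▸ H.tau_mono h.le) (fun e => ?_)
    linarith [((H.tau_eq_zero_iff c).1 e.symm).2]

lemma tau_neg_iff (H : IsPrincipalPair m n L k k' l l') (c : ℝ) : H.tau c < 0 ↔ c < H.lo := by
  have hlo : H.tau H.lo = 0 := (H.tau_eq_zero_iff _).2 ⟨le_rfl, H.lo_lt_hi.le⟩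
  constructor
  · intro h
    by_contra! hle
    linarith [H.tau_mono hle]
  · intro h
    refine lt_of_le_of_ne (hlo ▸ H.tau_mono h.le) (fun e => ?_)
    linarith [((H.tau_eq_zero_iff c).1 e).1]

lemma lab_mem (H : IsPrincipalPair m n L k k' l l') (c : ℝ) : H.lab c ∈ Icc (-1 : ℝ) 1 :=
  ⟨le_max_left _ _, max_le (by norm_num) (min_le_left _ _)⟩

lemma lab_of_hi_le (H : IsPrincipalPair m n L k k' l l') {c : ℝ} (h : H.hi ≤ c) : H.lab c = 1 := by
  have hlt := H.lo_lt_hi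
  have : 1 ≤ (2 * c - H.lo - H.hi) / (H.hi - H.lo) := by
    rw [le_div_iff₀ (by linarith)]; linarith
  unfold lab
  rw [min_eq_left this, max_eq_right (by norm_num)]

lemma lab_of_le_lo (H : IsPrincipalPair m n L k k' l l') {c : ℝ} (h : c ≤ H.lo) : H.lab c = -1 := by
  have hlt := H.lo_lt_hi
  have : (2 * c - H.lo - H.hi) / (H.hi - H.lo) ≤ -1 := by
    rw [div_le_iff₀ (by linarith)]; linarith
  unfold lab
  exact max_eq_left ((min_le_right _ _).trans this)

lemma lab_of_mem (H : IsPrincipalPair m n L k k' l l') {c : ℝ} (h : H.lo ≤ c ∧ c ≤ H.hi) :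
    H.lab c = (2 * c - H.lo - H.hi) / (H.hi - H.lo) := by
  have hlt := H.lo_lt_hi
  have h1 : (2 * c - H.lo - H.hi) / (H.hi - H.lo) ≤ 1 := by
    rw [div_le_iff₀ (by linarith)]; linarith [h.2]
  have h2 : -1 ≤ (2 * c - H.lo - H.hi) / (H.hi - H.lo) := by
    rw [le_div_iff₀ (by linarith)]; linarith [h.1]
  unfold lab
  rw [min_eq_right h1, max_eq_right h2]

lemma lab_strictMono (H : IsPrincipalPair m n L k k' l l') {c d : ℝ} (hc : H.lo ≤ c ∧ c ≤ H.hi)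
    (hd : H.lo ≤ d ∧ d ≤ H.hi) (hcd : c < d) : H.lab c < H.lab d := by
  have hlt := H.lo_lt_hi
  rw [H.lab_of_mem hc, H.lab_of_mem hd]
  exact div_lt_div_of_pos_right (by linarith) (by linarith)

/-- The ordinate of the point with abscissa `x` on the model leaf with label `c`. -/
noncomputable def height (H : IsPrincipalPair m n L k k' l l') (c x : ℝ) : ℝ :=
  H.tau c + H.lab c * max (-x) 0

lemma height_wd (H : IsPrincipalPair m n L k k' l l') {c d u : ℝ}
    (h : H.fieldS.sol c u = H.fieldS.sol d u) :
    H.height c (H.X (u, H.fieldS.sol c u)) = H.height d (H.X (u, H.fieldS.sol d u)) := by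
  rcases eq_or_ne c d with rfl | hne
  · rfl
  rcases le_total u (-1) with hu | hu
  · rw [H.fieldS.sol_left _ hu, H.fieldS.sol_left _ hu] at h
    exact absurd h hne
  have hm := H.S_merge (H.fieldS.isSol_sol c) (H.fieldS.isSol_sol d) hu h
    (by rwa [H.fieldS.sol_neg_one, H.fieldS.sol_neg_one])
  have hX : 0 ≤ H.X (u, H.fieldS.sol c u) := by
    have := (H.X_strictMono (H.fieldS.isSol_sol c)).monotone hm.2.1
    simp only [hm.2.2.1, X_zero] at this
    exact this
  have h1 := (H.tau_eq_zero_iff c).2 ((H.sol_zero_iff c).1 hm.2.2.1)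
  have h2 := (H.tau_eq_zero_iff d).2 ((H.sol_zero_iff d).1 hm.2.2.2)
  rw [← h]
  simp only [height, h1, h2, max_eq_right (neg_nonpos.2 hX), mul_zero]

/-- The ordinate of the image of a point in the model. -/
noncomputable def Y (H : IsPrincipalPair m n L k k' l l') (z : ℝ × ℝ) : ℝ :=
  H.height (H.fieldS.sol_surjective z.1 z.2).choose (H.X z)

lemma Y_sol (H : IsPrincipalPair m n L k k' l l') (c u : ℝ) :
    H.Y (u, H.fieldS.sol c u) = H.height c (H.X (u, H.fieldS.sol c u)) := by
  have := (H.fieldS.sol_surjective u (H.fieldS.sol c u)).choose_spec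
  have h := H.height_wd this
  rw [this] at h
  exact h

lemma continuous_Y (H : IsPrincipalPair m n L k k' l l') : Continuous H.Y := by
  refine continuous_of_comp_family (a := H.fieldS.sol) H.fieldS.continuous_sol
    H.fieldS.sol_abs_sub_le H.fieldS.sol_surjective ?_
  simp only [Y_sol, height]
  have h1 : Continuous fun z : ℝ × ℝ => H.tau z.1 :=
    (H.fieldS.continuous_sol.comp (f := fun z : ℝ × ℝ => (z.1, (1 : ℝ))) (by fun_prop)).sub
      continuous_const
  have h2 : Continuous fun z : ℝ × ℝ => H.lab z.1 := by unfold lab; fun_prop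
  have h3 : Continuous fun z : ℝ × ℝ => H.X (z.2, H.fieldS.sol z.1 z.2) :=
    H.continuous_X.comp (continuous_snd.prodMk H.fieldS.continuous_sol)
  exact h1.add (h2.mul (h3.neg.max continuous_const))

lemma Y_strictMono_leafP (H : IsPrincipalPair m n L k k' l l') (x : ℝ) :
    StrictMono fun v => H.Y (H.leafP x v, v) := by
  intro v v' hv
  obtain ⟨c, hc⟩ := H.fieldS.sol_surjective (H.leafP x v) v
  obtain ⟨d, hd⟩ := H.fieldS.sol_surjective (H.leafP x v') v'
  have hlt := H.lt_of_cross (H.fieldS.isSol_sol c) (H.isSol_leafP x) hc hv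
  have hcd : c < d := by
    by_contra! hle
    linarith [H.fieldS.sol_mono (H.leafP x v') hle]
  have e1 := H.Y_sol c (H.leafP x v)
  have e2 := H.Y_sol d (H.leafP x v')
  rw [hc, X_leafP] at e1
  rw [hd, X_leafP] at e2
  beta_reduce
  rw [e1, e2]
  by_contra! hge
  simp only [height] at hge
  have ht := H.tau_mono hcd.le
  have hl := H.lab_mono hcd.le
  have hm0 : 0 ≤ max (-x) 0 := le_max_right _ _
  have hl' := mul_le_mul_of_nonneg_right hl hm0
  have hte : H.tau c = H.tau d := by linarith
  have htz : H.tau c = 0 := by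
    by_contra hne
    exact hcd.ne (H.tau_injOn hne hte)
  have hcz := (H.tau_eq_zero_iff c).1 htz
  have hdz := (H.tau_eq_zero_iff d).1 (hte ▸ htz)
  rcases lt_or_ge x 0 with hx | hx
  · have := H.lab_strictMono hcz hdz hcd
    rw [max_eq_left (by linarith)] at hge
    nlinarith
  · have hc0 := (H.sol_zero_iff c).2 hcz
    have hd0 := (H.sol_zero_iff d).2 hdz
    have hu : 0 ≤ H.leafP x v := by
      by_contra! hneg
      have := H.X_strictMono (H.fieldS.isSol_sol c) hneg
      simp only [hc0, X_zero, hc, X_leafP] at this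
      linarith
    have hu' : 0 ≤ H.leafP x v' := by
      by_contra! hneg
      have := H.X_strictMono (H.fieldS.isSol_sol d) hneg
      simp only [hd0, X_zero, hd, X_leafP] at this
      linarith
    have := H.fieldS.eq_of_eq (H.fieldS.isSol_sol c) (H.fieldS.isSol_sol d) hu' (hc0.trans hd0.symm)
    linarith

/-- The homeomorphism onto the model. -/
noncomputable def model (H : IsPrincipalPair m n L k k' l l') (z : ℝ × ℝ) : ℝ × ℝ := (H.X z, H.Y z)

lemma model_zero (H : IsPrincipalPair m n L k k' l l') : H.model (0, 0) = (0, 0) := by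
  obtain ⟨c, hc⟩ := H.fieldS.sol_surjective 0 0
  have := H.Y_sol c 0
  rw [hc, X_zero, height, (H.tau_eq_zero_iff c).2 ((H.sol_zero_iff c).1 hc)] at this
  simp [model, X_zero, this]

lemma isOpenEmbedding_model (H : IsPrincipalPair m n L k k' l l') : IsOpenEmbedding H.model := by
  refine .of_continuous_injective_isOpenMap (H.continuous_X.prodMk H.continuous_Y) ?_ ?_
  · intro z w h
    have hX : H.X z = H.X w := congrArg Prod.fst h
    have hY : H.Y z = H.Y w := congrArg Prod.snd h
    have ez : z = (H.leafP (H.X z) z.2, z.2) := by rw [H.leafP_X z]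
    have ew : w = (H.leafP (H.X z) w.2, w.2) := by rw [hX, H.leafP_X w]
    rw [ez, ew] at hY
    have h2 : z.2 = w.2 := (H.Y_strictMono_leafP (H.X z)).injective hY
    rw [ez, ew, h2]
  · let e : ℝ × ℝ ≃ₜ ℝ × ℝ :=
      { toFun := fun z => (H.X z, z.2)
        invFun := fun z => (H.leafP z.1 z.2, z.2)
        left_inv := fun z => by simp [H.leafP_X]
        right_inv := fun z => by simp [H.X_leafP]
        continuous_toFun := H.continuous_X.prodMk continuous_snd
        continuous_invFun := H.continuous_leafP.prodMk continuous_snd }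
    have h1 := isOpenMap_of_fiberwise_strictMono (y := fun z => H.Y (H.leafP z.1 z.2, z.2))
      (H.continuous_Y.comp (H.continuous_leafP.prodMk continuous_snd)) H.Y_strictMono_leafP
    have h2 := h1.comp e.isOpenMap
    convert h2 using 1
    funext z
    simp [model, e, H.leafP_X]

lemma sameSaddleNodeLeaf_iff (H : IsPrincipalPair m n L k k' l l') {z w : ℝ × ℝ} :
    SameSaddleNodeLeaf (H.model z) (H.model w) ↔
      ∃ f, IsSol m f ∧ f z.1 = z.2 ∧ f w.1 = w.2 ∧ (f 0 = 0 → 0 < z.1 * w.1) := by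
  have hpar : ∀ c u, H.lo ≤ c ∧ c ≤ H.hi → (0 < H.X (u, H.fieldS.sol c u) ↔ 0 < u) ∧
      (H.X (u, H.fieldS.sol c u) < 0 ↔ u < 0) := by
    intro c u hc
    have h0 := (H.sol_zero_iff c).2 hc
    have hm := H.X_strictMono (H.fieldS.isSol_sol c)
    have e : H.X (0, H.fieldS.sol c 0) = 0 := by rw [h0, X_zero]
    constructor
    · have := hm.lt_iff_lt (a := 0) (b := u)
      beta_reduce at this
      rwa [e] at this
    · have := hm.lt_iff_lt (a := u) (b := 0)
      beta_reduce at this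
      rwa [e] at this
  constructor
  · intro h
    obtain ⟨c, hc⟩ := H.fieldS.sol_surjective z.1 z.2
    obtain ⟨d, hd⟩ := H.fieldS.sol_surjective w.1 w.2
    have hzY : (H.model z).2 = H.tau c + H.lab c * max (-(H.model z).1) 0 := by
      have := H.Y_sol c z.1
      rwa [hc] at this
    have hwY : (H.model w).2 = H.tau d + H.lab d * max (-(H.model w).1) 0 := by
      have := H.Y_sol d w.1
      rwa [hd] at this
    have hzp : H.lo ≤ c ∧ c ≤ H.hi → (0 < (H.model z).1 ↔ 0 < z.1) ∧ ((H.model z).1 < 0 ↔ z.1 < 0) :=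
      fun h => by simpa [hc, model] using hpar c z.1 h
    have hwp : H.lo ≤ d ∧ d ≤ H.hi → (0 < (H.model w).1 ↔ 0 < w.1) ∧ ((H.model w).1 < 0 ↔ w.1 < 0) :=
      fun h => by simpa [hd, model] using hpar d w.1 h
    have hray : ∀ c, ∀ x s y : ℝ, x < 0 → s ∈ Icc (-1 : ℝ) 1 → y = H.tau c + H.lab c * max (-x) 0 →
        y = s * x → (H.lo ≤ c ∧ c ≤ H.hi) ∧ H.lab c = -s := by
      intro c x s y hx hs hy hy'
      rw [max_eq_left (by linarith)] at hy
      have hpc : H.lo ≤ c ∧ c ≤ H.hi := by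
        constructor
        · by_contra! hlt
          have h1 := (H.tau_neg_iff c).2 hlt
          rw [H.lab_of_le_lo hlt.le] at hy
          nlinarith [hs.1, hs.2]
        · by_contra! hlt
          have h1 := (H.tau_pos_iff c).2 hlt
          rw [H.lab_of_hi_le hlt.le] at hy
          nlinarith [hs.1, hs.2]
      refine ⟨hpc, ?_⟩
      rw [(H.tau_eq_zero_iff c).2 hpc] at hy
      have : (H.lab c + s) * x = 0 := by linarith
      rcases mul_eq_zero.1 this with h | h <;> linarith
    have hup : ∀ c, ∀ x τ y : ℝ, 0 < τ → y = H.tau c + H.lab c * max (-x) 0 →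
        y = τ + max (-x) 0 → H.tau c = τ ∧ ¬ (H.lo ≤ c ∧ c ≤ H.hi) := by
      intro c x τ y hτ hy hy'
      have hm := le_max_right (-x) 0
      have hl := H.lab_mem c
      have h1 : 0 < H.tau c := by nlinarith [hl.2]
      have h2 := (H.tau_pos_iff c).1 h1
      rw [H.lab_of_hi_le h2.le] at hy
      exact ⟨by linarith, fun h => by linarith [h.2]⟩
    have hdn : ∀ c, ∀ x τ y : ℝ, 0 < τ → y = H.tau c + H.lab c * max (-x) 0 →
        y = -(τ + max (-x) 0) → H.tau c = -τ ∧ ¬ (H.lo ≤ c ∧ c ≤ H.hi) := by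
      intro c x τ y hτ hy hy'
      have hm := le_max_right (-x) 0
      have hl := H.lab_mem c
      have h1 : H.tau c < 0 := by nlinarith [hl.1]
      have h2 := (H.tau_neg_iff c).1 h1
      rw [H.lab_of_le_lo h2.le] at hy
      exact ⟨by linarith, fun h => by linarith [h.1]⟩
    rcases h with ⟨hz, hw, hz2, hw2⟩ | ⟨s, hs, hz, hw, hz2, hw2⟩ | ⟨τ, hτ, hz2, hw2⟩ | ⟨τ, hτ, hz2, hw2⟩
    · rw [hz2, max_eq_right (by linarith), mul_zero, add_zero] at hzY
      rw [hw2, max_eq_right (by linarith), mul_zero, add_zero] at hwY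
      have hcz := (H.tau_eq_zero_iff c).1 hzY.symm
      have hdz := (H.tau_eq_zero_iff d).1 hwY.symm
      have hz1 := (hzp hcz).1.1 hz
      have hw1 := (hwp hdz).1.1 hw
      refine ⟨_, H.fieldS.isSol_sol c, hc, ?_, fun _ => mul_pos hz1 hw1⟩
      rw [← hd]
      exact H.fieldS.eq_of_eq (H.fieldS.isSol_sol c) (H.fieldS.isSol_sol d) hw1.le
        (((H.sol_zero_iff c).2 hcz).trans ((H.sol_zero_iff d).2 hdz).symm)
    · obtain ⟨hcz, hcl⟩ := hray c _ s _ hz hs hzY hz2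
      obtain ⟨hdz, hdl⟩ := hray d _ s _ hw hs hwY hw2
      have hcd : c = d := by
        by_contra hne
        rcases lt_or_gt_of_ne hne with h | h
        · linarith [H.lab_strictMono hcz hdz h]
        · linarith [H.lab_strictMono hdz hcz h]
      subst hcd
      exact ⟨_, H.fieldS.isSol_sol c, hc, hd, fun _ =>
        mul_pos_of_neg_of_neg ((hzp hcz).2.1 hz) ((hwp hdz).2.1 hw)⟩
    · obtain ⟨hcl, hcz⟩ := hup c _ τ _ hτ hzY hz2
      obtain ⟨hdl, -⟩ := hup d _ τ _ hτ hwY hw2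
      have hcd := H.tau_injOn (by rw [hcl]; exact hτ.ne') (hcl.trans hdl.symm)
      subst hcd
      exact ⟨_, H.fieldS.isSol_sol c, hc, hd, fun h => absurd ((H.sol_zero_iff c).1 h) hcz⟩
    · obtain ⟨hcl, hcz⟩ := hdn c _ τ _ hτ hzY hz2
      obtain ⟨hdl, -⟩ := hdn d _ τ _ hτ hwY hw2
      have hcd := H.tau_injOn (by rw [hcl]; linarith) (hcl.trans hdl.symm)
      subst hcd
      exact ⟨_, H.fieldS.isSol_sol c, hc, hd, fun h => absurd ((H.sol_zero_iff c).1 h) hcz⟩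
  · rintro ⟨f, hf, hz, hw, hside⟩
    rw [H.fieldS.eq_sol hf] at hz hw hside
    set c := f (-1) with hcdef
    have hzY : (H.model z).2 = H.tau c + H.lab c * max (-(H.model z).1) 0 := by
      have := H.Y_sol c z.1
      rwa [hz] at this
    have hwY : (H.model w).2 = H.tau c + H.lab c * max (-(H.model w).1) 0 := by
      have := H.Y_sol c w.1
      rwa [hw] at this
    by_cases hc : H.lo ≤ c ∧ c ≤ H.hi
    · have hs := hside ((H.sol_zero_iff c).2 hc)
      have h1 := hpar c z.1 hc
      have h2 := hpar c w.1 hc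
      rw [hz] at h1
      rw [hw] at h2
      rw [(H.tau_eq_zero_iff c).2 hc, zero_add] at hzY hwY
      rcases pos_and_pos_or_neg_and_neg_of_mul_pos hs with ⟨hz0, hw0⟩ | ⟨hz0, hw0⟩
      · have h3 : 0 < (H.model z).1 := h1.1.2 hz0
        have h4 : 0 < (H.model w).1 := h2.1.2 hw0
        left
        refine ⟨h3, h4, ?_, ?_⟩
        · rw [hzY, max_eq_right (by linarith), mul_zero]
        · rw [hwY, max_eq_right (by linarith), mul_zero]
      · have h3 : (H.model z).1 < 0 := h1.2.2 hz0
        have h4 : (H.model w).1 < 0 := h2.2.2 hw0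
        right; left
        have hl := H.lab_mem c
        refine ⟨-H.lab c, ⟨by linarith [hl.2], by linarith [hl.1]⟩, h3, h4, ?_, ?_⟩
        · rw [hzY, max_eq_left (by linarith)]; ring
        · rw [hwY, max_eq_left (by linarith)]; ring
    · rcases lt_or_ge c H.lo with h | h
      · have ht := (H.tau_neg_iff c).2 h
        rw [H.lab_of_le_lo h.le] at hzY hwY
        right; right; right
        exact ⟨-H.tau c, by linarith, by rw [hzY]; ring, by rw [hwY]; ring⟩
      · have h' : H.hi < c := by
          by_contra! hle
          exact hc ⟨h, hle⟩
        have ht := (H.tau_pos_iff c).2 h'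
        rw [H.lab_of_hi_le h'.le] at hzY hwY
        right; right; left
        exact ⟨H.tau c, ht, by rw [hzY]; ring, by rw [hwY]; ring⟩

lemma sameParallelLeaf_iff (H : IsPrincipalPair m n L k k' l l') {z w : ℝ × ℝ} :
    SameParallelLeaf (H.model z) (H.model w) ↔
      ∃ p, IsSol (fun v u => n u v) p ∧ p z.2 = z.1 ∧ p w.2 = w.1 ∧ (p 0 = 0 → 0 < z.2 * w.2) := by
  have hY0 : H.Y (0, 0) = 0 := congrArg Prod.snd H.model_zero
  have hs : ∀ v, (0 < H.Y (H.leafP 0 v, v) ↔ 0 < v) ∧ (H.Y (H.leafP 0 v, v) < 0 ↔ v < 0) := by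
    intro v
    have hm := H.Y_strictMono_leafP 0
    have e : H.Y (H.leafP 0 0, 0) = 0 := by rw [leafP_zero, hY0]
    constructor
    · have := hm.lt_iff_lt (a := 0) (b := v)
      beta_reduce at this
      rwa [e] at this
    · have := hm.lt_iff_lt (a := v) (b := 0)
      beta_reduce at this
      rwa [e] at this
  have hsame : ∀ z w : ℝ × ℝ, H.X z = 0 → H.X w = 0 → (0 < H.Y z * H.Y w ↔ 0 < z.2 * w.2) := by
    intro z w hz hw
    have h1 := hs z.2
    have h2 := hs w.2
    have ez : H.leafP 0 z.2 = z.1 := by rw [← hz, H.leafP_X]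
    have ew : H.leafP 0 w.2 = w.1 := by rw [← hw, H.leafP_X]
    rw [ez] at h1
    rw [ew] at h2
    rw [mul_pos_iff, mul_pos_iff]
    exact or_congr (and_congr h1.1 h2.1) (and_congr h1.2 h2.2)
  simp only [SameParallelLeaf, model]
  constructor
  · rintro ⟨h1, h2⟩
    refine ⟨H.leafP (H.X z), H.isSol_leafP _, H.leafP_X z, by rw [h1, H.leafP_X w], fun h0 => ?_⟩
    have hz0 : H.X z = 0 := by
      have := H.X_leafP (H.X z) 0
      rw [h0, X_zero] at this
      exact this.symm
    exact (hsame z w hz0 (h1 ▸ hz0)).1 (h2 hz0)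
  · rintro ⟨p, hp, hz, hw, h0⟩
    obtain ⟨x, rfl⟩ := H.eq_leafP hp
    have ez : H.X z = x := by
      have := H.X_leafP x z.2
      rwa [hz] at this
    have ew : H.X w = x := by
      have := H.X_leafP x w.2
      rwa [hw] at this
    refine ⟨ez.trans ew.symm, fun hx => ?_⟩
    have hx0 : x = 0 := ez.symm.trans hx
    exact (hsame z w hx (ew.trans hx0)).2 (h0 (by rw [hx0, leafP_zero]))

lemma model_snd_strictMono (H : IsPrincipalPair m n L k k' l l')
    (hp : IsSol (fun v u => n u v) p) : StrictMono fun v => (H.model (p v, v)).2 := by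
  obtain ⟨x, rfl⟩ := H.eq_leafP hp
  exact H.Y_strictMono_leafP x

lemma model_fst_strictMono (H : IsPrincipalPair m n L k k' l l') (hf : IsSol m f) :
    StrictMono fun u => (H.model (u, f u)).1 := H.X_strictMono hf

end IsPrincipalPair

/-! ### Integral curves of planar line fields -/

/-- `z` and `w` lie on a common integral curve, contained in `W`, of the planar line field `ℓ`. -/
def PlanarLine (ℓ : ℝ × ℝ → Set (ℝ × ℝ)) (W : Set (ℝ × ℝ)) (z w : ℝ × ℝ) : Prop :=
  ∃ γ : ℝ → ℝ × ℝ, ContDiff ℝ 1 γ ∧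
    (∀ t, γ t ∈ W ∧ deriv γ t ≠ 0 ∧ deriv γ t ∈ ℓ (γ t)) ∧ z ∈ range γ ∧ w ∈ range γ

/-- The lines of slope `dv/du = m`. -/
def slopeField (m : ℝ → ℝ → ℝ) (z : ℝ × ℝ) : Set (ℝ × ℝ) := {w | w.2 = m z.1 z.2 * w.1}

/-- The lines of slope `du/dv = n`. -/
def coslopeField (n : ℝ → ℝ → ℝ) (z : ℝ × ℝ) : Set (ℝ × ℝ) := {w | w.1 = n z.1 z.2 * w.2}

namespace IsSingularField

variable {F : ℝ → ℝ → ℝ} {L : ℝ} {k k' : ℝ → ℝ} {f : ℝ → ℝ}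

lemma exists_sol_of_curve_aux (hF : IsSingularField F L k k') {a b a' : ℝ → ℝ}
    (ha : ∀ t, HasDerivAt a (a' t) t) (hb : ∀ t, HasDerivAt b (F (a t) (b t) * a' t) t)
    (hpos : ∀ t, 0 < a' t) (h0 : ∀ t, a t ≠ 0 ∨ b t ≠ 0) {t₀ t₁ : ℝ} (ht : t₀ ≤ t₁) :
    ∃ f, IsSol F f ∧ f (a t₀) = b t₀ ∧ f (a t₁) = b t₁ ∧ (f 0 = 0 → 0 < a t₀ * a t₁) := by
  obtain ⟨c, hc⟩ := hF.sol_surjective (a t₀) (b t₀)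
  set f := hF.sol c with hfdef
  have hf : IsSol F f := hF.isSol_sol c
  have hac : Continuous a := continuous_iff_continuousAt.2 fun t => (ha t).continuousAt
  have hbc : Continuous b := continuous_iff_continuousAt.2 fun t => (hb t).continuousAt
  have hmono : StrictMono a := strictMono_of_hasDerivAt_pos ha hpos
  have hex : ∃ e, ∀ t, t ≠ e → a t ≠ 0 := by
    by_cases h : ∃ e, a e = 0
    · obtain ⟨e, he⟩ := h
      exact ⟨e, fun t hte h => hte (hmono.injective (h.trans he.symm))⟩
    · push Not at h
      exact ⟨0, fun t _ => h t⟩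
  obtain ⟨e, he⟩ := hex
  have key : ∀ t, t₀ ≤ t → f (a t) = b t := by
    intro t htt
    have := sq_le_sq_mul_exp_of_deriv (φ := fun t => b t - f (a t))
      (φ' := fun t => F (a t) (b t) * a' t - F (a t) (f (a t)) * a' t)
      (k := fun t => k (a t)) (k' := fun t => k' (a t) * a' t) (c := e) htt
      (hbc.sub (hf.cont.comp hac)).continuousOn (hF.weight_cont.comp hac).continuousOn
      (fun t _ hte => (hb t).sub ((hf.deriv (a t) (Or.inl (he t hte))).comp t (ha t)))
      (fun t _ hte => (hF.weight_deriv (a t) (he t hte)).comp t (ha t))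
      (fun t _ hte => by
        have := hF.one_sided (a t) (he t hte) (b t) (f (a t))
        nlinarith [mul_le_mul_of_nonneg_right this (hpos t).le])
    simp only [hc, sub_self] at this
    nlinarith [sq_nonneg (b t - f (a t))]
  refine ⟨f, hf, hc, key t₁ ht, fun hf0 => ?_⟩
  by_contra! hle
  have hmon := hmono.monotone ht
  have hI : (0 : ℝ) ∈ Icc (a t₀) (a t₁) := by
    constructor
    · by_contra! h; nlinarith
    · by_contra! h; nlinarith
  obtain ⟨t, ht, hat⟩ := intermediate_value_Icc ht hac.continuousOn hI
  have h1 := key t ht.1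
  rw [hat, hf0] at h1
  rcases h0 t with h | h
  · exact h hat
  · exact h h1.symm

lemma exists_sol_of_curve (hF : IsSingularField F L k k') {a b a' : ℝ → ℝ}
    (ha : ∀ t, HasDerivAt a (a' t) t) (hb : ∀ t, HasDerivAt b (F (a t) (b t) * a' t) t)
    (hne : ∀ t, a' t ≠ 0) (hcont : Continuous a') (h0 : ∀ t, a t ≠ 0 ∨ b t ≠ 0) (t₀ t₁ : ℝ) :
    ∃ f, IsSol F f ∧ f (a t₀) = b t₀ ∧ f (a t₁) = b t₁ ∧ (f 0 = 0 → 0 < a t₀ * a t₁) := by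
  have symm : ∀ x y : ℝ × ℝ, (∃ f, IsSol F f ∧ f x.1 = x.2 ∧ f y.1 = y.2 ∧ (f 0 = 0 → 0 < x.1 * y.1)) →
      ∃ f, IsSol F f ∧ f y.1 = y.2 ∧ f x.1 = x.2 ∧ (f 0 = 0 → 0 < y.1 * x.1) := by
    rintro x y ⟨f, h1, h2, h3, h4⟩
    exact ⟨f, h1, h3, h2, fun h => by rw [mul_comm]; exact h4 h⟩
  have both : ∀ {a b a' : ℝ → ℝ}, (∀ t, HasDerivAt a (a' t) t) →
      (∀ t, HasDerivAt b (F (a t) (b t) * a' t) t) → (∀ t, 0 < a' t) →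
      (∀ t, a t ≠ 0 ∨ b t ≠ 0) → ∀ t₀ t₁ : ℝ,
      ∃ f, IsSol F f ∧ f (a t₀) = b t₀ ∧ f (a t₁) = b t₁ ∧ (f 0 = 0 → 0 < a t₀ * a t₁) := by
    intro a b a' ha hb hpos h0 t₀ t₁
    rcases le_total t₀ t₁ with h | h
    · exact hF.exists_sol_of_curve_aux ha hb hpos h0 h
    · exact symm (a t₁, b t₁) (a t₀, b t₀) (hF.exists_sol_of_curve_aux ha hb hpos h0 h)
  rcases lt_or_gt_of_ne (hne 0) with hn | hp
  · have hneg : ∀ t, a' t < 0 := by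
      intro t
      by_contra! h
      obtain ⟨s, hs⟩ := mem_range_of_exists_le_of_exists_ge hcont ⟨0, hn.le⟩ ⟨t, h⟩
      exact hne s hs
    have := both (a := fun t => a (-t)) (b := fun t => b (-t)) (a' := fun t => -a' (-t))
      (fun t => ((ha (-t)).comp t (hasDerivAt_neg t)).congr_deriv (by ring))
      (fun t => ((hb (-t)).comp t (hasDerivAt_neg t)).congr_deriv (by ring))
      (fun t => by linarith [hneg (-t)]) (fun t => h0 (-t)) (-t₀) (-t₁)
    simpa only [neg_neg] using this
  · have hpos : ∀ t, 0 < a' t := by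
      intro t
      by_contra! h
      obtain ⟨s, hs⟩ := mem_range_of_exists_le_of_exists_ge hcont ⟨t, h⟩ ⟨0, hp.le⟩
      exact hne s hs
    exact both ha hb hpos h0 t₀ t₁

lemma exists_curve_of_sol (hF : IsSingularField F L k k') (hf : IsSol F f) {U : Set (ℝ × ℝ)}
    (hU : IsOpen U) (hU0 : ∀ z ∈ U, z.1 ≠ 0 ∨ z.2 ≠ 0) {s₁ s₂ : ℝ}
    (h : ∀ s ∈ uIcc s₁ s₂, (s, f s) ∈ U) :
    ∃ a b : ℝ → ℝ, ContDiff ℝ 1 a ∧ ContDiff ℝ 1 b ∧ (∀ t, (a t, b t) ∈ U ∧ deriv a t ≠ 0 ∧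
      deriv b t = F (a t) (b t) * deriv a t) ∧
      (∃ t, (a t, b t) = (s₁, f s₁)) ∧ ∃ t, (a t, b t) = (s₂, f s₂) := by
  have hV : IsOpen {s | (s, f s) ∈ U} := hU.preimage (continuous_id.prodMk hf.cont)
  obtain ⟨ε, hε, hsub⟩ := isCompact_uIcc.exists_thickening_subset_open hV h
  set lo := min s₁ s₂ - ε with hlo
  set hi := max s₁ s₂ + ε with hhi
  have hmm : min s₁ s₂ ≤ max s₁ s₂ := min_le_max
  have hI : ∀ s ∈ Ioo lo hi, (s, f s) ∈ U := by
    intro s hs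
    apply hsub
    rw [Metric.mem_thickening_iff]
    refine ⟨max (min s₁ s₂) (min s (max s₁ s₂)), ⟨le_max_left _ _, max_le hmm (min_le_right _ _)⟩, ?_⟩
    rw [Real.dist_eq, abs_lt]
    constructor
    · rcases le_total (min s₁ s₂) s with h | h
      · have : max (min s₁ s₂) (min s (max s₁ s₂)) ≤ s := max_le h (min_le_left _ _)
        linarith
      · have : max (min s₁ s₂) (min s (max s₁ s₂)) ≤ min s₁ s₂ :=
          max_le le_rfl ((min_le_left _ _).trans h)
        linarith [hs.1]
    · rcases le_total s (max s₁ s₂) with h | h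
      · rw [min_eq_left h]
        linarith [le_max_right (min s₁ s₂) s]
      · rw [min_eq_right h]
        linarith [le_max_right (min s₁ s₂) (max s₁ s₂), hs.2]
  have hw : 0 < (hi - lo) / Real.pi := div_pos (by linarith) Real.pi_pos
  set σ : ℝ → ℝ := fun t => (lo + hi) / 2 + (hi - lo) / Real.pi * Real.arctan t with hσ
  set σ' : ℝ → ℝ := fun t => (hi - lo) / Real.pi * (1 / (1 + t ^ 2)) with hσ'
  have hσd : ∀ t, HasDerivAt σ (σ' t) t := fun t =>
    ((Real.hasDerivAt_arctan t).const_mul _).const_add _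
  have hσpos : ∀ t, 0 < σ' t := fun t => mul_pos hw (by positivity)
  have hσc : ContDiff ℝ 1 σ := contDiff_const.add (contDiff_const.mul Real.contDiff_arctan)
  have hσI : ∀ t, σ t ∈ Ioo lo hi := fun t => by
    have h1 := Real.neg_pi_div_two_lt_arctan t
    have h2 := Real.arctan_lt_pi_div_two t
    have e : (hi - lo) / Real.pi * (Real.pi / 2) = (hi - lo) / 2 := by
      field_simp
    constructor
    · have := mul_lt_mul_of_pos_left h1 hw
      simp only [hσ]; linarith
    · have := mul_lt_mul_of_pos_left h2 hw
      simp only [hσ]; linarith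
  have hσs : ∀ s ∈ Ioo lo hi, ∃ t, σ t = s := fun s hs => by
    refine ⟨Real.tan ((s - (lo + hi) / 2) / ((hi - lo) / Real.pi)), ?_⟩
    have e : (hi - lo) / 2 = (hi - lo) / Real.pi * (Real.pi / 2) := by field_simp
    simp only [hσ]
    rw [Real.arctan_tan]
    · rw [← mul_div_assoc, mul_div_cancel_left₀ _ hw.ne']; ring
    · rw [lt_div_iff₀ hw]; linarith [hs.1]
    · rw [div_lt_iff₀ hw]; linarith [hs.2]
  have hbd : ∀ t, HasDerivAt (fun t => f (σ t)) (F (σ t) (f (σ t)) * σ' t) t := fun t =>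
    (hf.deriv (σ t) (hU0 _ (hI _ (hσI t)))).comp t (hσd t)
  have hbc : ContDiff ℝ 1 fun t => f (σ t) := by
    rw [contDiff_one_iff_deriv]
    refine ⟨fun t => (hbd t).differentiableAt, ?_⟩
    rw [show deriv (fun t => f (σ t)) = fun t => F (σ t) (f (σ t)) * σ' t from
      funext fun t => (hbd t).deriv]
    rw [continuous_iff_continuousAt]
    intro t
    have h1 : ContinuousAt (fun t => (σ t, f (σ t))) t :=
      (hσc.continuous.prodMk (hf.cont.comp hσc.continuous)).continuousAt
    have h2 : ContinuousAt σ' t := by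
      have : Continuous σ' := continuous_const.mul
        (continuous_const.div (by fun_prop) fun x => by positivity)
      exact this.continuousAt
    exact (ContinuousAt.comp (f := fun t => (σ t, f (σ t)))
      (hF.cont (σ t) (f (σ t)) (hU0 _ (hI _ (hσI t)))) h1).mul h2
  refine ⟨σ, fun t => f (σ t), hσc, hbc, fun t => ⟨hI _ (hσI t), ?_, ?_⟩, ?_, ?_⟩
  · rw [(hσd t).deriv]; exact (hσpos t).ne'
  · rw [(hσd t).deriv, (hbd t).deriv]
  · obtain ⟨t, ht⟩ := hσs s₁ ⟨by linarith [min_le_left s₁ s₂], by linarith [le_max_left s₁ s₂]⟩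
    exact ⟨t, by simp only [ht]⟩
  · obtain ⟨t, ht⟩ := hσs s₂ ⟨by linarith [min_le_right s₁ s₂], by linarith [le_max_right s₁ s₂]⟩
    exact ⟨t, by simp only [ht]⟩

end IsSingularField

/-! ### The model foliations -/

lemma SameSaddleNodeLeaf.smul {z w : ℝ × ℝ} (h : SameSaddleNodeLeaf z w) {ρ : ℝ} (hρ : 0 < ρ) :
    SameSaddleNodeLeaf (ρ • z) (ρ • w) := by
  have hm : ∀ x : ℝ, max (-(ρ * x)) 0 = ρ * max (-x) 0 := fun x => by
    rw [mul_max_of_nonneg _ _ hρ.le, mul_zero, mul_neg]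
  simp only [SameSaddleNodeLeaf, Prod.smul_fst, Prod.smul_snd, smul_eq_mul, hm]
  rcases h with ⟨h1, h2, h3, h4⟩ | ⟨s, hs, h1, h2, h3, h4⟩ | ⟨τ, hτ, h3, h4⟩ | ⟨τ, hτ, h3, h4⟩
  · exact Or.inl ⟨by positivity, by positivity, by simp [h3], by simp [h4]⟩
  · exact Or.inr (Or.inl ⟨s, hs, mul_neg_of_pos_of_neg hρ h1, mul_neg_of_pos_of_neg hρ h2,
      by rw [h3]; ring, by rw [h4]; ring⟩)
  · exact Or.inr (Or.inr (Or.inl ⟨ρ * τ, by positivity, by rw [h3]; ring, by rw [h4]; ring⟩))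
  · exact Or.inr (Or.inr (Or.inr ⟨ρ * τ, by positivity, by rw [h3]; ring, by rw [h4]; ring⟩))

lemma sameSaddleNodeLeaf_smul_iff {z w : ℝ × ℝ} {ρ : ℝ} (hρ : 0 < ρ) :
    SameSaddleNodeLeaf (ρ • z) (ρ • w) ↔ SameSaddleNodeLeaf z w := by
  refine ⟨fun h => ?_, fun h => h.smul hρ⟩
  have := h.smul (inv_pos.2 hρ)
  rwa [inv_smul_smul₀ hρ.ne', inv_smul_smul₀ hρ.ne'] at this

lemma sameParallelLeaf_smul_iff {z w : ℝ × ℝ} {ρ : ℝ} (hρ : 0 < ρ) :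
    SameParallelLeaf (ρ • z) (ρ • w) ↔ SameParallelLeaf z w := by
  simp only [SameParallelLeaf, Prod.smul_fst, Prod.smul_snd, smul_eq_mul]
  have e : ρ * z.2 * (ρ * w.2) = ρ ^ 2 * (z.2 * w.2) := by ring
  rw [e, mul_pos_iff_of_pos_left (by positivity), mul_eq_zero, or_iff_right hρ.ne',
    mul_right_inj' hρ.ne']

lemma SameSaddleNodeLeaf.symm {z w : ℝ × ℝ} (h : SameSaddleNodeLeaf z w) :
    SameSaddleNodeLeaf w z := by
  rcases h with ⟨h1, h2, h3, h4⟩ | ⟨s, hs, h1, h2, h3, h4⟩ | ⟨τ, hτ, h3, h4⟩ | ⟨τ, hτ, h3, h4⟩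
  · exact Or.inl ⟨h2, h1, h4, h3⟩
  · exact Or.inr (Or.inl ⟨s, hs, h2, h1, h4, h3⟩)
  · exact Or.inr (Or.inr (Or.inl ⟨τ, hτ, h4, h3⟩))
  · exact Or.inr (Or.inr (Or.inr ⟨τ, hτ, h4, h3⟩))

lemma SameSaddleNodeLeaf.trans {x y z : ℝ × ℝ} (h : SameSaddleNodeLeaf x y)
    (h' : SameSaddleNodeLeaf y z) : SameSaddleNodeLeaf x z := by
  have hm0 := le_max_right (-y.1) 0
  have hm1 := le_max_left (-y.1) 0
  rcases h with ⟨h1, h2, h3, h4⟩ | ⟨s, hs, h1, h2, h3, h4⟩ | ⟨τ, hτ, h3, h4⟩ | ⟨τ, hτ, h3, h4⟩ <;>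
  rcases h' with ⟨g1, g2, g3, g4⟩ | ⟨s', hs', g1, g2, g3, g4⟩ | ⟨τ', hτ', g3, g4⟩ | ⟨τ', hτ', g3, g4⟩
  · exact Or.inl ⟨h1, g2, h3, g4⟩
  · linarith
  · linarith
  · linarith
  · linarith
  · have : s = s' := mul_right_cancel₀ h2.ne (h4.symm.trans g3)
    subst this
    exact Or.inr (Or.inl ⟨s, hs, h1, g2, h3, g4⟩)
  · nlinarith [hs.1, hs.2]
  · nlinarith [hs.1, hs.2]
  · linarith
  · nlinarith [hs'.1, hs'.2]
  · have : τ = τ' := by linarith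
    subst this
    exact Or.inr (Or.inr (Or.inl ⟨τ, hτ, h3, g4⟩))
  · linarith
  · linarith
  · nlinarith [hs'.1, hs'.2]
  · linarith
  · have : τ = τ' := by linarith
    subst this
    exact Or.inr (Or.inr (Or.inr ⟨τ, hτ, h3, g4⟩))

lemma SameParallelLeaf.symm {z w : ℝ × ℝ} (h : SameParallelLeaf z w) : SameParallelLeaf w z :=
  ⟨h.1.symm, fun h0 => by rw [mul_comm]; exact h.2 (h.1.trans h0)⟩

lemma SameParallelLeaf.trans {x y z : ℝ × ℝ} (h : SameParallelLeaf x y)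
    (h' : SameParallelLeaf y z) : SameParallelLeaf x z :=
  ⟨h.1.trans h'.1, fun h0 => by
    have h1 := h.2 h0
    have h2 := h'.2 (h.1.symm.trans h0)
    have h3 : y.2 ≠ 0 := fun e => by rw [e, mul_zero] at h1; exact lt_irrefl _ h1
    have h4 : 0 < (x.2 * z.2) * y.2 ^ 2 := by nlinarith [mul_pos h1 h2]
    exact pos_of_mul_pos_left h4 (sq_nonneg _)⟩

/-- Leaves of the saddle-node model meet squares in arcs. -/
lemma SameSaddleNodeLeaf.abs_snd_lt {z w q : ℝ × ℝ} {ρ : ℝ} (hzq : SameSaddleNodeLeaf z q)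
    (hzw : SameSaddleNodeLeaf z w) (hz1 : |z.1| < ρ) (hw1 : |w.1| < ρ) (hz : |z.2| < ρ)
    (hw : |w.2| < ρ) (hq : q.1 ∈ uIcc z.1 w.1) : |q.1| < ρ ∧ |q.2| < ρ := by
  have hρ : 0 < ρ := (abs_nonneg _).trans_lt hz1
  have hq1 : |q.1| < ρ := by
    rw [abs_lt] at *
    rcases le_total z.1 w.1 with h | h
    · rw [uIcc_of_le h] at hq; constructor <;> linarith [hq.1, hq.2]
    · rw [uIcc_of_ge h] at hq; constructor <;> linarith [hq.1, hq.2]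
  refine ⟨hq1, ?_⟩
  have hmax : max (-q.1) 0 ≤ max (-z.1) 0 ∨ max (-q.1) 0 ≤ max (-w.1) 0 := by
    rcases le_total z.1 w.1 with h | h
    · rw [uIcc_of_le h] at hq
      left; exact max_le_max (by linarith [hq.1]) le_rfl
    · rw [uIcc_of_ge h] at hq
      right; exact max_le_max (by linarith [hq.1]) le_rfl
  have hqw := hzq.symm.trans hzw
  have hm0 := le_max_right (-q.1) 0
  have hm1 := le_max_left (-q.1) 0
  rw [abs_lt] at hz hw
  rcases hzq with ⟨h1, h2, h3, h4⟩ | ⟨s, hs, h1, h2, h3, h4⟩ | ⟨τ, hτ, h3, h4⟩ | ⟨τ, hτ, h3, h4⟩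
  · rw [h4, abs_zero]; exact hρ
  · rw [abs_lt] at hq1 ⊢
    constructor <;> nlinarith [hs.1, hs.2]
  · have hw2 : w.2 = τ + max (-w.1) 0 := by
      rcases hqw with ⟨g1, g2, g3, g4⟩ | ⟨s', hs', g1, g2, g3, g4⟩ | ⟨τ', hτ', g3, g4⟩ | ⟨τ', hτ', g3, g4⟩
      · linarith
      · nlinarith [hs'.1, hs'.2]
      · linarith
      · linarith
    rw [abs_lt]
    constructor
    · linarith
    · rcases hmax with h | h <;> linarith [hz.2, hw.2]
  · have hw2 : w.2 = -(τ + max (-w.1) 0) := by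
      rcases hqw with ⟨g1, g2, g3, g4⟩ | ⟨s', hs', g1, g2, g3, g4⟩ | ⟨τ', hτ', g3, g4⟩ | ⟨τ', hτ', g3, g4⟩
      · linarith
      · nlinarith [hs'.1, hs'.2]
      · linarith
      · linarith
    rw [abs_lt]
    constructor
    · rcases hmax with h | h <;> linarith [hz.1, hw.1]
    · linarith

/-- The open square centred at the origin with half-side `ρ`. -/
def squareOf (ρ : ℝ) : Set (ℝ × ℝ) := Ioo (-ρ) ρ ×ˢ Ioo (-ρ) ρ

lemma mem_squareOf {ρ : ℝ} {z : ℝ × ℝ} : z ∈ squareOf ρ ↔ |z.1| < ρ ∧ |z.2| < ρ := by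
  simp [squareOf, abs_lt, mem_prod]

lemma isOpen_squareOf (ρ : ℝ) : IsOpen (squareOf ρ) := isOpen_Ioo.prod isOpen_Ioo

lemma ne_zero_iff_coord {z : ℝ × ℝ} : z ≠ (0, 0) ↔ z.1 ≠ 0 ∨ z.2 ≠ 0 := by
  rw [Ne, Prod.ext_iff, not_and_or]

namespace IsPrincipalPair

variable {m n : ℝ → ℝ → ℝ} {L : ℝ} {k k' l l' : ℝ → ℝ}

lemma planarLine_slope_iff (H : IsPrincipalPair m n L k k' l l') (ρ : ℝ) {z w : ℝ × ℝ}
    (hz : z ∈ H.model ⁻¹' squareOf ρ \ {(0, 0)}) (hw : w ∈ H.model ⁻¹' squareOf ρ \ {(0, 0)}) :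
    PlanarLine (slopeField m) (H.model ⁻¹' squareOf ρ \ {(0, 0)}) z w ↔
      SameSaddleNodeLeaf (H.model z) (H.model w) := by
  have hcont := H.isOpenEmbedding_model.continuous
  have hopen : IsOpen (H.model ⁻¹' squareOf ρ \ {(0, 0)}) :=
    ((isOpen_squareOf ρ).preimage hcont).sdiff isClosed_singleton
  constructor
  · rintro ⟨γ, hγ, hγ', ⟨t₀, rfl⟩, ⟨t₁, rfl⟩⟩
    rw [sameSaddleNodeLeaf_iff]
    have hd : ∀ t, HasDerivAt γ (deriv γ t) t := fun t =>
      (hγ.differentiable one_ne_zero t).hasDerivAt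
    have h1 : ∀ t, HasDerivAt (fun t => (γ t).1) (deriv γ t).1 t := fun t =>
      (ContinuousLinearMap.fst ℝ ℝ ℝ).hasFDerivAt.comp_hasDerivAt t (hd t)
    have h2 : ∀ t, HasDerivAt (fun t => (γ t).2) (deriv γ t).2 t := fun t =>
      (ContinuousLinearMap.snd ℝ ℝ ℝ).hasFDerivAt.comp_hasDerivAt t (hd t)
    refine H.fieldS.exists_sol_of_curve (a := fun t => (γ t).1) (b := fun t => (γ t).2)
      (a' := fun t => (deriv γ t).1) h1 (fun t => ?_) (fun t h0 => ?_) ?_ (fun t => ?_) t₀ t₁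
    · rw [← show (deriv γ t).2 = _ from (hγ' t).2.2]; exact h2 t
    · refine (hγ' t).2.1 (Prod.ext h0 ?_)
      rw [show (deriv γ t).2 = _ from (hγ' t).2.2, h0, mul_zero]; rfl
    · exact continuous_fst.comp (hγ.continuous_deriv le_rfl)
    · exact ne_zero_iff_coord.1 (hγ' t).1.2
  · intro h
    obtain ⟨f, hf, hfz, hfw, h0⟩ := H.sameSaddleNodeLeaf_iff.1 h
    have hmono := H.model_fst_strictMono hf
    have hsub : ∀ s ∈ uIcc z.1 w.1, (s, f s) ∈ H.model ⁻¹' squareOf ρ \ {(0, 0)} := by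
      intro s hs
      have hcase : z.1 ≤ s ∧ s ≤ w.1 ∨ w.1 ≤ s ∧ s ≤ z.1 := by
        rcases le_total z.1 w.1 with h | h
        · rw [uIcc_of_le h] at hs; exact Or.inl hs
        · rw [uIcc_of_ge h] at hs; exact Or.inr hs
      have hs0 : f 0 = 0 → 0 < z.1 * s := fun e => by
        have := h0 e
        rcases pos_and_pos_or_neg_and_neg_of_mul_pos this with ⟨a, b⟩ | ⟨a, b⟩ <;>
          rcases hcase with hc | hc
        · exact mul_pos a (a.trans_le hc.1)
        · exact mul_pos a (b.trans_le hc.1)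
        · exact mul_pos_of_neg_of_neg a (hc.2.trans_lt b)
        · exact mul_pos_of_neg_of_neg a (hc.2.trans_lt a)
      refine ⟨?_, ?_⟩
      · have hq : SameSaddleNodeLeaf (H.model z) (H.model (s, f s)) :=
          H.sameSaddleNodeLeaf_iff.2 ⟨f, hf, hfz, rfl, hs0⟩
        have hz' := mem_squareOf.1 hz.1
        have hw' := mem_squareOf.1 hw.1
        refine mem_squareOf.2 (hq.abs_snd_lt h hz'.1 hw'.1 hz'.2 hw'.2 ?_)
        have ez : (H.model (z.1, f z.1)).1 = (H.model z).1 := by rw [hfz]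
        have ew : (H.model (w.1, f w.1)).1 = (H.model w).1 := by rw [hfw]
        rw [← ez, ← ew, mem_uIcc]
        exact hcase.imp (fun hc => ⟨hmono.monotone hc.1, hmono.monotone hc.2⟩)
          (fun hc => ⟨hmono.monotone hc.1, hmono.monotone hc.2⟩)
      · intro e
        have e1 : s = 0 := congrArg Prod.fst e
        have e2 : f s = 0 := congrArg Prod.snd e
        rw [e1] at e2
        have := hs0 e2
        rw [e1, mul_zero] at this
        exact lt_irrefl _ this
    obtain ⟨a, b, ha, hb, hab, ⟨t₁, ht₁⟩, ⟨t₂, ht₂⟩⟩ := H.fieldS.exists_curve_of_sol hf hopen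
      (fun z hz => ne_zero_iff_coord.1 hz.2) hsub
    have hd : ∀ t, deriv (fun t => (a t, b t)) t = (deriv a t, deriv b t) := fun t =>
      ((ha.differentiable one_ne_zero t).hasDerivAt.prodMk
        (hb.differentiable one_ne_zero t).hasDerivAt).deriv
    refine ⟨fun t => (a t, b t), ha.prodMk hb, fun t => ⟨(hab t).1, ?_, ?_⟩, ⟨t₁, ?_⟩, ⟨t₂, ?_⟩⟩
    · rw [hd]
      exact fun e => (hab t).2.1 (congrArg Prod.fst e)
    · rw [hd]
      exact (hab t).2.2
    · beta_reduce; rw [ht₁, hfz]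
    · beta_reduce; rw [ht₂, hfw]

lemma planarLine_coslope_iff (H : IsPrincipalPair m n L k k' l l') (ρ : ℝ) {z w : ℝ × ℝ}
    (hz : z ∈ H.model ⁻¹' squareOf ρ \ {(0, 0)}) (hw : w ∈ H.model ⁻¹' squareOf ρ \ {(0, 0)}) :
    PlanarLine (coslopeField n) (H.model ⁻¹' squareOf ρ \ {(0, 0)}) z w ↔
      SameParallelLeaf (H.model z) (H.model w) := by
  have hcont := H.isOpenEmbedding_model.continuous
  have hopen : IsOpen (H.model ⁻¹' squareOf ρ \ {(0, 0)}) :=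
    ((isOpen_squareOf ρ).preimage hcont).sdiff isClosed_singleton
  constructor
  · rintro ⟨γ, hγ, hγ', ⟨t₀, rfl⟩, ⟨t₁, rfl⟩⟩
    rw [sameParallelLeaf_iff]
    have hd : ∀ t, HasDerivAt γ (deriv γ t) t := fun t =>
      (hγ.differentiable one_ne_zero t).hasDerivAt
    have h1 : ∀ t, HasDerivAt (fun t => (γ t).1) (deriv γ t).1 t := fun t =>
      (ContinuousLinearMap.fst ℝ ℝ ℝ).hasFDerivAt.comp_hasDerivAt t (hd t)
    have h2 : ∀ t, HasDerivAt (fun t => (γ t).2) (deriv γ t).2 t := fun t =>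
      (ContinuousLinearMap.snd ℝ ℝ ℝ).hasFDerivAt.comp_hasDerivAt t (hd t)
    refine H.fieldP.exists_sol_of_curve (a := fun t => (γ t).2) (b := fun t => (γ t).1)
      (a' := fun t => (deriv γ t).2) h2 (fun t => ?_) (fun t h0 => ?_) ?_ (fun t => ?_) t₀ t₁
    · rw [← show (deriv γ t).1 = _ from (hγ' t).2.2]; exact h1 t
    · refine (hγ' t).2.1 (Prod.ext ?_ h0)
      rw [show (deriv γ t).1 = _ from (hγ' t).2.2, h0, mul_zero]; rfl
    · exact continuous_snd.comp (hγ.continuous_deriv le_rfl)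
    · exact (ne_zero_iff_coord.1 (hγ' t).1.2).symm
  · intro h
    obtain ⟨p, hp, hpz, hpw, h0⟩ := H.sameParallelLeaf_iff.1 h
    have hmono := H.model_snd_strictMono hp
    have hsub : ∀ s ∈ uIcc z.2 w.2,
        (s, p s) ∈ Prod.swap ⁻¹' (H.model ⁻¹' squareOf ρ \ {(0, 0)}) := by
      intro s hs
      have hcase : z.2 ≤ s ∧ s ≤ w.2 ∨ w.2 ≤ s ∧ s ≤ z.2 := by
        rcases le_total z.2 w.2 with h | h
        · rw [uIcc_of_le h] at hs; exact Or.inl hs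
        · rw [uIcc_of_ge h] at hs; exact Or.inr hs
      have hs0 : p 0 = 0 → 0 < z.2 * s := fun e => by
        have := h0 e
        rcases pos_and_pos_or_neg_and_neg_of_mul_pos this with ⟨a, b⟩ | ⟨a, b⟩ <;>
          rcases hcase with hc | hc
        · exact mul_pos a (a.trans_le hc.1)
        · exact mul_pos a (b.trans_le hc.1)
        · exact mul_pos_of_neg_of_neg a (hc.2.trans_lt b)
        · exact mul_pos_of_neg_of_neg a (hc.2.trans_lt a)
      refine ⟨?_, ?_⟩
      · have hq : SameParallelLeaf (H.model z) (H.model (p s, s)) :=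
          H.sameParallelLeaf_iff.2 ⟨p, hp, hpz, rfl, hs0⟩
        have hz' := mem_squareOf.1 hz.1
        have hw' := mem_squareOf.1 hw.1
        refine mem_squareOf.2 ⟨by rw [Prod.swap_prod_mk, ← hq.1]; exact hz'.1, ?_⟩
        have ez : (H.model (p z.2, z.2)).2 = (H.model z).2 := by rw [hpz]
        have ew : (H.model (p w.2, w.2)).2 = (H.model w).2 := by rw [hpw]
        have h3 := abs_lt.1 hz'.2
        have h4 := abs_lt.1 hw'.2
        rw [← ez] at h3
        rw [← ew] at h4
        rw [abs_lt]
        rcases hcase with hc | hc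
        · exact ⟨h3.1.trans_le (hmono.monotone hc.1), (hmono.monotone hc.2).trans_lt h4.2⟩
        · exact ⟨h4.1.trans_le (hmono.monotone hc.1), (hmono.monotone hc.2).trans_lt h3.2⟩
      · intro e
        have e1 : s = 0 := congrArg Prod.snd e
        have e2 : p s = 0 := congrArg Prod.fst e
        rw [e1] at e2
        have := hs0 e2
        rw [e1, mul_zero] at this
        exact lt_irrefl _ this
    obtain ⟨a, b, ha, hb, hab, ⟨t₁, ht₁⟩, ⟨t₂, ht₂⟩⟩ := H.fieldP.exists_curve_of_sol hp
      (hopen.preimage continuous_swap) (fun z hz => (ne_zero_iff_coord.1 hz.2).symm) hsub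
    have hd : ∀ t, deriv (fun t => (b t, a t)) t = (deriv b t, deriv a t) := fun t =>
      ((hb.differentiable one_ne_zero t).hasDerivAt.prodMk
        (ha.differentiable one_ne_zero t).hasDerivAt).deriv
    refine ⟨fun t => (b t, a t), hb.prodMk ha, fun t => ⟨(hab t).1, ?_, ?_⟩, ⟨t₁, ?_⟩, ⟨t₂, ?_⟩⟩
    · rw [hd]
      exact fun e => (hab t).2.1 (congrArg Prod.snd e)
    · rw [hd]
      exact (hab t).2.2
    · have e1 : a t₁ = z.2 := congrArg Prod.fst ht₁
      have e2 : b t₁ = p z.2 := congrArg Prod.snd ht₁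
      beta_reduce; rw [e1, e2, hpz]
    · have e1 : a t₂ = w.2 := congrArg Prod.fst ht₂
      have e2 : b t₂ = p w.2 := congrArg Prod.snd ht₂
      beta_reduce; rw [e1, e2, hpw]

/-- Every neighbourhood of the origin contains one which is carried onto the model square. -/
theorem exists_local_model (H : IsPrincipalPair m n L k k' l l') {O : Set (ℝ × ℝ)}
    (hO : O ∈ 𝓝 ((0, 0) : ℝ × ℝ)) :
    ∃ Φ : OpenPartialHomeomorph (ℝ × ℝ) (ℝ × ℝ), Φ.source ⊆ O ∧ (0, 0) ∈ Φ.source ∧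
      Φ (0, 0) = (0, 0) ∧ Φ.target = squareOf 1 ∧
      ∀ z ∈ Φ.source \ {(0, 0)}, ∀ w ∈ Φ.source \ {(0, 0)},
        (PlanarLine (slopeField m) (Φ.source \ {(0, 0)}) z w ↔ SameSaddleNodeLeaf (Φ z) (Φ w)) ∧
        (PlanarLine (coslopeField n) (Φ.source \ {(0, 0)}) z w ↔
          SameParallelLeaf (Φ z) (Φ w)) := by
  have hemb := H.isOpenEmbedding_model
  have him : H.model '' O ∈ 𝓝 ((0, 0) : ℝ × ℝ) := by
    have := hemb.isOpenMap.image_mem_nhds hO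
    rwa [H.model_zero] at this
  obtain ⟨ρ, hρ, hball⟩ := Metric.mem_nhds_iff.1 him
  have hsq : squareOf ρ ⊆ H.model '' O := fun z hz => hball (by
    have := mem_squareOf.1 hz
    rw [Metric.mem_ball, Prod.dist_eq, Real.dist_eq, Real.dist_eq]
    simpa using this)
  let e := hemb.toOpenPartialHomeomorph H.model
  let sc : ℝ × ℝ ≃ₜ ℝ × ℝ := Homeomorph.smulOfNeZero ρ⁻¹ (inv_ne_zero hρ.ne')
  have hsc : ∀ z, ρ⁻¹ • z ∈ squareOf 1 ↔ z ∈ squareOf ρ := fun z => by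
    simp only [mem_squareOf, Prod.smul_fst, Prod.smul_snd, smul_eq_mul, abs_mul,
      abs_of_pos (inv_pos.2 hρ), inv_mul_lt_one₀ hρ]
  let Φ := (e.trans sc.toOpenPartialHomeomorph).trans
    (OpenPartialHomeomorph.ofSet (squareOf 1) (isOpen_squareOf 1))
  have hΦ : ∀ z, Φ z = ρ⁻¹ • H.model z := fun z => rfl
  have hsource : Φ.source = H.model ⁻¹' squareOf ρ := by
    ext z
    simp only [Φ, e, mfld_simps]
    exact hsc _
  have htarget : Φ.target = squareOf 1 := by
    ext z
    simp only [Φ, e, mfld_simps]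
    refine and_iff_left_of_imp fun hz => ?_
    have h2 : ρ • z ∈ squareOf ρ := by
      rw [← hsc, inv_smul_smul₀ hρ.ne']; exact hz
    obtain ⟨y, -, hy⟩ := hsq h2
    refine ⟨y, ?_⟩
    rw [hy]
    change ρ • z = (ρ⁻¹)⁻¹ • z
    rw [inv_inv]
  refine ⟨Φ, ?_, ?_, ?_, htarget, ?_⟩
  · rw [hsource]
    intro z hz
    obtain ⟨y, hy, hye⟩ := hsq hz
    rwa [← hemb.injective hye]
  · rw [hsource, mem_preimage, H.model_zero, mem_squareOf]
    simpa using hρ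
  · rw [hΦ, H.model_zero]; simp
  · rw [hsource]
    intro z hz w hw
    rw [hΦ, hΦ, sameSaddleNodeLeaf_smul_iff (inv_pos.2 hρ), sameParallelLeaf_smul_iff (inv_pos.2 hρ)]
    exact ⟨H.planarLine_slope_iff ρ hz hw, H.planarLine_coslope_iff ρ hz hw⟩

end IsPrincipalPair

/-- Counting separatrices in a model: `T` is the set of points of the model whose leaf tends to
the origin, and `I` a set of representatives of the leaves in `T` which are limits of leaves
outside `T`. -/
theorem ncard_separatrices_eq {M : Type*} [TopologicalSpace M] [ChartedSpace E2 M]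
    {𝓛 : ∀ q : M, Set (TangentSpace (𝓡 2) q)} {p : M} (Φ : OpenPartialHomeomorph M (ℝ × ℝ))
    (hp : p ∈ Φ.source) (hΦp : Φ p = (0, 0)) (hQ : Φ.target = squareOf 1)
    {R : ℝ × ℝ → ℝ × ℝ → Prop} (hsymm : ∀ z w, R z w → R w z)
    (htrans : ∀ x y z, R x y → R y z → R x z)
    (hrefl : ∀ z, z ≠ (0, 0) → R z z)
    (hR : ∀ x ∈ Φ.source \ {p}, ∀ y ∈ Φ.source \ {p},
      (OnCommonLine 𝓛 (Φ.source \ {p}) x y ↔ R (Φ x) (Φ y)))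
    {T : Set (ℝ × ℝ)} (hT : ∀ z ∈ T, z ≠ (0, 0) → ∀ t ∈ Ioc (0 : ℝ) 1, R z (t • z))
    (hT' : ∀ z ∉ T, z ≠ (0, 0) → ∃ ε > 0, ∀ w, R z w → ε ≤ |w.1| ∨ ε ≤ |w.2|)
    (I : Finset (ℝ × ℝ)) (hI : ∀ e ∈ I, e ∈ squareOf 1 ∧ e ≠ (0, 0) ∧ e ∈ T)
    (hI_acc : ∀ e ∈ I, ∀ w, R e w → w ∈ closure Tᶜ)
    (hI_inj : ∀ e ∈ I, ∀ e' ∈ I, R e e' → e = e')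
    (hI_surj : ∀ z ∈ T, z ∈ closure Tᶜ → z ≠ (0, 0) → ∃ e ∈ I, R z e) :
    (separatrices 𝓛 (Φ.source \ {p}) p).ncard = I.card := by
  set W := Φ.source \ {p} with hW
  have hne : ∀ x ∈ W, Φ x ≠ (0, 0) := fun x hx h =>
    hx.2 (Φ.injOn hx.1 hp (h.trans hΦp.symm))
  have hback : ∀ z ∈ squareOf 1, z ≠ (0, 0) → Φ.symm z ∈ W ∧ Φ (Φ.symm z) = z := by
    intro z hz hz0
    rw [← hQ] at hz
    refine ⟨⟨Φ.map_target hz, fun h => hz0 ?_⟩, Φ.right_inv hz⟩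
    rw [← Φ.right_inv hz, mem_singleton_iff.1 h, hΦp]
  have hleaf : ∀ x ∈ W, ∀ y, y ∈ leafThrough 𝓛 W x ↔ y ∈ W ∧ R (Φ x) (Φ y) := by
    intro x hx y
    constructor
    · intro h
      have hy : y ∈ W := by
        obtain ⟨γ, -, hγ, -, t, rfl⟩ := h
        exact (hγ t).1
      exact ⟨hy, (hR x hx y hy).1 h⟩
    · rintro ⟨hy, h⟩
      exact (hR x hx y hy).2 h
  have htend : ∀ x ∈ W, p ∈ closure (leafThrough 𝓛 W x) ↔ Φ x ∈ T := by
    intro x hx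
    have hx0 := hne x hx
    constructor
    · intro hcl
      by_contra hxT
      obtain ⟨ε, hε, hfar⟩ := hT' _ hxT hx0
      have hV : Φ.source ∩ Φ ⁻¹' squareOf ε ∈ 𝓝 p := by
        refine (Φ.isOpen_inter_preimage (isOpen_squareOf ε)).mem_nhds ⟨hp, ?_⟩
        rw [mem_preimage, hΦp, mem_squareOf]; simpa using hε
      obtain ⟨y, hy, hyl⟩ := mem_closure_iff_nhds.1 hcl _ hV
      have h1 := mem_squareOf.1 hy.2
      rcases hfar _ ((hleaf x hx y).1 hyl).2 with h | h
      · exact absurd h1.1 (not_lt.2 h)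
      · exact absurd h1.2 (not_lt.2 h)
    · intro hxT
      have hc : Tendsto (fun t : ℝ => Φ.symm (t • Φ x)) (𝓝[>] 0) (𝓝 p) := by
        have h1 : Tendsto (fun t : ℝ => t • Φ x) (𝓝[>] 0) (𝓝 (0, 0)) := by
          have : Continuous fun t : ℝ => t • Φ x := by fun_prop
          have := this.tendsto 0
          rw [zero_smul] at this
          exact this.mono_left nhdsWithin_le_nhds
        have h2 := Φ.continuousAt_symm (hΦp ▸ Φ.map_source hp)
        have h3 : Φ.symm (0, 0) = p := by rw [← hΦp, Φ.left_inv hp]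
        have := h2.tendsto.comp h1
        rwa [h3] at this
      refine mem_closure_of_tendsto hc ?_
      filter_upwards [Ioc_mem_nhdsGT (zero_lt_one' ℝ)] with t ht
      have hxQ : Φ x ∈ squareOf 1 := hQ ▸ Φ.map_source hx.1
      have hQt : t • Φ x ∈ squareOf 1 := by
        rw [mem_squareOf] at hxQ ⊢
        simp only [Prod.smul_fst, Prod.smul_snd, smul_eq_mul, abs_mul, abs_of_pos ht.1]
        exact ⟨(mul_le_of_le_one_left (abs_nonneg _) ht.2).trans_lt hxQ.1,
          (mul_le_of_le_one_left (abs_nonneg _) ht.2).trans_lt hxQ.2⟩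
      obtain ⟨h3, h4⟩ := hback _ hQt (smul_ne_zero ht.1.ne' hx0)
      exact (hleaf x hx _).2 ⟨h3, by rw [h4]; exact hT _ hxT hx0 t ht⟩
  have hacc : ∀ y ∈ W, (∀ U ∈ 𝓝 y, ∃ z ∈ U ∩ W, p ∉ closure (leafThrough 𝓛 W z)) ↔
      Φ y ∈ closure Tᶜ := by
    intro y hy
    rw [mem_closure_iff_nhds]
    constructor
    · intro h V hV
      obtain ⟨z, hz, hzp⟩ := h _ ((Φ.continuousAt hy.1).preimage_mem_nhds hV)
      exact ⟨Φ z, hz.1, fun hzT => hzp ((htend z hz.2).2 hzT)⟩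
    · intro h U hU
      have hyQ : Φ y ∈ squareOf 1 := hQ ▸ Φ.map_source hy.1
      have h1 : Φ.symm ⁻¹' U ∈ 𝓝 (Φ y) := by
        refine (Φ.continuousAt_symm (Φ.map_source hy.1)).preimage_mem_nhds ?_
        rwa [Φ.left_inv hy.1]
      obtain ⟨z, hz, hzT⟩ := h _ (inter_mem h1 (inter_mem ((isOpen_squareOf 1).mem_nhds hyQ)
        (isOpen_compl_singleton.mem_nhds (hne y hy))))
      obtain ⟨h3, h4⟩ := hback z hz.2.1 hz.2.2
      refine ⟨Φ.symm z, ⟨hz.1, h3⟩, fun hcl => hzT ?_⟩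
      rw [← h4]; exact (htend _ h3).1 hcl
  have heq : separatrices 𝓛 W p = (fun e => leafThrough 𝓛 W (Φ.symm e)) '' (I : Set (ℝ × ℝ)) := by
    ext S
    constructor
    · rintro ⟨⟨x, hx, rfl⟩, hcl, hac⟩
      have hxx : x ∈ leafThrough 𝓛 W x := (hleaf x hx x).2 ⟨hx, hrefl _ (hne x hx)⟩
      obtain ⟨e, he, hre⟩ := hI_surj (Φ x) ((htend x hx).1 hcl)
        ((hacc x hx).1 (hac x hxx)) (hne x hx)
      obtain ⟨h3, h4⟩ := hback e (hI e he).1 (hI e he).2.1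
      refine ⟨e, he, ?_⟩
      ext y
      change y ∈ leafThrough 𝓛 W (Φ.symm e) ↔ _
      rw [hleaf _ h3, hleaf _ hx, h4]
      exact and_congr_right fun _ => ⟨fun h => htrans _ _ _ hre h,
        fun h => htrans _ _ _ (hsymm _ _ hre) h⟩
    · rintro ⟨e, he, rfl⟩
      obtain ⟨h3, h4⟩ := hback e (hI e he).1 (hI e he).2.1
      refine ⟨⟨_, h3, rfl⟩, (htend _ h3).2 (by rw [h4]; exact (hI e he).2.2), fun y hy => ?_⟩
      obtain ⟨hyW, hy⟩ := (hleaf _ h3 y).1 hy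
      exact (hacc y hyW).2 (hI_acc e he _ (h4 ▸ hy))
  rw [heq, InjOn.ncard_image, ncard_coe_finset]
  intro e he e' he' h
  obtain ⟨h3, h4⟩ := hback e (hI e he).1 (hI e he).2.1
  obtain ⟨h3', h4'⟩ := hback e' (hI e' he').1 (hI e' he').2.1
  have h5 : Φ.symm e' ∈ leafThrough 𝓛 W (Φ.symm e') :=
    (hleaf _ h3' _).2 ⟨h3', hrefl _ (hne _ h3')⟩
  have h6 : leafThrough 𝓛 W (Φ.symm e) = leafThrough 𝓛 W (Φ.symm e') := h
  rw [← h6, hleaf _ h3, h4, h4'] at h5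
  exact hI_inj e he e' he' h5.2

lemma SameSaddleNodeLeaf.refl {z : ℝ × ℝ} (hz : z ≠ (0, 0)) : SameSaddleNodeLeaf z z := by
  rcases lt_or_ge (max (-z.1) 0) z.2 with h | h
  · exact Or.inr (Or.inr (Or.inl ⟨z.2 - max (-z.1) 0, by linarith, by ring, by ring⟩))
  rcases lt_or_ge z.2 (-max (-z.1) 0) with h' | h'
  · exact Or.inr (Or.inr (Or.inr ⟨-z.2 - max (-z.1) 0, by linarith, by ring, by ring⟩))
  rcases lt_or_ge z.1 0 with h1 | h1
  · rw [max_eq_left (by linarith)] at h h'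
    refine Or.inr (Or.inl ⟨z.2 / z.1, ⟨?_, ?_⟩, h1, h1, ?_, ?_⟩)
    · rw [le_div_iff_of_neg h1]; linarith
    · rw [div_le_iff_of_neg h1]; linarith
    all_goals rw [div_mul_cancel₀ _ h1.ne]
  · rw [max_eq_right (by linarith)] at h h'
    have h2 : z.2 = 0 := by linarith
    refine Or.inl ⟨lt_of_le_of_ne h1 fun h3 => hz ?_, ?_, h2, h2⟩
    · exact Prod.ext h3.symm h2
    · exact lt_of_le_of_ne h1 fun h3 => hz (Prod.ext h3.symm h2)

lemma mem_closure_of_line {T : Set (ℝ × ℝ)} {z d : ℝ × ℝ}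
    (h : ∀ t > (0 : ℝ), z + t • d ∈ T) : z ∈ closure T := by
  have hc : Tendsto (fun t : ℝ => z + t • d) (𝓝[>] 0) (𝓝 z) := by
    have : Continuous fun t : ℝ => z + t • d := by fun_prop
    have := this.tendsto 0
    rw [zero_smul, add_zero] at this
    exact this.mono_left nhdsWithin_le_nhds
  refine mem_closure_of_tendsto hc ?_
  filter_upwards [self_mem_nhdsWithin] with t ht using h t ht

section

variable {M : Type*} [TopologicalSpace M] [ChartedSpace E2 M]
  {𝓛 : ∀ q : M, Set (TangentSpace (𝓡 2) q)} {p : M} (Φ : OpenPartialHomeomorph M (ℝ × ℝ))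

theorem ncard_separatrices_saddleNode (hp : p ∈ Φ.source) (hΦp : Φ p = (0, 0))
    (hQ : Φ.target = squareOf 1)
    (hR : ∀ x ∈ Φ.source \ {p}, ∀ y ∈ Φ.source \ {p},
      (OnCommonLine 𝓛 (Φ.source \ {p}) x y ↔ SameSaddleNodeLeaf (Φ x) (Φ y))) :
    (separatrices 𝓛 (Φ.source \ {p}) p).ncard = 3 := by
  let T : Set (ℝ × ℝ) := {z | |z.2| ≤ max (-z.1) 0}
  have hTo : IsOpen Tᶜ := by
    have : Tᶜ = {z : ℝ × ℝ | max (-z.1) 0 < |z.2|} := by ext z; simp [T]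
    rw [this]
    exact isOpen_lt (by fun_prop) (by fun_prop)
  have hacc : ∀ z : ℝ × ℝ, |z.2| = max (-z.1) 0 → z ∈ closure Tᶜ := by
    intro z hz
    rcases le_total 0 z.2 with h | h
    · refine mem_closure_of_line (d := (0, 1)) fun t ht => ?_
      rw [abs_of_nonneg h] at hz
      simp only [T, mem_compl_iff, mem_ofPred_eq, Prod.fst_add, Prod.snd_add, Prod.smul_fst,
        Prod.smul_snd, smul_eq_mul, mul_zero, add_zero, mul_one, not_le]
      rw [abs_of_nonneg (by linarith)]; linarith
    · refine mem_closure_of_line (d := (0, -1)) fun t ht => ?_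
      rw [abs_of_nonpos h] at hz
      simp only [T, mem_compl_iff, mem_ofPred_eq, Prod.fst_add, Prod.snd_add, Prod.smul_fst,
        Prod.smul_snd, smul_eq_mul, mul_zero, add_zero, mul_neg, mul_one, not_le]
      rw [abs_of_nonpos (by linarith)]; linarith
  have hbdry : ∀ z ∈ T, z ∈ closure Tᶜ → |z.2| = max (-z.1) 0 := by
    intro z hz hcl
    refine le_antisymm hz (not_lt.1 fun hlt => ?_)
    have ho : IsOpen {z : ℝ × ℝ | |z.2| < max (-z.1) 0} :=
      isOpen_lt (by fun_prop) (by fun_prop)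
    obtain ⟨w, hw, hwT⟩ := mem_closure_iff.1 hcl _ ho hlt
    exact hwT (show |w.2| ≤ _ from le_of_lt hw)
  have key := ncard_separatrices_eq (𝓛 := 𝓛) Φ hp hΦp hQ (R := SameSaddleNodeLeaf)
    (fun _ _ h => h.symm) (fun _ _ _ h h' => h.trans h') (fun _ h => .refl h) hR (T := T)
    ?_ ?_ {((1 / 2 : ℝ), (0 : ℝ)), (-(1 / 2) , 1 / 2), (-(1 / 2), -(1 / 2))} ?_ ?_ ?_ ?_
  · rw [key, Finset.card_eq_three]
    exact ⟨_, _, _, by norm_num, by norm_num, by norm_num, rfl⟩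
  · intro z hz hz0 t ht
    have hz' : |z.2| ≤ max (-z.1) 0 := hz
    rcases lt_or_ge z.1 0 with h1 | h1
    · rw [max_eq_left (by linarith), abs_le] at hz'
      refine Or.inr (Or.inl ⟨z.2 / z.1, ⟨?_, ?_⟩, h1, ?_, ?_, ?_⟩)
      · rw [le_div_iff_of_neg h1]; linarith
      · rw [div_le_iff_of_neg h1]; linarith
      · exact mul_neg_of_pos_of_neg ht.1 h1
      · rw [div_mul_cancel₀ _ h1.ne]
      · simp only [Prod.smul_snd, Prod.smul_fst, smul_eq_mul]
        rw [mul_left_comm, div_mul_cancel₀ _ h1.ne]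
    · rw [max_eq_right (by linarith), abs_nonpos_iff] at hz'
      have h3 : 0 < z.1 := lt_of_le_of_ne h1 fun h3 => hz0 (Prod.ext h3.symm hz')
      exact Or.inl ⟨h3, mul_pos ht.1 h3, hz', by simp [hz']⟩
  · intro z hz hz0
    have hz' : max (-z.1) 0 < |z.2| := not_le.1 hz
    refine ⟨|z.2| - max (-z.1) 0, by linarith, fun w hw => Or.inr ?_⟩
    rcases hw with ⟨h1, h2, h3, h4⟩ | ⟨s, hs, h1, h2, h3, h4⟩ | ⟨τ, hτ, h3, h4⟩ | ⟨τ, hτ, h3, h4⟩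
    · rw [h3, abs_zero] at hz'
      exact absurd (le_max_right (-z.1) 0) (not_le.2 hz')
    · exfalso
      rw [h3, abs_mul, max_eq_left (by linarith), abs_of_neg h1] at hz'
      have := abs_le.2 hs
      nlinarith
    · have e1 := le_max_right (-z.1) 0
      have e2 := le_max_right (-w.1) 0
      rw [h3, h4, abs_of_pos (by linarith), abs_of_pos (by linarith)]; linarith
    · have e1 := le_max_right (-z.1) 0
      have e2 := le_max_right (-w.1) 0
      rw [h3, h4, abs_neg, abs_neg, abs_of_pos (by linarith), abs_of_pos (by linarith)]; linarith
  · intro e he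
    simp only [Finset.mem_insert, Finset.mem_singleton] at he
    rcases he with rfl | rfl | rfl <;> refine ⟨?_, ?_, ?_⟩ <;>
      norm_num [mem_squareOf, T, abs_lt, abs_of_pos]
  · intro e he w hw
    apply hacc
    have he' : |e.2| = max (-e.1) 0 := by
      simp only [Finset.mem_insert, Finset.mem_singleton] at he
      rcases he with rfl | rfl | rfl <;> norm_num [abs_of_pos]
    have hm := le_max_right (-e.1) 0
    rcases hw with ⟨h1, h2, h3, h4⟩ | ⟨s, hs, h1, h2, h3, h4⟩ | ⟨τ, hτ, h3, h4⟩ | ⟨τ, hτ, h3, h4⟩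
    · rw [h4, abs_zero, max_eq_right (by linarith)]
    · rw [h3, abs_mul, abs_of_neg h1, max_eq_left (by linarith)] at he'
      have hs1 : |s| = 1 := mul_right_cancel₀ (neg_ne_zero.2 h1.ne) (by rw [he', one_mul])
      rw [h4, abs_mul, hs1, abs_of_neg h2, max_eq_left (by linarith), one_mul]
    · rw [h3, abs_of_pos (by linarith)] at he'; linarith
    · rw [h3, abs_neg, abs_of_pos (by linarith)] at he'; linarith
  · intro e he e' he' h
    simp only [Finset.mem_insert, Finset.mem_singleton] at he he'
    rcases he with rfl | rfl | rfl <;> rcases he' with rfl | rfl | rfl <;> first | rfl | exfalso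
    all_goals
      rcases h with ⟨h1, h2, h3, h4⟩ | ⟨s, hs, h1, h2, h3, h4⟩ | ⟨τ, hτ, h3, h4⟩ | ⟨τ, hτ, h3, h4⟩ <;>
      norm_num at * <;> linarith
  · intro z hz hcl hz0
    have hz' := hbdry z hz hcl
    rcases lt_or_ge z.1 0 with h1 | h1
    · rw [max_eq_left (by linarith)] at hz'
      rcases (abs_eq (by linarith)).1 hz' with h | h
      · exact ⟨(-(1 / 2), 1 / 2), by simp, Or.inr (Or.inl ⟨-1, by norm_num, h1, by norm_num,
          by rw [h]; ring, by norm_num⟩)⟩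
      · exact ⟨(-(1 / 2), -(1 / 2)), by simp, Or.inr (Or.inl ⟨1, by norm_num, h1, by norm_num,
          by rw [h]; ring, by norm_num⟩)⟩
    · rw [max_eq_right (by linarith), abs_eq_zero] at hz'
      refine ⟨(1 / 2, 0), by simp, Or.inl ⟨?_, by norm_num, hz', rfl⟩⟩
      exact lt_of_le_of_ne h1 fun h3 => hz0 (Prod.ext h3.symm hz')

theorem ncard_separatrices_parallel (hp : p ∈ Φ.source) (hΦp : Φ p = (0, 0))
    (hQ : Φ.target = squareOf 1)
    (hR : ∀ x ∈ Φ.source \ {p}, ∀ y ∈ Φ.source \ {p},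
      (OnCommonLine 𝓛 (Φ.source \ {p}) x y ↔ SameParallelLeaf (Φ x) (Φ y))) :
    (separatrices 𝓛 (Φ.source \ {p}) p).ncard = 2 := by
  have hacc : ∀ z : ℝ × ℝ, z.1 = 0 → z ∈ closure ({z : ℝ × ℝ | z.1 = 0}ᶜ) := by
    intro z hz
    refine mem_closure_of_line (d := (1, 0)) fun t ht => ?_
    simp [hz, ht.ne']
  have hmul : ∀ z : ℝ × ℝ, z ≠ (0, 0) → z.1 = 0 → z.2 ≠ 0 := fun z hz h1 h2 => hz (Prod.ext h1 h2)
  have key := ncard_separatrices_eq (𝓛 := 𝓛) Φ hp hΦp hQ (R := SameParallelLeaf)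
    (fun _ _ h => h.symm) (fun _ _ _ h h' => h.trans h')
    (fun z hz => ⟨rfl, fun h => mul_self_pos.2 (hmul z hz h)⟩) hR (T := {z | z.1 = 0})
    ?_ ?_ {((0 : ℝ), (1 / 2 : ℝ)), (0, -(1 / 2))} ?_ ?_ ?_ ?_
  · rw [key, Finset.card_eq_two]
    exact ⟨_, _, by norm_num, rfl⟩
  · intro z hz hz0 t ht
    have hz' : z.1 = 0 := hz
    refine ⟨by simp [hz'], fun _ => ?_⟩
    have := mul_self_pos.2 (hmul z hz0 hz')
    simp only [Prod.smul_snd, smul_eq_mul]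
    nlinarith [mul_pos ht.1 this]
  · intro z hz _
    exact ⟨|z.1|, abs_pos.2 hz, fun w hw => Or.inl (by rw [hw.1])⟩
  · intro e he
    simp only [Finset.mem_insert, Finset.mem_singleton] at he
    rcases he with rfl | rfl <;> norm_num [mem_squareOf, abs_lt]
  · intro e he w hw
    apply hacc
    simp only [Finset.mem_insert, Finset.mem_singleton] at he
    rcases he with rfl | rfl <;> exact hw.1.symm
  · intro e he e' he' h
    simp only [Finset.mem_insert, Finset.mem_singleton] at he he'
    rcases he with rfl | rfl <;> rcases he' with rfl | rfl <;> first | rfl | exfalso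
    all_goals
      have := h.2 rfl
      norm_num at this
  · intro z hz _ hz0
    have hz' : z.1 = 0 := hz
    rcases lt_or_gt_of_ne (hmul z hz0 hz') with h | h
    · exact ⟨(0, -(1 / 2)), by simp, hz', fun _ => by simp; linarith⟩
    · exact ⟨(0, 1 / 2), by simp, hz', fun _ => by simp; linarith⟩

end

/-! ### Extension of a local pair of line fields to the plane -/

/-- The projection of the line onto `[-r, r]`. -/
def clampTo (r t : ℝ) : ℝ := max (-r) (min r t)

/-- A cutoff function, equal to `1` on `[-1/2, 1/2]` and to `0` off `(-1, 1)`. -/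
def cutoffOne (t : ℝ) : ℝ := max 0 (min 1 (2 * (1 - |t|)))

lemma abs_clampTo_le {r : ℝ} (hr : 0 < r) (t : ℝ) : |clampTo r t| ≤ r :=
  abs_le.2 ⟨le_max_left _ _, max_le (by linarith) (min_le_left _ _)⟩

lemma clampTo_of_abs_le {r t : ℝ} (h : |t| ≤ r) : clampTo r t = t := by
  rw [clampTo, min_eq_right (abs_le.1 h).2, max_eq_right (abs_le.1 h).1]

lemma clampTo_ne_zero {r t : ℝ} (hr : 0 < r) (ht : t ≠ 0) : clampTo r t ≠ 0 := by
  rcases lt_or_gt_of_ne ht with h | h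
  · exact (max_lt (by linarith) (lt_of_le_of_lt (min_le_right _ _) h)).ne
  · exact (lt_of_lt_of_le (lt_min hr h) (le_max_right _ _)).ne'

lemma min_abs_le_abs_clampTo {r t : ℝ} (hr : 0 < r) : min r |t| ≤ |clampTo r t| := by
  rcases le_total |t| r with h | h
  · rw [clampTo_of_abs_le h]; exact min_le_right _ _
  · refine (min_le_left _ _).trans ?_
    rcases le_abs.1 h with h | h
    · rw [clampTo, min_eq_left h, max_eq_right (by linarith), abs_of_pos hr]
    · rw [clampTo, min_eq_right (by linarith), max_eq_left (by linarith), abs_neg, abs_of_pos hr]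

@[fun_prop]
lemma continuous_clampTo (r : ℝ) : Continuous (clampTo r) := by unfold clampTo; fun_prop

@[fun_prop]
lemma continuous_cutoffOne : Continuous cutoffOne := by unfold cutoffOne; fun_prop

lemma cutoffOne_nonneg (t : ℝ) : 0 ≤ cutoffOne t := le_max_left _ _

lemma cutoffOne_le_one (t : ℝ) : cutoffOne t ≤ 1 := max_le zero_le_one (min_le_left _ _)

lemma cutoffOne_eq_zero {t : ℝ} (h : 1 ≤ |t|) : cutoffOne t = 0 :=
  max_eq_left ((min_le_right _ _).trans (by linarith))

lemma cutoffOne_eq_one {t : ℝ} (h : |t| ≤ 1 / 2) : cutoffOne t = 1 := by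
  rw [cutoffOne, min_eq_left (by linarith), max_eq_right zero_le_one]

lemma clampTo_mono (r : ℝ) : Monotone (clampTo r) := fun a b h => by
  unfold clampTo; gcongr

lemma clampTo_sub_le (r : ℝ) {a b : ℝ} (h : a ≤ b) : clampTo r b - clampTo r a ≤ b - a := by
  have h1 : min r b ≤ min r a + (b - a) := by
    rw [← min_add_add_right]
    exact min_le_min (by linarith) (by linarith)
  have h2 : max (-r) (min r b) ≤ max (-r) (min r a) + (b - a) :=
    max_le (by linarith [le_max_left (-r) (min r a)]) (by linarith [le_max_right (-r) (min r a)])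
  unfold clampTo
  linarith

lemma abs_clampTo_sub_le (r a b : ℝ) : |clampTo r a - clampTo r b| ≤ |a - b| := by
  wlog h : b ≤ a
  · rw [abs_sub_comm, abs_sub_comm a]
    exact this r b a (le_of_not_ge h)
  rw [abs_of_nonneg (sub_nonneg.2 h), abs_of_nonneg (sub_nonneg.2 (clampTo_mono r h))]
  exact clampTo_sub_le r h

/-- A one-sided Lipschitz condition is inherited by the composition with a projection. -/
lemma one_sided_clampTo {g : ℝ → ℝ} {C r : ℝ} (hC : 0 ≤ C) (a b : ℝ)
    (hg : (g (clampTo r a) - g (clampTo r b)) * (clampTo r a - clampTo r b) ≤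
      C * (clampTo r a - clampTo r b) ^ 2) :
    (g (clampTo r a) - g (clampTo r b)) * (a - b) ≤ C * (a - b) ^ 2 := by
  have key : ∀ a b, a ≤ b → (g (clampTo r b) - g (clampTo r a)) * (clampTo r b - clampTo r a) ≤
      C * (clampTo r b - clampTo r a) ^ 2 →
      (g (clampTo r b) - g (clampTo r a)) * (b - a) ≤ C * (b - a) ^ 2 := by
    intro a b hab h
    have h1 := clampTo_sub_le r hab
    have h2 := clampTo_mono r hab
    rcases h2.eq_or_lt with h3 | h3
    · rw [h3, sub_self, zero_mul]; positivity
    · have h4 : g (clampTo r b) - g (clampTo r a) ≤ C * (clampTo r b - clampTo r a) := by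
        have : 0 < clampTo r b - clampTo r a := sub_pos.2 h3
        by_contra! hlt
        nlinarith
      have h5 : C * (clampTo r b - clampTo r a) ≤ C * (b - a) :=
        mul_le_mul_of_nonneg_left h1 hC
      nlinarith
  rcases le_total a b with h | h
  · have := key a b h (by linarith)
    linarith
  · exact key b a h hg

/-- The estimates, on the square of half-side `r`, for the slopes `dv/du = m` and `du/dv = n` of
the two principal line fields. -/
structure IsLocalPair (m n : ℝ → ℝ → ℝ) (r L C : ℝ) : Prop where
  r_pos : 0 < r
  r_le : r ≤ 1 / 2
  C_nonneg : 0 ≤ C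
  bound_m : ∀ u v, |u| ≤ r → |v| ≤ r → |m u v| ≤ L
  bound_n : ∀ u v, |u| ≤ r → |v| ≤ r → |n u v| ≤ L
  cont_m : ∀ u v, |u| ≤ r → |v| ≤ r → (u ≠ 0 ∨ v ≠ 0) →
    ContinuousWithinAt (Function.uncurry m) {z | |z.1| ≤ r ∧ |z.2| ≤ r} (u, v)
  cont_n : ∀ u v, |u| ≤ r → |v| ≤ r → (u ≠ 0 ∨ v ≠ 0) →
    ContinuousWithinAt (Function.uncurry n) {z | |z.1| ≤ r ∧ |z.2| ≤ r} (u, v)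
  one_sided : ∀ u v₁ v₂, |u| ≤ r → |v₁| ≤ r → |v₂| ≤ r → u ≠ 0 →
    (m u v₁ - m u v₂) * (v₁ - v₂) ≤ C * (v₁ - v₂) ^ 2
  lip : ∀ ε > 0, ∀ u v₁ v₂, |u| ≤ r → |v₁| ≤ r → |v₂| ≤ r →
    (ε ≤ |u| ∨ (ε ≤ v₁ ∧ ε ≤ v₂) ∨ (v₁ ≤ -ε ∧ v₂ ≤ -ε)) →
    |m u v₁ - m u v₂| ≤ C / ε ^ 2 * |v₁ - v₂|
  two_sided : ∀ v u₁ u₂, |v| ≤ r → |u₁| ≤ r → |u₂| ≤ r → v ≠ 0 →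
    |n u₁ v - n u₂ v| ≤ C * (1 + 1 / √|v|) * |u₁ - u₂|
  transversal : ∀ u v, |u| ≤ r → |v| ≤ r → (u ≠ 0 ∨ v ≠ 0) → m u v * n u v < 1
  barrier : ∃ C > 0, ∃ c > 0, ∀ u v, |u| ≤ r → |v| ≤ r → (u ≠ 0 ∨ v ≠ 0) →
    (C * u ^ 2 ≤ v → m u v ≤ -c ∧ 0 ≤ n u v) ∧ (v ≤ -(C * u ^ 2) → c ≤ m u v ∧ n u v ≤ 0)

namespace IsLocalPair

variable {m n : ℝ → ℝ → ℝ} {r L C : ℝ}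

/-- The extension of a function on a square, with a cutoff in the first variable. -/
noncomputable def extend (r : ℝ) (m : ℝ → ℝ → ℝ) (u v : ℝ) : ℝ :=
  cutoffOne u * m (clampTo r u) (clampTo r v)

lemma extend_eq (H : IsLocalPair m n r L C) {u v : ℝ} (hu : |u| ≤ r) (hv : |v| ≤ r)
    (g : ℝ → ℝ → ℝ) : extend r g u v = g u v := by
  rw [extend, cutoffOne_eq_one (hu.trans H.r_le), one_mul, clampTo_of_abs_le hu,
    clampTo_of_abs_le hv]

lemma abs_extend_le {g : ℝ → ℝ → ℝ} (hr : 0 < r)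
    (hg : ∀ u v, |u| ≤ r → |v| ≤ r → |g u v| ≤ L) (u v : ℝ) : |extend r g u v| ≤ L := by
  rw [extend, abs_mul, abs_of_nonneg (cutoffOne_nonneg u)]
  refine (mul_le_of_le_one_left (abs_nonneg _) (cutoffOne_le_one u)).trans ?_
  exact hg _ _ (abs_clampTo_le hr u) (abs_clampTo_le hr v)

lemma abs_extend_sub_le {g : ℝ → ℝ → ℝ} {K : ℝ} (hK : 0 ≤ K) {u v₁ v₂ : ℝ}
    (h : |g (clampTo r u) (clampTo r v₁) - g (clampTo r u) (clampTo r v₂)| ≤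
      K * |clampTo r v₁ - clampTo r v₂|) : |extend r g u v₁ - extend r g u v₂| ≤ K * |v₁ - v₂| := by
  rw [extend, extend, ← mul_sub, abs_mul, abs_of_nonneg (cutoffOne_nonneg u)]
  refine (mul_le_of_le_one_left (abs_nonneg _) (cutoffOne_le_one u)).trans (h.trans ?_)
  exact mul_le_mul_of_nonneg_left (abs_clampTo_sub_le _ _ _) hK

lemma continuousAt_extend {g : ℝ → ℝ → ℝ} (hr : 0 < r)
    (hg : ∀ u v, |u| ≤ r → |v| ≤ r → (u ≠ 0 ∨ v ≠ 0) →
      ContinuousWithinAt (Function.uncurry g) {z | |z.1| ≤ r ∧ |z.2| ≤ r} (u, v))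
    {u v : ℝ} (huv : u ≠ 0 ∨ v ≠ 0) : ContinuousAt (Function.uncurry (extend r g)) (u, v) := by
  have h1 := hg _ _ (abs_clampTo_le hr u) (abs_clampTo_le hr v)
    (huv.imp (clampTo_ne_zero hr) (clampTo_ne_zero hr))
  have h2 : Tendsto (fun z : ℝ × ℝ => (clampTo r z.1, clampTo r z.2)) (𝓝 (u, v))
      (𝓝[{z | |z.1| ≤ r ∧ |z.2| ≤ r}] (clampTo r u, clampTo r v)) :=
    tendsto_nhdsWithin_iff.2 ⟨Continuous.tendsto (by fun_prop) (u, v),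
      Eventually.of_forall fun z => ⟨abs_clampTo_le hr _, abs_clampTo_le hr _⟩⟩
  have h3 : Continuous fun z : ℝ × ℝ => cutoffOne z.1 := by fun_prop
  exact h3.continuousAt.mul (h1.tendsto.comp h2)

lemma le_abs_clampTo {r ε t : ℝ} (hr : 0 < r) (h : ε ≤ |t|) : min r ε ≤ |clampTo r t| :=
  (min_le_min_left _ h).trans (min_abs_le_abs_clampTo hr)

lemma le_clampTo {r ε t : ℝ} (h : ε ≤ t) : min r ε ≤ clampTo r t :=
  (min_le_min_left _ h).trans (le_max_right _ _)

lemma clampTo_le {r ε t : ℝ} (h : t ≤ -ε) : clampTo r t ≤ -min r ε := by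
  refine max_le (neg_le_neg (min_le_left _ _)) ((min_le_right _ _).trans ?_)
  linarith [min_le_right r ε]

theorem isPrincipalPair (H : IsLocalPair m n r L C) :
    IsPrincipalPair (extend r m) (fun u v => extend r (fun v u => n u v) v u) L (fun u => C * u)
      (fun _ => C) (fun v => C / √r * (v + 2 * (√v - √(-v))))
      (fun v => C / √r * (1 + 2 * (1 / (2 * √v) - 1 / (2 * √(-v)) * (-1)))) := by
  have hr := H.r_pos
  have hcl : ∀ t, |clampTo r t| ≤ r := abs_clampTo_le hr
  have hC := H.C_nonneg
  have hsq : ∀ v, |v| ≠ 0 → 1 + 2 * (1 / (2 * √v) - 1 / (2 * √(-v)) * (-1)) = 1 + 1 / √|v| := by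
    intro v hv
    rcases lt_or_gt_of_ne (abs_ne_zero.1 hv) with h | h
    · rw [abs_of_neg h, Real.sqrt_eq_zero_of_nonpos h.le]
      have := Real.sqrt_pos.2 (neg_pos.2 h)
      field_simp
      simp
    · rw [abs_of_pos h, Real.sqrt_eq_zero_of_nonpos (neg_nonpos.2 h.le)]
      have := Real.sqrt_pos.2 h
      field_simp
      simp
  have hweight : ∀ v ≠ 0, ∀ u₁ u₂,
      |extend r (fun v u => n u v) v u₁ - extend r (fun v u => n u v) v u₂| ≤
        C * (1 + 1 / √|clampTo r v|) * |u₁ - u₂| := fun v hv u₁ u₂ =>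
    abs_extend_sub_le (by positivity)
      (H.two_sided _ _ _ (hcl _) (hcl _) (hcl _) (clampTo_ne_zero hr hv))
  have hr1 : √r ≤ 1 := Real.sqrt_le_one.2 (by linarith [H.r_le])
  have hr0 : 0 < √r := Real.sqrt_pos.2 hr
  have htwo : ∀ v ≠ 0, ∀ u₁ u₂,
      |extend r (fun v u => n u v) v u₁ - extend r (fun v u => n u v) v u₂| ≤
        C / √r * (1 + 2 * (1 / (2 * √v) - 1 / (2 * √(-v)) * (-1))) * |u₁ - u₂| := by
    intro v hv u₁ u₂
    rw [hsq v (abs_ne_zero.2 hv)]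
    have hv' : 0 < |v| := abs_pos.2 hv
    rcases le_total 1 |v| with h1 | h1
    · rw [extend, extend, cutoffOne_eq_zero h1, zero_mul, zero_mul, sub_self, abs_zero]
      positivity
    · refine (hweight v hv u₁ u₂).trans (mul_le_mul_of_nonneg_right ?_ (abs_nonneg _))
      have h2 : r * |v| ≤ |clampTo r v| := by
        refine le_trans (le_min ?_ ?_) (min_abs_le_abs_clampTo hr)
        · exact mul_le_of_le_one_right hr.le h1
        · exact mul_le_of_le_one_left (abs_nonneg _) (by linarith [H.r_le])
      have h3 : √r * √|v| ≤ √|clampTo r v| := by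
        rw [← Real.sqrt_mul hr.le]; exact Real.sqrt_le_sqrt h2
      have h4 : 1 / √|clampTo r v| ≤ 1 / (√r * √|v|) :=
        one_div_le_one_div_of_le (by positivity) h3
      have h5 : 1 ≤ 1 / √r := by rw [le_div_iff₀ hr0]; linarith
      calc C * (1 + 1 / √|clampTo r v|) ≤ C * (1 / √r + 1 / (√r * √|v|)) := by gcongr
        _ = C / √r * (1 + 1 / √|v|) := by
          have : 0 < √|v| := Real.sqrt_pos.2 hv'
          field_simp
  refine ⟨⟨abs_extend_le hr H.bound_m, fun t y ht => by rw [extend, cutoffOne_eq_zero ht, zero_mul],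
    fun t y h => continuousAt_extend hr H.cont_m h, fun ε hε => ?_, by fun_prop, fun t _ => ?_,
    fun t ht y₁ y₂ => ?_⟩, ⟨abs_extend_le hr fun v u hv hu => H.bound_n u v hu hv,
    fun t y ht => by rw [extend, cutoffOne_eq_zero ht, zero_mul],
    fun t y h => continuousAt_extend hr (fun v u hv hu h => ?_) h, fun ε hε => ?_, by fun_prop,
    fun v hv => ?_, fun v hv u₁ u₂ => ?_⟩, fun ε hε => ?_, htwo, fun u v h => ?_, ?_⟩
  · have hε' : 0 < min r ε := lt_min hr hε
    refine ⟨(C / min r ε ^ 2).toNNReal, fun t ht => LipschitzWith.of_dist_le_mul fun v₁ v₂ => ?_⟩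
    rw [Real.coe_toNNReal _ (by positivity), Real.dist_eq, Real.dist_eq]
    exact abs_extend_sub_le (by positivity)
      (H.lip _ hε' _ _ _ (hcl _) (hcl _) (hcl _) (Or.inl (le_abs_clampTo hr ht)))
  · simpa using (hasDerivAt_id t).const_mul C
  · have h1 := one_sided_clampTo (g := m (clampTo r t)) (r := r) hC y₁ y₂
      (H.one_sided _ _ _ (hcl _) (hcl _) (hcl _) (clampTo_ne_zero hr ht))
    have h2 := cutoffOne_nonneg t
    have h3 := cutoffOne_le_one t
    have h4 : 0 ≤ C * (y₁ - y₂) ^ 2 := by positivity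
    rw [extend, extend, ← mul_sub, mul_assoc]
    calc _ ≤ cutoffOne t * (C * (y₁ - y₂) ^ 2) := mul_le_mul_of_nonneg_left h1 h2
      _ ≤ _ := mul_le_of_le_one_left h4 h3
  · have h1 := H.cont_n u v hu hv h.symm
    have h2 : Tendsto Prod.swap (𝓝[{z : ℝ × ℝ | |z.1| ≤ r ∧ |z.2| ≤ r}] (v, u))
        (𝓝[{z : ℝ × ℝ | |z.1| ≤ r ∧ |z.2| ≤ r}] (u, v)) :=
      tendsto_nhdsWithin_iff.2 ⟨(continuous_swap.tendsto (v, u)).mono_left nhdsWithin_le_nhds,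
        eventually_nhdsWithin_of_forall fun z hz => ⟨hz.2, hz.1⟩⟩
    exact h1.tendsto.comp h2
  · have hε' : 0 < min r ε := lt_min hr hε
    refine ⟨(C * (1 + 1 / √(min r ε))).toNNReal, fun t ht =>
      LipschitzWith.of_dist_le_mul fun v₁ v₂ => ?_⟩
    have ht0 : t ≠ 0 := abs_pos.1 (hε.trans_le ht)
    rw [Real.coe_toNNReal _ (by positivity), Real.dist_eq, Real.dist_eq]
    refine (hweight t ht0 _ _).trans (mul_le_mul_of_nonneg_right ?_ (abs_nonneg _))
    have : 0 < √(min r ε) := Real.sqrt_pos.2 hε'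
    have := le_abs_clampTo hr ht
    gcongr
  · refine HasDerivAt.const_mul _ ((hasDerivAt_id v).add (HasDerivAt.const_mul _ ?_))
    exact (Real.hasDerivAt_sqrt hv).sub
      ((Real.hasDerivAt_sqrt (neg_ne_zero.2 hv)).comp v (hasDerivAt_neg v))
  · calc _ ≤ |(extend r (fun v u => n u v) v u₁ - extend r (fun v u => n u v) v u₂) * (u₁ - u₂)| :=
        le_abs_self _
      _ ≤ _ := by
        rw [abs_mul, ← sq_abs (u₁ - u₂), sq, ← mul_assoc]
        exact mul_le_mul_of_nonneg_right (htwo v hv u₁ u₂) (abs_nonneg _)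
  · have hε' : 0 < min r ε := lt_min hr hε
    refine ⟨C / min r ε ^ 2, fun u _ v₁ v₂ h => abs_extend_sub_le (by positivity)
      (H.lip _ hε' _ _ _ (hcl _) (hcl _) (hcl _) (Or.inr ?_))⟩
    exact h.imp (fun h => ⟨le_clampTo h.1, le_clampTo h.2⟩)
      (fun h => ⟨clampTo_le h.1, clampTo_le h.2⟩)
  · have h1 := H.transversal _ _ (hcl u) (hcl v)
      (h.imp (clampTo_ne_zero hr) (clampTo_ne_zero hr))
    have h2 : extend r m u v * extend r (fun v u => n u v) v u = (cutoffOne u * cutoffOne v) *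
      (m (clampTo r u) (clampTo r v) * n (clampTo r u) (clampTo r v)) := by
      simp only [extend]; ring
    have h3 : cutoffOne u * cutoffOne v ≤ 1 :=
      mul_le_one₀ (cutoffOne_le_one u) (cutoffOne_nonneg v) (cutoffOne_le_one v)
    have h4 : 0 ≤ cutoffOne u * cutoffOne v := mul_nonneg (cutoffOne_nonneg u) (cutoffOne_nonneg v)
    rw [h2]
    rcases le_total 0 (m (clampTo r u) (clampTo r v) * n (clampTo r u) (clampTo r v)) with h5 | h5
    · exact (mul_le_of_le_one_left h5 h3).trans_lt h1
    · exact (mul_nonpos_of_nonneg_of_nonpos h4 h5).trans_lt one_pos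
  · obtain ⟨K, hK, c, hc, hb⟩ := H.barrier
    refine ⟨K, hK, c, hc, r, hr, fun u v hu hv h => ?_⟩
    rw [H.extend_eq hu hv, H.extend_eq hv hu]
    exact hb u v hu hv h

end IsLocalPair

/-! ### The principal slopes as roots of a quadratic equation -/

/-- The root `-2n / (m + √(m² - 4ln))` of `l x² + m x + n = 0`. -/
noncomputable def slopeRoot (l m n : ℝ) : ℝ := -2 * n / (m + √(m ^ 2 - 4 * l * n))

section

variable {l m n : ℝ}

lemma slopeRoot_mul (hD : m + √(m ^ 2 - 4 * l * n) ≠ 0) :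
    slopeRoot l m n * (m + √(m ^ 2 - 4 * l * n)) = -2 * n := div_mul_cancel₀ _ hD

lemma slopeRoot_eq_zero (hδ : 0 ≤ m ^ 2 - 4 * l * n) (hD : m + √(m ^ 2 - 4 * l * n) ≠ 0) :
    l * slopeRoot l m n ^ 2 + m * slopeRoot l m n + n = 0 := by
  have h1 := slopeRoot_mul hD
  have h2 := Real.sq_sqrt hδ
  set s := √(m ^ 2 - 4 * l * n)
  set x := slopeRoot l m n
  have : (l * x ^ 2 + m * x + n) * (m + s) ^ 2 = 0 := by
    linear_combination (l * (x * (m + s) - 2 * n) + m * (m + s)) * h1 + n * h2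
  exact (mul_eq_zero.1 this).resolve_right (pow_ne_zero 2 hD)

lemma two_mul_slopeRoot (hδ : 0 ≤ m ^ 2 - 4 * l * n) (hD : m + √(m ^ 2 - 4 * l * n) ≠ 0) :
    2 * l * slopeRoot l m n + m = √(m ^ 2 - 4 * l * n) := by
  have h1 := slopeRoot_mul hD
  have h2 := Real.sq_sqrt hδ
  set s := √(m ^ 2 - 4 * l * n)
  set x := slopeRoot l m n
  have : (2 * l * x + m - s) * (m + s) = 0 := by
    linear_combination 2 * l * h1 - h2
  linarith [(mul_eq_zero.1 this).resolve_right hD]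

lemma slopeRoot_mul_slopeRoot (hδ : 0 ≤ m ^ 2 - 4 * l * n) (hD : m + √(m ^ 2 - 4 * l * n) ≠ 0) :
    1 - slopeRoot l m n * slopeRoot n m l =
      2 * √(m ^ 2 - 4 * l * n) / (m + √(m ^ 2 - 4 * l * n)) := by
  have h2 := Real.sq_sqrt hδ
  have h3 : m ^ 2 - 4 * n * l = m ^ 2 - 4 * l * n := by ring
  rw [slopeRoot, slopeRoot, h3]
  set s := √(m ^ 2 - 4 * l * n)
  field_simp
  linear_combination -h2

lemma HasDerivAt.slopeRoot {l m n : ℝ → ℝ} {l' m' n' t : ℝ} (hl : HasDerivAt l l' t)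
    (hm : HasDerivAt m m' t) (hn : HasDerivAt n n' t) (hδ : 0 < m t ^ 2 - 4 * l t * n t)
    (hD : m t + √(m t ^ 2 - 4 * l t * n t) ≠ 0) :
    HasDerivAt (fun t => _root_.slopeRoot (l t) (m t) (n t))
      (-(l' * _root_.slopeRoot (l t) (m t) (n t) ^ 2 + m' * _root_.slopeRoot (l t) (m t) (n t) + n')
        / √(m t ^ 2 - 4 * l t * n t)) t := by
  have h1 := ((hm.fun_pow 2).sub ((hl.const_mul 4).mul hn)).sqrt hδ.ne'
  have h2 := (hn.const_mul (-2)).div (hm.add h1) hD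
  refine h2.congr_deriv ?_
  have hs := Real.sq_sqrt hδ.le
  have hs0 := (Real.sqrt_pos.2 hδ).ne'
  simp only [Pi.add_apply, Pi.sub_apply, Pi.mul_apply]
  rw [_root_.slopeRoot]
  set s := √(m t ^ 2 - 4 * l t * n t)
  simp only [Nat.cast_ofNat, Nat.add_one_sub_one, pow_one]
  field_simp
  linear_combination (-n') * hs

end

/-- The second-order behaviour at the origin of a coefficient `l` with linear part `βv`, whose
quadratic part restricts to `γu²/2` on the axis `v = 0`. -/
structure IsScalarJet (l lu lv : ℝ → ℝ → ℝ) (β γ C r : ℝ) : Prop where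
  cont : ∀ u v, |u| ≤ r → |v| ≤ r → ContinuousAt (Function.uncurry l) (u, v)
  deriv_u : ∀ u v, |u| ≤ r → |v| ≤ r → HasDerivAt (fun u => l u v) (lu u v) u
  deriv_v : ∀ u v, |u| ≤ r → |v| ≤ r → HasDerivAt (fun v => l u v) (lv u v) v
  deriv_comp : ∀ (f : ℝ → ℝ) (f' u : ℝ), |u| ≤ r → |f u| ≤ r → HasDerivAt f f' u →
    HasDerivAt (fun t => l t (f t)) (lu u (f u) + f' * lv u (f u)) u
  val : ∀ u v, |u| ≤ r → |v| ≤ r →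
    |l u v - (β * v + γ / 2 * u ^ 2)| ≤ C * ((|u| + |v|) * (|v| + u ^ 2))
  val_u : ∀ u v, |u| ≤ r → |v| ≤ r → |lu u v - γ * u| ≤ C * (|v| + u ^ 2)
  val_v : ∀ u v, |u| ≤ r → |v| ≤ r → |lv u v - β| ≤ C * (|u| + |v|)

/-- The discriminant and the denominator of `slopeRoot` are bounded below, in homogeneous
coordinates. -/
lemma exists_discriminant_bound {b c B K : ℝ} (hb : 0 < b) (hχ : 0 < b * K - c * B) :
    ∃ η > 0, ∃ κ > 0, ∀ x y e₁ e₂ e₃ : ℝ, |x| + y = 1 → 0 ≤ y → |e₁| ≤ η → |e₂| ≤ η → |e₃| ≤ η →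
      let l := -(b * x + B / 2 * y) + e₁
      let m := c * x + K / 2 * y + e₂
      let n := b * x + B / 2 * y + e₃
      κ ≤ m ^ 2 - 4 * l * n ∧ κ ≤ m + √(m ^ 2 - 4 * l * n) := by
  let d : (ℝ × ℝ × ℝ) × (ℝ × ℝ) → ℝ := fun z =>
    (c * z.2.1 + K / 2 * z.2.2 + z.1.2.1) ^ 2 - 4 * (-(b * z.2.1 + B / 2 * z.2.2) + z.1.1) *
      (b * z.2.1 + B / 2 * z.2.2 + z.1.2.2)
  let G : (ℝ × ℝ × ℝ) × (ℝ × ℝ) → ℝ := fun z =>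
    min (d z) (c * z.2.1 + K / 2 * z.2.2 + z.1.2.1 + √(d z))
  have hG : Continuous G := by fun_prop
  let P : Set (ℝ × ℝ) := {z | |z.1| + z.2 = 1 ∧ 0 ≤ z.2}
  have hP : IsCompact P := by
    refine Metric.isCompact_of_isClosed_isBounded ?_ ?_
    · exact (isClosed_eq (f := fun z : ℝ × ℝ => |z.1| + z.2) (by fun_prop) continuous_const).inter
        (isClosed_le continuous_const continuous_snd)
    · refine (Metric.isBounded_closedBall (x := (0 : ℝ × ℝ)) (r := 1)).subset fun z hz => ?_
      rw [mem_closedBall_zero_iff, Prod.norm_def, Real.norm_eq_abs, Real.norm_eq_abs]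
      exact max_le (by linarith [hz.1, hz.2]) (by
        rw [abs_of_nonneg hz.2]; linarith [hz.1, abs_nonneg z.1])
  have hpos : ∀ z ∈ P, 0 < G (0, z) := by
    rintro ⟨x, y⟩ ⟨h1, h2⟩
    simp only at h1 h2
    have hd : d (0, x, y) = (c * x + K / 2 * y) ^ 2 + 4 * (b * x + B / 2 * y) ^ 2 := by
      simp only [d, Prod.fst_zero, Prod.snd_zero]; ring
    have key : ¬ (b * x + B / 2 * y = 0 ∧ c * x + K / 2 * y ≤ 0) := by
      rintro ⟨h3, h4⟩
      have h5 : (b * K - c * B) * y ≤ 0 := by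
        have : (b * K - c * B) * y = 2 * b * (c * x + K / 2 * y) - 2 * c * (b * x + B / 2 * y) := by
          ring
        rw [this, h3]
        nlinarith [mul_nonpos_of_nonneg_of_nonpos hb.le h4]
      have h6 : y = 0 := le_antisymm (by by_contra! h; nlinarith) h2
      rw [h6] at h3 h1
      have h7 : x = 0 := by
        rcases mul_eq_zero.1 (show b * x = 0 by linarith) with h | h
        · exact absurd h hb.ne'
        · exact h
      rw [h7] at h1
      norm_num at h1
    refine lt_min ?_ ?_
    · rw [hd]
      by_contra! hle
      have e1 : b * x + B / 2 * y = 0 := by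
        refine pow_eq_zero_iff two_ne_zero |>.1 (le_antisymm ?_ (sq_nonneg _))
        nlinarith [sq_nonneg (c * x + K / 2 * y)]
      have e2 : c * x + K / 2 * y = 0 := by
        refine pow_eq_zero_iff two_ne_zero |>.1 (le_antisymm ?_ (sq_nonneg _))
        nlinarith [sq_nonneg (b * x + B / 2 * y)]
      exact key ⟨e1, e2.le⟩
    · rw [hd]
      simp only [Prod.fst_zero, Prod.snd_zero, add_zero]
      rcases eq_or_ne (b * x + B / 2 * y) 0 with h3 | h3
      · have h4 : 0 < c * x + K / 2 * y := by
          by_contra! h4; exact key ⟨h3, h4⟩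
        have := Real.sqrt_nonneg ((c * x + K / 2 * y) ^ 2 + 4 * (b * x + B / 2 * y) ^ 2)
        linarith
      · have h4 : |c * x + K / 2 * y| < √((c * x + K / 2 * y) ^ 2 + 4 * (b * x + B / 2 * y) ^ 2) := by
          rw [Real.lt_sqrt (abs_nonneg _), sq_abs]
          have : 0 < (b * x + B / 2 * y) ^ 2 := by positivity
          linarith
        linarith [neg_abs_le (c * x + K / 2 * y)]
  have hPne : P.Nonempty := ⟨(0, 1), by simp [P]⟩
  obtain ⟨z₀, hz₀, hmin⟩ := hP.exists_isMinOn hPne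
    (hG.comp (Continuous.prodMk_right (0 : ℝ × ℝ × ℝ))).continuousOn
  have hκ := hpos z₀ hz₀
  have hev : ∀ᶠ e in 𝓝 (0 : ℝ × ℝ × ℝ), ∀ z ∈ P, G (0, z₀) / 2 < G (e, z) := by
    refine hP.eventually_forall_of_forall_eventually fun z hz => ?_
    refine hG.continuousAt.eventually (lt_mem_nhds ?_)
    have : G (0, z₀) ≤ G (0, z) := hmin hz
    linarith
  obtain ⟨η, hη, hball⟩ := Metric.eventually_nhds_iff_ball.1 hev
  refine ⟨η / 2, by positivity, G (0, z₀) / 2, by positivity, fun x y e₁ e₂ e₃ h1 h2 h3 h4 h5 => ?_⟩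
  have := hball (e₁, e₂, e₃) (by
    rw [mem_ball_zero_iff]
    simp only [Prod.norm_def, Real.norm_eq_abs]
    refine lt_of_le_of_lt (max_le h3 (max_le h4 h5)) (by linarith)) (x, y) ⟨h1, h2⟩
  exact ⟨(this.trans_le (min_le_left _ _)).le, (this.trans_le (min_le_right _ _)).le⟩

/-- The coefficients of the equation `l x² + m x + n = 0` of the principal directions near an
umbilic of type `D¹₂,₃`. -/
structure IsPrincipalJet (l lu lv m mu mv n nu nv : ℝ → ℝ → ℝ) (b c B K C r : ℝ) : Prop where
  jetl : IsScalarJet l lu lv (-b) (-B) C r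
  jetm : IsScalarJet m mu mv c K C r
  jetn : IsScalarJet n nu nv b B C r
  b_pos : 0 < b
  chi_pos : 0 < b * K - c * B
  C_nonneg : 0 ≤ C
  r_pos : 0 < r
  r_le : r ≤ 1 / 2

namespace IsPrincipalJet

variable {l lu lv m mu mv n nu nv : ℝ → ℝ → ℝ} {b c B K C r : ℝ}

lemma rho_pos {u v : ℝ} (h : u ≠ 0 ∨ v ≠ 0) : 0 < |v| + u ^ 2 := by
  rcases h with h | h
  · have := pow_pos (abs_pos.2 h) 2; rw [sq_abs] at this; positivity
  · have := abs_pos.2 h; positivity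

/-- Bounds for the coefficients and the discriminant in terms of `|v| + u²`. -/
lemma exists_bounds (H : IsPrincipalJet l lu lv m mu mv n nu nv b c B K C r) :
    ∃ r' > 0, r' ≤ r ∧ ∃ κ > 0, ∃ A > 0, ∀ u v, |u| ≤ r' → |v| ≤ r' → (u ≠ 0 ∨ v ≠ 0) →
      0 < m u v ^ 2 - 4 * l u v * n u v ∧
      κ * (|v| + u ^ 2) ≤ √(m u v ^ 2 - 4 * l u v * n u v) ∧
      κ * (|v| + u ^ 2) ≤ m u v + √(m u v ^ 2 - 4 * l u v * n u v) ∧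
      m u v + √(m u v ^ 2 - 4 * l u v * n u v) ≤ A * (|v| + u ^ 2) ∧
      |l u v| ≤ A * (|v| + u ^ 2) ∧ |m u v| ≤ A * (|v| + u ^ 2) ∧ |n u v| ≤ A * (|v| + u ^ 2) := by
  have hC := H.C_nonneg
  obtain ⟨η, hη, κ, hκ, hd⟩ := exists_discriminant_bound H.b_pos H.chi_pos
  set A := |b| + |c| + |B| + |K| + C with hA
  have hb' : 0 < |b| := abs_pos.2 H.b_pos.ne'
  have hA0 : 0 < A := by positivity
  have hr' : 0 < min r (η / (2 * C + 1)) := lt_min H.r_pos (by positivity)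
  refine ⟨min r (η / (2 * C + 1)), hr', min_le_left _ _, min κ √κ,
    lt_min hκ (Real.sqrt_pos.2 hκ), 4 * A, by positivity, fun u v hu hv h => ?_⟩
  have hρ := rho_pos h
  have hur := hu.trans (min_le_left _ _)
  have hvr := hv.trans (min_le_left _ _)
  have hs : |u| + |v| ≤ 1 := by linarith [H.r_le]
  have hs0 : 0 ≤ |u| + |v| := by positivity
  have hsη : C * (|u| + |v|) ≤ η := by
    have h1 : |u| + |v| ≤ 2 * (η / (2 * C + 1)) := by
      linarith [hu.trans (min_le_right _ _), hv.trans (min_le_right _ _)]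
    calc C * (|u| + |v|) ≤ C * (2 * (η / (2 * C + 1))) := mul_le_mul_of_nonneg_left h1 hC
      _ ≤ η := by
        rw [mul_div_assoc', mul_div_assoc', div_le_iff₀ (by positivity)]; nlinarith
  set ρ := |v| + u ^ 2 with hρdef
  have hscale : ∀ g β γ : ℝ, |g - (β * v + γ / 2 * u ^ 2)| ≤ C * ((|u| + |v|) * ρ) →
      |(g - (β * v + γ / 2 * u ^ 2)) / ρ| ≤ η := fun g β γ hg => by
    rw [abs_div, abs_of_pos hρ, div_le_iff₀ hρ]
    nlinarith
  have hbd : ∀ g β γ : ℝ, |g - (β * v + γ / 2 * u ^ 2)| ≤ C * ((|u| + |v|) * ρ) →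
      |β| + |γ| + C ≤ A → |g| ≤ A * ρ := fun g β γ hg hle => by
    have h1 : |g| ≤ |g - (β * v + γ / 2 * u ^ 2)| + |β * v + γ / 2 * u ^ 2| := by
      have := abs_add_le (g - (β * v + γ / 2 * u ^ 2)) (β * v + γ / 2 * u ^ 2)
      rwa [sub_add_cancel] at this
    have h2 : |β * v + γ / 2 * u ^ 2| ≤ |β| * |v| + |γ| / 2 * u ^ 2 := by
      refine (abs_add_le _ _).trans ?_
      rw [abs_mul, abs_mul, abs_div, abs_two, abs_of_nonneg (sq_nonneg u)]
    have h3 : (|u| + |v|) * ρ ≤ ρ := mul_le_of_le_one_left hρ.le hs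
    have h4 : C * ((|u| + |v|) * ρ) ≤ C * ρ := mul_le_mul_of_nonneg_left h3 hC
    have h5 : |β| * |v| ≤ |β| * ρ :=
      mul_le_mul_of_nonneg_left (by rw [hρdef]; linarith [sq_nonneg u]) (abs_nonneg _)
    have h6 : |γ| / 2 * u ^ 2 ≤ |γ| * ρ := by
      have : |γ| * u ^ 2 ≤ |γ| * ρ :=
        mul_le_mul_of_nonneg_left (by rw [hρdef]; linarith [abs_nonneg v]) (abs_nonneg _)
      have : 0 ≤ |γ| * u ^ 2 := by positivity
      linarith
    have h7 : (|β| + |γ| + C) * ρ ≤ A * ρ := mul_le_mul_of_nonneg_right hle hρ.le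
    linarith
  have hl := H.jetl.val u v hur hvr
  have hm := H.jetm.val u v hur hvr
  have hn := H.jetn.val u v hur hvr
  have bl : |l u v| ≤ A * ρ := hbd _ _ _ hl (by
    rw [abs_neg, abs_neg, hA]; linarith [abs_nonneg c, abs_nonneg K])
  have bm : |m u v| ≤ A * ρ := hbd _ _ _ hm (by
    rw [hA]; linarith [abs_nonneg b, abs_nonneg B])
  have bn : |n u v| ≤ A * ρ := hbd _ _ _ hn (by
    rw [hA]; linarith [abs_nonneg c, abs_nonneg K])
  have key := hd (v / ρ) (u ^ 2 / ρ) _ _ _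
    (by rw [abs_div, abs_of_pos hρ, ← add_div, div_self hρ.ne']) (by positivity)
    (hscale _ _ _ hl) (hscale _ _ _ hm) (hscale _ _ _ hn)
  have el : -(b * (v / ρ) + B / 2 * (u ^ 2 / ρ)) + (l u v - (-b * v + -B / 2 * u ^ 2)) / ρ =
      l u v / ρ := by field_simp; ring
  have em : c * (v / ρ) + K / 2 * (u ^ 2 / ρ) + (m u v - (c * v + K / 2 * u ^ 2)) / ρ =
      m u v / ρ := by field_simp; ring
  have en : b * (v / ρ) + B / 2 * (u ^ 2 / ρ) + (n u v - (b * v + B / 2 * u ^ 2)) / ρ =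
      n u v / ρ := by field_simp; ring
  simp only [el, em, en] at key
  obtain ⟨k1, k2⟩ := key
  have ed : (m u v / ρ) ^ 2 - 4 * (l u v / ρ) * (n u v / ρ) =
      (m u v ^ 2 - 4 * l u v * n u v) / ρ ^ 2 := by field_simp
  have es : √((m u v ^ 2 - 4 * l u v * n u v) / ρ ^ 2) = √(m u v ^ 2 - 4 * l u v * n u v) / ρ := by
    rw [Real.sqrt_div' _ (by positivity), Real.sqrt_sq hρ.le]
  have k3 := Real.sqrt_le_sqrt k1
  rw [ed] at k1 k2 k3
  rw [es] at k2 k3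
  rw [← add_div] at k2
  rw [le_div_iff₀ hρ] at k2 k3
  rw [le_div_iff₀ (by positivity)] at k1
  have hδ : 0 < m u v ^ 2 - 4 * l u v * n u v := lt_of_lt_of_le (by positivity) k1
  have hδA : √(m u v ^ 2 - 4 * l u v * n u v) ≤ 3 * (A * ρ) := by
    refine Real.sqrt_le_iff.2 ⟨by positivity, ?_⟩
    have h1 : m u v ^ 2 ≤ (A * ρ) ^ 2 := sq_le_sq' (abs_le.1 bm).1 (abs_le.1 bm).2
    have h2 : -(l u v * n u v) ≤ (A * ρ) * (A * ρ) := by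
      refine (neg_le_abs _).trans ?_
      rw [abs_mul]
      exact mul_le_mul bl bn (abs_nonneg _) (by positivity)
    have h3 := sq_nonneg (A * ρ)
    calc m u v ^ 2 - 4 * l u v * n u v = m u v ^ 2 + 4 * -(l u v * n u v) := by ring
      _ ≤ (A * ρ) ^ 2 + 4 * ((A * ρ) * (A * ρ)) := by gcongr
      _ ≤ (3 * (A * ρ)) ^ 2 := by
        rw [mul_pow, ← sq]; linarith only [h3]
  have hAρ : 0 ≤ A * ρ := by positivity
  refine ⟨hδ, le_trans ?_ k3, le_trans ?_ k2, ?_, ?_, ?_, ?_⟩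
  · exact mul_le_mul_of_nonneg_right (min_le_right _ _) hρ.le
  · exact mul_le_mul_of_nonneg_right (min_le_left _ _) hρ.le
  all_goals linarith only [(abs_le.1 bm).2, hδA, bl, bm, bn, hAρ]

/-- The value at a slope of the derivative of the quadratic form in the direction of the axis
`u = 0`. -/
lemma quadratic_identity {l m n s x b c : ℝ} (hs : s ^ 2 = m ^ 2 - 4 * l * n)
    (hx : x * (m + s) = -2 * n) :
    (b * (1 - x ^ 2) + c * x) * (m + s) ^ 2 =
      2 * (m + s) * (b * m - c * n) - 4 * b * n * (l + n) := by
  linear_combination b * hs + (c * (m + s) - b * (x * (m + s) - 2 * n)) * hx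

set_option maxHeartbeats 1000000 in
/-- Bounds for the slopes and their derivatives. -/
lemma exists_deriv_bounds (H : IsPrincipalJet l lu lv m mu mv n nu nv b c B K C r) :
    ∃ r' > 0, r' ≤ r ∧ ∃ A > 0, ∃ d > 0, ∀ u v, |u| ≤ r' → |v| ≤ r' → (u ≠ 0 ∨ v ≠ 0) →
      0 < m u v ^ 2 - 4 * l u v * n u v ∧
      0 < m u v + √(m u v ^ 2 - 4 * l u v * n u v) ∧
      |slopeRoot (l u v) (m u v) (n u v)| ≤ A ∧
      |slopeRoot (n u v) (m u v) (l u v)| ≤ A ∧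
      -(lv u v * slopeRoot (l u v) (m u v) (n u v) ^ 2 +
        mv u v * slopeRoot (l u v) (m u v) (n u v) + nv u v)
          / √(m u v ^ 2 - 4 * l u v * n u v) ≤ A ∧
      |-(lv u v * slopeRoot (l u v) (m u v) (n u v) ^ 2 +
        mv u v * slopeRoot (l u v) (m u v) (n u v) + nv u v)
          / √(m u v ^ 2 - 4 * l u v * n u v)| ≤ A / (|v| + u ^ 2) ∧
      |-(nu u v * slopeRoot (n u v) (m u v) (l u v) ^ 2 +
        mu u v * slopeRoot (n u v) (m u v) (l u v) + lu u v)
          / √(m u v ^ 2 - 4 * l u v * n u v)| ≤ A * (1 + |u| / (|v| + u ^ 2)) ∧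
      d * u ^ 2 / (|v| + u ^ 2) - A * (|u| + |v|) ≤
        lv u v * slopeRoot (l u v) (m u v) (n u v) ^ 2 +
          mv u v * slopeRoot (l u v) (m u v) (n u v) + nv u v := by
  obtain ⟨r', hr', hrr, κ, hκ, A, hA, hb⟩ := H.exists_bounds
  have hC := H.C_nonneg
  have hχ := H.chi_pos
  have hb0 := H.b_pos
  set χ := b * K - c * B with hχdef
  have hx0 : 0 ≤ 2 * A / κ := by positivity
  set x₀ := 2 * A / κ with hx₀
  obtain ⟨C₁, hC₁⟩ : ∃ C₁, C₁ = (2 * A * (b + |c|) * C + 8 * b * A * C) / κ ^ 2 := ⟨_, rfl⟩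
  obtain ⟨C₂, hC₂⟩ : ∃ C₂, C₂ = C₁ + C * (x₀ ^ 2 + x₀ + 1) := ⟨_, rfl⟩
  have hC₁0 : 0 ≤ C₁ := by rw [hC₁]; positivity
  have hC₂0 : 0 ≤ C₂ := by rw [hC₂]; positivity
  obtain ⟨G, hG⟩ : ∃ G, G = x₀ + (C₂ + C₂ ^ 2 * A / (4 * χ)) / κ +
    ((b + C) * x₀ ^ 2 + (|c| + C) * x₀ + (b + C)) / κ +
    ((|B| + C) * x₀ ^ 2 + (|K| + C) * x₀ + (|B| + C)) / κ + 1 + C₂ := ⟨_, rfl⟩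
  have p1 : 0 ≤ (C₂ + C₂ ^ 2 * A / (4 * χ)) / κ := by positivity
  have p2 : 0 ≤ ((b + C) * x₀ ^ 2 + (|c| + C) * x₀ + (b + C)) / κ := by positivity
  have p3 : 0 ≤ ((|B| + C) * x₀ ^ 2 + (|K| + C) * x₀ + (|B| + C)) / κ := by positivity
  refine ⟨r', hr', hrr, G, by linarith, χ / A, by positivity, fun u v hu hv h => ?_⟩
  obtain ⟨hδ, hκs, hκD, hAD, hl, hm, hn⟩ := hb u v hu hv h
  have hρ := rho_pos h
  have hur := hu.trans hrr
  have hvr := hv.trans hrr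
  have jl := H.jetl.val u v hur hvr
  have jm := H.jetm.val u v hur hvr
  have jn := H.jetn.val u v hur hvr
  have hs2 := Real.sq_sqrt hδ.le
  set s := √(m u v ^ 2 - 4 * l u v * n u v) with hsdef
  have hρv : |v| ≤ |v| + u ^ 2 := by linarith [sq_nonneg u]
  obtain ⟨ρ, hρdef⟩ : ∃ ρ, ρ = |v| + u ^ 2 := ⟨_, rfl⟩
  obtain ⟨e, he⟩ : ∃ e, e = |u| + |v| := ⟨_, rfl⟩
  have he0 : 0 ≤ e := by rw [he]; positivity
  have he1 : e ≤ 1 := by linarith [H.r_le]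
  rw [← hρdef] at hκs hκD hAD hl hm hn jl jm jn hρ hρv ⊢
  rw [← he] at jl jm jn ⊢
  set D := m u v + s with hD
  have hD0 : 0 < D := lt_of_lt_of_le (by positivity) hκD
  have hs0 : 0 < s := lt_of_lt_of_le (by positivity) hκs
  have hx : slopeRoot (l u v) (m u v) (n u v) * D = -2 * n u v := slopeRoot_mul hD0.ne'
  have hsym : m u v ^ 2 - 4 * n u v * l u v = m u v ^ 2 - 4 * l u v * n u v := by ring
  have hy : slopeRoot (n u v) (m u v) (l u v) * D = -2 * l u v := by
    have := slopeRoot_mul (l := n u v) (m := m u v) (n := l u v)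
    rw [hsym] at this
    exact this hD0.ne'
  set x := slopeRoot (l u v) (m u v) (n u v)
  set y := slopeRoot (n u v) (m u v) (l u v)
  have habs : ∀ x g : ℝ, x * D = -2 * g → |g| ≤ A * ρ → |x| ≤ x₀ := fun x g hxg hg => by
    rw [hx₀, le_div_iff₀ hκ]
    have h1 : |x| * D = 2 * |g| := by
      rw [← abs_of_pos hD0, ← abs_mul, hxg, abs_mul, abs_neg, abs_two]
    have h2 : |x| * (κ * ρ) ≤ |x| * D := mul_le_mul_of_nonneg_left hκD (abs_nonneg _)
    have h3 : |x| * κ * ρ ≤ 2 * A * ρ := by linarith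
    exact le_of_mul_le_mul_right h3 hρ
  have hxx := habs x _ hx hn
  have hyy := habs y _ hy hl
  have hpoly : ∀ x α β γ a₁ a₂ a₃ : ℝ, |x| ≤ x₀ → |α| ≤ a₁ → |β| ≤ a₂ → |γ| ≤ a₃ →
      |α * x ^ 2 + β * x + γ| ≤ a₁ * x₀ ^ 2 + a₂ * x₀ + a₃ := by
    intro x α β γ a₁ a₂ a₃ hx h1 h2 h3
    refine (abs_add_three _ _ _).trans ?_
    rw [abs_mul, abs_mul, abs_pow]
    have := abs_nonneg x
    have := (abs_nonneg _).trans h1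
    have := (abs_nonneg _).trans h2
    gcongr
  have jlv := H.jetl.val_v u v hur hvr
  have jmv := H.jetm.val_v u v hur hvr
  have jnv := H.jetn.val_v u v hur hvr
  have jlu := H.jetl.val_u u v hur hvr
  have jmu := H.jetm.val_u u v hur hvr
  have jnu := H.jetn.val_u u v hur hvr
  rw [← he] at jlv jmv jnv
  rw [← hρdef] at jlu jmu jnu
  -- the numerator is bounded below
  have hlow : χ * u ^ 2 / (A * ρ) - C₂ * e ≤ lv u v * x ^ 2 + mv u v * x + nv u v := by
    have e1 := quadratic_identity (b := b) (c := c) hs2 hx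
    have e2 : χ / 2 * u ^ 2 - (b + |c|) * (C * (e * ρ)) ≤ b * m u v - c * n u v := by
      have h1 : b * m u v - c * n u v = χ / 2 * u ^ 2 + b * (m u v - (c * v + K / 2 * u ^ 2)) -
          c * (n u v - (b * v + B / 2 * u ^ 2)) := by rw [hχdef]; ring
      have h2 : |c * (n u v - (b * v + B / 2 * u ^ 2))| ≤ |c| * (C * (e * ρ)) := by
        rw [abs_mul]; exact mul_le_mul_of_nonneg_left jn (abs_nonneg _)
      have h3 : b * -(C * (e * ρ)) ≤ b * (m u v - (c * v + K / 2 * u ^ 2)) :=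
        mul_le_mul_of_nonneg_left (abs_le.1 jm).1 hb0.le
      linarith [(abs_le.1 h2).2]
    have e3 : b * n u v * (l u v + n u v) ≤ b * (A * ρ) * (2 * (C * (e * ρ))) := by
      refine (le_abs_self _).trans ?_
      rw [abs_mul, abs_mul, abs_of_pos hb0]
      have h1 : |l u v + n u v| ≤ 2 * (C * (e * ρ)) := by
        have := abs_add_le (l u v - (-b * v + -B / 2 * u ^ 2)) (n u v - (b * v + B / 2 * u ^ 2))
        have h2 : l u v - (-b * v + -B / 2 * u ^ 2) + (n u v - (b * v + B / 2 * u ^ 2)) =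
          l u v + n u v := by ring
        rw [h2] at this
        linarith
      gcongr
    have hQ : χ * u ^ 2 ≤ (b * (1 - x ^ 2) + c * x + C₁ * e) * D := by
      have hD2 : κ ^ 2 * ρ ^ 2 ≤ D ^ 2 := by rw [← mul_pow]; gcongr
      have h4 : 2 * D * (χ / 2 * u ^ 2 - (b + |c|) * (C * (e * ρ))) ≤
          2 * D * (b * m u v - c * n u v) := mul_le_mul_of_nonneg_left e2 (by positivity)
      have h5 : D * ((b + |c|) * (C * (e * ρ))) ≤ A * ρ * ((b + |c|) * (C * (e * ρ))) := by gcongr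
      have h6 : C₁ * e * (κ ^ 2 * ρ ^ 2) ≤ C₁ * e * D ^ 2 :=
        mul_le_mul_of_nonneg_left hD2 (by positivity)
      have h7 : C₁ * e * (κ ^ 2 * ρ ^ 2) =
          (2 * A * (b + |c|) * C + 8 * b * A * C) * e * ρ ^ 2 := by
        rw [hC₁]; field_simp
      have h8 : D * (χ * u ^ 2) ≤ D * ((b * (1 - x ^ 2) + c * x + C₁ * e) * D) := by
        have h9 : D * ((b * (1 - x ^ 2) + c * x + C₁ * e) * D) =
          (b * (1 - x ^ 2) + c * x) * D ^ 2 + C₁ * e * D ^ 2 := by ring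
        rw [h9, e1]
        linear_combination h4 + 2 * h5 + h6 + 4 * e3 - h7
      exact le_of_mul_le_mul_left h8 hD0
    have hQ' : χ * u ^ 2 / (A * ρ) ≤ b * (1 - x ^ 2) + c * x + C₁ * e := by
      rw [div_le_iff₀ (by positivity)]
      refine hQ.trans (mul_le_mul_of_nonneg_left hAD ?_)
      by_contra! hlt
      have : 0 ≤ χ * u ^ 2 := by positivity
      nlinarith
    have h10 := hpoly x _ _ _ _ _ _ hxx jlv jmv jnv
    have h11 : lv u v * x ^ 2 + mv u v * x + nv u v = b * (1 - x ^ 2) + c * x +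
      ((lv u v - -b) * x ^ 2 + (mv u v - c) * x + (nv u v - b)) := by ring
    rw [h11, hC₂]
    linear_combination hQ' + (abs_le.1 h10).1
  have hdiv : ∀ N W : ℝ, 0 ≤ W → N ≤ W * ρ → N / s ≤ W / κ := fun N W hW hN => by
    rw [div_le_div_iff₀ hs0 hκ]
    calc N * κ ≤ W * ρ * κ := mul_le_mul_of_nonneg_right hN hκ.le
      _ = W * (κ * ρ) := by ring
      _ ≤ W * s := mul_le_mul_of_nonneg_left hκs hW
  have habs_sub : ∀ g β W : ℝ, |g - β| ≤ W → |g| ≤ |β| + W := fun g β W hg => by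
    have := abs_add_le (g - β) β
    rw [sub_add_cancel] at this
    linarith
  refine ⟨hδ, hD0, by linarith, by linarith, ?_, ?_, ?_, ?_⟩
  · refine (hdiv _ (C₂ + C₂ ^ 2 * A / (4 * χ)) (by positivity) ?_).trans (by linarith)
    have h1 : C₂ * |u| ≤ χ * u ^ 2 / (A * ρ) + C₂ ^ 2 * A / (4 * χ) * ρ := by
      have h2 : χ * u ^ 2 / (A * ρ) + C₂ ^ 2 * A / (4 * χ) * ρ - C₂ * |u| =
          (2 * χ * |u| - C₂ * A * ρ) ^ 2 / (4 * χ * A * ρ) := by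
        rw [← sq_abs u]; field_simp; ring
      have h3 : 0 ≤ (2 * χ * |u| - C₂ * A * ρ) ^ 2 / (4 * χ * A * ρ) := by positivity
      linarith
    have h4 : C₂ * |v| ≤ C₂ * ρ := mul_le_mul_of_nonneg_left hρv hC₂0
    rw [he] at hlow
    linear_combination hlow + h1 + h4
  · have h1 : |lv u v * x ^ 2 + mv u v * x + nv u v| ≤
        (b + C) * x₀ ^ 2 + (|c| + C) * x₀ + (b + C) := by
      have hCe : C * e ≤ C := mul_le_of_le_one_right hC he1
      refine hpoly _ _ _ _ _ _ _ hxx ?_ ?_ ?_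
      · have := habs_sub _ _ _ jlv
        rw [abs_neg, abs_of_pos hb0] at this; linarith
      · have := habs_sub _ _ _ jmv; linarith
      · have := habs_sub _ _ _ jnv
        rw [abs_of_pos hb0] at this; linarith
    rw [abs_div, abs_neg, abs_of_pos hs0, div_le_div_iff₀ hs0 hρ]
    have h2 := mul_le_mul_of_nonneg_right h1 hρ.le
    have h3 : ((b + C) * x₀ ^ 2 + (|c| + C) * x₀ + (b + C)) / κ ≤ G := by linarith
    rw [div_le_iff₀ hκ] at h3
    calc _ ≤ _ := h2
      _ ≤ G * κ * ρ := mul_le_mul_of_nonneg_right h3 hρ.le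
      _ = G * (κ * ρ) := by ring
      _ ≤ G * s := mul_le_mul_of_nonneg_left hκs (by linarith)
  · have hW : ∀ g β, |g - β * u| ≤ C * ρ → |g| ≤ (|β| + C) * (|u| + ρ) := fun g β hg => by
      have h1 := habs_sub _ _ _ hg
      rw [abs_mul] at h1
      have : 0 ≤ |β| * ρ := by positivity
      have : 0 ≤ C * |u| := by positivity
      linarith
    have h1 := hpoly _ _ _ _ _ _ _ hyy (hW _ _ jnu) (hW _ _ jmu) (hW _ _ jlu)
    rw [abs_neg B] at h1
    rw [abs_div, abs_neg, abs_of_pos hs0]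
    have h2 : |nu u v * y ^ 2 + mu u v * y + lu u v| ≤
        ((|B| + C) * x₀ ^ 2 + (|K| + C) * x₀ + (|B| + C)) * (|u| + ρ) := by
      linarith
    rw [div_le_iff₀ hs0]
    have h3 : ((|B| + C) * x₀ ^ 2 + (|K| + C) * x₀ + (|B| + C)) / κ ≤ G := by linarith
    rw [div_le_iff₀ hκ] at h3
    have h4 : G * (1 + |u| / ρ) * (κ * ρ) = G * κ * (|u| + ρ) := by field_simp; ring
    calc _ ≤ _ := h2
      _ ≤ G * κ * (|u| + ρ) := mul_le_mul_of_nonneg_right h3 (by positivity)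
      _ = G * (1 + |u| / ρ) * (κ * ρ) := h4.symm
      _ ≤ _ := mul_le_mul_of_nonneg_left hκs (mul_nonneg (by linarith) (by positivity))
  · have h1 : C₂ * e ≤ G * e := mul_le_mul_of_nonneg_right (by linarith) he0
    have h2 : χ / A * u ^ 2 / ρ = χ * u ^ 2 / (A * ρ) := by field_simp
    rw [h2]
    linarith

end IsPrincipalJet

namespace IsPrincipalJet

variable {l lu lv m mu mv n nu nv : ℝ → ℝ → ℝ} {b c B K C r : ℝ}

lemma continuousAt_slopeRoot {X : Type*} [TopologicalSpace X] {f g h : X → ℝ} {x : X}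
    (hf : ContinuousAt f x) (hg : ContinuousAt g x) (hh : ContinuousAt h x)
    (hD : g x + √(g x ^ 2 - 4 * f x * h x) ≠ 0) :
    ContinuousAt (fun x => slopeRoot (f x) (g x) (h x)) x := by
  unfold slopeRoot
  exact (continuousAt_const.mul hh).div
    (hg.add ((hg.pow 2).sub ((continuousAt_const.mul hf).mul hh)).sqrt) hD

/-- Above and below a parabola the slopes have definite signs. -/
lemma exists_slope_barrier (H : IsPrincipalJet l lu lv m mu mv n nu nv b c B K C r) :
    ∃ r' > 0, r' ≤ r ∧ ∃ G > 0, ∃ d > 0, ∀ u v, |u| ≤ r' → |v| ≤ r' → (u ≠ 0 ∨ v ≠ 0) →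
      (G * u ^ 2 ≤ v → slopeRoot (l u v) (m u v) (n u v) ≤ -d ∧
        0 ≤ slopeRoot (n u v) (m u v) (l u v)) ∧
      (v ≤ -(G * u ^ 2) → d ≤ slopeRoot (l u v) (m u v) (n u v) ∧
        slopeRoot (n u v) (m u v) (l u v) ≤ 0) := by
  obtain ⟨r', hr', hrr, κ, hκ, A, hA, hbd⟩ := H.exists_bounds
  have hb0 := H.b_pos
  have hC := H.C_nonneg
  refine ⟨min r' (b / (16 * C + 1)), lt_min hr' (by positivity), (min_le_left _ _).trans hrr,
    1 + 2 * |B| / b, by positivity, b / (2 * A), by positivity, fun u v hu hv h => ?_⟩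
  obtain ⟨hδ, -, hκD, hAD, -⟩ := hbd u v (hu.trans (min_le_left _ _)) (hv.trans (min_le_left _ _)) h
  have hρ := rho_pos h
  have hur := (hu.trans (min_le_left _ _)).trans hrr
  have hvr := (hv.trans (min_le_left _ _)).trans hrr
  have jl := H.jetl.val u v hur hvr
  have jn := H.jetn.val u v hur hvr
  have hD0 : 0 < m u v + √(m u v ^ 2 - 4 * l u v * n u v) := lt_of_lt_of_le (by positivity) hκD
  have hx := slopeRoot_mul hD0.ne'
  have hsym : m u v ^ 2 - 4 * n u v * l u v = m u v ^ 2 - 4 * l u v * n u v := by ring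
  have hy := slopeRoot_mul (l := n u v) (m := m u v) (n := l u v)
  rw [hsym] at hy
  replace hy := hy hD0.ne'
  set D := m u v + √(m u v ^ 2 - 4 * l u v * n u v)
  set x := slopeRoot (l u v) (m u v) (n u v)
  set y := slopeRoot (n u v) (m u v) (l u v)
  have hsmall : C * (|u| + |v|) ≤ b / 8 := by
    have h1 : |u| + |v| ≤ 2 * (b / (16 * C + 1)) := by
      linarith [hu.trans (min_le_right _ _), hv.trans (min_le_right _ _)]
    calc C * (|u| + |v|) ≤ C * (2 * (b / (16 * C + 1))) := mul_le_mul_of_nonneg_left h1 hC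
      _ ≤ b / 8 := by
        rw [mul_div_assoc', mul_div_assoc', div_le_div_iff₀ (by positivity) (by norm_num)]
        nlinarith
  have herr : C * ((|u| + |v|) * (|v| + u ^ 2)) ≤ b / 8 * (|v| + u ^ 2) := by
    rw [← mul_assoc]; exact mul_le_mul_of_nonneg_right hsmall hρ.le
  have hpar : (1 + 2 * |B| / b) * u ^ 2 ≤ |v| → u ^ 2 ≤ |v| ∧ |B / 2 * u ^ 2| ≤ b / 4 * |v| := by
    intro h1
    have h2 : 0 ≤ 2 * |B| / b * u ^ 2 := by positivity
    refine ⟨by linarith, ?_⟩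
    rw [abs_mul, abs_of_nonneg (sq_nonneg u), abs_div, abs_two]
    have h3 : 2 * |B| / b * u ^ 2 ≤ |v| := by linarith [sq_nonneg u]
    rw [div_mul_eq_mul_div, div_le_iff₀ hb0] at h3
    linarith
  have hj := abs_le.1 jl
  have hk := abs_le.1 jn
  have hdiv : b / (2 * A) * D ≤ b / 2 * (|v| + u ^ 2) := by
    rw [div_mul_eq_mul_div, div_le_iff₀ (by positivity)]
    linarith [mul_le_mul_of_nonneg_left hAD hb0.le]
  have hu2 := sq_nonneg u
  constructor
  · intro hle
    have hv0 : 0 ≤ v := le_trans (by positivity) hle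
    rw [abs_of_nonneg hv0] at *
    obtain ⟨h1, h2⟩ := hpar hle
    have hB := abs_le.1 h2
    have h3 := mul_le_mul_of_nonneg_left h1 hb0.le
    have h4 := mul_nonneg hb0.le hv0
    have hn : b / 4 * (v + u ^ 2) ≤ n u v := by linarith only [hB.1, hk.1, herr, h3]
    have hl : l u v ≤ 0 := by linarith only [hB.1, hj.2, herr, h3, h4]
    constructor
    · by_contra! hlt
      have := mul_lt_mul_of_pos_right hlt hD0
      linarith
    · by_contra! hlt
      have := mul_neg_of_neg_of_pos hlt hD0
      linarith
  · intro hle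
    have hv0 : v ≤ 0 := hle.trans (neg_nonpos.2 (by positivity))
    rw [abs_of_nonpos hv0] at *
    obtain ⟨h1, h2⟩ := hpar (by linarith)
    have hB := abs_le.1 h2
    have h3 := mul_le_mul_of_nonneg_left h1 hb0.le
    have h4 := mul_nonpos_of_nonneg_of_nonpos hb0.le hv0
    have hn : n u v ≤ -(b / 4 * (-v + u ^ 2)) := by linarith only [hB.2, hk.2, herr, h3]
    have hl : 0 ≤ l u v := by linarith only [hB.2, hj.1, herr, h3, h4]
    constructor
    · by_contra! hlt
      have := mul_lt_mul_of_pos_right hlt hD0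
      linarith
    · by_contra! hlt
      have := mul_pos hlt hD0
      linarith

theorem exists_isLocalPair (H : IsPrincipalJet l lu lv m mu mv n nu nv b c B K C r) :
    ∃ r' > 0, r' ≤ r ∧ ∃ L A, (∀ u v, |u| ≤ r' → |v| ≤ r' → (u ≠ 0 ∨ v ≠ 0) →
        0 < m u v ^ 2 - 4 * l u v * n u v ∧
        0 < m u v + √(m u v ^ 2 - 4 * l u v * n u v)) ∧
      IsLocalPair (fun u v => slopeRoot (l u v) (m u v) (n u v))
        (fun u v => slopeRoot (n u v) (m u v) (l u v)) r' L A := by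
  obtain ⟨r₁, hr₁, hrr₁, A, hA, d', -, hd⟩ := H.exists_deriv_bounds
  obtain ⟨r₂, hr₂, hrr₂, G, hG, d, hd0, hbar⟩ := H.exists_slope_barrier
  refine ⟨min r₁ r₂, lt_min hr₁ hr₂, (min_le_left _ _).trans hrr₁,
    max A (|slopeRoot (l 0 0) (m 0 0) (n 0 0)| + |slopeRoot (n 0 0) (m 0 0) (l 0 0)|), A, ?_, ?_⟩
  · intro u v hu hv h
    have := hd u v (hu.trans (min_le_left _ _)) (hv.trans (min_le_left _ _)) h
    exact ⟨this.1, this.2.1⟩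
  set r' := min r₁ r₂
  have hd' : ∀ u v, |u| ≤ r' → |v| ≤ r' → (u ≠ 0 ∨ v ≠ 0) → _ := fun u v hu hv h =>
    hd u v (hu.trans (min_le_left _ _)) (hv.trans (min_le_left _ _)) h
  have hle : r' ≤ r := (min_le_left _ _).trans hrr₁
  have hsym : ∀ l m n : ℝ, m ^ 2 - 4 * n * l = m ^ 2 - 4 * l * n := fun l m n => by ring
  have hS : ∀ u v, |u| ≤ r' → |v| ≤ r' → (u ≠ 0 ∨ v ≠ 0) → _ := fun u v hu hv h =>
    (H.jetl.deriv_v u v (hu.trans hle) (hv.trans hle)).slopeRoot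
      (H.jetm.deriv_v u v (hu.trans hle) (hv.trans hle))
      (H.jetn.deriv_v u v (hu.trans hle) (hv.trans hle)) (hd' u v hu hv h).1
      (hd' u v hu hv h).2.1.ne'
  have hP : ∀ u v, |u| ≤ r' → |v| ≤ r' → (u ≠ 0 ∨ v ≠ 0) → _ := fun u v hu hv h =>
    (H.jetn.deriv_u u v (hu.trans hle) (hv.trans hle)).slopeRoot
      (H.jetm.deriv_u u v (hu.trans hle) (hv.trans hle))
      (H.jetl.deriv_u u v (hu.trans hle) (hv.trans hle))
      (by rw [hsym]; exact (hd' u v hu hv h).1)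
      (by rw [hsym]; exact (hd' u v hu hv h).2.1.ne')
  have hmem : ∀ v₁ v₂ v : ℝ, |v₁| ≤ r' → |v₂| ≤ r' → v ∈ uIcc v₁ v₂ → |v| ≤ r' := by
    intro v₁ v₂ v h1 h2 hv
    rw [abs_le] at *
    exact ⟨(le_min h1.1 h2.1).trans hv.1, hv.2.trans (max_le h1.2 h2.2)⟩
  refine ⟨lt_min hr₁ hr₂, hle.trans H.r_le, hA.le, ?_, ?_, ?_, ?_, ?_, ?_, ?_, ?_, ?_⟩
  · intro u v hu hv
    by_cases h : u ≠ 0 ∨ v ≠ 0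
    · exact (hd' u v hu hv h).2.2.1.trans (le_max_left _ _)
    · push Not at h
      rw [h.1, h.2]
      exact le_max_of_le_right (le_add_of_nonneg_right (abs_nonneg _))
  · intro u v hu hv
    by_cases h : u ≠ 0 ∨ v ≠ 0
    · exact (hd' u v hu hv h).2.2.2.1.trans (le_max_left _ _)
    · push Not at h
      rw [h.1, h.2]
      exact le_max_of_le_right (le_add_of_nonneg_left (abs_nonneg _))
  · intro u v hu hv h
    exact (continuousAt_slopeRoot (H.jetl.cont u v (hu.trans hle) (hv.trans hle))
      (H.jetm.cont u v (hu.trans hle) (hv.trans hle))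
      (H.jetn.cont u v (hu.trans hle) (hv.trans hle))
      (hd' u v hu hv h).2.1.ne').continuousWithinAt
  · intro u v hu hv h
    refine (continuousAt_slopeRoot (H.jetn.cont u v (hu.trans hle) (hv.trans hle))
      (H.jetm.cont u v (hu.trans hle) (hv.trans hle))
      (H.jetl.cont u v (hu.trans hle) (hv.trans hle)) ?_).continuousWithinAt
    change m u v + √(m u v ^ 2 - 4 * n u v * l u v) ≠ 0
    rw [hsym]
    exact (hd' u v hu hv h).2.1.ne'
  · intro u v₁ v₂ hu hv₁ hv₂ hu0
    have key : ∀ v₁ v₂, |v₁| ≤ r' → |v₂| ≤ r' → v₁ ≤ v₂ →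
        slopeRoot (l u v₂) (m u v₂) (n u v₂) - slopeRoot (l u v₁) (m u v₁) (n u v₁) ≤
          A * (v₂ - v₁) := by
      intro v₁ v₂ hv₁ hv₂ hle
      have hI : ∀ v ∈ Icc v₁ v₂, |v| ≤ r' := fun v hv =>
        hmem v₁ v₂ v hv₁ hv₂ (Icc_subset_uIcc hv)
      refine (convex_Icc v₁ v₂).image_sub_le_mul_sub_of_deriv_le
        (f := fun v => slopeRoot (l u v) (m u v) (n u v))
        (fun v hv => (hS u v hu (hI v hv) (Or.inl hu0)).continuousAt.continuousWithinAt)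
        (fun v hv => (hS u v hu (hI v (interior_subset hv))
          (Or.inl hu0)).differentiableAt.differentiableWithinAt)
        (fun v hv => ?_) v₁ (left_mem_Icc.2 hle) v₂ (right_mem_Icc.2 hle) hle
      rw [(hS u v hu (hI v (interior_subset hv)) (Or.inl hu0)).deriv]
      exact (hd' u v hu (hI v (interior_subset hv)) (Or.inl hu0)).2.2.2.2.1
    rcases le_total v₁ v₂ with h | h
    · nlinarith [key v₁ v₂ hv₁ hv₂ h]
    · nlinarith [key v₂ v₁ hv₂ hv₁ h]
  · intro ε hε u v₁ v₂ hu hv₁ hv₂ h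
    have hfar : ∀ v ∈ uIcc v₁ v₂, (u ≠ 0 ∨ v ≠ 0) ∧ ε ^ 2 ≤ |v| + u ^ 2 := by
      intro v hv
      have hvr := hmem v₁ v₂ v hv₁ hv₂ hv
      have hlt : ε ≤ |v| → (u ≠ 0 ∨ v ≠ 0) ∧ ε ^ 2 ≤ |v| + u ^ 2 := fun h => by
        refine ⟨Or.inr (abs_pos.1 (hε.trans_le h)), ?_⟩
        have : ε ≤ 1 := (h.trans hvr).trans (by linarith [H.r_le])
        nlinarith [sq_nonneg u]
      rcases h with h | h | h
      · refine ⟨Or.inl (abs_pos.1 (hε.trans_le h)), ?_⟩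
        rw [← sq_abs u]
        have := pow_le_pow_left₀ hε.le h 2
        linarith [abs_nonneg v]
      · exact hlt (((le_min h.1 h.2).trans hv.1).trans (le_abs_self v))
      · exact hlt (by linarith [hv.2.trans (max_le h.1 h.2), neg_abs_le v])
    have := (convex_uIcc v₁ v₂).norm_image_sub_le_of_norm_hasDerivWithin_le
      (f := fun v => slopeRoot (l u v) (m u v) (n u v)) (C := A / ε ^ 2)
      (fun v hv => (hS u v hu (hmem v₁ v₂ v hv₁ hv₂ hv) (hfar v hv).1).hasDerivWithinAt)
      (fun v hv => ?_) right_mem_uIcc left_mem_uIcc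
    · exact this
    · refine (hd' u v hu (hmem v₁ v₂ v hv₁ hv₂ hv) (hfar v hv).1).2.2.2.2.2.1.trans ?_
      exact div_le_div_of_nonneg_left hA.le (by positivity) (hfar v hv).2
  · intro v u₁ u₂ hv hu₁ hu₂ hv0
    have := (convex_uIcc u₁ u₂).norm_image_sub_le_of_norm_hasDerivWithin_le
      (f := fun u => slopeRoot (n u v) (m u v) (l u v)) (C := A * (1 + 1 / √|v|))
      (fun u hu => (hP u v (hmem u₁ u₂ u hu₁ hu₂ hu) hv (Or.inr hv0)).hasDerivWithinAt)
      (fun u hu => ?_) right_mem_uIcc left_mem_uIcc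
    · exact this
    · rw [hsym, Real.norm_eq_abs]
      refine (hd' u v (hmem u₁ u₂ u hu₁ hu₂ hu) hv (Or.inr hv0)).2.2.2.2.2.2.1.trans ?_
      refine mul_le_mul_of_nonneg_left (add_le_add_right ?_ 1) hA.le
      have hv' := abs_pos.2 hv0
      have hs := Real.sqrt_pos.2 hv'
      rw [div_le_div_iff₀ (rho_pos (Or.inr hv0)) hs, one_mul, ← sq_abs u]
      nlinarith [Real.sq_sqrt hv'.le, sq_nonneg (|u| - √|v|), abs_nonneg u, hs]
  · intro u v hu hv h
    obtain ⟨h1, h2, -⟩ := hd' u v hu hv h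
    have := slopeRoot_mul_slopeRoot h1.le h2.ne'
    have : 0 < 2 * √(m u v ^ 2 - 4 * l u v * n u v) /
      (m u v + √(m u v ^ 2 - 4 * l u v * n u v)) :=
      div_pos (mul_pos two_pos (Real.sqrt_pos.2 h1)) h2
    linarith
  · exact ⟨G, hG, d, hd0, fun u v hu hv h =>
      hbar u v (hu.trans (min_le_right _ _)) (hv.trans (min_le_right _ _)) h⟩

end IsPrincipalJet

/-! ### A linear equation with an irregular singular point -/

/-- The key differential inequality for `u² y' = -a y + e`. -/
lemma antitoneOn_sq_sub_mul_exp {y y' : ℝ → ℝ} {I : Set ℝ} (hI : Convex ℝ I) {a η : ℝ} (ha : 0 < a)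
    (h0 : ∀ u ∈ I, u ≠ 0) (hy : ∀ u ∈ I, HasDerivAt y (y' u) u)
    (h : ∀ u ∈ I, u ^ 2 * (y' u * y u) ≤ -a * y u ^ 2 + η * |y u|) :
    AntitoneOn (fun u => (y u ^ 2 - (η / a) ^ 2) * Real.exp (-(a / u))) I := by
  have hd : ∀ u ∈ I, HasDerivAt (fun u => (y u ^ 2 - (η / a) ^ 2) * Real.exp (-(a / u)))
      ((2 * y u * y' u) * Real.exp (-(a / u)) +
        (y u ^ 2 - (η / a) ^ 2) * (Real.exp (-(a / u)) * (a / u ^ 2))) u := by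
    intro u hu
    have h1 : HasDerivAt (fun u : ℝ => -(a / u)) (a / u ^ 2) u := by
      have := ((hasDerivAt_inv (h0 u hu)).const_mul a).neg
      refine this.congr_deriv ?_
      have := h0 u hu
      field_simp
    have h2 := ((hy u hu).fun_pow 2).sub_const ((η / a) ^ 2)
    refine (h2.mul h1.exp).congr_deriv ?_
    simp only [Nat.cast_ofNat, Nat.add_one_sub_one, pow_one]
  refine antitoneOn_of_deriv_nonpos hI (fun u hu => (hd u hu).continuousAt.continuousWithinAt)
    (fun u hu => (hd u (interior_subset hu)).differentiableAt.differentiableWithinAt)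
    fun u hu => ?_
  replace hu := interior_subset hu
  rw [(hd u hu).deriv]
  have hu2 : 0 < u ^ 2 := by have := h0 u hu; positivity
  have key : 2 * y u * y' u + (y u ^ 2 - (η / a) ^ 2) * (a / u ^ 2) ≤ 0 := by
    have h1 : 2 * y u * y' u + (y u ^ 2 - (η / a) ^ 2) * (a / u ^ 2) =
      (2 * (u ^ 2 * (y' u * y u)) + (y u ^ 2 - (η / a) ^ 2) * a) / u ^ 2 := by
      have hu0 := h0 u hu
      field_simp
    rw [h1]
    refine div_nonpos_of_nonpos_of_nonneg ?_ hu2.le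
    have h2 := h u hu
    have h3 : -2 * a * y u ^ 2 + 2 * η * |y u| + (y u ^ 2 - (η / a) ^ 2) * a =
        -(a * (|y u| - η / a) ^ 2) := by
      rw [← sq_abs (y u)]; field_simp; ring
    have h4 : 0 ≤ a * (|y u| - η / a) ^ 2 := by positivity
    linarith
  have : 2 * y u * y' u * Real.exp (-(a / u)) +
      (y u ^ 2 - (η / a) ^ 2) * (Real.exp (-(a / u)) * (a / u ^ 2)) =
      (2 * y u * y' u + (y u ^ 2 - (η / a) ^ 2) * (a / u ^ 2)) * Real.exp (-(a / u)) := by ring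
  rw [this]
  exact mul_nonpos_of_nonpos_of_nonneg key (Real.exp_pos _).le

lemma singular_sq_le {y y' a e : ℝ → ℝ} {u a₀ η : ℝ} (ha : a₀ ≤ a u) (he : |e u| ≤ η)
    (h : u ^ 2 * y' u = -a u * y u + e u) :
    u ^ 2 * (y' u * y u) ≤ -a₀ * y u ^ 2 + η * |y u| := by
  have h1 : u ^ 2 * (y' u * y u) = -(a u * y u ^ 2) + e u * y u := by
    rw [← mul_assoc, h]; ring
  have h2 : e u * y u ≤ η * |y u| := (le_abs_self _).trans (by
    rw [abs_mul]; exact mul_le_mul_of_nonneg_right he (abs_nonneg _))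
  have h3 : a₀ * y u ^ 2 ≤ a u * y u ^ 2 := mul_le_mul_of_nonneg_right ha (sq_nonneg _)
  linarith

lemma tendsto_zero_of_sq_le {X : Type*} {f : Filter X} {y : X → ℝ}
    (h : ∀ η > 0, ∀ᶠ x in f, y x ^ 2 ≤ η ^ 2) : Tendsto y f (𝓝 0) := by
  rw [Metric.tendsto_nhds]
  intro ε hε
  filter_upwards [h (ε / 2) (by positivity)] with x hx
  rw [Real.dist_eq, sub_zero]
  exact (abs_le_of_sq_le_sq hx (by positivity)).trans_lt (by linarith)

/-- Solutions of `u² y' = -a y + e` tend to `0` at the node side of the singular point. -/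
lemma tendsto_zero_of_singular_left {y y' a e : ℝ → ℝ} {a₀ : ℝ} (ha₀ : 0 < a₀)
    (hy : ∀ᶠ u in 𝓝[<] 0, HasDerivAt y (y' u) u)
    (h : ∀ᶠ u in 𝓝[<] 0, u ^ 2 * y' u = -a u * y u + e u)
    (ha : ∀ᶠ u in 𝓝[<] 0, a₀ ≤ a u) (he : Tendsto e (𝓝[<] 0) (𝓝 0)) :
    Tendsto y (𝓝[<] 0) (𝓝 0) := by
  refine tendsto_zero_of_sq_le fun η hη => ?_
  have he' : ∀ᶠ u in 𝓝[<] 0, |e u| ≤ a₀ * η / 2 := by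
    have := (Metric.tendsto_nhds.1 he) (a₀ * η / 2) (by positivity)
    filter_upwards [this] with u hu
    rw [Real.dist_eq, sub_zero] at hu
    exact hu.le
  obtain ⟨c, hc, hI⟩ := mem_nhdsLT_iff_exists_Ioo_subset.1 (hy.and (h.and (ha.and he')))
  have hc0 : c < 0 := hc
  have hanti := antitoneOn_sq_sub_mul_exp (convex_Ioo c 0) (η := a₀ * η / 2) ha₀
    (fun u hu => hu.2.ne) (fun u hu => (hI hu).1)
    (fun u hu => singular_sq_le (hI hu).2.2.1 (hI hu).2.2.2 (hI hu).2.1)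
  have hη2 : a₀ * η / 2 / a₀ = η / 2 := by field_simp
  rw [hη2] at hanti
  set M := (y (c / 2) ^ 2 - (η / 2) ^ 2) * Real.exp (-(a₀ / (c / 2)))
  have hlim : Tendsto (fun u : ℝ => M * Real.exp (a₀ / u)) (𝓝[<] 0) (𝓝 0) := by
    have h1 : Tendsto (fun u : ℝ => a₀ / u) (𝓝[<] 0) atBot := by
      simp_rw [div_eq_mul_inv]
      exact tendsto_inv_nhdsLT_zero.const_mul_atBot ha₀
    simpa using (Real.tendsto_exp_atBot.comp h1).const_mul M
  have hsm : ∀ᶠ u in 𝓝[<] 0, M * Real.exp (a₀ / u) < η ^ 2 / 2 :=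
    hlim.eventually (gt_mem_nhds (by positivity))
  filter_upwards [hsm, Ioo_mem_nhdsLT (show c / 2 < 0 by linarith)] with u hu hu'
  have h1 := hanti (a := c / 2) ⟨by linarith, by linarith⟩ ⟨by linarith [hu'.1], hu'.2⟩ hu'.1.le
  have h2 : (y u ^ 2 - (η / 2) ^ 2) * Real.exp (-(a₀ / u)) * Real.exp (a₀ / u) ≤
      M * Real.exp (a₀ / u) := mul_le_mul_of_nonneg_right h1 (Real.exp_pos _).le
  rw [mul_assoc, ← Real.exp_add, neg_add_cancel, Real.exp_zero, mul_one] at h2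
  nlinarith

/-- A solution of `u² y' = -a y + e` with `u² y` bounded tends to `0` at the saddle side of the
singular point. -/
lemma tendsto_zero_of_singular_right {y y' a e : ℝ → ℝ} {a₀ : ℝ} (ha₀ : 0 < a₀)
    (hy : ∀ᶠ u in 𝓝[>] 0, HasDerivAt y (y' u) u)
    (h : ∀ᶠ u in 𝓝[>] 0, u ^ 2 * y' u = -a u * y u + e u)
    (ha : ∀ᶠ u in 𝓝[>] 0, a₀ ≤ a u) (he : Tendsto e (𝓝[>] 0) (𝓝 0))
    {N : ℝ} (hb : ∀ᶠ u in 𝓝[>] 0, |u ^ 2 * y u| ≤ N) :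
    Tendsto y (𝓝[>] 0) (𝓝 0) := by
  refine tendsto_zero_of_sq_le fun η hη => ?_
  have he' : ∀ᶠ u in 𝓝[>] 0, |e u| ≤ a₀ * η := by
    have := (Metric.tendsto_nhds.1 he) (a₀ * η) (by positivity)
    filter_upwards [this] with u hu
    rw [Real.dist_eq, sub_zero] at hu
    exact hu.le
  obtain ⟨c, hc, hI⟩ := mem_nhdsGT_iff_exists_Ioo_subset.1 (hy.and (h.and (ha.and (he'.and hb))))
  have hc0 : 0 < c := hc
  have hanti := antitoneOn_sq_sub_mul_exp (convex_Ioo 0 c) (η := a₀ * η) ha₀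
    (fun u hu => hu.1.ne') (fun u hu => (hI hu).1)
    (fun u hu => singular_sq_le (hI hu).2.2.1 (hI hu).2.2.2.1 (hI hu).2.1)
  have hη2 : a₀ * η / a₀ = η := by field_simp
  rw [hη2] at hanti
  have hlim : Tendsto (fun s : ℝ => N ^ 2 / a₀ ^ 4 * ((a₀ / s) ^ 4 * Real.exp (-(a₀ / s))))
      (𝓝[>] 0) (𝓝 0) := by
    have h1 : Tendsto (fun u : ℝ => a₀ / u) (𝓝[>] 0) atTop := by
      simp_rw [div_eq_mul_inv]
      exact tendsto_inv_nhdsGT_zero.const_mul_atTop ha₀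
    simpa using ((Real.tendsto_pow_mul_exp_neg_atTop_nhds_zero 4).comp h1).const_mul
      (N ^ 2 / a₀ ^ 4)
  filter_upwards [Ioo_mem_nhdsGT hc0] with u hu
  have hle : (y u ^ 2 - η ^ 2) * Real.exp (-(a₀ / u)) ≤ 0 := by
    refine ge_of_tendsto hlim ?_
    filter_upwards [Ioo_mem_nhdsGT hu.1] with s hs
    have hsI : s ∈ Ioo 0 c := ⟨hs.1, hs.2.trans hu.2⟩
    refine (hanti hsI hu hs.2.le).trans ?_
    have hs0 := hs.1
    have h1 : N ^ 2 / a₀ ^ 4 * ((a₀ / s) ^ 4 * Real.exp (-(a₀ / s))) =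
        N ^ 2 / s ^ 4 * Real.exp (-(a₀ / s)) := by field_simp
    rw [h1]
    refine mul_le_mul_of_nonneg_right ?_ (Real.exp_pos _).le
    rw [le_div_iff₀ (by positivity)]
    have h2 : |s ^ 2 * y s| ≤ N := (hI hsI).2.2.2.2
    have h3 := sq_le_sq' (abs_le.1 h2).1 (abs_le.1 h2).2
    nlinarith [sq_nonneg (η * s ^ 2)]
  have := Real.exp_pos (-(a₀ / u))
  by_contra! hlt
  nlinarith

lemma tendsto_zero_of_singular {y y' a e : ℝ → ℝ} {a₀ : ℝ} (ha₀ : 0 < a₀)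
    (hy : ∀ᶠ u in 𝓝[≠] 0, HasDerivAt y (y' u) u)
    (h : ∀ᶠ u in 𝓝[≠] 0, u ^ 2 * y' u = -a u * y u + e u)
    (ha : ∀ᶠ u in 𝓝[≠] 0, a₀ ≤ a u) (he : Tendsto e (𝓝[≠] 0) (𝓝 0))
    {N : ℝ} (hb : ∀ᶠ u in 𝓝[≠] 0, |u ^ 2 * y u| ≤ N) :
    Tendsto y (𝓝[≠] 0) (𝓝 0) := by
  rw [← nhdsLT_sup_nhdsGT] at *
  rw [eventually_sup] at hy h ha hb
  rw [tendsto_sup] at he ⊢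
  exact ⟨tendsto_zero_of_singular_left ha₀ hy.1 h.1 ha.1 he.1,
    tendsto_zero_of_singular_right ha₀ hy.2 h.2 ha.2 he.2 hb.2⟩

namespace IsPrincipalJet

variable {l lu lv m mu mv n nu nv : ℝ → ℝ → ℝ} {b c B K C r : ℝ}

lemma tendsto_jet {g gu gv : ℝ → ℝ → ℝ} {β γ : ℝ} (hg : IsScalarJet g gu gv β γ C r) (hr : 0 < r)
    {f : ℝ → ℝ} (hf : Tendsto f (𝓝[≠] 0) (𝓝 0)) :
    Tendsto (fun u => gu u (f u)) (𝓝[≠] 0) (𝓝 0) := by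
  have hu : Tendsto (fun u : ℝ => u) (𝓝[≠] 0) (𝓝 0) := nhdsWithin_le_nhds
  have h1 : Tendsto (fun u => |γ * u| + C * (|f u| + u ^ 2)) (𝓝[≠] 0) (𝓝 0) := by
    have := ((hu.const_mul γ).abs).add ((hf.abs.add (hu.pow 2)).const_mul C)
    simpa using this
  refine squeeze_zero_norm' ?_ h1
  have hsmall : ∀ᶠ x : ℝ in 𝓝 0, |x| ≤ r := by
    filter_upwards [Metric.closedBall_mem_nhds (0 : ℝ) hr] with x hx
    simpa using hx
  filter_upwards [hu.eventually hsmall, hf.eventually hsmall] with u h2 h3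
  have h4 := abs_add_le (gu u (f u) - γ * u) (γ * u)
  rw [sub_add_cancel] at h4
  rw [Real.norm_eq_abs]
  linarith [hg.val_u u (f u) h2 h3]

/-- A leaf of the first foliation which is tangent to the axis `v = 0` on both sides of the
origin, and its slope. -/
theorem exists_center_leaf (H : IsPrincipalJet l lu lv m mu mv n nu nv b c B K C r) :
    ∃ f x σ : ℝ → ℝ, ∃ κ > 0, ∃ A, f 0 = 0 ∧ x 0 = 0 ∧ Tendsto x (𝓝[≠] 0) (𝓝 0) ∧
      ∀ᶠ u in 𝓝[≠] 0, HasDerivAt f (x u) u ∧ |f u| ≤ A * u ^ 2 ∧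
        κ * u ^ 2 ≤ σ u ∧ σ u ≤ A * u ^ 2 ∧
        l u (f u) * x u ^ 2 + m u (f u) * x u + n u (f u) = 0 ∧
        2 * l u (f u) * x u + m u (f u) = σ u ∧ |l u (f u)| ≤ A * u ^ 2 ∧
        ∃ x', HasDerivAt x x' u := by
  obtain ⟨r₁, hr₁, hrr₁, L, A₁, -, hpair⟩ := H.exists_isLocalPair
  obtain ⟨r₂, hr₂, hrr₂, κ, hκ, A₂, hA₂, hb⟩ := H.exists_bounds
  obtain ⟨r₃, hr₃, hrr₃, A₃, hA₃, d, hd, hder⟩ := H.exists_deriv_bounds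
  have HP := hpair.isPrincipalPair
  obtain ⟨G, hG, ρ, hρ, htrap, -⟩ := HP.exists_barrier
  obtain ⟨c₀, hc₀⟩ := HP.fieldS.sol_surjective (-ρ) 0
  set f := HP.fieldS.sol c₀ with hf
  have hfsol := HP.fieldS.isSol_sol c₀
  have hleft : ∀ u, -ρ ≤ u → u ≤ 0 → |f u| ≤ G * u ^ 2 := fun u h1 h2 =>
    htrap f hfsol (-ρ) u le_rfl h1 (by linarith) (by rw [hc₀, abs_zero]; positivity) (Or.inl h2)
  have hf0 : f 0 = 0 := by simpa using hleft 0 (by linarith) le_rfl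
  have hfG : ∀ u, |u| ≤ ρ → |f u| ≤ G * u ^ 2 := fun u hu => by
    rcases le_total u 0 with h | h
    · exact hleft u (abs_le.1 hu).1 h
    · exact htrap f hfsol 0 u (by linarith) h (abs_le.1 hu).2 (by simp [hf0]) (Or.inr rfl)
  set x : ℝ → ℝ := fun u => slopeRoot (l u (f u)) (m u (f u)) (n u (f u)) with hx
  set σ : ℝ → ℝ := fun u => √(m u (f u) ^ 2 - 4 * l u (f u) * n u (f u)) with hσ
  have hu : Tendsto (fun u : ℝ => u) (𝓝[≠] 0) (𝓝 0) := nhdsWithin_le_nhds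
  have hft : Tendsto f (𝓝[≠] 0) (𝓝 0) := by
    have : Tendsto f (𝓝 0) (𝓝 (f 0)) := hfsol.cont.tendsto 0
    rw [hf0] at this
    exact this.mono_left nhdsWithin_le_nhds
  have hsmall : ∀ ε > 0, ∀ᶠ x : ℝ in 𝓝 0, |x| ≤ ε := fun ε hε => by
    filter_upwards [Metric.closedBall_mem_nhds (0 : ℝ) hε] with x hx
    simpa using hx
  have hev : ∀ ε > 0, ∀ᶠ u in 𝓝[≠] 0, u ≠ 0 ∧ |u| ≤ ε ∧ |f u| ≤ ε := fun ε hε =>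
    eventually_mem_nhdsWithin.and ((hu.eventually (hsmall ε hε)).and
      (hft.eventually (hsmall ε hε)))
  have hq : ∀ u, u ≠ 0 → |f u| ≤ G * u ^ 2 →
      u ^ 2 ≤ |f u| + u ^ 2 ∧ |f u| + u ^ 2 ≤ (G + 1) * u ^ 2 := fun u _ h2 =>
    ⟨by linarith [abs_nonneg (f u)], by linarith⟩
  -- the basic facts
  have hbasic : ∀ᶠ u in 𝓝[≠] 0, u ≠ 0 ∧ |f u| ≤ G * u ^ 2 ∧ HasDerivAt f (x u) u ∧
      κ * u ^ 2 ≤ σ u ∧ σ u ≤ (5 * A₂ * (G + 1)) * u ^ 2 ∧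
      l u (f u) * x u ^ 2 + m u (f u) * x u + n u (f u) = 0 ∧
      2 * l u (f u) * x u + m u (f u) = σ u ∧ |l u (f u)| ≤ (5 * A₂ * (G + 1)) * u ^ 2 ∧
      HasDerivAt x (-((lu u (f u) + x u * lv u (f u)) * x u ^ 2 +
        (mu u (f u) + x u * mv u (f u)) * x u + (nu u (f u) + x u * nv u (f u))) / σ u) u := by
    filter_upwards [hev r₁ hr₁, hev r₂ hr₂, hev ρ hρ] with u h1 h2 h3
    have hu0 := h1.1
    obtain ⟨b1, b2, b3, b4, b5, b6, b7⟩ := hb u (f u) h2.2.1 h2.2.2 (Or.inl hu0)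
    have hρ' := rho_pos (u := u) (v := f u) (Or.inl hu0)
    have hD : 0 < m u (f u) + √(m u (f u) ^ 2 - 4 * l u (f u) * n u (f u)) :=
      lt_of_lt_of_le (by positivity) b3
    have hGu := hfG u h3.2.1
    obtain ⟨q1, q2⟩ := hq u hu0 hGu
    have hfd : HasDerivAt f (x u) u := by
      have := hfsol.deriv u (Or.inl hu0)
      rwa [hpair.extend_eq h1.2.1 h1.2.2] at this
    refine ⟨hu0, hGu, hfd, (mul_le_mul_of_nonneg_left q1 hκ.le).trans b2, ?_,
      slopeRoot_eq_zero b1.le hD.ne', two_mul_slopeRoot b1.le hD.ne', ?_, ?_⟩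
    · have h4 := mul_le_mul_of_nonneg_left q2 hA₂.le
      have h5 : 0 ≤ A₂ * (|f u| + u ^ 2) := by positivity
      have h6 := (abs_le.1 b6).1
      simp only [hσ]
      linarith
    · have h4 := mul_le_mul_of_nonneg_left q2 hA₂.le
      have h5 : 0 ≤ A₂ * (|f u| + u ^ 2) := by positivity
      linarith
    · exact (H.jetl.deriv_comp f _ u (h1.2.1.trans hrr₁) (h1.2.2.trans hrr₁) hfd).slopeRoot
        (H.jetm.deriv_comp f _ u (h1.2.1.trans hrr₁) (h1.2.2.trans hrr₁) hfd)
        (H.jetn.deriv_comp f _ u (h1.2.1.trans hrr₁) (h1.2.2.trans hrr₁) hfd) b1 hD.ne'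
  set A := 5 * A₂ * (G + 1) with hA
  have hA0 : 0 < A := by positivity
  set V : ℝ → ℝ := fun u => lv u (f u) * x u ^ 2 + mv u (f u) * x u + nv u (f u) with hV
  set W : ℝ → ℝ := fun u => lu u (f u) * x u ^ 2 + mu u (f u) * x u + nu u (f u) with hW
  have hxb : ∀ᶠ u in 𝓝[≠] 0, |x u| ≤ A₃ := by
    filter_upwards [hev r₃ hr₃] with u h1
    exact (hder u (f u) h1.2.1 h1.2.2 (Or.inl h1.1)).2.2.1
  have hVlow : ∀ᶠ u in 𝓝[≠] 0, d / (2 * (G + 1)) ≤ V u := by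
    have hlim : Tendsto (fun u => A₃ * (|u| + |f u|)) (𝓝[≠] 0) (𝓝 0) := by
      simpa using (hu.abs.add hft.abs).const_mul A₃
    filter_upwards [hev r₃ hr₃, hbasic,
      hlim.eventually (ge_mem_nhds (show 0 < d / (2 * (G + 1)) by positivity))] with u h1 h2 h3
    obtain ⟨q1, q2⟩ := hq u h2.1 h2.2.1
    have h4 := (hder u (f u) h1.2.1 h1.2.2 (Or.inl h1.1)).2.2.2.2.2.2.2
    have h5 : d / (G + 1) ≤ d * u ^ 2 / (|f u| + u ^ 2) := by
      rw [div_le_div_iff₀ (by positivity) (rho_pos (Or.inl h1.1))]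
      calc d * (|f u| + u ^ 2) ≤ d * ((G + 1) * u ^ 2) := mul_le_mul_of_nonneg_left q2 hd.le
        _ = _ := by ring
    have h6 : d / (G + 1) = d / (2 * (G + 1)) + d / (2 * (G + 1)) := by field_simp; norm_num
    simp only [hV]
    linarith
  have hWlim : Tendsto W (𝓝[≠] 0) (𝓝 0) := by
    have hbdd : ∀ g : ℝ → ℝ, Tendsto g (𝓝[≠] 0) (𝓝 0) → ∀ k : ℕ,
        Tendsto (fun u => g u * x u ^ k) (𝓝[≠] 0) (𝓝 0) := by
      intro g hg k
      refine squeeze_zero_norm' ?_ (by simpa using hg.abs.mul_const (A₃ ^ k))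
      filter_upwards [hxb] with u h1
      rw [Real.norm_eq_abs, abs_mul, abs_pow]
      gcongr
    have h1 := hbdd _ (tendsto_jet H.jetl H.r_pos hft) 2
    have h2 := hbdd _ (tendsto_jet H.jetm H.r_pos hft) 1
    have h3 := tendsto_jet H.jetn H.r_pos hft
    simpa using (h1.add h2).add h3
  have hn0 : n 0 0 = 0 := by
    have := H.jetn.val 0 0 (by simpa using H.r_pos.le) (by simpa using H.r_pos.le)
    simpa using this
  refine ⟨f, x, σ, κ, hκ, max G A, hf0, by simp [hx, hf0, hn0, slopeRoot], ?_, ?_⟩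
  · refine tendsto_zero_of_singular (a := fun u => u ^ 2 / σ u * V u)
      (e := fun u => -(u ^ 2 / σ u * W u)) (a₀ := d / (2 * (G + 1)) / A) (N := A₃) (by positivity)
      (hbasic.mono fun u h => h.2.2.2.2.2.2.2.2) ?_ ?_ ?_ ?_
    · filter_upwards [hbasic] with u h1
      simp only [hV, hW]
      ring
    · filter_upwards [hbasic, hVlow] with u h1 h2
      have hu2 : 0 < u ^ 2 := by have := h1.1; positivity
      have hσ0 : 0 < σ u := lt_of_lt_of_le (by positivity) h1.2.2.2.1
      have h3 : 1 / A ≤ u ^ 2 / σ u := by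
        rw [div_le_div_iff₀ hA0 hσ0]; linarith [h1.2.2.2.2.1]
      calc d / (2 * (G + 1)) / A = 1 / A * (d / (2 * (G + 1))) := by ring
        _ ≤ u ^ 2 / σ u * V u := mul_le_mul h3 h2 (by positivity) (by positivity)
    · refine squeeze_zero_norm' ?_ (by simpa using hWlim.abs.const_mul κ⁻¹)
      filter_upwards [hbasic] with u h1
      have hu2 : 0 < u ^ 2 := by have := h1.1; positivity
      have hσ0 : 0 < σ u := lt_of_lt_of_le (by positivity) h1.2.2.2.1
      rw [norm_neg, Real.norm_eq_abs, abs_mul, abs_of_pos (div_pos hu2 hσ0)]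
      refine mul_le_mul_of_nonneg_right ?_ (abs_nonneg _)
      rw [inv_eq_one_div, div_le_div_iff₀ hσ0 hκ]
      linarith [h1.2.2.2.1]
    · filter_upwards [hxb, hu.eventually (hsmall 1 one_pos)] with u h1 h2
      rw [abs_mul, abs_pow]
      exact (mul_le_of_le_one_left (abs_nonneg _) (pow_le_one₀ (abs_nonneg _) h2)).trans h1
  · filter_upwards [hbasic] with u h
    exact ⟨h.2.2.1, h.2.1.trans (mul_le_mul_of_nonneg_right (le_max_left _ _) (sq_nonneg _)),
      h.2.2.2.1, h.2.2.2.2.1.trans (mul_le_mul_of_nonneg_right (le_max_right _ _) (sq_nonneg _)),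
      h.2.2.2.2.2.1, h.2.2.2.2.2.2.1, h.2.2.2.2.2.2.2.1.trans
        (mul_le_mul_of_nonneg_right (le_max_right _ _) (sq_nonneg _)), _, h.2.2.2.2.2.2.2.2⟩

end IsPrincipalJet

/-! ### Taylor coefficients from an asymptotic expansion -/

lemma isLittleO_pow_succ_of_deriv {g g' : ℝ → ℝ} {j : ℕ} (hg : ∀ᶠ t in 𝓝 0, HasDerivAt g (g' t) t)
    (h0 : g 0 = 0) (h : g' =o[𝓝 0] fun t => t ^ j) : g =o[𝓝 0] fun t => t ^ (j + 1) := by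
  rw [isLittleO_iff] at h ⊢
  intro ε hε
  obtain ⟨δ, hδ, hI⟩ := Metric.eventually_nhds_iff_ball.1 (hg.and (h hε))
  filter_upwards [Metric.ball_mem_nhds 0 hδ] with t ht
  have hsub : ∀ s ∈ uIcc 0 t, s ∈ Metric.ball (0 : ℝ) δ ∧ |s| ≤ |t| := fun s hs => by
    have h1 : |s| ≤ |t| := by simpa using abs_sub_left_of_mem_uIcc hs
    rw [mem_ball_zero_iff, Real.norm_eq_abs] at ht ⊢
    exact ⟨h1.trans_lt ht, h1⟩
  have := (convex_uIcc (0 : ℝ) t).norm_image_sub_le_of_norm_hasDerivWithin_le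
    (f := g) (f' := g') (C := ε * |t| ^ j)
    (fun s hs => (hI s (hsub s hs).1).1.hasDerivWithinAt)
    (fun s hs => ((hI s (hsub s hs).1).2.trans (by
      rw [norm_pow, Real.norm_eq_abs]
      have := (hsub s hs).2
      gcongr))) left_mem_uIcc right_mem_uIcc
  rw [h0, sub_zero, sub_zero] at this
  rw [norm_pow, pow_succ, ← mul_assoc, Real.norm_eq_abs t]
  exact this

lemma deriv_chain_eq_zero {n : ℕ} {φ : ℕ → ℝ → ℝ}
    (hφ : ∀ k < n, ∀ᶠ t in 𝓝 0, HasDerivAt (φ k) (φ (k + 1) t) t)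
    (hc : ContinuousAt (φ n) 0) (h : φ 0 =o[𝓝 0] fun t => t ^ n) : ∀ k ≤ n, φ k 0 = 0 := by
  intro k
  induction k using Nat.strong_induction_on with
  | _ k ih =>
    intro hk
    have hcont : ContinuousAt (φ k) 0 := by
      rcases hk.lt_or_eq with hk | rfl
      · exact (hφ k hk).self_of_nhds.continuousAt
      · exact hc
    have hexp : ∀ i ≤ k, (fun t => φ (k - i) t - φ k 0 / i.factorial * t ^ i)
        =o[𝓝 0] fun t => t ^ i := by
      intro i
      induction i with
      | zero =>
        intro _
        have := hcont.tendsto.sub_const (φ k 0)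
        rw [sub_self] at this
        simpa [isLittleO_one_iff] using this
      | succ i hi =>
        intro hik
        have h1 : k - i = (k - (i + 1)) + 1 := by omega
        refine isLittleO_pow_succ_of_deriv (g' := fun t => φ (k - i) t -
          φ k 0 / i.factorial * t ^ i) ?_ ?_ (hi (by omega))
        · filter_upwards [hφ (k - (i + 1)) (by omega)] with t ht
          rw [h1]
          refine (ht.sub ((hasDerivAt_pow (i + 1) t).const_mul _)).congr_deriv ?_
          rw [Nat.factorial_succ]
          have : (i.factorial : ℝ) ≠ 0 := by positivity
          have : ((i : ℝ) + 1) ≠ 0 := by positivity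
          push_cast
          field_simp
        · rw [ih (k - (i + 1)) (by omega) (by omega)]; simp
    have h1 := hexp k le_rfl
    rw [Nat.sub_self] at h1
    have h2 : φ 0 =o[𝓝 0] fun t => t ^ k := by
      refine h.trans_isBigO ?_
      refine IsBigO.of_bound 1 ?_
      filter_upwards [Metric.ball_mem_nhds (0 : ℝ) one_pos] with t ht
      rw [mem_ball_zero_iff] at ht
      rw [norm_pow, norm_pow, one_mul]
      exact pow_le_pow_of_le_one (norm_nonneg _) ht.le hk
    have h3 := (h2.sub h1).congr_left (fun t => sub_sub_cancel (φ 0 t) _)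
    have h4 : (fun t : ℝ => φ k 0 / k.factorial) =o[𝓝[≠] 0] fun _ => (1 : ℝ) := by
      have h5 := (h3.mono nhdsWithin_le_nhds : _ =o[𝓝[≠] (0 : ℝ)] _)
      have h6 := h5.mul_isBigO (isBigO_refl (fun t : ℝ => (t ^ k)⁻¹) (𝓝[≠] 0))
      refine h6.congr' ?_ ?_ <;> filter_upwards [eventually_mem_nhdsWithin] with t ht
      · have : t ^ k ≠ 0 := pow_ne_zero _ ht
        field_simp
      · exact mul_inv_cancel₀ (pow_ne_zero _ ht)
    rw [isLittleO_one_iff] at h4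
    have h5 := tendsto_nhds_unique h4 tendsto_const_nhds
    have : (k.factorial : ℝ) ≠ 0 := by positivity
    have h7 : φ k 0 / k.factorial = 0 := h5.symm
    rwa [div_eq_zero_iff, or_iff_left this] at h7

lemma deriv_chain_eq {n : ℕ} {φ : ℕ → ℝ → ℝ} (q : Polynomial ℝ)
    (hφ : ∀ k < n, ∀ᶠ t in 𝓝 0, HasDerivAt (φ k) (φ (k + 1) t) t)
    (hc : ContinuousAt (φ n) 0) (h : (fun t => φ 0 t - q.eval t) =o[𝓝 0] fun t => t ^ n) :
    ∀ k ≤ n, φ k 0 = (Polynomial.derivative^[k] q).eval 0 := by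
  intro k hk
  have := deriv_chain_eq_zero (n := n)
    (φ := fun k t => φ k t - (Polynomial.derivative^[k] q).eval t) (fun k hk => ?_)
    (hc.sub (Polynomial.continuous _).continuousAt) h k hk
  · linarith
  · filter_upwards [hφ k hk] with t ht
    rw [Function.iterate_succ_apply']
    exact ht.sub (Polynomial.hasDerivAt _ t)

/-! ### Partial derivatives in the plane -/

lemma e2_eq (x : E2) : x = x 0 • (!₂[1, 0] : E2) + x 1 • (!₂[0, 1] : E2) := by
  ext i; fin_cases i <;> simp

lemma e2_eta (x : E2) : !₂[x 0, x 1] = x := by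
  ext i; fin_cases i <;> simp

lemma fderiv_apply_e2 (f : E2 → ℝ) (x w : E2) :
    fderiv ℝ f x w = w 0 * du f x + w 1 * dv f x := by
  conv_lhs => rw [e2_eq w]
  simp [du, dv]

lemma ContDiffAt.du {f : E2 → ℝ} {x : E2} {n : ℕ} (hf : ContDiffAt ℝ (n + 1 : ℕ) f x) :
    ContDiffAt ℝ n (_root_.du f) x :=
  (hf.fderiv_right (m := n) (by norm_cast)).clm_apply contDiffAt_const

lemma ContDiffAt.dv {f : E2 → ℝ} {x : E2} {n : ℕ} (hf : ContDiffAt ℝ (n + 1 : ℕ) f x) :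
    ContDiffAt ℝ n (_root_.dv f) x :=
  (hf.fderiv_right (m := n) (by norm_cast)).clm_apply contDiffAt_const

lemma fderiv_fderiv_apply {V : Type*} [NormedAddCommGroup V] [NormedSpace ℝ V] {f : V → ℝ} {x : V}
    (hf : ContDiffAt ℝ 2 f x) (w y : V) :
    fderiv ℝ (fun x => fderiv ℝ f x w) x y = fderiv ℝ (fderiv ℝ f) x y w := by
  have h := (hf.fderiv_right (m := 1) le_rfl).differentiableAt one_ne_zero
  have h2 := h.hasFDerivAt.clm_apply (hasFDerivAt_const w x)
  rw [h2.fderiv]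
  simp

lemma fderiv_fderiv_symm {V : Type*} [NormedAddCommGroup V] [NormedSpace ℝ V] {f : V → ℝ} {x : V}
    (hf : ContDiffAt ℝ 2 f x) (w y : V) :
    fderiv ℝ (fderiv ℝ f) x y w = fderiv ℝ (fderiv ℝ f) x w y :=
  (hf.isSymmSndFDerivAt (by simp)) y w

lemma dv_du {f : E2 → ℝ} {x : E2} (hf : ContDiffAt ℝ 2 f x) : dv (du f) x = du (dv f) x := by
  have h1 : dv (du f) x = _ := fderiv_fderiv_apply hf !₂[1, 0] !₂[0, 1]
  have h2 : du (dv f) x = _ := fderiv_fderiv_apply hf !₂[0, 1] !₂[1, 0]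
  rw [h1, h2, fderiv_fderiv_symm hf]

/-- The partial derivative of order `i` in `u` and `j` in `v`. -/
noncomputable def par (f : E2 → ℝ) (i j : ℕ) : E2 → ℝ := du^[i] (dv^[j] f)

lemma par_succ (f : E2 → ℝ) (i j : ℕ) : par f (i + 1) j = du (par f i j) :=
  Function.iterate_succ_apply' _ _ _

lemma contDiffAt_par {f : E2 → ℝ} {x : E2} {n : ℕ} : ∀ {i j : ℕ},
    ContDiffAt ℝ (n + (i + j) : ℕ) f x → ContDiffAt ℝ n (par f i j) x := by
  have hv : ∀ (j n : ℕ), ContDiffAt ℝ (n + j : ℕ) f x → ContDiffAt ℝ n (dv^[j] f) x := by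
    intro j
    induction j with
    | zero => intro n h; exact h
    | succ j ih =>
      intro n h
      rw [Function.iterate_succ_apply']
      exact (ih (n + 1) (by convert h using 2; omega)).dv
  intro i j h
  induction i generalizing n with
  | zero => exact hv j n (by rwa [zero_add] at h)
  | succ i ih =>
    rw [par_succ]
    exact (ih (n := n + 1) (by convert h using 2; omega)).du

lemma dv_par {f : E2 → ℝ} {U : Set E2} (hU : IsOpen U) {n : ℕ}
    (hf : ∀ x ∈ U, ContDiffAt ℝ n f x) (i j : ℕ) (hij : i + j + 1 ≤ n) :
    ∀ x ∈ U, dv (par f i j) x = par f i (j + 1) x := by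
  induction i with
  | zero => intro x _; simp only [par, Function.iterate_zero, id, Function.iterate_succ_apply']
  | succ i ih =>
    intro x hx
    have h2 : ContDiffAt ℝ 2 (par f i j) x :=
      contDiffAt_par ((hf x hx).of_le (by norm_cast; omega))
    rw [par_succ, par_succ, dv_du h2]
    have : dv (par f i j) =ᶠ[𝓝 x] par f i (j + 1) := by
      filter_upwards [hU.mem_nhds hx] with y hy using ih (by omega) y hy
    simp only [du]
    rw [this.fderiv_eq]

/-- Along a line the derivatives are given by the binomial formula, so that an expansion of `f`
determines its partial derivatives. -/
theorem par_eq_of_isLittleO {f : E2 → ℝ} {U : Set E2} (hU : IsOpen U) (h0 : (0 : E2) ∈ U) {n : ℕ}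
    (hf : ∀ x ∈ U, ContDiffAt ℝ n f x) (w : E2) (q : Polynomial ℝ)
    (h : (fun t : ℝ => f (t • w) - q.eval t) =o[𝓝 0] fun t => t ^ n) : ∀ k ≤ n,
    ∑ ij ∈ Finset.HasAntidiagonal.antidiagonal k, (k.choose ij.1 : ℝ) * (w 0 ^ ij.1 * w 1 ^ ij.2 *
      par f ij.1 ij.2 0) = (Polynomial.derivative^[k] q).eval 0 := by
  have hline : ∀ᶠ t : ℝ in 𝓝 0, t • w ∈ U := by
    have : Continuous fun t : ℝ => t • w := by fun_prop
    have := this.tendsto 0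
    rw [zero_smul] at this
    exact this.eventually (hU.mem_nhds h0)
  have := deriv_chain_eq (n := n) (φ := fun k t => ∑ ij ∈ Finset.HasAntidiagonal.antidiagonal k,
    (k.choose ij.1 : ℝ) * (w 0 ^ ij.1 * w 1 ^ ij.2 * par f ij.1 ij.2 (t • w))) q
    (fun k hk => ?_) ?_ ?_
  · intro k hk
    simpa using this k hk
  · filter_upwards [hline] with t ht
    have hd : HasDerivAt (fun t : ℝ => t • w) w t := by
      simpa using (hasDerivAt_id t).smul_const w
    rw [Finset.sum_antidiagonal_choose_succ_mul
      (fun i j => w 0 ^ i * w 1 ^ j * par f i j (t • w)), add_comm, ← Finset.sum_add_distrib]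
    refine HasDerivAt.fun_sum fun ij hij => ?_
    have hij' : ij.1 + ij.2 = k := Finset.HasAntidiagonal.mem_antidiagonal.1 hij
    have h1 : DifferentiableAt ℝ (par f ij.1 ij.2) (t • w) :=
      (contDiffAt_par (n := 1) ((hf _ ht).of_le (by norm_cast; omega))).differentiableAt one_ne_zero
    have h2 := (h1.hasFDerivAt.comp_hasDerivAt t hd)
    refine ((h2.const_mul (w 0 ^ ij.1 * w 1 ^ ij.2)).const_mul (k.choose ij.1 : ℝ)).congr_deriv ?_
    rw [fderiv_apply_e2, dv_par hU hf _ _ (by omega) _ ht, ← par_succ, ← hij', Nat.choose_symm_add]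
    ring
  · have hd : ContinuousAt (fun t : ℝ => t • w) 0 := by fun_prop
    refine tendsto_finsetSum _ fun ij hij => ?_
    have hij' : ij.1 + ij.2 = n := Finset.HasAntidiagonal.mem_antidiagonal.1 hij
    have h1 : ContinuousAt (par f ij.1 ij.2) ((0 : ℝ) • w) :=
      (contDiffAt_par (n := 0) ((hf _ (by rwa [zero_smul])).of_le
        (by norm_cast; omega))).continuousAt
    exact ((h1.comp (f := fun t : ℝ => t • w) hd).const_mul _).const_mul _
  · simpa [par] using h

/-- The partial derivatives of order at most four read off from the expansion of a Monge chart. -/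
structure IsMongeJet (h : E2 → ℝ) (k a b c A B C : ℝ) : Prop where
  p10 : par h 1 0 0 = 0
  p01 : par h 0 1 0 = 0
  p20 : par h 2 0 0 = k
  p11 : par h 1 1 0 = 0
  p02 : par h 0 2 0 = k
  p30 : par h 3 0 0 = a
  p21 : par h 2 1 0 = 0
  p12 : par h 1 2 0 = b
  p03 : par h 0 3 0 = c
  p40 : par h 4 0 0 = A
  p31 : par h 3 1 0 = B
  p22 : par h 2 2 0 = C

lemma eval_iterate_derivative_quartic (p₂ p₃ p₄ : ℝ) :
    let q := Polynomial.C p₂ * Polynomial.X ^ 2 + Polynomial.C p₃ * Polynomial.X ^ 3 +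
      Polynomial.C p₄ * Polynomial.X ^ 4
    (Polynomial.derivative^[1] q).eval 0 = 0 ∧ (Polynomial.derivative^[2] q).eval 0 = 2 * p₂ ∧
      (Polynomial.derivative^[3] q).eval 0 = 6 * p₃ ∧
      (Polynomial.derivative^[4] q).eval 0 = 24 * p₄ := by
  refine ⟨?_, ?_, ?_, ?_⟩ <;>
    rw [← Polynomial.coeff_zero_eq_eval_zero, Polynomial.coeff_iterate_derivative] <;>
    simp only [Polynomial.coeff_add, Polynomial.coeff_C_mul, Polynomial.coeff_X_pow] <;>
    norm_num [Nat.descFactorial]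

theorem isMongeJet_of_isBigO {h : E2 → ℝ} {U : Set E2} (hU : IsOpen U) (h0 : (0 : E2) ∈ U)
    (hh : ∀ x ∈ U, ContDiffAt ℝ (5 : ℕ) h x) {k a b c A B C D E : ℝ}
    (htaylor : (fun x : E2 => h x -
        (k / 2 * (x 0 ^ 2 + x 1 ^ 2) + a / 6 * x 0 ^ 3 + b / 2 * (x 0 * x 1 ^ 2)
          + c / 6 * x 1 ^ 3 + A / 24 * x 0 ^ 4 + B / 6 * (x 0 ^ 3 * x 1)
          + C / 4 * (x 0 ^ 2 * x 1 ^ 2) + D / 6 * (x 0 * x 1 ^ 3) + E / 24 * x 1 ^ 4))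
      =O[𝓝 0] (fun x : E2 => ‖x‖ ^ 5)) :
    IsMongeJet h k a b c A B C := by
  have key : ∀ x y : ℝ, ∀ j ≤ 4, _ := fun x y => by
    refine par_eq_of_isLittleO hU h0 (n := 4) (fun x hx => (hh x hx).of_le (by norm_cast)) !₂[x, y]
      (Polynomial.C (k / 2 * (x ^ 2 + y ^ 2)) * Polynomial.X ^ 2 +
        Polynomial.C (a / 6 * x ^ 3 + b / 2 * (x * y ^ 2) + c / 6 * y ^ 3) * Polynomial.X ^ 3 +
        Polynomial.C (A / 24 * x ^ 4 + B / 6 * (x ^ 3 * y) + C / 4 * (x ^ 2 * y ^ 2) +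
          D / 6 * (x * y ^ 3) + E / 24 * y ^ 4) * Polynomial.X ^ 4) ?_
    have hd : Tendsto (fun t : ℝ => t • (!₂[x, y] : E2)) (𝓝 0) (𝓝 0) := by
      have : Continuous fun t : ℝ => t • (!₂[x, y] : E2) := by fun_prop
      simpa using this.tendsto 0
    have h1 := htaylor.comp_tendsto hd
    have h2 : (fun t : ℝ => ‖t • (!₂[x, y] : E2)‖ ^ 5) =O[𝓝 0] fun t : ℝ => t ^ 5 := by
      refine IsBigO.of_bound (‖(!₂[x, y] : E2)‖ ^ 5) (Eventually.of_forall fun t => ?_)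
      rw [norm_smul, mul_pow, norm_mul, norm_pow, norm_pow, norm_norm, norm_norm, norm_pow]
      rw [mul_comm]
    have h3 : (fun t : ℝ => t ^ 5) =o[𝓝 0] fun t : ℝ => t ^ 4 := isLittleO_pow_pow (by norm_num)
    refine ((h1.trans h2).trans_isLittleO h3).congr_left fun t => ?_
    simp
    ring
  have k1 : ∀ x y, _ := fun x y => (key x y 1 (by norm_num)).trans
    (eval_iterate_derivative_quartic _ _ _).1
  have k2 : ∀ x y, _ := fun x y => (key x y 2 (by norm_num)).trans
    (eval_iterate_derivative_quartic _ _ _).2.1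
  have k3 : ∀ x y, _ := fun x y => (key x y 3 (by norm_num)).trans
    (eval_iterate_derivative_quartic _ _ _).2.2.1
  have k4 : ∀ x y, _ := fun x y => (key x y 4 (by norm_num)).trans
    (eval_iterate_derivative_quartic _ _ _).2.2.2
  clear key
  simp [Finset.Nat.antidiagonal_succ, Nat.choose] at k1 k2 k3 k4
  have e1 := k1 1 0
  have e2 := k1 0 1
  have e3 := k2 1 0
  have e4 := k2 0 1
  have e5 := k2 1 1
  have f1 := k3 1 0
  have f2 := k3 0 1
  have f3 := k3 1 1
  have f4 := k3 1 (-1)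
  have g1 := k4 1 0
  have g2 := k4 0 1
  have g3 := k4 1 1
  have g4 := k4 1 (-1)
  have g5 := k4 1 2
  norm_num at e1 e2 e3 e4 e5 f1 f2 f3 f4 g1 g2 g3 g4 g5
  exact ⟨by linarith only [e1], by linarith only [e2], by linarith only [e3],
    by linarith only [e3, e4, e5], by linarith only [e4], by linarith only [f1],
    by linarith only [f1, f2, f3, f4], by linarith only [f1, f2, f3, f4], by linarith only [f2],
    by linarith only [g1], by linarith only [g1, g2, g3, g4, g5],
    by linarith only [g1, g2, g3, g4, g5]⟩

/-! ### The coefficients of the equation of the principal directions -/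

section

variable {p q r s t : ℝ → ℝ} {p₁ q₁ r₁ s₁ t₁ x : ℝ}

lemma hasDerivAt_coeffL (hp : HasDerivAt p p₁ x) (hq : HasDerivAt q q₁ x) (hs : HasDerivAt s s₁ x)
    (ht : HasDerivAt t t₁ x) :
    HasDerivAt (fun x => p x * q x * t x - (1 + q x ^ 2) * s x)
      (p₁ * q x * t x + p x * q₁ * t x + p x * q x * t₁ - 2 * q x * q₁ * s x - (1 + q x ^ 2) * s₁)
      x := by
  refine (((hp.fun_mul hq).fun_mul ht).fun_sub (((hq.fun_pow 2).const_add 1).fun_mul hs)).congr_deriv ?_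
  norm_num
  ring

lemma hasDerivAt_coeffM (hp : HasDerivAt p p₁ x) (hq : HasDerivAt q q₁ x) (hr : HasDerivAt r r₁ x)
    (ht : HasDerivAt t t₁ x) :
    HasDerivAt (fun x => (1 + p x ^ 2) * t x - (1 + q x ^ 2) * r x)
      (2 * p x * p₁ * t x + (1 + p x ^ 2) * t₁ - 2 * q x * q₁ * r x - (1 + q x ^ 2) * r₁) x := by
  refine ((((hp.fun_pow 2).const_add 1).fun_mul ht).fun_sub
    (((hq.fun_pow 2).const_add 1).fun_mul hr)).congr_deriv ?_
  norm_num
  ring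

lemma hasDerivAt_coeffN (hp : HasDerivAt p p₁ x) (hq : HasDerivAt q q₁ x) (hs : HasDerivAt s s₁ x)
    (hr : HasDerivAt r r₁ x) :
    HasDerivAt (fun x => (1 + p x ^ 2) * s x - p x * q x * r x)
      (2 * p x * p₁ * s x + (1 + p x ^ 2) * s₁ -
        (p₁ * q x * r x + p x * q₁ * r x + p x * q x * r₁)) x := by
  refine ((((hp.fun_pow 2).const_add 1).fun_mul hs).fun_sub
    ((hp.fun_mul hq).fun_mul hr)).congr_deriv ?_
  norm_num
  ring

end

/-- The derivatives at the origin of a coefficient which enter in the local analysis. -/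
structure HasCoeffJet (g : E2 → ℝ) (β γ : ℝ) : Prop where
  zero : g 0 = 0
  du_zero : du g 0 = 0
  dv_zero : dv g 0 = β
  du_du : du (du g) 0 = γ

section

variable {h : E2 → ℝ} {U : Set E2}

lemma coeff_eq_par (hU : IsOpen U) (hh : ∀ x ∈ U, ContDiffAt ℝ (5 : ℕ) h x) {x : E2} (hx : x ∈ U) :
    du h x = par h 1 0 x ∧ dv h x = par h 0 1 x ∧ du (du h) x = par h 2 0 x ∧
      dv (du h) x = par h 1 1 x ∧ dv (dv h) x = par h 0 2 x :=
  ⟨rfl, rfl, rfl, dv_par hU hh 1 0 (by norm_num) x hx, rfl⟩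

lemma hasDerivAt_comp_e2 {g : E2 → ℝ} {f : ℝ → E2} {f' : E2} {t : ℝ}
    (hg : DifferentiableAt ℝ g (f t)) (hf : HasDerivAt f f' t) :
    HasDerivAt (fun t => g (f t)) (f' 0 * du g (f t) + f' 1 * dv g (f t)) t :=
  (hg.hasFDerivAt.comp_hasDerivAt t hf).congr_deriv (fderiv_apply_e2 _ _ _)

lemma hasDerivAt_par (hU : IsOpen U) (hh : ∀ x ∈ U, ContDiffAt ℝ (5 : ℕ) h x) {f : ℝ → E2} {f' : E2}
    {t : ℝ} (hf : HasDerivAt f f' t) (ht : f t ∈ U) {i j : ℕ} (hij : i + j ≤ 4) :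
    HasDerivAt (fun t => par h i j (f t))
      (f' 0 * par h (i + 1) j (f t) + f' 1 * par h i (j + 1) (f t)) t := by
  have h1 : DifferentiableAt ℝ (par h i j) (f t) :=
    (contDiffAt_par (n := 1) ((hh _ ht).of_le (by norm_cast; omega))).differentiableAt one_ne_zero
  refine (hasDerivAt_comp_e2 h1 hf).congr_deriv ?_
  rw [dv_par hU hh i j (by omega) _ ht, par_succ]

lemma contDiffAt_coeff (hh : ∀ x ∈ U, ContDiffAt ℝ (5 : ℕ) h x) {x : E2} (hx : x ∈ U) :
    ContDiffAt ℝ (3 : ℕ) (coeffL h) x ∧ ContDiffAt ℝ (3 : ℕ) (coeffM h) x ∧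
      ContDiffAt ℝ (3 : ℕ) (coeffN h) x := by
  have hu : ContDiffAt ℝ (4 : ℕ) (du h) x := (hh x hx).du
  have hv : ContDiffAt ℝ (4 : ℕ) (dv h) x := (hh x hx).dv
  have huu : ContDiffAt ℝ (3 : ℕ) (du (du h)) x := hu.du
  have huv : ContDiffAt ℝ (3 : ℕ) (dv (du h)) x := hu.dv
  have hvv : ContDiffAt ℝ (3 : ℕ) (dv (dv h)) x := hv.dv
  replace hu : ContDiffAt ℝ (3 : ℕ) (du h) x := hu.of_le (by norm_cast)
  replace hv : ContDiffAt ℝ (3 : ℕ) (dv h) x := hv.of_le (by norm_cast)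
  refine ⟨?_, ?_, ?_⟩
  · exact ((hu.mul hv).mul hvv).sub ((contDiffAt_const.add (hv.pow 2)).mul huv)
  · exact ((contDiffAt_const.add (hu.pow 2)).mul hvv).sub
      ((contDiffAt_const.add (hv.pow 2)).mul huu)
  · exact ((contDiffAt_const.add (hu.pow 2)).mul huv).sub ((hu.mul hv).mul huu)

lemma hasDerivAt_smul_vec (w : E2) (t : ℝ) : HasDerivAt (fun t : ℝ => t • w) w t := by
  simpa using (hasDerivAt_id t).smul_const w

lemma eventually_smul_mem (hU : IsOpen U) (h0 : (0 : E2) ∈ U) (w : E2) :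
    ∀ᶠ t : ℝ in 𝓝 0, t • w ∈ U := by
  have : Continuous fun t : ℝ => t • w := by fun_prop
  have := this.tendsto 0
  rw [zero_smul] at this
  exact this.eventually (hU.mem_nhds h0)

/-- The jet is computed by restriction to the coordinate axes. -/
lemma hasCoeffJet_of_lines {g : E2 → ℝ} (hU : IsOpen U) (h0 : (0 : E2) ∈ U)
    (hg : ∀ x ∈ U, ContDiffAt ℝ (3 : ℕ) g x) {β γ : ℝ} (hz : g 0 = 0)
    {g₁ : ℝ → ℝ} (hu : ∀ᶠ t in 𝓝 0, HasDerivAt (fun t : ℝ => g (t • !₂[1, 0])) (g₁ t) t)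
    (hu0 : g₁ 0 = 0) (huu : HasDerivAt g₁ γ 0)
    (hv : HasDerivAt (fun t : ℝ => g (t • !₂[0, 1])) β 0) : HasCoeffJet g β γ := by
  have hd : ∀ x ∈ U, DifferentiableAt ℝ g x := fun x hx =>
    (hg x hx).differentiableAt (by norm_num)
  have h1 : ∀ᶠ t in 𝓝 0, du g (t • !₂[1, 0]) = g₁ t := by
    filter_upwards [hu, eventually_smul_mem hU h0 !₂[1, 0]] with t ht htU
    have := (hasDerivAt_comp_e2 (hd _ htU) (hasDerivAt_smul_vec _ t)).unique ht
    simpa using this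
  refine ⟨hz, ?_, ?_, ?_⟩
  · have := h1.self_of_nhds
    rw [zero_smul] at this
    rw [this, hu0]
  · have h2 := hasDerivAt_comp_e2 (t := 0) (f := fun t : ℝ => t • !₂[0, 1])
      (hd _ (by rwa [zero_smul])) (hasDerivAt_smul_vec _ 0)
    have := h2.unique hv
    simpa using this
  · have h3 : ContDiffAt ℝ (2 : ℕ) (du g) 0 := (hg 0 h0).du
    have h2 := hasDerivAt_comp_e2 (g := du g) (t := 0) (f := fun t : ℝ => t • !₂[1, 0])
      (by rw [zero_smul]; exact h3.differentiableAt (by norm_num)) (hasDerivAt_smul_vec _ 0)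
    have h4 := (h2.congr_of_eventuallyEq (h1.mono fun t ht => ht.symm)).unique huu
    simpa using h4

theorem hasCoeffJet_coeff (hU : IsOpen U) (h0 : (0 : E2) ∈ U)
    (hh : ∀ x ∈ U, ContDiffAt ℝ (5 : ℕ) h x) {k a b c A B C : ℝ}
    (hj : IsMongeJet h k a b c A B C) (hab : a = b) :
    HasCoeffJet (coeffL h) (-b) (-B) ∧ HasCoeffJet (coeffM h) c (C - A + 2 * k ^ 3) ∧
      HasCoeffJet (coeffN h) b B := by
  have hL : ∀ x ∈ U, coeffL h x = par h 1 0 x * par h 0 1 x * par h 0 2 x -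
      (1 + par h 0 1 x ^ 2) * par h 1 1 x := fun x hx => by
    obtain ⟨h1, h2, h3, h4, h5⟩ := coeff_eq_par hU hh hx
    rw [coeffL, h1, h2, h4, h5]
  have hM : ∀ x ∈ U, coeffM h x = (1 + par h 1 0 x ^ 2) * par h 0 2 x -
      (1 + par h 0 1 x ^ 2) * par h 2 0 x := fun x hx => by
    obtain ⟨h1, h2, h3, h4, h5⟩ := coeff_eq_par hU hh hx
    rw [coeffM, h1, h2, h3, h5]
  have hN : ∀ x ∈ U, coeffN h x = (1 + par h 1 0 x ^ 2) * par h 1 1 x -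
      par h 1 0 x * par h 0 1 x * par h 2 0 x := fun x hx => by
    obtain ⟨h1, h2, h3, h4, h5⟩ := coeff_eq_par hU hh hx
    rw [coeffN, h1, h2, h3, h4]
  have hline : ∀ (w : E2), ∀ᶠ t : ℝ in 𝓝 0, ∀ᶠ s : ℝ in 𝓝 t, s • w ∈ U := fun w =>
    eventually_eventually_nhds.2 (eventually_smul_mem hU h0 w)
  have hparu : ∀ {i j : ℕ}, i + j ≤ 4 → ∀ {t : ℝ}, t • (!₂[1, 0] : E2) ∈ U →
      HasDerivAt (fun t : ℝ => par h i j (t • !₂[1, 0])) (par h (i + 1) j (t • !₂[1, 0])) t :=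
    fun hij t ht => by simpa using hasDerivAt_par hU hh (hasDerivAt_smul_vec !₂[1, 0] t) ht hij
  have hparv : ∀ {i j : ℕ}, i + j ≤ 4 → ∀ {t : ℝ}, t • (!₂[0, 1] : E2) ∈ U →
      HasDerivAt (fun t : ℝ => par h i j (t • !₂[0, 1])) (par h i (j + 1) (t • !₂[0, 1])) t :=
    fun hij t ht => by simpa using hasDerivAt_par hU hh (hasDerivAt_smul_vec !₂[0, 1] t) ht hij
  have hu0 : (0 : ℝ) • (!₂[1, 0] : E2) ∈ U := by rwa [zero_smul]
  have hv0 : (0 : ℝ) • (!₂[0, 1] : E2) ∈ U := by rwa [zero_smul]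
  have H : ∀ i j : ℕ, i + j ≤ 4 → HasDerivAt (fun t : ℝ => par h i j (t • !₂[1, 0]))
      (par h (i + 1) j ((0 : ℝ) • !₂[1, 0])) 0 := fun i j hij => hparu hij hu0
  have P10 := hj.p10
  have P01 := hj.p01
  have P11 := hj.p11
  refine ⟨hasCoeffJet_of_lines hU h0 (fun x hx => (contDiffAt_coeff hh hx).1)
    (by rw [hL 0 h0, P10, P01, P11]; ring)
    (by filter_upwards [hline !₂[1, 0]] with t ht
        exact (hasDerivAt_coeffL (hparu (by norm_num) ht.self_of_nhds)
          (hparu (by norm_num) ht.self_of_nhds) (hparu (by norm_num) ht.self_of_nhds)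
          (hparu (by norm_num) ht.self_of_nhds)).congr_of_eventuallyEq
          (ht.mono fun s hs => hL _ hs)) ?_ ?_ ?_,
    hasCoeffJet_of_lines hU h0 (fun x hx => (contDiffAt_coeff hh hx).2.1)
    (by rw [hM 0 h0, P10, P01, hj.p20, hj.p02]; ring)
    (by filter_upwards [hline !₂[1, 0]] with t ht
        exact (hasDerivAt_coeffM (hparu (by norm_num) ht.self_of_nhds)
          (hparu (by norm_num) ht.self_of_nhds) (hparu (by norm_num) ht.self_of_nhds)
          (hparu (by norm_num) ht.self_of_nhds)).congr_of_eventuallyEq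
          (ht.mono fun s hs => hM _ hs)) ?_ ?_ ?_,
    hasCoeffJet_of_lines hU h0 (fun x hx => (contDiffAt_coeff hh hx).2.2)
    (by rw [hN 0 h0, P10, P01, P11]; ring)
    (by filter_upwards [hline !₂[1, 0]] with t ht
        exact (hasDerivAt_coeffN (hparu (by norm_num) ht.self_of_nhds)
          (hparu (by norm_num) ht.self_of_nhds) (hparu (by norm_num) ht.self_of_nhds)
          (hparu (by norm_num) ht.self_of_nhds)).congr_of_eventuallyEq
          (ht.mono fun s hs => hN _ hs)) ?_ ?_ ?_⟩
  · simp only [zero_smul, P10, P01, P11, hj.p21]; ring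
  · refine (((((((H 2 0 (by norm_num)).fun_mul (H 0 1 (by norm_num))).fun_mul
      (H 0 2 (by norm_num))).fun_add (((H 1 0 (by norm_num)).fun_mul (H 1 1 (by norm_num))).fun_mul
      (H 0 2 (by norm_num)))).fun_add (((H 1 0 (by norm_num)).fun_mul (H 0 1 (by norm_num))).fun_mul
      (H 1 2 (by norm_num)))).fun_sub ((((H 0 1 (by norm_num)).const_mul 2).fun_mul
      (H 1 1 (by norm_num))).fun_mul (H 1 1 (by norm_num)))).fun_sub
      ((((H 0 1 (by norm_num)).fun_pow 2).const_add 1).fun_mul (H 2 1 (by norm_num)))).congr_deriv ?_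
    simp only [zero_smul, P10, P01, P11, hj.p31]
    norm_num
  · refine ((hasDerivAt_coeffL (hparv (by norm_num) hv0) (hparv (by norm_num) hv0)
      (hparv (by norm_num) hv0) (hparv (by norm_num) hv0)).congr_of_eventuallyEq
      ((hline !₂[0, 1]).self_of_nhds.mono fun s hs => hL _ hs)).congr_deriv ?_
    simp only [zero_smul, P10, P01, P11, hj.p12, hj.p02]; ring
  · simp only [zero_smul, P10, P01, P11, hj.p12, hj.p30]; linarith
  · refine (((((((H 1 0 (by norm_num)).const_mul 2).fun_mul (H 2 0 (by norm_num))).fun_mul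
      (H 0 2 (by norm_num))).fun_add ((((H 1 0 (by norm_num)).fun_pow 2).const_add 1).fun_mul
      (H 1 2 (by norm_num)))).fun_sub ((((H 0 1 (by norm_num)).const_mul 2).fun_mul
      (H 1 1 (by norm_num))).fun_mul (H 2 0 (by norm_num)))).fun_sub
      ((((H 0 1 (by norm_num)).fun_pow 2).const_add 1).fun_mul (H 3 0 (by norm_num)))).congr_deriv ?_
    simp only [zero_smul, P10, P01, P11, hj.p22, hj.p40, hj.p20, hj.p02]
    norm_num
    ring
  · refine ((hasDerivAt_coeffM (hparv (by norm_num) hv0) (hparv (by norm_num) hv0)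
      (hparv (by norm_num) hv0) (hparv (by norm_num) hv0)).congr_of_eventuallyEq
      ((hline !₂[0, 1]).self_of_nhds.mono fun s hs => hM _ hs)).congr_deriv ?_
    simp only [zero_smul, P10, P01, P11, hj.p03, hj.p21]; ring
  · simp only [zero_smul, P10, P01, P11, hj.p21]; ring
  · refine (((((H 1 0 (by norm_num)).const_mul 2).fun_mul (H 2 0 (by norm_num))).fun_mul
      (H 1 1 (by norm_num))).fun_add ((((H 1 0 (by norm_num)).fun_pow 2).const_add 1).fun_mul
      (H 2 1 (by norm_num)))).fun_sub (((((H 2 0 (by norm_num)).fun_mul (H 0 1 (by norm_num))).fun_mul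
      (H 2 0 (by norm_num))).fun_add (((H 1 0 (by norm_num)).fun_mul (H 1 1 (by norm_num))).fun_mul
      (H 2 0 (by norm_num)))).fun_add (((H 1 0 (by norm_num)).fun_mul (H 0 1 (by norm_num))).fun_mul
      (H 3 0 (by norm_num)))) |>.congr_deriv ?_
    simp only [zero_smul, P10, P01, P11, hj.p31, hj.p21]
    norm_num
  · refine ((hasDerivAt_coeffN (hparv (by norm_num) hv0) (hparv (by norm_num) hv0)
      (hparv (by norm_num) hv0) (hparv (by norm_num) hv0)).congr_of_eventuallyEq
      ((hline !₂[0, 1]).self_of_nhds.mono fun s hs => hN _ hs)).congr_deriv ?_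
    simp only [zero_smul, P10, P01, P11, hj.p12, hj.p20]; ring

lemma norm_vec_le (u v : ℝ) : ‖(!₂[u, v] : E2)‖ ≤ |u| + |v| := by
  rw [e2_eq (!₂[u, v] : E2)]
  refine (norm_add_le _ _).trans (le_of_eq ?_)
  simp [norm_smul, EuclideanSpace.norm_eq]

lemma hasDerivAt_vec {a b : ℝ → ℝ} {a' b' t : ℝ} (ha : HasDerivAt a a' t) (hb : HasDerivAt b b' t) :
    HasDerivAt (fun t => (!₂[a t, b t] : E2)) !₂[a', b'] t := by
  have h := (ha.smul_const (!₂[1, 0] : E2)).fun_add (hb.smul_const (!₂[0, 1] : E2))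
  have e : ∀ x y : ℝ, x • (!₂[1, 0] : E2) + y • !₂[0, 1] = !₂[x, y] := fun x y => by
    ext i; fin_cases i <;> simp
  simpa only [e] using h

end

lemma IsScalarJet.mono {l lu lv : ℝ → ℝ → ℝ} {β γ C r C' r' : ℝ} (H : IsScalarJet l lu lv β γ C r)
    (hC : C ≤ C') (hr : r' ≤ r) : IsScalarJet l lu lv β γ C' r' where
  cont u v hu hv := H.cont u v (hu.trans hr) (hv.trans hr)
  deriv_u u v hu hv := H.deriv_u u v (hu.trans hr) (hv.trans hr)
  deriv_v u v hu hv := H.deriv_v u v (hu.trans hr) (hv.trans hr)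
  deriv_comp f f' u hu hv := H.deriv_comp f f' u (hu.trans hr) (hv.trans hr)
  val u v hu hv := (H.val u v (hu.trans hr) (hv.trans hr)).trans
    (mul_le_mul_of_nonneg_right hC (by positivity))
  val_u u v hu hv := (H.val_u u v (hu.trans hr) (hv.trans hr)).trans
    (mul_le_mul_of_nonneg_right hC (by positivity))
  val_v u v hu hv := (H.val_v u v (hu.trans hr) (hv.trans hr)).trans
    (mul_le_mul_of_nonneg_right hC (by positivity))

/-- Changes of sign of the coefficient and of the first coordinate. -/
lemma IsScalarJet.reflect {l lu lv : ℝ → ℝ → ℝ} {β γ C r : ℝ} (H : IsScalarJet l lu lv β γ C r)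
    {s τ : ℝ} (hs : |s| = 1) (hτ : |τ| = 1) :
    IsScalarJet (fun u v => s * l (τ * u) v) (fun u v => s * τ * lu (τ * u) v)
      (fun u v => s * lv (τ * u) v) (s * β) (s * γ) C r := by
  have habs : ∀ u, |τ * u| = |u| := fun u => by rw [abs_mul, hτ, one_mul]
  have hsq : τ ^ 2 = 1 := by rw [← sq_abs, hτ, one_pow]
  have hm : ∀ u v, |u| ≤ r → |v| ≤ r → |τ * u| ≤ r := fun u v hu _ => by rwa [habs]
  refine ⟨fun u v hu hv => ?_, fun u v hu hv => ?_, fun u v hu hv => ?_,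
    fun f f' u hu hv hf => ?_, fun u v hu hv => ?_, fun u v hu hv => ?_, fun u v hu hv => ?_⟩
  · have h1 := H.cont (τ * u) v (hm u v hu hv) hv
    have h2 : ContinuousAt (fun z : ℝ × ℝ => (τ * z.1, z.2)) (u, v) := by fun_prop
    exact (ContinuousAt.comp (f := fun z : ℝ × ℝ => (τ * z.1, z.2)) h1 h2).const_mul s
  · have h1 := (H.deriv_u (τ * u) v (hm u v hu hv) hv)
    have h2 := (h1.comp u ((hasDerivAt_id u).const_mul τ)).const_mul s
    refine h2.congr_deriv ?_
    ring
  · exact (H.deriv_v (τ * u) v (hm u v hu hv) hv).const_mul s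
  · have e : ∀ t, τ * (τ * t) = t := fun t => by rw [← mul_assoc, ← sq, hsq, one_mul]
    have h1 : HasDerivAt (fun t => f (τ * t)) (f' * τ) (τ * u) := by
      have h2 : HasDerivAt f f' (τ * (τ * u)) := by rwa [e]
      have h3 := h2.comp (τ * u) ((hasDerivAt_id (τ * u)).const_mul τ)
      rw [mul_one] at h3
      exact h3
    have h3 := H.deriv_comp (fun t => f (τ * t)) _ (τ * u) (hm u (f u) hu hv)
      (by simpa only [e] using hv) h1
    have h4 := (h3.comp u ((hasDerivAt_id u).const_mul τ)).const_mul s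
    simp only [Function.comp_def, e, mul_one] at h4
    refine h4.congr_deriv ?_
    linear_combination (s * f' * lv (τ * u) (f u)) * hsq
  · have h1 := H.val (τ * u) v (hm u v hu hv) hv
    rw [habs, mul_pow, hsq, one_mul] at h1
    rw [← one_mul (C * _), ← hs]
    refine le_trans (le_of_eq ?_) (mul_le_mul_of_nonneg_left h1 (abs_nonneg s))
    rw [← abs_mul]; congr 1; ring
  · have h1 := H.val_u (τ * u) v (hm u v hu hv) hv
    rw [mul_pow, hsq, one_mul] at h1
    have hsτ : |s * τ| = 1 := by rw [abs_mul, hs, hτ, one_mul]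
    rw [← one_mul (C * _), ← hsτ]
    refine le_trans (le_of_eq ?_) (mul_le_mul_of_nonneg_left h1 (abs_nonneg _))
    rw [← abs_mul]; congr 1; linear_combination (s * γ * u) * hsq
  · have h1 := H.val_v (τ * u) v (hm u v hu hv) hv
    rw [habs] at h1
    rw [← one_mul (C * _), ← hs]
    refine le_trans (le_of_eq ?_) (mul_le_mul_of_nonneg_left h1 (abs_nonneg s))
    rw [← abs_mul]; congr 1; ring

/-- A coefficient of class `C³` satisfies the estimates required for the planar analysis. -/
theorem HasCoeffJet.exists_isScalarJet {g : E2 → ℝ} {β γ : ℝ} (hj : HasCoeffJet g β γ)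
    {U : Set E2} (hU : IsOpen U) (h0 : (0 : E2) ∈ U) (hg : ∀ x ∈ U, ContDiffAt ℝ (3 : ℕ) g x) :
    ∃ C ≥ 0, ∃ r > 0, (∀ u v, |u| ≤ r → |v| ≤ r → (!₂[u, v] : E2) ∈ U) ∧
      IsScalarJet (fun u v => g !₂[u, v]) (fun u v => du g !₂[u, v]) (fun u v => dv g !₂[u, v])
        β γ C r := by
  have c1 : ∀ x ∈ U, ContDiffAt ℝ (2 : ℕ) (du g) x := fun x hx => (hg x hx).du
  have c2 : ∀ x ∈ U, ContDiffAt ℝ (2 : ℕ) (dv g) x := fun x hx => (hg x hx).dv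
  have c3 : ∀ x ∈ U, ContDiffAt ℝ (1 : ℕ) (du (du g)) x := fun x hx => (c1 x hx).du
  obtain ⟨K₁, t₁, ht₁, l₁⟩ := ((c1 0 h0).of_le (m := 1) (by norm_cast)).exists_lipschitzOnWith
  obtain ⟨K₂, t₂, ht₂, l₂⟩ := ((c2 0 h0).of_le (m := 1) (by norm_cast)).exists_lipschitzOnWith
  obtain ⟨K₃, t₃, ht₃, l₃⟩ := ((c3 0 h0).of_le (m := 1) (by norm_cast)).exists_lipschitzOnWith
  obtain ⟨ρ, hρ, hball⟩ := Metric.mem_nhds_iff.1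
    (inter_mem (inter_mem ht₁ ht₂) (inter_mem ht₃ (hU.mem_nhds h0)))
  have hmem : ∀ u v, |u| ≤ ρ / 3 → |v| ≤ ρ / 3 → (!₂[u, v] : E2) ∈ (t₁ ∩ t₂) ∩ (t₃ ∩ U) :=
    fun u v hu hv => hball (by
      rw [mem_ball_zero_iff]; linarith [norm_vec_le u v])
  obtain ⟨K, hK⟩ : ∃ K : ℝ, K = K₁ + K₂ + K₃ := ⟨_, rfl⟩
  have b₁ : (K₁ : ℝ) ≤ K := by rw [hK]; linarith [K₂.2, K₃.2]
  have b₂ : (K₂ : ℝ) ≤ K := by rw [hK]; linarith [K₁.2, K₃.2]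
  have b₃ : (K₃ : ℝ) ≤ K := by rw [hK]; linarith [K₂.2, K₁.2]
  have hK0 : 0 ≤ K := K₁.2.trans b₁
  have hr : 0 < ρ / 3 := by positivity
  have hz : (!₂[0, 0] : E2) = 0 := by ext i; fin_cases i <;> simp
  have hdiff : ∀ u v, |u| ≤ ρ / 3 → |v| ≤ ρ / 3 → DifferentiableAt ℝ g !₂[u, v] :=
    fun u v hu hv => (hg _ (hmem u v hu hv).2.2).differentiableAt (by norm_num)
  have du' : ∀ u v, |u| ≤ ρ / 3 → |v| ≤ ρ / 3 →
      HasDerivAt (fun u => g !₂[u, v]) (du g !₂[u, v]) u := fun u v hu hv => by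
    simpa using hasDerivAt_comp_e2 (f := fun u => !₂[u, v]) (hdiff u v hu hv)
      (hasDerivAt_vec (hasDerivAt_id u) (hasDerivAt_const u v))
  have dv' : ∀ u v, |u| ≤ ρ / 3 → |v| ≤ ρ / 3 →
      HasDerivAt (fun v => g !₂[u, v]) (dv g !₂[u, v]) v := fun u v hu hv => by
    simpa using hasDerivAt_comp_e2 (f := fun v => !₂[u, v]) (hdiff u v hu hv)
      (hasDerivAt_vec (hasDerivAt_const v u) (hasDerivAt_id v))
  have valv : ∀ u v, |u| ≤ ρ / 3 → |v| ≤ ρ / 3 → |dv g !₂[u, v] - β| ≤ K * (|u| + |v|) := by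
    intro u v hu hv
    have h1 := l₂.dist_le_mul _ (hmem u v hu hv).1.2 0 (mem_of_mem_nhds ht₂)
    rw [hj.dv_zero, dist_zero_right, Real.dist_eq] at h1
    exact h1.trans (mul_le_mul b₂ (norm_vec_le u v) (norm_nonneg _) hK0)
  have hzero : |(0 : ℝ)| ≤ ρ / 3 := by rw [abs_zero]; exact hr.le
  have hseg : ∀ a : ℝ, |a| ≤ ρ / 3 → ∀ s ∈ uIcc 0 a, |s| ≤ ρ / 3 ∧ |s| ≤ |a| := fun a ha s hs => by
    have h1 : |s| ≤ |a| := by simpa using abs_sub_left_of_mem_uIcc hs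
    exact ⟨h1.trans ha, h1⟩
  have axis : ∀ u, |u| ≤ ρ / 3 → |du g !₂[u, 0] - γ * u| ≤ K * u ^ 2 := by
    intro u hu
    have hd : ∀ s, |s| ≤ ρ / 3 → HasDerivAt (fun s => du g !₂[s, 0] - γ * s)
        (du (du g) !₂[s, 0] - γ) s := fun s hs => by
      have h1 := hasDerivAt_comp_e2 (f := fun u => !₂[u, 0])
        ((c1 _ (hmem s 0 hs hzero).2.2).differentiableAt (by norm_num))
        (hasDerivAt_vec (hasDerivAt_id s) (hasDerivAt_const s 0))
      simpa using h1.fun_sub ((hasDerivAt_id s).const_mul γ)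
    have := (convex_uIcc (0 : ℝ) u).norm_image_sub_le_of_norm_hasDerivWithin_le
      (C := K * |u|) (fun s hs => (hd s (hseg u hu s hs).1).hasDerivWithinAt)
      (fun s hs => ?_) left_mem_uIcc right_mem_uIcc
    · simp only [hz, hj.du_zero, mul_zero, sub_zero] at this
      rw [← sq_abs u, sq, ← mul_assoc]
      exact this
    · have h1 := l₃.dist_le_mul _ (hmem s 0 (hseg u hu s hs).1 hzero).2.1 0 (mem_of_mem_nhds ht₃)
      rw [hj.du_du, dist_zero_right, Real.dist_eq] at h1
      refine h1.trans (mul_le_mul b₃ ((norm_vec_le s 0).trans ?_) (norm_nonneg _) hK0)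
      rw [abs_zero, add_zero]
      exact (hseg u hu s hs).2
  refine ⟨K, hK0, ρ / 3, hr, fun u v hu hv => (hmem u v hu hv).2.2, fun u v hu hv => ?_,
    du', dv', fun f f' u hu hv hf => ?_, fun u v hu hv => ?_, fun u v hu hv => ?_, valv⟩
  · have h1 : ContinuousAt (fun z : ℝ × ℝ => (!₂[z.1, z.2] : E2)) (u, v) := by fun_prop
    exact ContinuousAt.comp (f := fun z : ℝ × ℝ => (!₂[z.1, z.2] : E2)) (hdiff u v hu hv).continuousAt h1
  · simpa using hasDerivAt_comp_e2 (f := fun t => !₂[t, f t]) (hdiff u (f u) hu hv)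
      (hasDerivAt_vec (hasDerivAt_id u) hf)
  · have h1 := (convex_uIcc (0 : ℝ) u).norm_image_sub_le_of_norm_hasDerivWithin_le
      (f := fun s => g !₂[s, 0] - γ / 2 * s ^ 2) (f' := fun s => du g !₂[s, 0] - γ * s)
      (C := K * u ^ 2) (fun s hs => ?_) (fun s hs => ?_) left_mem_uIcc right_mem_uIcc
    · have h2 := (convex_uIcc (0 : ℝ) v).norm_image_sub_le_of_norm_hasDerivWithin_le
        (f := fun s => g !₂[u, s] - β * s) (f' := fun s => dv g !₂[u, s] - β)
        (C := K * (|u| + |v|)) (fun s hs => ?_) (fun s hs => ?_) left_mem_uIcc right_mem_uIcc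
      · simp only [hz, hj.zero, sub_zero, Real.norm_eq_abs] at h1 h2
        norm_num at h1 h2
        have h3 : g !₂[u, v] - (β * v + γ / 2 * u ^ 2) =
          (g !₂[u, v] - β * v - g !₂[u, 0]) + (g !₂[u, 0] - γ / 2 * u ^ 2) := by ring
        rw [h3]
        refine (abs_add_le _ _).trans ((add_le_add h2 h1).trans ?_)
        have h4 : 0 ≤ K * (|v| * u ^ 2) := by positivity
        linarith only [h4]
      · simpa using ((dv' u s hu (hseg v hv s hs).1).fun_sub
          ((hasDerivAt_id s).const_mul β)).hasDerivWithinAt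
      · refine (valv u s hu (hseg v hv s hs).1).trans (mul_le_mul_of_nonneg_left ?_ hK0)
        linarith [(hseg v hv s hs).2]
    · have h2 := ((du' s 0 (hseg u hu s hs).1 hzero).fun_sub
        ((hasDerivAt_pow 2 s).const_mul (γ / 2))).hasDerivWithinAt (s := uIcc 0 u)
      refine h2.congr_deriv ?_
      norm_num
      ring
    · refine (axis s (hseg u hu s hs).1).trans (mul_le_mul_of_nonneg_left ?_ hK0)
      exact sq_le_sq.2 (hseg u hu s hs).2
  · have h1 := l₁.dist_le_mul _ (hmem u v hu hv).1.1 _ (hmem u 0 hu hzero).1.1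
    have h2 : dist (!₂[u, v] : E2) !₂[u, 0] ≤ |v| := by
      have h3 : (!₂[u, v] : E2) - !₂[u, 0] = !₂[0, v] := by ext i; fin_cases i <;> simp
      rw [dist_eq_norm, h3]
      simpa using norm_vec_le 0 v
    have h3 : |du g !₂[u, v] - du g !₂[u, 0]| ≤ K * |v| :=
      h1.trans (mul_le_mul b₁ h2 dist_nonneg hK0)
    have h4 := abs_add_le (du g !₂[u, v] - du g !₂[u, 0]) (du g !₂[u, 0] - γ * u)
    rw [sub_add_sub_cancel] at h4
    linarith [axis u hu]

/-- A function `h` on a neighbourhood `U` of the origin whose coefficients `L, M, N` have the jets of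
an umbilic of type `D¹₂,₃`. -/
structure IsMongeUmbilic (h : E2 → ℝ) (U : Set E2) (b c B K : ℝ) : Prop where
  isOpen : IsOpen U
  zero_mem : (0 : E2) ∈ U
  smooth : ∀ x ∈ U, ContDiffAt ℝ (5 : ℕ) h x
  jetL : HasCoeffJet (coeffL h) (-b) (-B)
  jetM : HasCoeffJet (coeffM h) c K
  jetN : HasCoeffJet (coeffN h) b B
  b_ne : b ≠ 0
  chi_ne : b * K - c * B ≠ 0

namespace IsMongeUmbilic

variable {h : E2 → ℝ} {U : Set E2} {b c B K : ℝ}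

theorem exists_scalarJets (H : IsMongeUmbilic h U b c B K) :
    ∃ C ≥ 0, ∃ r > 0, r ≤ 1 / 2 ∧ (∀ u v, |u| ≤ r → |v| ≤ r → (!₂[u, v] : E2) ∈ U) ∧
      IsScalarJet (fun u v => coeffL h !₂[u, v]) (fun u v => du (coeffL h) !₂[u, v])
        (fun u v => dv (coeffL h) !₂[u, v]) (-b) (-B) C r ∧
      IsScalarJet (fun u v => coeffM h !₂[u, v]) (fun u v => du (coeffM h) !₂[u, v])
        (fun u v => dv (coeffM h) !₂[u, v]) c K C r ∧
      IsScalarJet (fun u v => coeffN h !₂[u, v]) (fun u v => du (coeffN h) !₂[u, v])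
        (fun u v => dv (coeffN h) !₂[u, v]) b B C r := by
  obtain ⟨C₁, hC₁, r₁, hr₁, hU₁, j₁⟩ := H.jetL.exists_isScalarJet H.isOpen H.zero_mem
    fun x hx => (contDiffAt_coeff H.smooth hx).1
  obtain ⟨C₂, hC₂, r₂, hr₂, -, j₂⟩ := H.jetM.exists_isScalarJet H.isOpen H.zero_mem
    fun x hx => (contDiffAt_coeff H.smooth hx).2.1
  obtain ⟨C₃, hC₃, r₃, hr₃, -, j₃⟩ := H.jetN.exists_isScalarJet H.isOpen H.zero_mem
    fun x hx => (contDiffAt_coeff H.smooth hx).2.2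
  have e₁ : min (min r₁ r₂) (min r₃ (1 / 2)) ≤ r₁ := (min_le_left _ _).trans (min_le_left _ _)
  have e₂ : min (min r₁ r₂) (min r₃ (1 / 2)) ≤ r₂ := (min_le_left _ _).trans (min_le_right _ _)
  have e₃ : min (min r₁ r₂) (min r₃ (1 / 2)) ≤ r₃ := (min_le_right _ _).trans (min_le_left _ _)
  refine ⟨C₁ + C₂ + C₃, by positivity, min (min r₁ r₂) (min r₃ (1 / 2)), by positivity,
    (min_le_right _ _).trans (min_le_right _ _),
    fun u v hu hv => hU₁ u v (hu.trans e₁) (hv.trans e₁), j₁.mono (by linarith) e₁,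
    j₂.mono (by linarith) e₂, j₃.mono (by linarith) e₃⟩

/-- After a change of signs and a reflection the jets are normalized. -/
theorem exists_isPrincipalJet (H : IsMongeUmbilic h U b c B K) :
    ∃ s τ : ℝ, |s| = 1 ∧ |τ| = 1 ∧ 0 < s * τ * b ∧ ∃ C r,
      (∀ u v, |u| ≤ r → |v| ≤ r → (!₂[u, v] : E2) ∈ U) ∧
      IsPrincipalJet (fun u v => s * τ * coeffL h !₂[τ * u, v])
        (fun u v => s * τ * τ * du (coeffL h) !₂[τ * u, v])
        (fun u v => s * τ * dv (coeffL h) !₂[τ * u, v])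
        (fun u v => s * coeffM h !₂[τ * u, v])
        (fun u v => s * τ * du (coeffM h) !₂[τ * u, v])
        (fun u v => s * dv (coeffM h) !₂[τ * u, v])
        (fun u v => s * τ * coeffN h !₂[τ * u, v])
        (fun u v => s * τ * τ * du (coeffN h) !₂[τ * u, v])
        (fun u v => s * τ * dv (coeffN h) !₂[τ * u, v])
        (s * τ * b) (s * c) (s * τ * B) (s * K) C r := by
  obtain ⟨C, hC, r, hr, hr2, hU, jl, jm, jn⟩ := H.exists_scalarJets
  obtain ⟨τ, hτ, hτχ⟩ : ∃ τ : ℝ, |τ| = 1 ∧ 0 < τ * (b * K - c * B) := by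
    rcases lt_or_gt_of_ne H.chi_ne with h | h
    · exact ⟨-1, by norm_num, by linarith⟩
    · exact ⟨1, by norm_num, by linarith⟩
  obtain ⟨s, hs, hsb⟩ : ∃ s : ℝ, |s| = 1 ∧ 0 < s * τ * b := by
    have : τ * b ≠ 0 := mul_ne_zero (abs_ne_zero.1 (by rw [hτ]; norm_num)) H.b_ne
    rcases lt_or_gt_of_ne this with h | h
    · exact ⟨-1, by norm_num, by linarith⟩
    · exact ⟨1, by norm_num, by linarith⟩
  have hsτ : |s * τ| = 1 := by rw [abs_mul, hs, hτ, one_mul]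
  have hs2 : s ^ 2 = 1 := by rw [← sq_abs, hs, one_pow]
  have jl' := jl.reflect hsτ hτ
  rw [mul_neg, mul_neg] at jl'
  refine ⟨s, τ, hs, hτ, hsb, C, r, hU, jl', jm.reflect hs hτ, jn.reflect hsτ hτ, hsb, ?_, hC,
    hr, hr2⟩
  have : s * τ * b * (s * K) - s * c * (s * τ * B) = s ^ 2 * (τ * (b * K - c * B)) := by ring
  rw [this, hs2, one_mul]
  exact hτχ

/-! #### Derivatives of `𝒯` and of the Lie–Cartan field -/

lemma coeff_differentiableAt (H : IsMongeUmbilic h U b c B K) {x : E2} (hx : x ∈ U) :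
    DifferentiableAt ℝ (coeffL h) x ∧ DifferentiableAt ℝ (coeffM h) x ∧
      DifferentiableAt ℝ (coeffN h) x :=
  ⟨(contDiffAt_coeff H.smooth hx).1.differentiableAt (by norm_num),
    (contDiffAt_coeff H.smooth hx).2.1.differentiableAt (by norm_num),
    (contDiffAt_coeff H.smooth hx).2.2.differentiableAt (by norm_num)⟩

lemma contDiffAt_curvT (H : IsMongeUmbilic h U b c B K) {y : E2 × ℝ} (hy : y.1 ∈ U) :
    ContDiffAt ℝ (3 : ℕ) (curvT h) y := by
  obtain ⟨h1, h2, h3⟩ := contDiffAt_coeff H.smooth hy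
  have e : ∀ g : E2 → ℝ, ContDiffAt ℝ (3 : ℕ) g y.1 →
      ContDiffAt ℝ (3 : ℕ) (fun y : E2 × ℝ => g y.1) y := fun g hg => hg.comp y contDiffAt_fst
  exact (((e _ h1).mul (contDiffAt_snd.pow 2)).add ((e _ h2).mul contDiffAt_snd)).add (e _ h3)

lemma fderiv_curvT (H : IsMongeUmbilic h U b c B K) {y : E2 × ℝ} (hy : y.1 ∈ U) (w : E2 × ℝ) :
    fderiv ℝ (curvT h) y w =
      fderiv ℝ (coeffL h) y.1 w.1 * y.2 ^ 2 + fderiv ℝ (coeffM h) y.1 w.1 * y.2 +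
        fderiv ℝ (coeffN h) y.1 w.1 + w.2 * (2 * coeffL h y.1 * y.2 + coeffM h y.1) := by
  obtain ⟨h1, h2, h3⟩ := H.coeff_differentiableAt hy
  have e : ∀ g : E2 → ℝ, DifferentiableAt ℝ g y.1 → HasFDerivAt (fun y : E2 × ℝ => g y.1)
      ((fderiv ℝ g y.1).comp (ContinuousLinearMap.fst ℝ E2 ℝ)) y := fun g hg =>
    hg.hasFDerivAt.comp y hasFDerivAt_fst
  have := (((e _ h1).mul ((hasFDerivAt_snd (𝕜 := ℝ) (p := y)).pow 2)).add
    ((e _ h2).mul hasFDerivAt_snd)).add (e _ h3)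
  rw [HasFDerivAt.fderiv (f := curvT h) this]
  simp
  ring

lemma fderiv_curvT_apply (h : E2 → ℝ) (y : E2 × ℝ) (p q z : ℝ) :
    fderiv ℝ (curvT h) y (!₂[p, q], z) = p * fderiv ℝ (curvT h) y (!₂[1, 0], 0) +
      q * fderiv ℝ (curvT h) y (!₂[0, 1], 0) + z * fderiv ℝ (curvT h) y (0, 1) := by
  have : ((!₂[p, q], z) : E2 × ℝ) = p • (!₂[1, 0], 0) + q • (!₂[0, 1], 0) + z • (0, 1) := by
    ext i
    · fin_cases i <;> simp
    · simp
  rw [this, map_add, map_add, map_smul, map_smul, map_smul]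
  rfl

/-- The third component of the Lie–Cartan field. -/
noncomputable def verticalPart (h : E2 → ℝ) (y : E2 × ℝ) : ℝ :=
  -(du (coeffL h) y.1 * y.2 ^ 2 + du (coeffM h) y.1 * y.2 + du (coeffN h) y.1 +
    y.2 * (dv (coeffL h) y.1 * y.2 ^ 2 + dv (coeffM h) y.1 * y.2 + dv (coeffN h) y.1))

/-- The derivative of `𝒯` with respect to the slope. -/
noncomputable def slopePart (h : E2 → ℝ) (y : E2 × ℝ) : ℝ :=
  2 * coeffL h y.1 * y.2 + coeffM h y.1

lemma lieCartan_eq (H : IsMongeUmbilic h U b c B K) {y : E2 × ℝ} (hy : y.1 ∈ U) :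
    lieCartan h y = (!₂[slopePart h y, y.2 * slopePart h y], verticalPart h y) := by
  simp only [lieCartan, H.fderiv_curvT hy, slopePart, verticalPart]
  simp [du, dv]

lemma contDiffAt_slopePart (H : IsMongeUmbilic h U b c B K) {y : E2 × ℝ} (hy : y.1 ∈ U) :
    ContDiffAt ℝ (2 : ℕ) (slopePart h) y := by
  obtain ⟨h1, h2, h3⟩ := contDiffAt_coeff H.smooth hy
  have e : ∀ g : E2 → ℝ, ContDiffAt ℝ (3 : ℕ) g y.1 →
      ContDiffAt ℝ (2 : ℕ) (fun y : E2 × ℝ => g y.1) y := fun g hg =>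
    (hg.of_le (by norm_cast)).comp y contDiffAt_fst
  exact ((contDiffAt_const.mul (e _ h1)).mul contDiffAt_snd).add (e _ h2)

lemma contDiffAt_verticalPart (H : IsMongeUmbilic h U b c B K) {y : E2 × ℝ} (hy : y.1 ∈ U) :
    ContDiffAt ℝ (2 : ℕ) (verticalPart h) y := by
  obtain ⟨h1, h2, h3⟩ := contDiffAt_coeff H.smooth hy
  have eu : ∀ g : E2 → ℝ, ContDiffAt ℝ (3 : ℕ) g y.1 →
      ContDiffAt ℝ (2 : ℕ) (fun y : E2 × ℝ => du g y.1) y := fun g hg =>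
    ContDiffAt.comp (g := du g) y hg.du contDiffAt_fst
  have ev : ∀ g : E2 → ℝ, ContDiffAt ℝ (3 : ℕ) g y.1 →
      ContDiffAt ℝ (2 : ℕ) (fun y : E2 × ℝ => dv g y.1) y := fun g hg =>
    ContDiffAt.comp (g := dv g) y hg.dv contDiffAt_fst
  have s1 : ContDiffAt ℝ (2 : ℕ) (fun y : E2 × ℝ => y.2) y := contDiffAt_snd
  exact (((((eu _ h1).mul (s1.pow 2)).add ((eu _ h2).mul s1)).add (eu _ h3)).add
    (s1.mul ((((ev _ h1).mul (s1.pow 2)).add ((ev _ h2).mul s1)).add (ev _ h3)))).neg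

lemma eventually_mem (H : IsMongeUmbilic h U b c B K) :
    ∀ᶠ y : E2 × ℝ in 𝓝 (0, 0), y.1 ∈ U :=
  (continuous_fst.tendsto ((0 : E2), (0 : ℝ))).eventually (H.isOpen.mem_nhds H.zero_mem)

lemma contDiffAt_lieCartan (H : IsMongeUmbilic h U b c B K) :
    ContDiffAt ℝ 2 (lieCartan h) (0, 0) := by
  have h1 : ContDiffAt ℝ 2 (slopePart h) (0, 0) := H.contDiffAt_slopePart H.zero_mem
  have h2 : ContDiffAt ℝ 2 (verticalPart h) (0, 0) := H.contDiffAt_verticalPart H.zero_mem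
  have h3 : ContDiffAt ℝ 2 (fun y : E2 × ℝ => (slopePart h y • (!₂[1, 0] : E2) +
      (y.2 * slopePart h y) • (!₂[0, 1] : E2), verticalPart h y)) (0, 0) :=
    ((h1.smul contDiffAt_const).add ((contDiffAt_snd.mul h1).smul contDiffAt_const)).prodMk h2
  refine h3.congr_of_eventuallyEq ?_
  filter_upwards [H.eventually_mem] with y hy
  rw [H.lieCartan_eq hy, e2_eq !₂[slopePart h y, y.2 * slopePart h y]]
  rfl

lemma fderiv_slopePart (H : IsMongeUmbilic h U b c B K) (w : E2 × ℝ) :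
    fderiv ℝ (slopePart h) (0, 0) w = c * w.1 1 := by
  obtain ⟨h1, h2, h3⟩ := H.coeff_differentiableAt H.zero_mem
  have e : ∀ g : E2 → ℝ, DifferentiableAt ℝ g 0 → HasFDerivAt (fun y : E2 × ℝ => g y.1)
      ((fderiv ℝ g 0).comp (ContinuousLinearMap.fst ℝ E2 ℝ)) (0, 0) := fun g hg =>
    HasFDerivAt.comp (g := g) ((0, 0) : E2 × ℝ) hg.hasFDerivAt hasFDerivAt_fst
  have := (((e _ h1).const_mul 2).mul hasFDerivAt_snd).add (e _ h2)
  rw [HasFDerivAt.fderiv (f := slopePart h) this]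
  simp [fderiv_apply_e2, H.jetL.zero, H.jetM.du_zero, H.jetM.dv_zero]
  ring

lemma fderiv_verticalPart (H : IsMongeUmbilic h U b c B K) (w : E2 × ℝ) :
    fderiv ℝ (verticalPart h) (0, 0) w =
      -(B * w.1 0 + dv (du (coeffN h)) 0 * w.1 1 + b * w.2) := by
  obtain ⟨h1, h2, h3⟩ := contDiffAt_coeff H.smooth H.zero_mem
  have e : ∀ g : E2 → ℝ, DifferentiableAt ℝ g 0 → HasFDerivAt (fun y : E2 × ℝ => g y.1)
      ((fderiv ℝ g 0).comp (ContinuousLinearMap.fst ℝ E2 ℝ)) (0, 0) := fun g hg =>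
    HasFDerivAt.comp (g := g) ((0, 0) : E2 × ℝ) hg.hasFDerivAt hasFDerivAt_fst
  have eu : ∀ g : E2 → ℝ, ContDiffAt ℝ (3 : ℕ) g 0 → _ := fun g hg =>
    e (du g) ((ContDiffAt.du (n := 2) hg).differentiableAt (by norm_num))
  have ev : ∀ g : E2 → ℝ, ContDiffAt ℝ (3 : ℕ) g 0 → _ := fun g hg =>
    e (dv g) ((ContDiffAt.dv (n := 2) hg).differentiableAt (by norm_num))
  have s1 : HasFDerivAt (fun y : E2 × ℝ => y.2) (ContinuousLinearMap.snd ℝ E2 ℝ) (0, 0) :=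
    hasFDerivAt_snd
  have := (((((eu _ h1).mul (s1.pow 2)).add ((eu _ h2).mul s1)).add (eu _ h3)).add
    (s1.mul ((((ev _ h1).mul (s1.pow 2)).add ((ev _ h2).mul s1)).add (ev _ h3)))).neg
  rw [HasFDerivAt.fderiv (f := verticalPart h) this]
  simp [fderiv_apply_e2, H.jetN.du_du, H.jetM.du_zero, H.jetN.dv_zero]
  ring

end IsMongeUmbilic

lemma tendsto_mul_sign {τ : ℝ} (hτ : |τ| = 1) :
    Tendsto (fun u : ℝ => τ * u) (𝓝[≠] 0) (𝓝[≠] 0) := by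
  have hτ0 : τ ≠ 0 := fun h => by simp [h] at hτ
  refine tendsto_nhdsWithin_iff.2 ⟨?_, ?_⟩
  · have : Tendsto (fun u : ℝ => τ * u) (𝓝 0) (𝓝 (τ * 0)) := tendsto_id.const_mul τ
    rw [mul_zero] at this
    exact this.mono_left nhdsWithin_le_nhds
  · filter_upwards [self_mem_nhdsWithin] with u hu
    exact mul_ne_zero hτ0 hu

lemma mul_self_of_abs_eq_one {τ : ℝ} (hτ : |τ| = 1) : τ * τ = 1 := by
  rw [← abs_mul_abs_self, hτ, one_mul]

/-- A version of `tendsto_zero_of_singular` for both signs of the coefficient. -/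
lemma tendsto_zero_of_singular_of_abs {y y' a e : ℝ → ℝ} {a₀ τ N : ℝ} (hτ : |τ| = 1) (ha₀ : 0 < a₀)
    (hy : ∀ᶠ u in 𝓝[≠] 0, HasDerivAt y (y' u) u)
    (h : ∀ᶠ u in 𝓝[≠] 0, u ^ 2 * y' u = -a u * y u + e u)
    (ha : ∀ᶠ u in 𝓝[≠] 0, a₀ ≤ τ * a u) (he : Tendsto e (𝓝[≠] 0) (𝓝 0))
    (hb : ∀ᶠ u in 𝓝[≠] 0, |u ^ 2 * y u| ≤ N) : Tendsto y (𝓝[≠] 0) (𝓝 0) := by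
  have ht := tendsto_mul_sign hτ
  have hττ := mul_self_of_abs_eq_one hτ
  have key := tendsto_zero_of_singular (y := fun u => y (τ * u)) (y' := fun u => y' (τ * u) * τ)
    (a := fun u => τ * a (τ * u)) (e := fun u => τ * e (τ * u)) (N := N) ha₀ ?_ ?_ ?_ ?_ ?_
  · have := key.comp ht
    refine this.congr fun u => ?_
    simp only [Function.comp_apply]
    rw [← mul_assoc, hττ, one_mul]
  · filter_upwards [ht.eventually hy] with u hu
    have h1 : HasDerivAt (fun u : ℝ => τ * u) τ u := by
      simpa using (hasDerivAt_id u).const_mul τ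
    exact hu.comp u h1
  · filter_upwards [ht.eventually h] with u hu
    linear_combination τ * hu - τ * u ^ 2 * y' (τ * u) * hττ
  · exact ht.eventually ha
  · simpa using (he.comp ht).const_mul τ
  · filter_upwards [ht.eventually hb] with u hu
    rwa [mul_pow, sq τ, hττ, one_mul] at hu

lemma eventually_nhds_of_eventually_ne {p : ℝ → Prop} {x : ℝ} (h : ∀ᶠ u in 𝓝[≠] x, p u)
    (hx : p x) : ∀ᶠ u in 𝓝 x, p u := by
  filter_upwards [eventually_nhdsWithin_iff.1 h] with u hu
  by_cases hux : u = x
  · rwa [hux]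
  · exact hu hux

/-- A continuous function with continuous derivative off `0` which has a limit at `0`. -/
lemma contDiffAt_one_of_tendsto {m : ℝ → ℝ} {k₀ : ℝ} (h0 : Tendsto m (𝓝[≠] 0) (𝓝 (m 0)))
    (hm : ∀ᶠ u in 𝓝[≠] 0, DifferentiableAt ℝ m u)
    (hk : ∀ᶠ u in 𝓝[≠] 0, ContinuousAt (deriv m) u)
    (hlim : Tendsto (deriv m) (𝓝[≠] 0) (𝓝 k₀)) :
    HasDerivAt m k₀ 0 ∧ ContDiffAt ℝ 1 m 0 := by
  have hc : ContinuousAt m 0 := continuousAt_iff_punctured_nhds.2 h0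
  have hd : HasDerivAt m k₀ 0 := by
    have hg : ContinuousAt (Function.update (deriv m) 0 k₀) 0 := by
      rw [continuousAt_update_same]
      exact hlim
    have := hasDerivAt_of_eventually_ne (f := m) (g := Function.update (deriv m) 0 k₀) (x := 0)
    simp only [Function.update_self] at this
    refine this ?_ hc hg
    filter_upwards [eventually_nhdsWithin_iff.1 hm] with u hu hu0
    rw [Function.update_of_ne hu0]
    exact (hu hu0).hasDerivAt
  have hk' : ∀ᶠ u in 𝓝 0, ContinuousAt (deriv m) u := by
    refine eventually_nhds_of_eventually_ne hk ?_
    refine continuousAt_iff_punctured_nhds.2 ?_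
    rwa [hd.deriv]
  have hm' : ∀ᶠ u in 𝓝 0, DifferentiableAt ℝ m u :=
    eventually_nhds_of_eventually_ne hm hd.differentiableAt
  refine ⟨hd, contDiffAt_one_iff.2 ⟨fun u => ContinuousLinearMap.toSpanSingleton ℝ (deriv m u),
    {u | ContinuousAt (deriv m) u ∧ DifferentiableAt ℝ m u}, hk'.and hm', ?_, ?_⟩⟩
  · intro u hu
    refine ContinuousAt.continuousWithinAt ?_
    exact (ContinuousLinearMap.toSpanSingletonCLE (𝕜 := ℝ) (E := ℝ)).continuous.continuousAt.comp
      hu.1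
  · intro u hu
    exact hu.2.hasDerivAt.hasFDerivAt

namespace IsMongeUmbilic

variable {h : E2 → ℝ} {U : Set E2} {b c B K : ℝ}

lemma fderiv_lieCartan (H : IsMongeUmbilic h U b c B K) (w : E2 × ℝ) :
    fderiv ℝ (lieCartan h) (0, 0) w =
      (!₂[c * w.1 1, 0], -(B * w.1 0 + dv (du (coeffN h)) 0 * w.1 1 + b * w.2)) := by
  have h1 : HasFDerivAt (slopePart h) (fderiv ℝ (slopePart h) (0, 0)) (0, 0) :=
    ((H.contDiffAt_slopePart H.zero_mem).differentiableAt (by norm_num)).hasFDerivAt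
  have h2 : HasFDerivAt (verticalPart h) (fderiv ℝ (verticalPart h) (0, 0)) (0, 0) :=
    ((H.contDiffAt_verticalPart H.zero_mem).differentiableAt (by norm_num)).hasFDerivAt
  have h3 := ((h1.smul_const (!₂[1, 0] : E2)).add
    ((hasFDerivAt_snd.mul h1).smul_const (!₂[0, 1] : E2))).prodMk h2
  have h4 : lieCartan h =ᶠ[𝓝 (0, 0)] fun y : E2 × ℝ => (slopePart h y • (!₂[1, 0] : E2) +
      (y.2 * slopePart h y) • (!₂[0, 1] : E2), verticalPart h y) := by
    filter_upwards [H.eventually_mem] with y hy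
    rw [H.lieCartan_eq hy, e2_eq !₂[slopePart h y, y.2 * slopePart h y]]
    rfl
  have h0 : slopePart h (0, 0) = 0 := by simp [slopePart, H.jetM.zero]
  rw [HasFDerivAt.fderiv (HasFDerivAt.congr_of_eventuallyEq h3 h4)]
  ext i
  · fin_cases i <;> simp [H.fderiv_slopePart, h0]
  · simp [H.fderiv_verticalPart]

/-- A curve in `𝒯 = 0` through the origin, tangent to its projection, and its slope. -/
theorem exists_center_slope (H : IsMongeUmbilic h U b c B K) :
    ∃ F m : ℝ → ℝ, ∃ s τ κ A : ℝ, |s| = 1 ∧ |τ| = 1 ∧ 0 < s * τ * b ∧ 0 < κ ∧ F 0 = 0 ∧ m 0 = 0 ∧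
      Tendsto m (𝓝[≠] 0) (𝓝 0) ∧ ∀ᶠ u in 𝓝[≠] 0, HasDerivAt F (m u) u ∧ |F u| ≤ A * u ^ 2 ∧
        κ * u ^ 2 ≤ s * slopePart h (!₂[u, F u], m u) ∧
        s * slopePart h (!₂[u, F u], m u) ≤ A * u ^ 2 ∧ curvT h (!₂[u, F u], m u) = 0 ∧
        |coeffL h !₂[u, F u]| ≤ A * u ^ 2 ∧ DifferentiableAt ℝ m u := by
  obtain ⟨s, τ, hs, hτ, hsb, C, r, -, hj⟩ := H.exists_isPrincipalJet
  obtain ⟨f, x, σ, κ, hκ, A, hf0, hx0, hx, hev⟩ := hj.exists_center_leaf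
  have hττ := mul_self_of_abs_eq_one hτ
  have hss := mul_self_of_abs_eq_one hs
  have hsτ : |s * τ| = 1 := by rw [abs_mul, hs, hτ, one_mul]
  refine ⟨fun u => f (τ * u), fun u => τ * x (τ * u), s, τ, κ, A, hs, hτ, hsb, hκ, by simp [hf0],
    by simp [hx0], by simpa using (hx.comp (tendsto_mul_sign hτ)).const_mul τ, ?_⟩
  filter_upwards [(tendsto_mul_sign hτ).eventually hev] with u ⟨h1, h2, h3, h4, h5, h6, h7, x', h8⟩
  have hd : HasDerivAt (fun u : ℝ => τ * u) τ u := by simpa using (hasDerivAt_id u).const_mul τ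
  have hu2 : (τ * u) ^ 2 = u ^ 2 := by rw [mul_pow, sq τ, hττ, one_mul]
  have hττu : τ * (τ * u) = u := by rw [← mul_assoc, hττ, one_mul]
  simp only [hττu, hu2] at h2 h3 h4 h5 h6 h7
  have h6' : s * slopePart h (!₂[u, f (τ * u)], τ * x (τ * u)) = σ (τ * u) := by
    rw [← h6]; simp only [slopePart]; ring
  refine ⟨(h1.comp u hd).congr_deriv (mul_comm _ _), h2, by rwa [h6'], by rwa [h6'], ?_, ?_,
    ((h8.comp u hd).const_mul τ).differentiableAt⟩
  · simp only [curvT]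
    linear_combination (s * τ) * h5 - (coeffM h !₂[u, f (τ * u)] * τ * x (τ * u)) * hss
      - (coeffL h !₂[u, f (τ * u)] * x (τ * u) ^ 2) * (hss * (τ * τ) + hττ - hττ)
      - coeffN h !₂[u, f (τ * u)] * (s * s * hττ + hss)
  · rwa [abs_mul, hsτ, one_mul] at h7

end IsMongeUmbilic

lemma hasDerivAt_graph {F m : ℝ → ℝ} {F' m' u : ℝ} (hF : HasDerivAt F F' u)
    (hm : HasDerivAt m m' u) :
    HasDerivAt (fun u => ((!₂[u, F u], m u) : E2 × ℝ)) (!₂[1, F'], m') u := by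
  have h1 := (((hasDerivAt_id u).smul_const (!₂[1, 0] : E2)).add
    (hF.smul_const (!₂[0, 1] : E2))).prodMk hm
  have e : (fun u => ((!₂[u, F u], m u) : E2 × ℝ)) =
      fun u => (id u • (!₂[1, 0] : E2) + F u • (!₂[0, 1] : E2), m u) := by
    ext u i
    · fin_cases i <;> simp
    · rfl
  rw [e]
  refine h1.congr_deriv ?_
  ext i
  · fin_cases i <;> simp
  · rfl

namespace IsMongeUmbilic

variable {h : E2 → ℝ} {U : Set E2} {b c B K : ℝ}

lemma hasDerivAt_comp_prod {P : E2 × ℝ → ℝ} {γ : ℝ → E2 × ℝ} {p q z u : ℝ}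
    (hP : DifferentiableAt ℝ P (γ u)) (hγ : HasDerivAt γ (!₂[p, q], z) u) :
    HasDerivAt (fun u => P (γ u)) (p * fderiv ℝ P (γ u) (!₂[1, 0], 0) +
      q * fderiv ℝ P (γ u) (!₂[0, 1], 0) + z * fderiv ℝ P (γ u) (0, 1)) u := by
  refine (hP.hasFDerivAt.comp_hasDerivAt u hγ).congr_deriv ?_
  have : ((!₂[p, q], z) : E2 × ℝ) = p • (!₂[1, 0], 0) + q • (!₂[0, 1], 0) + z • (0, 1) := by
    ext i
    · fin_cases i <;> simp
    · simp
  rw [this, map_add, map_add, map_smul, map_smul, map_smul]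
  rfl

lemma slope_mul_eq_vertical (H : IsMongeUmbilic h U b c B K) {γ : ℝ → E2 × ℝ} {k u : ℝ}
    (hU : (γ u).1 ∈ U) (hγ : HasDerivAt γ (!₂[1, (γ u).2], k) u)
    (hT : ∀ᶠ t in 𝓝 u, curvT h (γ t) = 0) :
    slopePart h (γ u) * k = verticalPart h (γ u) := by
  have h1 := hasDerivAt_comp_prod ((H.contDiffAt_curvT hU).differentiableAt (by norm_num)) hγ
  have h2 : HasDerivAt (fun t => curvT h (γ t)) 0 u :=
    (hasDerivAt_const u 0).congr_of_eventuallyEq hT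
  have h3 := h1.unique h2
  have e := H.lieCartan_eq hU
  simp only [lieCartan, Prod.mk.injEq] at e
  have e1 : fderiv ℝ (curvT h) (γ u) (0, 1) = slopePart h (γ u) := by
    have := congrArg (fun x : E2 => x 0) e.1
    simpa using this
  rw [e1] at h3
  linear_combination h3 + e.2

theorem tendsto_center_slope (H : IsMongeUmbilic h U b c B K) {F m : ℝ → ℝ} {s τ κ A : ℝ}
    (hs : |s| = 1) (hτ : |τ| = 1) (hsb : 0 < s * τ * b) (hκ : 0 < κ)
    (hF : Tendsto F (𝓝[≠] 0) (𝓝 0)) (hm : Tendsto m (𝓝[≠] 0) (𝓝 0))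
    (hev : ∀ᶠ u in 𝓝[≠] 0, HasDerivAt F (m u) u ∧
        κ * u ^ 2 ≤ s * slopePart h (!₂[u, F u], m u) ∧
        s * slopePart h (!₂[u, F u], m u) ≤ A * u ^ 2 ∧ curvT h (!₂[u, F u], m u) = 0 ∧
        |coeffL h !₂[u, F u]| ≤ A * u ^ 2 ∧ DifferentiableAt ℝ m u) :
    Tendsto (deriv m) (𝓝[≠] 0) (𝓝 (-(B / b))) ∧ ∀ᶠ u in 𝓝[≠] 0, ContinuousAt (deriv m) u := by
  set γ : ℝ → E2 × ℝ := fun u => (!₂[u, F u], m u) with hγ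
  set P : ℝ → ℝ := fun u => slopePart h (γ u) with hP
  set R : ℝ → ℝ := fun u => verticalPart h (γ u) with hR
  have hu : Tendsto (fun u : ℝ => u) (𝓝[≠] 0) (𝓝 0) := nhdsWithin_le_nhds
  have hγt : Tendsto γ (𝓝[≠] 0) (𝓝 (0, 0)) := by
    have h1 : Tendsto (fun u => (u • (!₂[1, 0] : E2) + F u • (!₂[0, 1] : E2), m u)) (𝓝[≠] 0)
        (𝓝 ((0 : ℝ) • (!₂[1, 0] : E2) + (0 : ℝ) • (!₂[0, 1] : E2), (0 : ℝ))) :=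
      ((hu.smul_const _).add (hF.smul_const _)).prodMk_nhds hm
    rw [zero_smul, zero_smul, add_zero] at h1
    refine h1.congr fun u => ?_
    simp only [hγ]
    rw [e2_eq !₂[u, F u]]
    rfl
  have hP0 : slopePart h (0, 0) = 0 := by simp [slopePart, H.jetM.zero]
  have hR0 : verticalPart h (0, 0) = 0 := by simp [verticalPart, H.jetN.du_zero]
  have hRt : Tendsto R (𝓝[≠] 0) (𝓝 0) := by
    have := (H.contDiffAt_verticalPart H.zero_mem).continuousAt.tendsto.comp hγt
    rwa [hR0] at this
  have hDR : ∀ w, Tendsto (fun u => fderiv ℝ (verticalPart h) (γ u) w) (𝓝[≠] 0)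
      (𝓝 (fderiv ℝ (verticalPart h) (0, 0) w)) := fun w => by
    have h1 : ContDiffAt ℝ 1 (fderiv ℝ (verticalPart h)) (0, 0) :=
      (H.contDiffAt_verticalPart H.zero_mem).fderiv_right (by norm_cast)
    exact ((h1.continuousAt.clm_apply continuousAt_const).tendsto).comp hγt
  have hDP : ∀ w, Tendsto (fun u => fderiv ℝ (slopePart h) (γ u) w) (𝓝[≠] 0)
      (𝓝 (fderiv ℝ (slopePart h) (0, 0) w)) := fun w => by
    have h1 : ContDiffAt ℝ 1 (fderiv ℝ (slopePart h)) (0, 0) :=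
      (H.contDiffAt_slopePart H.zero_mem).fderiv_right (by norm_cast)
    exact ((h1.continuousAt.clm_apply continuousAt_const).tendsto).comp hγt
  have hUev : ∀ᶠ u in 𝓝[≠] 0, (γ u).1 ∈ U := hγt.eventually H.eventually_mem
  have hmain : ∀ᶠ u in 𝓝[≠] 0, P u ≠ 0 ∧ HasDerivAt γ (!₂[1, m u], deriv m u) u ∧
      deriv m u = R u / P u := by
    have h0 : ∀ᶠ u in 𝓝[≠] (0 : ℝ), u ≠ 0 := self_mem_nhdsWithin
    filter_upwards [hev, hUev, eventually_nhdsNE_eventually_nhds_iff.2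
      (hev.mono fun u h => h.2.2.2.1), h0] with u h1 h2 h3 h4
    have hPne : P u ≠ 0 := fun hP0 => by
      have h5 := h1.2.1
      have : slopePart h (!₂[u, F u], m u) = P u := rfl
      rw [this, hP0, mul_zero] at h5
      have : 0 < κ * u ^ 2 := by positivity
      linarith
    have hγd : HasDerivAt γ (!₂[1, m u], deriv m u) u :=
      hasDerivAt_graph h1.1 h1.2.2.2.2.2.hasDerivAt
    refine ⟨hPne, hγd, ?_⟩
    have := H.slope_mul_eq_vertical (γ := γ) h2 hγd h3
    rw [eq_div_iff hPne, mul_comm]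
    exact this
  have hPd : ∀ᶠ u in 𝓝[≠] 0, HasDerivAt P (1 * fderiv ℝ (slopePart h) (γ u) (!₂[1, 0], 0) +
      m u * fderiv ℝ (slopePart h) (γ u) (!₂[0, 1], 0) +
      deriv m u * fderiv ℝ (slopePart h) (γ u) (0, 1)) u := by
    filter_upwards [hmain, hUev] with u h1 h2
    exact hasDerivAt_comp_prod ((H.contDiffAt_slopePart h2).differentiableAt (by norm_num)) h1.2.1
  have hRd : ∀ᶠ u in 𝓝[≠] 0, HasDerivAt R (1 * fderiv ℝ (verticalPart h) (γ u) (!₂[1, 0], 0) +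
      m u * fderiv ℝ (verticalPart h) (γ u) (!₂[0, 1], 0) +
      deriv m u * fderiv ℝ (verticalPart h) (γ u) (0, 1)) u := by
    filter_upwards [hmain, hUev] with u h1 h2
    exact hasDerivAt_comp_prod ((H.contDiffAt_verticalPart h2).differentiableAt (by norm_num))
      h1.2.1
  have hloc : ∀ᶠ u in 𝓝[≠] 0, deriv m =ᶠ[𝓝 u] fun u => R u / P u :=
    eventually_nhdsNE_eventually_nhds_iff.2 (hmain.mono fun u h => h.2.2)
  refine ⟨?_, ?_⟩
  swap
  · filter_upwards [hmain, hPd, hRd, hloc] with u h1 h2 h3 h4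
    exact (h3.continuousAt.div h2.continuousAt h1.1).congr h4.symm
  have hL3 : ∀ᶠ u in 𝓝[≠] 0,
      fderiv ℝ (slopePart h) (γ u) (0, 1) = 2 * coeffL h !₂[u, F u] := by
    filter_upwards [hUev] with u h1
    obtain ⟨h2, h3, h4⟩ := H.coeff_differentiableAt h1
    have e : ∀ g : E2 → ℝ, DifferentiableAt ℝ g (γ u).1 → HasFDerivAt (fun y : E2 × ℝ => g y.1)
        ((fderiv ℝ g (γ u).1).comp (ContinuousLinearMap.fst ℝ E2 ℝ)) (γ u) := fun g hg =>
      HasFDerivAt.comp (g := g) (γ u) hg.hasFDerivAt hasFDerivAt_fst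
    have := (((e _ h2).const_mul 2).mul hasFDerivAt_snd).add (e _ h3)
    rw [HasFDerivAt.fderiv (f := slopePart h) this]
    simp [hγ]
  have hss := mul_self_of_abs_eq_one hs
  have hA : 0 < A := by
    have h0 : ∀ᶠ u in 𝓝[≠] (0 : ℝ), u ≠ 0 := self_mem_nhdsWithin
    obtain ⟨u, h1, h2⟩ := (hev.and h0).exists
    have h3 := h1.2.1.trans h1.2.2.1
    have : 0 < u ^ 2 := by positivity
    have := le_of_mul_le_mul_right h3 this
    linarith
  set ε : ℝ → ℝ := fun u => 2 * coeffL h !₂[u, F u] * (R u / P u) with hε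
  set Q : ℝ → ℝ := fun u => fderiv ℝ (verticalPart h) (γ u) (0, 1) -
    fderiv ℝ (slopePart h) (γ u) (!₂[1, 0], 0) -
    m u * fderiv ℝ (slopePart h) (γ u) (!₂[0, 1], 0) - ε u with hQ
  have hbd : ∀ᶠ u in 𝓝[≠] 0, u ≠ 0 ∧ 1 / A ≤ s * (u ^ 2 / P u) ∧ |u ^ 2 / P u| ≤ 1 / κ := by
    have h0 : ∀ᶠ u in 𝓝[≠] (0 : ℝ), u ≠ 0 := self_mem_nhdsWithin
    filter_upwards [hev, h0] with u h1 h2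
    have hu2 : 0 < u ^ 2 := by positivity
    have h3 : κ * u ^ 2 ≤ s * P u := h1.2.1
    have h4 : s * P u ≤ A * u ^ 2 := h1.2.2.1
    have h5 : 0 < s * P u := lt_of_lt_of_le (by positivity) h3
    have e : s * (u ^ 2 / P u) = u ^ 2 / (s * P u) := by
      have : P u ≠ 0 := fun h => by simp [h] at h5
      have : s ≠ 0 := fun h => by simp [h] at h5
      field_simp
      rw [sq, hss]
    refine ⟨h2, ?_, ?_⟩
    · rw [e, div_le_div_iff₀ hA h5]
      linarith
    · have : |u ^ 2 / P u| = s * (u ^ 2 / P u) := by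
        have h6 : 0 < s * (u ^ 2 / P u) := by rw [e]; positivity
        rw [← abs_of_pos h6, abs_mul, hs, one_mul]
      rw [this, e, div_le_div_iff₀ h5 hκ]
      linarith
  have hεt : Tendsto ε (𝓝[≠] 0) (𝓝 0) := by
    have h1 : Tendsto (fun u => 2 * A * |R u| * (1 / κ)) (𝓝[≠] 0) (𝓝 0) := by
      simpa using ((hRt.abs.const_mul (2 * A)).mul_const (1 / κ))
    refine squeeze_zero_norm' ?_ h1
    filter_upwards [hev, hbd, hmain] with u h2 h3 h4
    have h5 : |coeffL h !₂[u, F u]| ≤ A * u ^ 2 := h2.2.2.2.2.1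
    have e1 : ε u = 2 * (coeffL h !₂[u, F u] / u ^ 2) * R u * (u ^ 2 / P u) := by
      have := h3.1
      have := h4.1
      simp only [hε]
      field_simp
    have h6 : |coeffL h !₂[u, F u] / u ^ 2| ≤ A := by
      have : 0 < u ^ 2 := by have := h3.1; positivity
      rw [abs_div, abs_of_pos this, div_le_iff₀ this]
      exact h5
    rw [Real.norm_eq_abs, e1, abs_mul, abs_mul, abs_mul, abs_two]
    gcongr
    exact h3.2.2
  have hQt : Tendsto Q (𝓝[≠] 0) (𝓝 (-b)) := by
    have := (((hDR (0, 1)).sub (hDP (!₂[1, 0], 0))).sub (hm.mul (hDP (!₂[0, 1], 0)))).sub hεt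
    simpa [H.fderiv_verticalPart, H.fderiv_slopePart] using this
  set e₀ : ℝ → ℝ := fun u => fderiv ℝ (verticalPart h) (γ u) (!₂[1, 0], 0) +
    m u * fderiv ℝ (verticalPart h) (γ u) (!₂[0, 1], 0) - Q u * (B / b) with he₀
  have he₀t : Tendsto e₀ (𝓝[≠] 0) (𝓝 0) := by
    have := ((hDR (!₂[1, 0], 0)).add (hm.mul (hDR (!₂[0, 1], 0)))).sub (hQt.mul_const (B / b))
    simpa [H.fderiv_verticalPart, mul_div_cancel₀ _ H.b_ne] using this
  have hy0 : Tendsto (fun u => R u / P u + B / b) (𝓝[≠] 0) (𝓝 0) := by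
    refine tendsto_zero_of_singular_of_abs (τ := τ) (a₀ := 1 / A * (s * τ * b / 2))
      (y' := fun u => deriv (fun u => R u / P u + B / b) u)
      (a := fun u => -(u ^ 2 / P u * Q u)) (e := fun u => u ^ 2 / P u * e₀ u)
      (N := 1 / κ + |B / b|) hτ (by positivity) ?_ ?_ ?_ ?_ ?_
    · filter_upwards [hmain, hPd, hRd] with u h1 h2 h3
      exact ((h3.div h2 h1.1).add_const _).differentiableAt.hasDerivAt
    · filter_upwards [hmain, hPd, hRd, hL3] with u h1 h2 h3 h4
      rw [((h3.fun_div h2 h1.1).add_const _).deriv, h4, h1.2.2]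
      have hPu := h1.1
      simp only [he₀, hQ, hε]
      field_simp
      ring
    · have hq : ∀ᶠ u in 𝓝[≠] 0, s * τ * b / 2 ≤ -(s * τ * Q u) := by
        have h1 : Tendsto (fun u => -(s * τ * Q u)) (𝓝[≠] 0) (𝓝 (s * τ * b)) := by
          simpa using (hQt.const_mul (s * τ)).neg
        exact h1.eventually (eventually_ge_nhds (by linarith))
      filter_upwards [hbd, hq] with u h1 h2
      have e : τ * -(u ^ 2 / P u * Q u) = (s * (u ^ 2 / P u)) * -(s * τ * Q u) := by
        linear_combination (u ^ 2 / P u * Q u * τ) * hss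
      rw [e]
      exact mul_le_mul h1.2.1 h2 (by positivity) (le_trans (by positivity) h1.2.1)
    · refine bdd_le_mul_tendsto_zero' (1 / κ) ?_ he₀t
      filter_upwards [hbd] with u h1 using h1.2.2
    · have hR1 : ∀ᶠ u in 𝓝[≠] 0, |R u| ≤ 1 := by
        have := hRt.abs
        rw [abs_zero] at this
        exact this.eventually (eventually_le_nhds one_pos)
      have hu1 : ∀ᶠ u : ℝ in 𝓝[≠] 0, u ^ 2 ≤ 1 := by
        have : Tendsto (fun u : ℝ => u ^ 2) (𝓝[≠] 0) (𝓝 0) := by simpa using hu.pow 2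
        exact this.eventually (eventually_le_nhds one_pos)
      filter_upwards [hbd, hR1, hu1] with u h1 h2 h3
      have e : u ^ 2 * (R u / P u + B / b) = u ^ 2 / P u * R u + u ^ 2 * (B / b) := by ring
      rw [e]
      refine (abs_add_le _ _).trans (add_le_add ?_ ?_)
      · rw [abs_mul]
        calc _ ≤ 1 / κ * 1 := mul_le_mul h1.2.2 h2 (abs_nonneg _) (by positivity)
          _ = 1 / κ := mul_one _
      · rw [abs_mul, abs_of_nonneg (sq_nonneg u)]
        exact mul_le_of_le_one_left (abs_nonneg _) h3
  have hlim : Tendsto (fun u => R u / P u) (𝓝[≠] 0) (𝓝 (-(B / b))) := by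
    have := hy0.sub_const (B / b)
    simpa using this
  exact hlim.congr' (hmain.mono fun u hu => hu.2.2.symm)

theorem exists_isCenterCurve (H : IsMongeUmbilic h U b c B K) :
    ∃ γ g, IsCenterCurve (lieCartan h) (curvT h) (0, 0) γ g := by
  obtain ⟨F, m, s, τ, κ, A, hs, hτ, hsb, hκ, hF0, hm0, hm, hev⟩ := H.exists_center_slope
  have hFb : ∀ᶠ u in 𝓝 0, |F u| ≤ A * u ^ 2 :=
    eventually_nhds_of_eventually_ne (hev.mono fun u h => h.2.1) (by simp [hF0])
  have hFd : HasDerivAt F 0 0 := by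
    rw [hasDerivAt_iff_isLittleO]
    have h1 : (fun u => F u) =O[𝓝 0] fun u : ℝ => u ^ 2 :=
      IsBigO.of_bound A (hFb.mono fun u hu => by simpa using hu)
    have h2 : (fun u : ℝ => u ^ 2) =o[𝓝 0] fun u : ℝ => u ^ 1 :=
      isLittleO_pow_pow (by norm_num)
    simpa [hF0] using h1.trans_isLittleO h2
  have hFt : Tendsto F (𝓝[≠] 0) (𝓝 0) := by
    have := hFd.continuousAt.tendsto
    rw [hF0] at this
    exact this.mono_left nhdsWithin_le_nhds
  obtain ⟨hk, hkc⟩ := H.tendsto_center_slope hs hτ hsb hκ hFt hm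
    (hev.mono fun u h => ⟨h.1, h.2.2⟩)
  obtain ⟨hmd, hmC⟩ := contDiffAt_one_of_tendsto (by rwa [hm0])
    (hev.mono fun u h => h.2.2.2.2.2.2) hkc hk
  have hdF : deriv F =ᶠ[𝓝[≠] 0] m := hev.mono fun u h => h.1.deriv
  have hFC : ContDiffAt ℝ 1 F 0 := by
    refine (contDiffAt_one_of_tendsto (k₀ := 0) (by rwa [hF0])
      (hev.mono fun u h => h.1.differentiableAt) ?_ (hm.congr' hdF.symm)).2
    filter_upwards [eventually_nhdsNE_eventually_nhds_iff.2 hdF, hev] with u h1 h2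
    exact h2.2.2.2.2.2.2.continuousAt.congr (EventuallyEq.symm h1)
  have hγ0 := hasDerivAt_graph hFd hmd
  have hz : (!₂[0, F 0] : E2) = 0 := by rw [hF0]; ext i; fin_cases i <;> rfl
  have hγt : ContinuousAt (fun u => ((!₂[u, F u], m u) : E2 × ℝ)) 0 := hγ0.continuousAt
  have hUev : ∀ᶠ u in 𝓝 0, (!₂[u, F u] : E2) ∈ U := by
    have : Tendsto (fun u => (!₂[u, F u] : E2)) (𝓝 0) (𝓝 0) := by
      have := (continuous_fst.tendsto _).comp hγt.tendsto
      rwa [hz] at this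
    exact this.eventually (H.isOpen.mem_nhds H.zero_mem)
  refine ⟨fun u => (!₂[u, F u], m u), fun u => slopePart h (!₂[u, F u], m u), ?_, ?_, ?_, ?_, ?_⟩
  · simp only [hz, hm0]
  · have h1 : ContDiffAt ℝ 1 (fun u => (u • (!₂[1, 0] : E2) + F u • (!₂[0, 1] : E2), m u)) 0 :=
      ((contDiffAt_id.smul contDiffAt_const).add (hFC.smul contDiffAt_const)).prodMk hmC
    refine h1.congr_of_eventuallyEq (Eventually.of_forall fun u => ?_)
    simp only
    rw [e2_eq !₂[u, F u]]
    rfl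
  · rw [hγ0.deriv]
    intro hc
    have := congrArg (fun y : E2 × ℝ => y.1 0) hc
    simp at this
  · rw [hγ0.deriv, H.fderiv_lieCartan]
    ext i
    · fin_cases i <;> simp
    · simp [mul_div_cancel₀ _ H.b_ne]
  · have h1 : ∀ᶠ u in 𝓝 0, curvT h (!₂[u, F u], m u) = 0 :=
      eventually_nhds_of_eventually_ne (hev.mono fun u h => h.2.2.2.2.1)
        (by simp [hz, hm0, curvT, H.jetN.zero])
    refine eventually_nhds_of_eventually_ne ?_ ?_
    · filter_upwards [hev, eventually_nhdsWithin_of_eventually_nhds h1,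
        eventually_nhdsWithin_of_eventually_nhds hUev, eventually_nhdsWithin_of_eventually_nhds
        (eventually_eventually_nhds.2 h1)] with u h2 h3 h4 h5
      have hγd := hasDerivAt_graph h2.1 h2.2.2.2.2.2.2.hasDerivAt
      refine ⟨h3, ?_⟩
      have h6 := H.slope_mul_eq_vertical (γ := fun u => (!₂[u, F u], m u)) h4 hγd h5
      rw [H.lieCartan_eq h4, hγd.deriv, ← h6]
      ext i
      · fin_cases i <;> simp [mul_comm]
      · simp
    · refine ⟨h1.self_of_nhds, ?_⟩
      have h2 : slopePart h ((0 : E2), (0 : ℝ)) = 0 := by simp [slopePart, H.jetM.zero]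
      have h3 : verticalPart h ((0 : E2), (0 : ℝ)) = 0 := by simp [verticalPart, H.jetN.du_zero]
      simp only [hz, hm0]
      rw [H.lieCartan_eq H.zero_mem, h2, h3, zero_smul]
      ext i
      · fin_cases i <;> simp
      · simp

end IsMongeUmbilic

namespace IsMongeUmbilic

variable {h : E2 → ℝ} {U : Set E2} {b c B K : ℝ}

lemma deriv_centerCurve (H : IsMongeUmbilic h U b c B K) {γ : ℝ → E2 × ℝ} {g : ℝ → ℝ}
    (hγ : IsCenterCurve (lieCartan h) (curvT h) (0, 0) γ g) :
    (deriv γ 0).1 1 = 0 ∧ (deriv γ 0).1 0 ≠ 0 := by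
  have hd : HasDerivAt γ (deriv γ 0) 0 := (hγ.contDiffAt.differentiableAt one_ne_zero).hasDerivAt
  have h1 : fderiv ℝ (curvT h) (0, 0) (deriv γ 0) = 0 := by
    have hT : DifferentiableAt ℝ (curvT h) (γ 0) := by
      rw [hγ.base]
      exact (H.contDiffAt_curvT H.zero_mem).differentiableAt (by norm_num)
    have h2 := hT.hasFDerivAt.comp_hasDerivAt 0 hd
    have h3 : HasDerivAt (curvT h ∘ γ) 0 0 :=
      (hasDerivAt_const 0 0).congr_of_eventuallyEq (hγ.invariant.mono fun s hs => hs.1)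
    rw [← hγ.base]
    exact h2.unique h3
  rw [H.fderiv_curvT H.zero_mem] at h1
  have hw1 : (deriv γ 0).1 1 = 0 := by
    simpa [fderiv_apply_e2, H.jetL.zero, H.jetM.zero, H.jetN.du_zero, H.jetN.dv_zero, H.b_ne]
      using h1
  refine ⟨hw1, fun h0 => hγ.regular ?_⟩
  have h2 := congrArg Prod.snd hγ.tangent
  rw [H.fderiv_lieCartan] at h2
  have h3 : (deriv γ 0).2 = 0 := by simpa [h0, hw1, H.b_ne] using h2
  ext i
  · fin_cases i
    · exact h0
    · exact hw1
  · exact h3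

/-- The asymptotics of `𝒯_m` along a curve in the surface `𝒯 = 0` tangent to the center direction. -/
lemma slopePart_isLittleO (H : IsMongeUmbilic h U b c B K) {γ : ℝ → E2 × ℝ} {w : E2} {z : ℝ}
    (h0 : γ 0 = (0, 0)) (hd : HasDerivAt γ (w, z) 0)
    (hT : ∀ᶠ s in 𝓝 0, curvT h (γ s) = 0) :
    (fun s => slopePart h (γ s) - (b * K - c * B) / (2 * b) * (w 0) ^ 2 * s ^ 2)
      =o[𝓝 0] fun s : ℝ => s ^ 2 := by
  obtain ⟨C, hC, r, hr, -, -, jl, jm, jn⟩ := H.exists_scalarJets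
  set x : ℝ → ℝ := fun s => (γ s).1 0 with hx
  set y : ℝ → ℝ := fun s => (γ s).1 1 with hy
  set m : ℝ → ℝ := fun s => (γ s).2 with hm
  have hb := H.b_ne
  have hxd : HasDerivAt x (w 0) 0 := by
    have := (EuclideanSpace.proj (𝕜 := ℝ) (0 : Fin 2)).hasFDerivAt.comp_hasDerivAt 0 hd.fst
    exact this
  have hyd : HasDerivAt y (w 1) 0 := by
    have := (EuclideanSpace.proj (𝕜 := ℝ) (1 : Fin 2)).hasFDerivAt.comp_hasDerivAt 0 hd.fst
    exact this
  have hx0 : x 0 = 0 := by simp [hx, h0]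
  have hy0 : y 0 = 0 := by simp [hy, h0]
  have hxt : Tendsto x (𝓝 0) (𝓝 0) := by simpa [hx0] using hxd.continuousAt.tendsto
  have hyt : Tendsto y (𝓝 0) (𝓝 0) := by simpa [hy0] using hyd.continuousAt.tendsto
  have hmt : Tendsto m (𝓝 0) (𝓝 0) := by
    have := (continuous_snd.tendsto _).comp hd.continuousAt.tendsto
    rw [h0] at this
    exact this
  have hmo : m =o[𝓝 0] fun _ => (1 : ℝ) := (isLittleO_one_iff ℝ).2 hmt
  have hsmall : ∀ᶠ s in 𝓝 0, |x s| ≤ r ∧ |y s| ≤ r := by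
    have : ∀ᶠ t : ℝ in 𝓝 0, |t| ≤ r := by
      filter_upwards [Metric.closedBall_mem_nhds (0 : ℝ) hr] with t ht
      simpa using ht
    exact (hxt.eventually this).and (hyt.eventually this)
  set ρ : ℝ → ℝ := fun s => |y s| + x s ^ 2 with hρ
  have hρ0 : ∀ s, 0 ≤ ρ s := fun s => by positivity
  have herr : ∀ {g gu gv : ℝ → ℝ → ℝ} {β δ : ℝ}, IsScalarJet g gu gv β δ C r →
      (fun s => g (x s) (y s) - (β * y s + δ / 2 * x s ^ 2)) =o[𝓝 0] ρ := by
    intro g gu gv β δ hg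
    have h1 : (fun s => C * (|x s| + |y s|)) =o[𝓝 0] fun _ => (1 : ℝ) := by
      refine (isLittleO_one_iff ℝ).2 ?_
      simpa using (hxt.abs.add hyt.abs).const_mul C
    have h2 := h1.mul_isBigO (isBigO_refl ρ (𝓝 0))
    simp only [one_mul] at h2
    refine IsBigO.trans_isLittleO (IsBigO.of_bound 1 ?_) h2
    filter_upwards [hsmall] with s hs
    have h3 := hg.val _ _ hs.1 hs.2
    rw [one_mul, Real.norm_eq_abs, Real.norm_eq_abs, mul_assoc]
    exact h3.trans (le_abs_self _)
  have hO : ∀ {g gu gv : ℝ → ℝ → ℝ} {β δ : ℝ}, IsScalarJet g gu gv β δ C r →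
      (fun s => g (x s) (y s)) =O[𝓝 0] ρ := by
    intro g gu gv β δ hg
    have h1 : (fun s => β * y s + δ / 2 * x s ^ 2) =O[𝓝 0] ρ := by
      refine IsBigO.of_bound (|β| + |δ / 2|) (Eventually.of_forall fun s => ?_)
      rw [Real.norm_eq_abs, Real.norm_eq_abs, abs_of_nonneg (hρ0 s)]
      refine (abs_add_le _ _).trans ?_
      rw [abs_mul, abs_mul, abs_of_nonneg (sq_nonneg (x s))]
      simp only [hρ]
      nlinarith [mul_nonneg (abs_nonneg β) (sq_nonneg (x s)),
        mul_nonneg (abs_nonneg (δ / 2)) (abs_nonneg (y s))]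
    have := (herr hg).isBigO.add h1
    simpa using this
  have e : ∀ f : E2 → ℝ, ∀ s, f !₂[x s, y s] = f (γ s).1 := fun f s => by
    rw [hx, hy, e2_eta]
  have hL := hO jl
  have hM := hO jm
  have eL := herr jl
  have eM := herr jm
  have eN := herr jn
  simp only [e] at hL hM eM eN
  have hLm : (fun s => coeffL h (γ s).1 * m s) =o[𝓝 0] ρ := by
    have := hL.mul_isLittleO hmo
    simpa using this
  have hLm2 : (fun s => coeffL h (γ s).1 * m s ^ 2) =o[𝓝 0] ρ := by
    have := hLm.mul hmo
    simpa [mul_assoc, sq] using this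
  have hMm : (fun s => coeffM h (γ s).1 * m s) =o[𝓝 0] ρ := by
    have := hM.mul_isLittleO hmo
    simpa using this
  have key : (fun s => b * y s + B / 2 * x s ^ 2) =o[𝓝 0] ρ := by
    have h1 := ((eN.add hLm2).add hMm).neg_left
    refine h1.congr' ?_ EventuallyEq.rfl
    filter_upwards [hT] with s hs
    simp only [curvT] at hs
    linear_combination -hs
  have hρO : ρ =O[𝓝 0] fun s : ℝ => s ^ 2 := by
    have hx2 : (fun s => x s ^ 2) =O[𝓝 0] fun s : ℝ => s ^ 2 := by
      have h1 := hxd.isBigO_sub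
      simp only [hx0, sub_zero] at h1
      exact h1.pow 2
    refine IsBigO.trans ?_ hx2
    have hb' : 0 < |b| := abs_pos.2 hb
    refine IsBigO.of_bound ((|B| + |b|) / |b| + 1) ?_
    filter_upwards [key.bound (half_pos hb')] with s hs
    rw [Real.norm_eq_abs, Real.norm_eq_abs, abs_of_nonneg (hρ0 s)] at hs
    rw [Real.norm_eq_abs, Real.norm_eq_abs, abs_of_nonneg (hρ0 s),
      abs_of_nonneg (sq_nonneg (x s))]
    have h2 : |b| * |y s| ≤ |b * y s + B / 2 * x s ^ 2| + |B| / 2 * x s ^ 2 := by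
      have h3 := abs_sub (b * y s + B / 2 * x s ^ 2) (B / 2 * x s ^ 2)
      rw [add_sub_cancel_right, abs_mul, abs_mul, abs_div, abs_two,
        abs_of_nonneg (sq_nonneg (x s))] at h3
      exact h3
    have h4 : |b| * |y s| ≤ (|B| + |b|) * x s ^ 2 := by
      simp only [hρ] at hs
      linarith
    have h5 : |y s| ≤ (|B| + |b|) / |b| * x s ^ 2 := by
      rw [div_mul_eq_mul_div, le_div_iff₀ hb']
      linarith
    simp only [hρ]
    linarith
  have hx2 : (fun s => x s ^ 2 - (w 0) ^ 2 * s ^ 2) =o[𝓝 0] fun s : ℝ => s ^ 2 := by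
    have h1 : (fun s => x s - w 0 * s) =o[𝓝 0] fun s : ℝ => s := by
      have := hasDerivAt_iff_isLittleO.1 hxd
      simpa [hx0, mul_comm] using this
    have h2 : (fun s => x s + w 0 * s) =O[𝓝 0] fun s : ℝ => s := by
      have h3 := hxd.isBigO_sub
      simp only [hx0, sub_zero] at h3
      exact h3.add ((isBigO_refl _ _).const_mul_left _)
    refine (h1.mul_isBigO h2).congr (fun s => ?_) fun s => ?_ <;> ring
  have hfin := (((eM.add (hLm.const_mul_left 2)).add (key.const_mul_left (c / b))).trans_isBigO
    hρO).add (hx2.const_mul_left ((b * K - c * B) / (2 * b)))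
  refine hfin.congr (fun s => ?_) fun s => rfl
  simp only [slopePart]
  field_simp
  ring

theorem isSaddleNode (H : IsMongeUmbilic h U b c B K) :
    IsSaddleNode (lieCartan h) (curvT h) (0, 0) where
  contDiffAt_surface := (H.contDiffAt_curvT H.zero_mem).of_le (by norm_cast)
  mem_surface := by simp [curvT, H.jetN.zero]
  regular_surface hc := by
    have h1 := H.fderiv_curvT (y := (0, 0)) H.zero_mem (!₂[0, 1], 0)
    rw [hc] at h1
    simp [fderiv_apply_e2, H.jetN.dv_zero] at h1
    exact H.b_ne h1.symm
  contDiffAt_field := H.contDiffAt_lieCartan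
  tangent_field := by
    filter_upwards [H.eventually_mem] with y hy _
    have h1 := fderiv_curvT_apply h y (fderiv ℝ (curvT h) y (0, 1))
      (y.2 * fderiv ℝ (curvT h) y (0, 1))
      (-(fderiv ℝ (curvT h) y (!₂[1, 0], 0) + y.2 * fderiv ℝ (curvT h) y (!₂[0, 1], 0)))
    simp only [lieCartan]
    rw [h1]
    ring
  singular := by
    rw [H.lieCartan_eq H.zero_mem]
    have h2 : slopePart h ((0 : E2), (0 : ℝ)) = 0 := by simp [slopePart, H.jetM.zero]
    have h3 : verticalPart h ((0 : E2), (0 : ℝ)) = 0 := by simp [verticalPart, H.jetN.du_zero]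
    rw [h2, h3]
    ext i
    · fin_cases i <;> simp
    · simp
  hyperbolic := by
    refine ⟨-b, neg_ne_zero.2 H.b_ne, (0, 1), by simp, ?_, ?_⟩
    · rw [H.fderiv_curvT H.zero_mem]
      simp [H.jetM.zero]
    · rw [H.fderiv_lieCartan]
      ext i
      · fin_cases i <;> simp
      · simp
  center := H.exists_isCenterCurve
  quadratic γ g hγ := by
    obtain ⟨hw1, hw0⟩ := H.deriv_centerCurve hγ
    have hd : HasDerivAt γ (deriv γ 0) 0 := (hγ.contDiffAt.differentiableAt one_ne_zero).hasDerivAt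
    have h1 := H.slopePart_isLittleO (w := (deriv γ 0).1) (z := (deriv γ 0).2) hγ.base hd
      (hγ.invariant.mono fun s hs => hs.1)
    set a₀ := (deriv γ 0).1 0 with ha₀
    set κ := (b * K - c * B) / (2 * b) * a₀ ^ 2 with hκ
    have hb := H.b_ne
    have hχ := H.chi_ne
    have hκ0 : κ ≠ 0 := by simp only [hκ]; positivity
    have hcont : ContinuousAt (fun s => (deriv γ s).1 0) 0 := by
      have h2 : ContinuousAt (deriv γ) 0 := by
        obtain ⟨f', u, hu, hf'⟩ := contDiffAt_one_iff.1 hγ.contDiffAt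
        have h3 : deriv γ =ᶠ[𝓝 0] fun s => f' s 1 := by
          filter_upwards [hu] with s hs
          exact (hf'.2 s hs).hasDerivAt.deriv
        refine ContinuousAt.congr ?_ h3.symm
        exact (hf'.1.continuousAt hu).clm_apply continuousAt_const
      exact ((EuclideanSpace.proj (𝕜 := ℝ) (0 : Fin 2)).continuous.continuousAt.comp
        continuousAt_fst).comp h2
    have hinv : Tendsto (fun s => ((deriv γ s).1 0)⁻¹) (𝓝 0) (𝓝 a₀⁻¹) := hcont.tendsto.inv₀ hw0
    have hne : ∀ᶠ s in 𝓝 0, (deriv γ s).1 0 ≠ 0 := hcont.eventually_ne hw0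
    have hUev : ∀ᶠ s in 𝓝 0, (γ s).1 ∈ U := by
      have := hd.continuousAt.tendsto
      rw [hγ.base] at this
      exact this.eventually H.eventually_mem
    refine ⟨κ * a₀⁻¹, mul_ne_zero hκ0 (inv_ne_zero hw0), ?_⟩
    have h2 : (fun s => (slopePart h (γ s) - κ * s ^ 2) * ((deriv γ s).1 0)⁻¹)
        =o[𝓝 0] fun s : ℝ => s ^ 2 := by
      simpa using h1.mul_isBigO (hinv.isBigO_one ℝ)
    have h3 : (fun s : ℝ => κ * s ^ 2 * (((deriv γ s).1 0)⁻¹ - a₀⁻¹))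
        =o[𝓝 0] fun s : ℝ => s ^ 2 := by
      have h4 : (fun s => ((deriv γ s).1 0)⁻¹ - a₀⁻¹) =o[𝓝 0] fun _ => (1 : ℝ) :=
        (isLittleO_one_iff ℝ).2 (by simpa using hinv.sub_const a₀⁻¹)
      simpa using ((isBigO_refl (fun s : ℝ => s ^ 2) (𝓝 0)).const_mul_left κ).mul_isLittleO h4
    refine (h2.add h3).congr' ?_ EventuallyEq.rfl
    filter_upwards [hne, hUev, hγ.invariant] with s hs hsU hsi
    have h4 := hsi.2
    rw [H.lieCartan_eq hsU] at h4
    have h5 : slopePart h (γ s) = g s * (deriv γ s).1 0 := by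
      have := congrArg (fun y : E2 × ℝ => y.1 0) h4
      simpa using this
    rw [h5]
    field_simp
    ring

end IsMongeUmbilic

/-! ### Wedge products and isometries -/

lemma inner_e3 (x y : E3) : inner ℝ x y = x 0 * y 0 + x 1 * y 1 + x 2 * y 2 := by
  simp [PiLp.inner_apply, Fin.sum_univ_three]
  ring

lemma inner_wedge (x y z : E3) : inner ℝ (wedge x y) z =
    (x 1 * y 2 - x 2 * y 1) * z 0 + (x 2 * y 0 - x 0 * y 2) * z 1 +
      (x 0 * y 1 - x 1 * y 0) * z 2 := by
  rw [inner_e3]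
  simp [wedge, cross_apply]

lemma wedge_comb (x y : E3) (p q s t : ℝ) :
    wedge (p • x + q • y) (s • x + t • y) = (p * t - q * s) • wedge x y := by
  ext i
  fin_cases i <;> simp [wedge, cross_apply] <;> ring

theorem exists_wedge_isometry (A : E3 ≃ₗᵢ[ℝ] E3) :
    ∃ δ : ℝ, |δ| = 1 ∧ ∀ x y, wedge (A x) (A y) = δ • A (wedge x y) := by
  let Q : Matrix (Fin 3) (Fin 3) ℝ := fun i j => A (EuclideanSpace.single j 1) i
  have hA : ∀ x i, A x i = ∑ j, Q i j * x j := by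
    intro x i
    have h1 : x = ∑ j, x j • EuclideanSpace.single j (1 : ℝ) := by
      ext i; fin_cases i <;> simp [Fin.sum_univ_three]
    conv_lhs => rw [h1]
    simp [Q, Finset.sum_apply, mul_comm]
  have hQ : Q.transpose * Q = 1 := by
    ext i j
    have h1 : inner ℝ (A (EuclideanSpace.single j 1)) (A (EuclideanSpace.single i 1)) =
        inner ℝ (EuclideanSpace.single j (1 : ℝ)) (EuclideanSpace.single i (1 : ℝ)) :=
      A.inner_map_map _ _
    rw [PiLp.inner_apply] at h1
    simp only [Matrix.mul_apply, Matrix.transpose_apply, Matrix.one_apply]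
    simp only [EuclideanSpace.inner_single_left, PiLp.single_apply] at h1
    simpa [Q, mul_comm, eq_comm] using h1
  have hdet : Q.det * Q.det = 1 := by
    have := congrArg Matrix.det hQ
    rwa [Matrix.det_mul, Matrix.det_transpose, Matrix.det_one] at this
  have htrip : ∀ x y z, inner ℝ (wedge (A x) (A y)) (A z) = Q.det * inner ℝ (wedge x y) z := by
    intro x y z
    rw [inner_wedge, inner_wedge, Matrix.det_fin_three]
    simp only [hA, Fin.sum_univ_three]
    ring
  refine ⟨Q.det, ?_, fun x y => ?_⟩
  · rcases mul_self_eq_one_iff.1 hdet with h | h <;> rw [h] <;> norm_num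
  · refine ext_inner_right ℝ fun v => ?_
    obtain ⟨z, rfl⟩ := A.surjective v
    rw [htrip, inner_smul_left, A.inner_map_map]
    rfl

/-! ### The geometry of a graph -/

/-- The graph immersion. -/
noncomputable def graphMap (h : E2 → ℝ) (x : E2) : E3 := !₂[x 0, x 1, h x]

/-- The differential of the graph immersion. -/
noncomputable def graphDeriv (h : E2 → ℝ) (x w : E2) : E3 := !₂[w 0, w 1, du h x * w 0 + dv h x * w 1]

/-- The squared area density of the graph. -/
noncomputable def areaSq (h : E2 → ℝ) (x : E2) : ℝ := 1 + du h x ^ 2 + dv h x ^ 2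

/-- The unnormalized normal. -/
noncomputable def graphNormal (h : E2 → ℝ) (x : E2) : E3 := !₂[-du h x, -dv h x, 1]

/-- The differential of the unnormalized normal. -/
noncomputable def graphNormalDeriv (h : E2 → ℝ) (x w : E2) : E3 :=
  !₂[-(du (du h) x * w 0 + dv (du h) x * w 1), -(dv (du h) x * w 0 + dv (dv h) x * w 1), 0]

/-- The unit normal. -/
noncomputable def unitNormal (h : E2 → ℝ) (x : E2) : E3 := (√(areaSq h x))⁻¹ • graphNormal h x

lemma areaSq_pos (h : E2 → ℝ) (x : E2) : 0 < areaSq h x := by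
  unfold areaSq; positivity

lemma fderiv_graphMap {h : E2 → ℝ} {x : E2} (hh : DifferentiableAt ℝ h x) :
    DifferentiableAt ℝ (graphMap h) x ∧ ∀ w, fderiv ℝ (graphMap h) x w = graphDeriv h x w := by
  have hp : ∀ i : Fin 2, HasFDerivAt (fun y : E2 => y i) (EuclideanSpace.proj (𝕜 := ℝ) i) x :=
    fun i => (EuclideanSpace.proj (𝕜 := ℝ) i).hasFDerivAt
  have hd : DifferentiableAt ℝ (graphMap h) x := by
    refine differentiableAt_euclidean.2 fun i => ?_
    fin_cases i
    · exact (hp 0).differentiableAt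
    · exact (hp 1).differentiableAt
    · exact hh
  refine ⟨hd, fun w => ?_⟩
  have h1 := fun i : Fin 3 =>
    (EuclideanSpace.proj (𝕜 := ℝ) i).hasFDerivAt.comp x hd.hasFDerivAt
  ext i
  have h2 : ∀ g', HasFDerivAt (fun y => graphMap h y i) g' x →
      fderiv ℝ (graphMap h) x w i = g' w := fun g' hg => by
    have := (h1 i).unique hg
    rw [← this]; rfl
  fin_cases i
  · exact h2 _ (hp 0)
  · exact h2 _ (hp 1)
  · refine (h2 _ hh.hasFDerivAt).trans ?_
    rw [fderiv_apply_e2]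
    simp [graphDeriv]
    ring

lemma fderiv_graphNormal {h : E2 → ℝ} {x : E2} (hh : ContDiffAt ℝ (5 : ℕ) h x) :
    DifferentiableAt ℝ (graphNormal h) x ∧
      ∀ w, fderiv ℝ (graphNormal h) x w = graphNormalDeriv h x w := by
  have hu : DifferentiableAt ℝ (du h) x :=
    (ContDiffAt.du (n := 4) hh).differentiableAt (by norm_num)
  have hv : DifferentiableAt ℝ (dv h) x :=
    (ContDiffAt.dv (n := 4) hh).differentiableAt (by norm_num)
  have hd : DifferentiableAt ℝ (graphNormal h) x := by
    refine differentiableAt_euclidean.2 fun i => ?_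
    fin_cases i
    · exact hu.fun_neg
    · exact hv.fun_neg
    · exact differentiableAt_const _
  refine ⟨hd, fun w => ?_⟩
  have h1 := fun i : Fin 3 =>
    (EuclideanSpace.proj (𝕜 := ℝ) i).hasFDerivAt.comp x hd.hasFDerivAt
  have hs : dv (du h) x = du (dv h) x := dv_du (hh.of_le (by norm_cast))
  ext i
  have h2 : ∀ g', HasFDerivAt (fun y => graphNormal h y i) g' x →
      fderiv ℝ (graphNormal h) x w i = g' w := fun g' hg => by
    have := (h1 i).unique hg
    rw [← this]; rfl
  fin_cases i
  · refine (h2 _ hu.hasFDerivAt.fun_neg).trans ?_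
    simp [graphNormalDeriv, fderiv_apply_e2 (du h)]
    ring
  · refine (h2 _ hv.hasFDerivAt.fun_neg).trans ?_
    simp [graphNormalDeriv, fderiv_apply_e2 (dv h), hs]
    ring
  · refine (h2 _ (hasFDerivAt_const _ _)).trans ?_
    simp [graphNormalDeriv]

lemma fderiv_unitNormal {h : E2 → ℝ} {x : E2} (hh : ContDiffAt ℝ (5 : ℕ) h x) :
    DifferentiableAt ℝ (unitNormal h) x ∧ ∀ w, ∃ t : ℝ, fderiv ℝ (unitNormal h) x w =
      (√(areaSq h x))⁻¹ • graphNormalDeriv h x w + t • graphNormal h x := by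
  obtain ⟨h1, h2⟩ := fderiv_graphNormal hh
  have hu : DifferentiableAt ℝ (du h) x :=
    (ContDiffAt.du (n := 4) hh).differentiableAt (by norm_num)
  have hv : DifferentiableAt ℝ (dv h) x :=
    (ContDiffAt.dv (n := 4) hh).differentiableAt (by norm_num)
  have hW : DifferentiableAt ℝ (fun x => (√(areaSq h x))⁻¹) x := by
    have h3 : DifferentiableAt ℝ (areaSq h) x := ((hu.pow 2).const_add 1).add (hv.pow 2)
    exact (h3.sqrt (areaSq_pos h x).ne').inv (Real.sqrt_pos.2 (areaSq_pos h x)).ne'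
  refine ⟨hW.smul h1, fun w => ⟨fderiv ℝ (fun x => (√(areaSq h x))⁻¹) x w, ?_⟩⟩
  have := (hW.hasFDerivAt.smul h1.hasFDerivAt)
  rw [HasFDerivAt.fderiv (f := unitNormal h) this]
  simp [h2]

lemma norm_unitNormal_inner (h : E2 → ℝ) (x : E2) :
    inner ℝ (graphNormal h x) (graphNormal h x) = areaSq h x := by
  rw [inner_e3]; simp [graphNormal, areaSq]; ring

lemma wedge_graphDeriv (h : E2 → ℝ) (x : E2) :
    wedge (graphDeriv h x !₂[1, 0]) (graphDeriv h x !₂[0, 1]) = graphNormal h x := by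
  ext i
  fin_cases i <;> simp [wedge, cross_apply, graphDeriv, graphNormal]

/-- The first fundamental form of the graph. -/
noncomputable def firstForm (h : E2 → ℝ) (x w : E2) : ℝ :=
  w 0 ^ 2 + w 1 ^ 2 + (du h x * w 0 + dv h x * w 1) ^ 2

lemma inner_graphDeriv (h : E2 → ℝ) (x w : E2) :
    inner ℝ (graphDeriv h x w) (graphDeriv h x w) = firstForm h x w := by
  rw [inner_e3]; simp [graphDeriv, firstForm]; ring

lemma firstForm_pos (h : E2 → ℝ) (x : E2) {w : E2} (hw : w ≠ 0) : 0 < firstForm h x w := by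
  unfold firstForm
  have : w 0 ≠ 0 ∨ w 1 ≠ 0 := by
    by_contra! hc
    exact hw (by ext i; fin_cases i; exacts [hc.1, hc.2])
  rcases this with h | h <;> positivity

/-- The quadratic form of principal directions. -/
noncomputable def principalForm (h : E2 → ℝ) (x w : E2) : ℝ :=
  coeffL h x * w 1 ^ 2 + coeffM h x * (w 0 * w 1) + coeffN h x * w 0 ^ 2

lemma torsion_graph (h : E2 → ℝ) (x w : E2) (s t : ℝ) :
    inner ℝ (wedge (s • graphNormalDeriv h x w + t • graphNormal h x) (graphDeriv h x w))
      (s • graphNormal h x) = s ^ 2 * principalForm h x w := by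
  rw [inner_wedge]
  simp [graphNormalDeriv, graphNormal, graphDeriv, principalForm, coeffL, coeffM, coeffN]
  ring

section Product

variable {V : Type*} [NormedAddCommGroup V] [NormedSpace ℝ V] {ρ T f : V → ℝ} {z : V}

lemma fderiv_mul_of_eq_zero (hρ : DifferentiableAt ℝ ρ z) (hT : DifferentiableAt ℝ T z)
    (h0 : T z = 0) : fderiv ℝ (fun y => ρ y * T y) z = ρ z • fderiv ℝ T z := by
  rw [fderiv_fun_mul hρ hT, h0, zero_smul, add_zero]

lemma fderiv_fderiv_mul_of_critical (hρ : ContDiffAt ℝ 2 ρ z) (hT : ContDiffAt ℝ 2 T z)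
    (h0 : T z = 0) (h1 : fderiv ℝ T z = 0) (x y : V) :
    fderiv ℝ (fderiv ℝ (fun y => ρ y * T y)) z x y = ρ z * fderiv ℝ (fderiv ℝ T) z x y := by
  have hev : fderiv ℝ (fun y => ρ y * T y) =ᶠ[𝓝 z]
      fun y => ρ y • fderiv ℝ T y + T y • fderiv ℝ ρ y := by
    filter_upwards [hρ.eventually (by norm_num), hT.eventually (by norm_num)] with y h2 h3
    exact fderiv_fun_mul (h2.differentiableAt (by norm_num)) (h3.differentiableAt (by norm_num))
  have hdρ : HasFDerivAt ρ (fderiv ℝ ρ z) z := (hρ.differentiableAt (by norm_num)).hasFDerivAt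
  have hdT : HasFDerivAt T (fderiv ℝ T z) z := (hT.differentiableAt (by norm_num)).hasFDerivAt
  have hddρ : HasFDerivAt (fderiv ℝ ρ) (fderiv ℝ (fderiv ℝ ρ) z) z :=
    ((hρ.fderiv_right (m := 1) (by norm_num)).differentiableAt (by norm_num)).hasFDerivAt
  have hddT : HasFDerivAt (fderiv ℝ T) (fderiv ℝ (fderiv ℝ T) z) z :=
    ((hT.fderiv_right (m := 1) (by norm_num)).differentiableAt (by norm_num)).hasFDerivAt
  rw [hev.fderiv_eq, ((hdρ.fun_smul hddT).fun_add (hdT.fun_smul hddρ)).fderiv]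
  simp [h0, h1]

/-- A product of a nonvanishing function and a function with a Morse cone. -/
lemma IsMorseCone.of_eventuallyEq_mul (hf : f =ᶠ[𝓝 z] fun y => ρ y * T y)
    (hρ : ContDiffAt ℝ 2 ρ z) (hρ0 : ρ z ≠ 0) (hT : IsMorseCone T z) : IsMorseCone f z := by
  have e2 : ∀ x y, fderiv ℝ (fderiv ℝ f) z x y = ρ z * fderiv ℝ (fderiv ℝ T) z x y :=
    fun x y => by
    rw [hf.fderiv.fderiv_eq]
    exact fderiv_fderiv_mul_of_critical hρ hT.contDiffAt hT.eq_zero hT.critical x y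
  refine ⟨⟨(hρ.mul hT.contDiffAt).congr_of_eventuallyEq hf, ?_, ?_, fun x hx => ?_⟩, ?_, ?_⟩
  · have := hf.self_of_nhds
    simp only at this
    rw [this, hT.eq_zero, mul_zero]
  · rw [hf.fderiv_eq, fderiv_mul_of_eq_zero (hρ.differentiableAt (by norm_num))
      (hT.contDiffAt.differentiableAt (by norm_num)) hT.eq_zero, hT.critical, smul_zero]
  · refine hT.nondegenerate x fun y => ?_
    have := hx y
    rw [e2] at this
    exact (mul_eq_zero.1 this).resolve_left hρ0
  · rcases lt_or_gt_of_ne hρ0 with h | h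
    · obtain ⟨x, hx⟩ := hT.exists_neg
      exact ⟨x, by rw [e2]; exact mul_pos_of_neg_of_neg h hx⟩
    · obtain ⟨x, hx⟩ := hT.exists_pos
      exact ⟨x, by rw [e2]; exact mul_pos h hx⟩
  · rcases lt_or_gt_of_ne hρ0 with h | h
    · obtain ⟨x, hx⟩ := hT.exists_pos
      exact ⟨x, by rw [e2]; exact mul_neg_of_neg_of_pos h hx⟩
    · obtain ⟨x, hx⟩ := hT.exists_neg
      exact ⟨x, by rw [e2]; exact mul_neg_of_pos_of_neg h hx⟩

end Product

namespace IsMongeUmbilic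

variable {h : E2 → ℝ} {U : Set E2} {b c B K : ℝ}

lemma fderiv_shift_curvT (H : IsMongeUmbilic h U b c B K) (m : ℝ) {y : E2 × ℝ}
    (hy : y.1 ∈ U) (w : E2 × ℝ) :
    fderiv ℝ (fun y => curvT h (y + (0, m))) y w =
      fderiv ℝ (coeffL h) y.1 w.1 * (y.2 + m) ^ 2 + fderiv ℝ (coeffM h) y.1 w.1 * (y.2 + m) +
        fderiv ℝ (coeffN h) y.1 w.1 + w.2 * (2 * coeffL h y.1 * (y.2 + m) + coeffM h y.1) := by
  rw [fderiv_comp_add_right, H.fderiv_curvT (y := y + (0, m)) (by simpa using hy)]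
  simp

lemma contDiffAt_shift_curvT (H : IsMongeUmbilic h U b c B K) (m : ℝ) :
    ContDiffAt ℝ (3 : ℕ) (fun y => curvT h (y + (0, m))) (0, 0) :=
  ContDiffAt.comp (g := curvT h) (0, 0) (H.contDiffAt_curvT (by simpa using H.zero_mem))
    (contDiffAt_id.add contDiffAt_const)

lemma fderiv_shift_curvT_zero (H : IsMongeUmbilic h U b c B K) (m : ℝ) (w : E2 × ℝ) :
    fderiv ℝ (fun y => curvT h (y + (0, m))) (0, 0) w = (b * (1 - m ^ 2) + c * m) * w.1 1 := by
  rw [H.fderiv_shift_curvT m H.zero_mem]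
  simp [fderiv_apply_e2, H.jetL.zero, H.jetM.zero, H.jetL.du_zero, H.jetM.du_zero, H.jetN.du_zero,
    H.jetL.dv_zero, H.jetM.dv_zero, H.jetN.dv_zero]
  ring

lemma hasFDerivAt_fst_comp {g : E2 → ℝ} (hg : ContDiffAt ℝ (1 : ℕ) g 0) :
    HasFDerivAt (fun y : E2 × ℝ => g y.1)
      ((fderiv ℝ g 0).comp (ContinuousLinearMap.fst ℝ E2 ℝ)) (0, 0) :=
  HasFDerivAt.comp (g := g) ((0, 0) : E2 × ℝ) (hg.differentiableAt (by norm_num)).hasFDerivAt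
    hasFDerivAt_fst

lemma hessian_shift_curvT (H : IsMongeUmbilic h U b c B K) (m : ℝ) (x : E2 × ℝ) (w : E2)
    (z : ℝ) :
    fderiv ℝ (fderiv ℝ (fun y => curvT h (y + (0, m)))) (0, 0) x (w, z) =
      w 0 * ((m ^ 2 * fderiv ℝ (du (coeffL h)) 0 x.1 + m * fderiv ℝ (du (coeffM h)) 0 x.1 +
        fderiv ℝ (du (coeffN h)) 0 x.1)) +
      w 1 * ((m ^ 2 * fderiv ℝ (dv (coeffL h)) 0 x.1 + m * fderiv ℝ (dv (coeffM h)) 0 x.1 +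
        fderiv ℝ (dv (coeffN h)) 0 x.1) + x.2 * (c - 2 * b * m)) +
      z * ((c - 2 * b * m) * x.1 1) := by
  have hC2 : ContDiffAt ℝ 2 (fun y => curvT h (y + (0, m))) (0, 0) :=
    (H.contDiffAt_shift_curvT m).of_le (by norm_cast)
  rw [← fderiv_fderiv_apply hC2]
  have hev : (fun y => fderiv ℝ (fun y => curvT h (y + (0, m))) y (w, z)) =ᶠ[𝓝 (0, 0)] fun y =>
      (w 0 * du (coeffL h) y.1 + w 1 * dv (coeffL h) y.1) * (y.2 + m) ^ 2 +
      (w 0 * du (coeffM h) y.1 + w 1 * dv (coeffM h) y.1) * (y.2 + m) +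
      (w 0 * du (coeffN h) y.1 + w 1 * dv (coeffN h) y.1) +
      z * (2 * coeffL h y.1 * (y.2 + m) + coeffM h y.1) := by
    filter_upwards [H.eventually_mem] with y hy
    rw [H.fderiv_shift_curvT m hy, fderiv_apply_e2, fderiv_apply_e2, fderiv_apply_e2]
  obtain ⟨h1, h2, h3⟩ := contDiffAt_coeff H.smooth H.zero_mem
  have eu : ∀ g : E2 → ℝ, ContDiffAt ℝ (3 : ℕ) g 0 → _ := fun g hg =>
    hasFDerivAt_fst_comp (g := du g) ((ContDiffAt.du (n := 2) hg).of_le (by norm_cast))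
  have ev : ∀ g : E2 → ℝ, ContDiffAt ℝ (3 : ℕ) g 0 → _ := fun g hg =>
    hasFDerivAt_fst_comp (g := dv g) ((ContDiffAt.dv (n := 2) hg).of_le (by norm_cast))
  have e : ∀ g : E2 → ℝ, ContDiffAt ℝ (3 : ℕ) g 0 → _ := fun g hg =>
    hasFDerivAt_fst_comp (g := g) (hg.of_le (by norm_cast))
  have s1 : HasFDerivAt (fun y : E2 × ℝ => y.2 + m) (ContinuousLinearMap.snd ℝ E2 ℝ) (0, 0) :=
    hasFDerivAt_snd.add_const m
  have uv : ∀ g : E2 → ℝ, ContDiffAt ℝ (3 : ℕ) g 0 → _ := fun g hg =>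
    ((eu g hg).const_mul (w 0)).fun_add ((ev g hg).const_mul (w 1))
  have := ((((uv _ h1).fun_mul (s1.pow 2)).fun_add ((uv _ h2).fun_mul s1)).fun_add
    (uv _ h3)).fun_add (((((e _ h1).const_mul 2).fun_mul s1).fun_add (e _ h2)).const_mul z)
  rw [hev.fderiv_eq, this.fderiv]
  simp [fderiv_apply_e2 (coeffL h), fderiv_apply_e2 (coeffM h), H.jetL.zero, H.jetL.du_zero,
    H.jetM.du_zero, H.jetL.dv_zero, H.jetM.dv_zero]
  ring

lemma isMorseCone_shift_curvT (H : IsMongeUmbilic h U b c B K) {m : ℝ}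
    (hm : b * (1 - m ^ 2) + c * m = 0) :
    IsMorseCone (fun y => curvT h (y + (0, m))) (0, 0) := by
  have hb := H.b_ne
  have hq : c - 2 * b * m ≠ 0 := fun h0 => by
    have h1 : (c - 2 * b * m) ^ 2 = c ^ 2 + 4 * b ^ 2 := by linear_combination (-4 * b) * hm
    rw [h0] at h1
    have : 0 < b ^ 2 := by positivity
    nlinarith [sq_nonneg c]
  have hm0 : m ≠ 0 := fun h0 => by
    rw [h0] at hm
    exact hb (by linarith)
  have huu : m ^ 2 * du (du (coeffL h)) 0 + m * du (du (coeffM h)) 0 + du (du (coeffN h)) 0 ≠ 0 := by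
    rw [H.jetL.du_du, H.jetM.du_du, H.jetN.du_du]
    intro h0
    have h1 : m * (b * K - c * B) = 0 := by linear_combination b * h0 - B * hm
    exact (mul_ne_zero hm0 H.chi_ne) h1
  have e := H.hessian_shift_curvT m
  refine ⟨⟨(H.contDiffAt_shift_curvT m).of_le (by norm_cast), ?_, ?_, fun x hx => ?_⟩, ?_, ?_⟩
  · simp [curvT, H.jetL.zero, H.jetM.zero, H.jetN.zero]
  · ext1
    · ext w; simp [H.fderiv_shift_curvT_zero, hm]
    · ext; simp [H.fderiv_shift_curvT_zero]
  · have h1 := hx (0, 1)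
    rw [e] at h1
    have hx1 : x.1 1 = 0 := by simpa [hq] using h1
    have h2 := hx (!₂[1, 0], 0)
    rw [e] at h2
    have hx0 : x.1 0 = 0 := by
      simp only [fderiv_apply_e2, hx1] at h2
      have : x.1 0 * (m ^ 2 * du (du (coeffL h)) 0 + m * du (du (coeffM h)) 0 +
          du (du (coeffN h)) 0) = 0 := by
        simp at h2
        linear_combination h2
      exact (mul_eq_zero.1 this).resolve_right huu
    have hx10 : x.1 = 0 := by ext i; fin_cases i; exacts [hx0, hx1]
    have h3 := hx (!₂[0, 1], 0)
    rw [e, hx10] at h3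
    have hx2 : x.2 = 0 := by simpa [hq] using h3
    exact Prod.ext hx10 hx2
  all_goals
    set V := m ^ 2 * fderiv ℝ (dv (coeffL h)) 0 !₂[0, 1] +
      m * fderiv ℝ (dv (coeffM h)) 0 !₂[0, 1] + fderiv ℝ (dv (coeffN h)) 0 !₂[0, 1] with hV
    have key : ∀ t : ℝ, fderiv ℝ (fderiv ℝ (fun y => curvT h (y + (0, m)))) (0, 0)
        (!₂[0, 1], t / (2 * (c - 2 * b * m))) (!₂[0, 1], t / (2 * (c - 2 * b * m))) = V + t :=
      fun t => by
      rw [e, hV]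
      generalize c - 2 * b * m = q at hq
      simp
      field_simp
      ring
  · exact ⟨_, by rw [key (1 - V)]; norm_num⟩
  · exact ⟨_, by rw [key (-1 - V)]; norm_num⟩

/-- The geodesic torsion of the graph, up to sign. -/
noncomputable def _root_.graphTorsion (h : E2 → ℝ) (ℓ : OnePoint ℝ) (y : E2 × ℝ) : ℝ :=
  (areaSq h y.1 * firstForm h y.1 (affineDirection ℓ y.2))⁻¹ *
    principalForm h y.1 (affineDirection ℓ y.2)

lemma contDiff_affineDirection (ℓ : OnePoint ℝ) : ContDiff ℝ 2 (affineDirection ℓ) := by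
  refine contDiff_euclidean.2 fun i => ?_
  induction ℓ using OnePoint.rec <;> fin_cases i <;> simp [affineDirection] <;> fun_prop

lemma affineDirection_ne_zero (ℓ : OnePoint ℝ) (s : ℝ) : affineDirection ℓ s ≠ 0 := by
  intro hc
  induction ℓ using OnePoint.rec
  · have := congrArg (fun x : E2 => x 1) hc
    simp [affineDirection] at this
  · have := congrArg (fun x : E2 => x 0) hc
    simp [affineDirection] at this

lemma contDiffAt_density (H : IsMongeUmbilic h U b c B K) (ℓ : OnePoint ℝ) :
    ContDiffAt ℝ 2 (fun y : E2 × ℝ =>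
      (areaSq h y.1 * firstForm h y.1 (affineDirection ℓ y.2))⁻¹) (0, 0) ∧
    (areaSq h 0 * firstForm h 0 (affineDirection ℓ 0))⁻¹ ≠ 0 := by
  have hpos : 0 < areaSq h 0 * firstForm h 0 (affineDirection ℓ 0) :=
    mul_pos (areaSq_pos h 0) (firstForm_pos h 0 (affineDirection_ne_zero ℓ 0))
  have hu : ContDiffAt ℝ 2 (fun y : E2 × ℝ => du h y.1) (0, 0) :=
    ContDiffAt.comp (g := du h) ((0, 0) : E2 × ℝ)
      ((ContDiffAt.du (n := 4) (H.smooth 0 H.zero_mem)).of_le (by norm_cast)) contDiffAt_fst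
  have hv : ContDiffAt ℝ 2 (fun y : E2 × ℝ => dv h y.1) (0, 0) :=
    ContDiffAt.comp (g := dv h) ((0, 0) : E2 × ℝ)
      ((ContDiffAt.dv (n := 4) (H.smooth 0 H.zero_mem)).of_le (by norm_cast)) contDiffAt_fst
  have ha : ∀ i, ContDiffAt ℝ 2 (fun y : E2 × ℝ => affineDirection ℓ y.2 i) (0, 0) := fun i =>
    (contDiff_euclidean.1 (contDiff_affineDirection ℓ) i).contDiffAt.comp ((0, 0) : E2 × ℝ)
      contDiffAt_snd
  refine ⟨ContDiffAt.inv ?_ hpos.ne', inv_ne_zero hpos.ne'⟩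
  exact ((contDiffAt_const.add (hu.pow 2)).add (hv.pow 2)).mul
    ((((ha 0).pow 2).add ((ha 1).pow 2)).add (((hu.mul (ha 0)).add (hv.mul (ha 1))).pow 2))

theorem torsion_critical (H : IsMongeUmbilic h U b c B K) {ℓ : OnePoint ℝ} {f : E2 × ℝ → ℝ}
    {δ : ℝ} (hδ : δ ≠ 0) (hf : f =ᶠ[𝓝 (0, 0)] fun y => δ * graphTorsion h ℓ y) :
    (fderiv ℝ f (0, 0) = 0 ↔ ∃ m : ℝ, ℓ = m ∧ b * (1 - m ^ 2) + c * m = 0) ∧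
      (fderiv ℝ f (0, 0) = 0 → IsMorseCone f (0, 0)) := by
  obtain ⟨hρ, hρ0⟩ := H.contDiffAt_density ℓ
  set ρ : E2 × ℝ → ℝ := fun y => δ *
    (areaSq h y.1 * firstForm h y.1 (affineDirection ℓ y.2))⁻¹ with hρd
  replace hρ : ContDiffAt ℝ 2 ρ (0, 0) := contDiffAt_const.mul hρ
  replace hρ0 : ρ (0, 0) ≠ 0 := mul_ne_zero hδ hρ0
  induction ℓ using OnePoint.rec with
  | infty =>
    have hne : fderiv ℝ f (0, 0) ≠ 0 := by
      obtain ⟨h1, h2, h3⟩ := contDiffAt_coeff H.smooth H.zero_mem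
      have e : ∀ g : E2 → ℝ, ContDiffAt ℝ (3 : ℕ) g 0 → _ := fun g hg =>
        hasFDerivAt_fst_comp (g := g) (hg.of_le (by norm_cast))
      have s1 : HasFDerivAt (fun y : E2 × ℝ => y.2) (ContinuousLinearMap.snd ℝ E2 ℝ) (0, 0) :=
        hasFDerivAt_snd
      have hT := ((e _ h1).fun_add ((e _ h2).fun_mul s1)).fun_add ((e _ h3).fun_mul (s1.pow 2))
      have hf' : f =ᶠ[𝓝 (0, 0)] fun y => ρ y *
          (coeffL h y.1 + coeffM h y.1 * y.2 + coeffN h y.1 * y.2 ^ 2) := by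
        refine hf.trans (Eventually.of_forall fun y => ?_)
        simp [hρd, graphTorsion, principalForm, affineDirection]
        ring
      rw [hf'.fderiv_eq, fderiv_mul_of_eq_zero (hρ.differentiableAt (by norm_num))
        hT.differentiableAt (by simp [H.jetL.zero]), hT.fderiv]
      intro hc
      have := congrArg (fun F : (E2 × ℝ) →L[ℝ] ℝ => F (!₂[0, 1], 0)) hc
      simp [fderiv_apply_e2, H.jetL.dv_zero, H.b_ne] at this
      exact hρ0 this
    refine ⟨⟨fun h0 => absurd h0 hne, ?_⟩, fun h0 => absurd h0 hne⟩
    rintro ⟨m, hm, -⟩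
    exact absurd hm (OnePoint.infty_ne_coe m)
  | coe m =>
    have hf' : f =ᶠ[𝓝 (0, 0)] fun y => ρ y * curvT h (y + (0, m)) := by
      refine hf.trans (Eventually.of_forall fun y => ?_)
      simp [hρd, graphTorsion, principalForm, affineDirection, curvT]
      ring
    have h0 : curvT h ((0, 0) + (0, m)) = 0 := by
      simp [curvT, H.jetL.zero, H.jetM.zero, H.jetN.zero]
    have hd := fderiv_mul_of_eq_zero (hρ.differentiableAt (by norm_num))
      ((H.contDiffAt_shift_curvT m).differentiableAt (by norm_num)) h0
    have key : fderiv ℝ f (0, 0) = 0 ↔ b * (1 - m ^ 2) + c * m = 0 := by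
      rw [hf'.fderiv_eq, hd, smul_eq_zero, or_iff_right hρ0]
      constructor
      · intro hc
        have := H.fderiv_shift_curvT_zero m (!₂[0, 1], 0)
        rw [hc] at this
        simpa using this.symm
      · intro hm
        exact (H.isMorseCone_shift_curvT hm).critical
    refine ⟨key.trans ⟨fun hm => ⟨m, rfl, hm⟩, ?_⟩, fun hc => ?_⟩
    · rintro ⟨m', hm', h1⟩
      rw [OnePoint.coe_eq_coe] at hm'
      rwa [hm']
    · exact (H.isMorseCone_shift_curvT (key.1 hc)).of_eventuallyEq_mul hf' hρ hρ0

lemma ncard_critical_slopes (hb : b ≠ 0) :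
    {ℓ : OnePoint ℝ | ∃ m : ℝ, ℓ = m ∧ b * (1 - m ^ 2) + c * m = 0}.ncard = 2 := by
  have hpos : 0 < c ^ 2 + 4 * b ^ 2 := by positivity
  have hsq := Real.sq_sqrt hpos.le
  set q := √(c ^ 2 + 4 * b ^ 2)
  have hq : 0 < q := Real.sqrt_pos.2 hpos
  have : {ℓ : OnePoint ℝ | ∃ m : ℝ, ℓ = m ∧ b * (1 - m ^ 2) + c * m = 0} =
      {(((c + q) / (2 * b) : ℝ) : OnePoint ℝ), (((c - q) / (2 * b) : ℝ) : OnePoint ℝ)} := by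
    ext ℓ
    simp only [mem_ofPred_eq, mem_insert_iff, mem_singleton_iff]
    constructor
    · rintro ⟨m, rfl, hm⟩
      rw [OnePoint.coe_eq_coe, OnePoint.coe_eq_coe, eq_div_iff (by positivity),
        eq_div_iff (by positivity)]
      have : (m * (2 * b) - (c + q)) * (m * (2 * b) - (c - q)) = 0 := by
        linear_combination (-4 * b) * hm - hsq
      rcases mul_eq_zero.1 this with h | h
      · left; linarith
      · right; linarith
    · rintro (rfl | rfl)
      · refine ⟨_, rfl, ?_⟩
        field_simp
        linear_combination -hsq
      · refine ⟨_, rfl, ?_⟩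
        field_simp
        linear_combination -hsq
  rw [this, ncard_pair]
  rw [Ne, OnePoint.coe_eq_coe, div_left_inj' (by positivity)]
  intro hc
  linarith

end IsMongeUmbilic

/-- The eigenvector equation `H w = κ I w` for the second fundamental form `H = (e, f; f, g)` relative
to the first fundamental form of a graph of slopes `(p, q)`, at `w = (s, t)`. -/
def ShapeEq (p q e f g κ s t : ℝ) : Prop :=
  e * s + f * t = κ * ((1 + p ^ 2) * s + p * q * t) ∧
    f * s + g * t = κ * (p * q * s + (1 + q ^ 2) * t)

namespace ShapeEq

variable {p q e f g κ κ₁ κ₂ s t s₁ t₁ s₂ t₂ : ℝ}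

lemma exists_of_form (h : (p * q * g - (1 + q ^ 2) * f) * t ^ 2 +
    ((1 + p ^ 2) * g - (1 + q ^ 2) * e) * (s * t) + ((1 + p ^ 2) * f - p * q * e) * s ^ 2 = 0)
    (h0 : s ≠ 0 ∨ t ≠ 0) : ∃ κ, ShapeEq p q e f g κ s t := by
  set a₁ := (1 + p ^ 2) * s + p * q * t with ha₁
  set a₂ := p * q * s + (1 + q ^ 2) * t with ha₂
  have hpos : a₁ ^ 2 + a₂ ^ 2 ≠ 0 := by
    intro hc
    have h1 : a₁ = 0 := by nlinarith [sq_nonneg a₁, sq_nonneg a₂]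
    have h2 : a₂ = 0 := by nlinarith [sq_nonneg a₁, sq_nonneg a₂]
    have h3 : s ^ 2 + t ^ 2 + (p * s + q * t) ^ 2 = 0 := by
      linear_combination s * (ha₁.symm.trans h1) + t * (ha₂.symm.trans h2)
    rcases h0 with h0 | h0
    · have : 0 < s ^ 2 := by positivity
      nlinarith [sq_nonneg t, sq_nonneg (p * s + q * t)]
    · have : 0 < t ^ 2 := by positivity
      nlinarith [sq_nonneg s, sq_nonneg (p * s + q * t)]
  have hdet : a₁ * (f * s + g * t) - a₂ * (e * s + f * t) = 0 := by
    rw [← h]; simp only [ha₁, ha₂]; ring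
  refine ⟨(a₁ * (e * s + f * t) + a₂ * (f * s + g * t)) / (a₁ ^ 2 + a₂ ^ 2), ?_, ?_⟩
  · rw [← ha₁]
    field_simp
    linear_combination -a₂ * hdet
  · rw [← ha₂]
    field_simp
    linear_combination a₁ * hdet

lemma inner_eq (h : ShapeEq p q e f g κ s t) (h₁ : ShapeEq p q e f g κ₁ s₁ t₁) (hne : κ ≠ κ₁) :
    s * s₁ + t * t₁ + (p * s + q * t) * (p * s₁ + q * t₁) = 0 := by
  have : (κ - κ₁) * (s * s₁ + t * t₁ + (p * s + q * t) * (p * s₁ + q * t₁)) = 0 := by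
    linear_combination -(s₁ * h.1 + t₁ * h.2) + s * h₁.1 + t * h₁.2
  exact (mul_eq_zero.1 this).resolve_left (sub_ne_zero.2 hne)

lemma sub_mul_eq (h₁ : ShapeEq p q e f g κ₁ s₁ t₁) (h₂ : ShapeEq p q e f g κ₂ s₂ t₂) :
    (κ₂ - κ₁) * (1 + p ^ 2 + q ^ 2) * (s₁ * t₂ - t₁ * s₂) =
      2 * ((1 + p ^ 2) * f - p * q * e) * (s₁ * s₂) +
      ((1 + p ^ 2) * g - (1 + q ^ 2) * e) * (s₁ * t₂ + t₁ * s₂) +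
      2 * (p * q * g - (1 + q ^ 2) * f) * (t₁ * t₂) := by
  linear_combination (p * q * s₂ + (1 + q ^ 2) * t₂) * h₁.1 - ((1 + p ^ 2) * s₂ + p * q * t₂) * h₁.2
    + (p * q * s₁ + (1 + q ^ 2) * t₁) * h₂.1 - ((1 + p ^ 2) * s₁ + p * q * t₁) * h₂.2

lemma smul (h : ShapeEq p q e f g κ s t) (c : ℝ) : ShapeEq p q e f g κ (c * s) (c * t) :=
  ⟨by linear_combination c * h.1, by linear_combination c * h.2⟩

lemma eq_or_eq (h₁ : ShapeEq p q e f g κ₁ s₁ t₁) (h₂ : ShapeEq p q e f g κ₂ s₂ t₂)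
    (hΔ : s₁ * t₂ - t₁ * s₂ ≠ 0) (h : ShapeEq p q e f g κ s t) (h0 : s ≠ 0 ∨ t ≠ 0) : κ = κ₁ ∨ κ = κ₂ := by
  by_contra! hc
  have e1 := h.inner_eq h₁ hc.1
  have e2 := h.inner_eq h₂ hc.2
  set a₁ := (1 + p ^ 2) * s + p * q * t with ha₁
  set a₂ := p * q * s + (1 + q ^ 2) * t with ha₂
  have h1 : a₁ = 0 := by
    have : a₁ * (s₁ * t₂ - t₁ * s₂) = 0 := by
      simp only [ha₁]; linear_combination t₂ * e1 - t₁ * e2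
    exact (mul_eq_zero.1 this).resolve_right hΔ
  have h2 : a₂ = 0 := by
    have : a₂ * (s₁ * t₂ - t₁ * s₂) = 0 := by
      simp only [ha₂]; linear_combination s₁ * e2 - s₂ * e1
    exact (mul_eq_zero.1 this).resolve_right hΔ
  have h3 : s ^ 2 + t ^ 2 + (p * s + q * t) ^ 2 = 0 := by
    linear_combination s * (ha₁.symm.trans h1) + t * (ha₂.symm.trans h2)
  rcases h0 with h0 | h0
  · have : 0 < s ^ 2 := by positivity
    nlinarith [sq_nonneg t, sq_nonneg (p * s + q * t)]
  · have : 0 < t ^ 2 := by positivity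
    nlinarith [sq_nonneg s, sq_nonneg (p * s + q * t)]

lemma iff_collinear (h₁ : ShapeEq p q e f g κ₁ s₁ t₁) (h₂ : ShapeEq p q e f g κ₂ s₂ t₂)
    (hκ : κ₁ ≠ κ₂) (hΔ : s₁ * t₂ - t₁ * s₂ ≠ 0) :
     ShapeEq p q e f g κ₁ s t ↔ s * t₁ = t * s₁ := by
  constructor
  · intro h
    have e1 := h.inner_eq h₂ hκ
    have e2 := h₁.inner_eq h₂ hκ
    set a₁ := (1 + p ^ 2) * s₂ + p * q * t₂ with ha₁
    set a₂ := p * q * s₂ + (1 + q ^ 2) * t₂ with ha₂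
    have h1 : (s * t₁ - t * s₁) * a₁ = 0 := by
      simp only [ha₁]; linear_combination t₁ * e1 - t * e2
    have h2 : (s * t₁ - t * s₁) * a₂ = 0 := by
      simp only [ha₂]; linear_combination s * e2 - s₁ * e1
    by_contra hc
    have h3 := (mul_eq_zero.1 h1).resolve_left (sub_ne_zero.2 hc)
    have h4 := (mul_eq_zero.1 h2).resolve_left (sub_ne_zero.2 hc)
    have h5 : s₂ ^ 2 + t₂ ^ 2 + (p * s₂ + q * t₂) ^ 2 = 0 := by
      linear_combination s₂ * (ha₁.symm.trans h3) + t₂ * (ha₂.symm.trans h4)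
    have h6 : s₂ = 0 := by nlinarith [sq_nonneg s₂, sq_nonneg t₂, sq_nonneg (p * s₂ + q * t₂)]
    have h7 : t₂ = 0 := by nlinarith [sq_nonneg s₂, sq_nonneg t₂, sq_nonneg (p * s₂ + q * t₂)]
    exact hΔ (by rw [h6, h7]; ring)
  · intro h
    have h0 : s₁ ≠ 0 ∨ t₁ ≠ 0 := by
      by_contra! hc
      exact hΔ (by rw [hc.1, hc.2]; ring)
    rcases h0 with h0 | h0
    · have := h₁.smul (s / s₁)
      rwa [div_mul_cancel₀ _ h0, div_mul_eq_mul_div, h, mul_div_cancel_right₀ _ h0] at this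
    · have := h₁.smul (t / t₁)
      rwa [div_mul_cancel₀ _ h0, div_mul_eq_mul_div, ← h, mul_div_cancel_right₀ _ h0] at this

end ShapeEq

/-- `w` is a principal direction at `x` of the graph of `h`, with normalized curvature `κ`. -/
def IsCurvatureVector (h : E2 → ℝ) (x : E2) (κ : ℝ) (w : E2) : Prop :=
  ShapeEq (du h x) (dv h x) (du (du h) x) (dv (du h) x) (dv (dv h) x) κ (w 0) (w 1)

lemma e2_ne_zero_iff {w : E2} : w ≠ 0 ↔ w 0 ≠ 0 ∨ w 1 ≠ 0 := by
  constructor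
  · intro hw
    by_contra! hc
    exact hw (by ext i; fin_cases i; exacts [hc.1, hc.2])
  · rintro (h | h) rfl <;> exact h rfl

lemma isCurvatureVector_iff {h : E2 → ℝ} {x : E2} (hh : ContDiffAt ℝ (5 : ℕ) h x) {ε κ : ℝ}
    (hε : ε * ε = 1) (w : E2) :
    ε • fderiv ℝ (unitNormal h) x w + κ • graphDeriv h x w = 0 ↔
      IsCurvatureVector h x (ε * √(areaSq h x) * κ) w := by
  obtain ⟨hd, hw⟩ := fderiv_unitNormal hh
  obtain ⟨t, ht⟩ := hw w
  have hW : 0 < √(areaSq h x) := Real.sqrt_pos.2 (areaSq_pos h x)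
  have hW2 : √(areaSq h x) ^ 2 = areaSq h x := Real.sq_sqrt (areaSq_pos h x).le
  have horth : inner ℝ (fderiv ℝ (unitNormal h) x w) (graphNormal h x) = 0 := by
    have hc : HasFDerivAt (fun y => inner ℝ (unitNormal h y) (unitNormal h y))
        (0 : E2 →L[ℝ] ℝ) x := by
      refine (hasFDerivAt_const (1 : ℝ) x).congr_of_eventuallyEq (Eventually.of_forall fun y => ?_)
      have : √(areaSq h y) ^ 2 = areaSq h y := Real.sq_sqrt (areaSq_pos h y).le
      have h0 : 0 < √(areaSq h y) := Real.sqrt_pos.2 (areaSq_pos h y)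
      simp only [unitNormal]
      rw [real_inner_smul_left, real_inner_smul_right, norm_unitNormal_inner]
      field_simp
      exact this.symm
    have h1 := (hd.hasFDerivAt.inner ℝ hd.hasFDerivAt).unique hc
    have h2 := congrArg (fun F : E2 →L[ℝ] ℝ => F w) h1
    simp only [ContinuousLinearMap.comp_apply, ContinuousLinearMap.prod_apply,
      fderivInnerCLM_apply, zero_apply] at h2
    have h3 : inner ℝ (fderiv ℝ (unitNormal h) x w) (unitNormal h x) = 0 := by
      rw [real_inner_comm] at h2
      linarith
    have h4 : (√(areaSq h x))⁻¹ * inner ℝ (fderiv ℝ (unitNormal h) x w) (graphNormal h x) = 0 := by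
      rw [← h3]
      exact (real_inner_smul_right _ _ _).symm
    exact (mul_eq_zero.1 h4).resolve_left (inv_ne_zero hW.ne')
  set V := ε • fderiv ℝ (unitNormal h) x w + κ • graphDeriv h x w with hV
  set W := √(areaSq h x) with hWd
  have h2 : inner ℝ V (graphNormal h x) = 0 := by
    rw [hV, inner_add_left, real_inner_smul_left, horth, real_inner_smul_left, inner_e3]
    simp [graphDeriv, graphNormal]
    right
    ring
  have h0 : V 0 + du h x * V 2 = ε / W * (-(du (du h) x * w 0 + dv (du h) x * w 1) +
      ε * W * κ * ((1 + du h x ^ 2) * w 0 + du h x * dv h x * w 1)) := by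
    rw [hV, ht]
    simp [graphDeriv, graphNormal, graphNormalDeriv]
    field_simp
    linear_combination (-(κ * W * ((1 + du h x ^ 2) * w 0 + du h x * dv h x * w 1))) * hε
  have h1 : V 1 + dv h x * V 2 = ε / W * (-(dv (du h) x * w 0 + dv (dv h) x * w 1) +
      ε * W * κ * (du h x * dv h x * w 0 + (1 + dv h x ^ 2) * w 1)) := by
    rw [hV, ht]
    simp [graphDeriv, graphNormal, graphNormalDeriv]
    field_simp
    linear_combination (-(κ * W * (du h x * dv h x * w 0 + (1 + dv h x ^ 2) * w 1))) * hε
  have hεW : ε / W ≠ 0 := div_ne_zero (fun hc => by simp [hc] at hε) hW.ne'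
  constructor
  · intro hV0
    rw [hV0] at h0 h1
    simp only [PiLp.zero_apply, mul_zero, add_zero] at h0 h1
    have h3 := (mul_eq_zero.1 h0.symm).resolve_left hεW
    have h4 := (mul_eq_zero.1 h1.symm).resolve_left hεW
    exact ⟨by linarith, by linarith⟩
  · intro hS
    have h3 : V 0 + du h x * V 2 = 0 := by rw [h0, mul_eq_zero]; right; linarith [hS.1]
    have h4 : V 1 + dv h x * V 2 = 0 := by rw [h1, mul_eq_zero]; right; linarith [hS.2]
    rw [inner_e3] at h2
    simp [graphNormal] at h2
    have h5 : V 2 * areaSq h x = 0 := by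
      unfold areaSq; linear_combination h2 + du h x * h3 + dv h x * h4
    have h6 := (mul_eq_zero.1 h5).resolve_right (areaSq_pos h x).ne'
    rw [h6] at h3 h4
    ext i
    fin_cases i
    · simpa using h3
    · simpa using h4
    · exact h6

namespace IsMongeUmbilic

variable {h : E2 → ℝ} {U : Set E2} {b c B K : ℝ}

/-- At the umbilic every direction is principal. -/
lemma exists_isCurvatureVector_zero (H : IsMongeUmbilic h U b c B K) :
    ∃ κ₀, ∀ κ, (∃ w, w ≠ 0 ∧ IsCurvatureVector h 0 κ w) ↔ κ = κ₀ := by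
  have hL := H.jetL.zero
  have hM := H.jetM.zero
  have hN := H.jetN.zero
  simp only [coeffL, coeffM, coeffN] at hL hM hN
  set p := du h 0
  set q := dv h 0
  set e := du (du h) 0
  set f := dv (du h) 0
  set g := dv (dv h) 0
  have hp : 0 < 1 + p ^ 2 := by positivity
  have e1 : e = e / (1 + p ^ 2) * (1 + p ^ 2) := by field_simp
  have e2 : f = e / (1 + p ^ 2) * (p * q) := by field_simp; linarith
  have e3 : g = e / (1 + p ^ 2) * (1 + q ^ 2) := by field_simp; linarith
  set κ₀ := e / (1 + p ^ 2)
  have hall : ∀ w : E2, IsCurvatureVector h 0 κ₀ w := fun w =>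
    ⟨by change e * _ + f * _ = _; rw [e1, e2]; ring, by change f * _ + g * _ = _; rw [e2, e3]; ring⟩
  refine ⟨κ₀, fun κ => ⟨?_, ?_⟩⟩
  · rintro ⟨w, hw, hκ⟩
    by_contra hne
    have := ShapeEq.inner_eq hκ (hall w) hne
    have h1 := firstForm_pos h 0 hw
    unfold firstForm at h1
    nlinarith
  · rintro rfl
    exact ⟨!₂[1, 0], e2_ne_zero_iff.2 (Or.inl (by simp)), hall _⟩

/-- The two principal line fields of the graph in normalized coordinates. -/
theorem exists_principal_fields (H : IsMongeUmbilic h U b c B K) :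
    ∃ s τ r L A : ℝ, ∃ m n : ℝ → ℝ → ℝ, |s| = 1 ∧ |τ| = 1 ∧ IsLocalPair m n r L A ∧
      ∀ u v, |u| ≤ r → |v| ≤ r → (!₂[τ * u, v] : E2) ∈ U ∧ ((u ≠ 0 ∨ v ≠ 0) →
        ∃ κ₁ κ₂, 0 < s * (κ₂ - κ₁) ∧
          (∀ κ, (∃ w, w ≠ 0 ∧ IsCurvatureVector h !₂[τ * u, v] κ w) ↔ κ = κ₁ ∨ κ = κ₂) ∧
          (∀ w, IsCurvatureVector h !₂[τ * u, v] κ₁ w ↔ w 1 = m u v * (τ * w 0)) ∧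
          (∀ w, IsCurvatureVector h !₂[τ * u, v] κ₂ w ↔ τ * w 0 = n u v * w 1)) := by
  obtain ⟨s, τ, hs, hτ, hsb, C, r₀, hU, hj⟩ := H.exists_isPrincipalJet
  obtain ⟨r, hr, hrr, L, A, hpos, hloc⟩ := hj.exists_isLocalPair
  refine ⟨s, τ, r, L, A, _, _, hs, hτ, hloc, fun u v hu hv => ⟨hU _ _ ?_ (hv.trans hrr), fun h0 => ?_⟩⟩
  · rw [abs_mul, hτ, one_mul]; exact hu.trans hrr
  obtain ⟨hδ, hD⟩ := hpos u v hu hv h0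
  have hττ := mul_self_of_abs_eq_one hτ
  have hss := mul_self_of_abs_eq_one hs
  set X : E2 := !₂[τ * u, v]
  have hm1 := slopeRoot_eq_zero hδ.le hD.ne'
  have hδ' : (s * coeffM h X) ^ 2 - 4 * (s * τ * coeffN h X) * (s * τ * coeffL h X) =
      (s * coeffM h X) ^ 2 - 4 * (s * τ * coeffL h X) * (s * τ * coeffN h X) := by ring
  have hn1 := slopeRoot_eq_zero (l := s * τ * coeffN h X) (m := s * coeffM h X)
    (n := s * τ * coeffL h X) (by rw [hδ']; exact hδ.le) (by rw [hδ']; exact hD.ne')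
  have hm2 := two_mul_slopeRoot hδ.le hD.ne'
  have hn2 := two_mul_slopeRoot (l := s * τ * coeffN h X) (m := s * coeffM h X)
    (n := s * τ * coeffL h X) (by rw [hδ']; exact hδ.le) (by rw [hδ']; exact hD.ne')
  rw [hδ'] at hn2
  have hmn := slopeRoot_mul_slopeRoot hδ.le hD.ne'
  have hsqrt := Real.sqrt_pos.2 hδ
  set σ := √((s * coeffM h X) ^ 2 - 4 * (s * τ * coeffL h X) * (s * τ * coeffN h X)) with hσ
  set x := slopeRoot (s * τ * coeffL h X) (s * coeffM h X) (s * τ * coeffN h X)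
  set y := slopeRoot (s * τ * coeffN h X) (s * coeffM h X) (s * τ * coeffL h X)
  have hxy : 0 < 1 - x * y := by rw [hmn]; positivity
  have hpolar : 2 * (s * τ * coeffN h X) * y + s * coeffM h X * (1 + x * y) +
      2 * (s * τ * coeffL h X) * x = σ * (1 - x * y) := by
    have h1 : (1 - x * y) * (s * coeffM h X + σ) = 2 * σ := by rw [hmn]; field_simp
    linear_combination hn2 + hm2 - h1
  obtain ⟨κ₁, h₁⟩ := ShapeEq.exists_of_form (p := du h X) (q := dv h X) (e := du (du h) X)
    (f := dv (du h) X) (g := dv (dv h) X) (s := τ) (t := x) (by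
      change coeffL h X * x ^ 2 + coeffM h X * (τ * x) + coeffN h X * τ ^ 2 = 0
      linear_combination s * τ * hm1 - (coeffL h X * x ^ 2 * τ * τ + coeffN h X * τ * τ +
        coeffM h X * x * τ) * hss - coeffL h X * x ^ 2 * hττ)
    (Or.inl fun h => by simp [h] at hτ)
  obtain ⟨κ₂, h₂⟩ := ShapeEq.exists_of_form (p := du h X) (q := dv h X) (e := du (du h) X)
    (f := dv (du h) X) (g := dv (dv h) X) (s := τ * y) (t := 1) (by
      change coeffL h X * 1 ^ 2 + coeffM h X * (τ * y * 1) + coeffN h X * (τ * y) ^ 2 = 0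
      linear_combination s * τ * hn1 - (coeffN h X * y ^ 2 * τ * τ + coeffL h X * τ * τ +
        coeffM h X * y * τ) * hss - coeffL h X * hττ)
    (Or.inr one_ne_zero)
  have hsub := h₁.sub_mul_eq h₂
  have hW : 0 < 1 + du h X ^ 2 + dv h X ^ 2 := by positivity
  have hdet : τ * 1 - x * (τ * y) = τ * (1 - x * y) := by ring
  have hτ0 : τ ≠ 0 := fun h => by simp [h] at hτ
  have hΔ : τ * 1 - x * (τ * y) ≠ 0 := by rw [hdet]; exact mul_ne_zero hτ0 hxy.ne'
  have hgap : 0 < s * (κ₂ - κ₁) := by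
    have e : s * (κ₂ - κ₁) * (1 + du h X ^ 2 + dv h X ^ 2) * (1 - x * y) = σ * (1 - x * y) := by
      rw [← hpolar]
      change (κ₂ - κ₁) * (1 + du h X ^ 2 + dv h X ^ 2) * (τ * 1 - x * (τ * y)) =
        2 * coeffN h X * (τ * (τ * y)) + coeffM h X * (τ * 1 + x * (τ * y)) +
          2 * coeffL h X * (x * 1) at hsub
      linear_combination s * τ * hsub - (s * (κ₂ - κ₁) * (1 + du h X ^ 2 + dv h X ^ 2) *
        (1 - x * y) - s * coeffM h X * (1 + x * y) - 2 * s * τ * coeffN h X * y) * hττ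
    have e' := mul_right_cancel₀ hxy.ne' e
    by_contra hc
    have := mul_nonpos_of_nonpos_of_nonneg (not_lt.1 hc) hW.le
    linarith
  have hne : κ₁ ≠ κ₂ := fun h => by rw [h] at hgap; simp at hgap
  refine ⟨κ₁, κ₂, hgap, fun κ => ⟨?_, ?_⟩, fun w => ?_, fun w => ?_⟩
  · rintro ⟨w, hw, hκ⟩
    exact ShapeEq.eq_or_eq h₁ h₂ hΔ hκ (e2_ne_zero_iff.1 hw)
  · rintro (rfl | rfl)
    · exact ⟨!₂[τ, x], e2_ne_zero_iff.2 (Or.inl (by simpa using hτ0)), h₁⟩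
    · exact ⟨!₂[τ * y, 1], e2_ne_zero_iff.2 (Or.inr (by simp)), h₂⟩
  · refine (ShapeEq.iff_collinear h₁ h₂ hne hΔ).trans ⟨fun h => ?_, fun h => ?_⟩
    · linear_combination -τ * h - w 1 * hττ
    · linear_combination -τ * h - x * w 0 * hττ
  · have hΔ' : τ * y * x - 1 * τ ≠ 0 := fun hc => hΔ (by linarith)
    refine (ShapeEq.iff_collinear h₂ h₁ hne.symm hΔ').trans ⟨fun h => ?_, fun h => ?_⟩
    · linear_combination τ * h + y * w 1 * hττ
    · linear_combination τ * h - w 0 * hττ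

end IsMongeUmbilic

section Isometry

variable (Γ : E3 ≃ᵃⁱ[ℝ] E3)

lemma affineIsometry_apply (y : E3) : Γ y = Γ.linearIsometryEquiv y + Γ 0 := by
  have := Γ.map_vadd 0 y
  simpa using this

lemma hasFDerivAt_affineIsometry (y : E3) :
    HasFDerivAt Γ (Γ.linearIsometryEquiv.toContinuousLinearEquiv : E3 →L[ℝ] E3) y := by
  have h1 : (Γ : E3 → E3) = fun y => Γ.linearIsometryEquiv y + Γ 0 :=
    funext (affineIsometry_apply Γ)
  rw [h1]
  exact (Γ.linearIsometryEquiv.toContinuousLinearEquiv : E3 →L[ℝ] E3).hasFDerivAt.add_const _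

lemma contDiff_affineIsometry {n : WithTop ℕ∞} : ContDiff ℝ n Γ := by
  have h1 : (Γ : E3 → E3) = fun y => Γ.linearIsometryEquiv y + Γ 0 :=
    funext (affineIsometry_apply Γ)
  rw [h1]
  exact (Γ.linearIsometryEquiv.toContinuousLinearEquiv : E3 →L[ℝ] E3).contDiff.add contDiff_const

end Isometry

/-- The coordinates of a tangent vector in a chart. -/
noncomputable def pushVec {M : Type*} [TopologicalSpace M] [ChartedSpace E2 M]
    (φ : OpenPartialHomeomorph M E2) (q : M) (v : TangentSpace (𝓡 2) q) : E2 :=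
  mfderiv (𝓡 2) (𝓡 2) φ q v

/-- A chart in which the immersion is, up to an isometry, the graph of a function of class `C⁵`. -/
structure IsGraphChart {M : Type*} [TopologicalSpace M] [ChartedSpace E2 M] (α : M → E3)
    (φ : OpenPartialHomeomorph M E2) (Γ : E3 ≃ᵃⁱ[ℝ] E3) (h : E2 → ℝ) : Prop where
  mdifferentiable : φ.MDifferentiable (𝓡 2) (𝓡 2)
  graph : ∀ x ∈ φ.target, Γ (α (φ.symm x)) = graphMap h x
  smooth : ∀ x ∈ φ.target, ContDiffAt ℝ (5 : ℕ) h x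

namespace IsGraphChart

variable {M : Type*} [TopologicalSpace M] [ChartedSpace E2 M] {α : M → E3}
  {φ : OpenPartialHomeomorph M E2} {Γ : E3 ≃ᵃⁱ[ℝ] E3} {h : E2 → ℝ}

lemma hasFDerivAt_param (H : IsGraphChart α φ Γ h) {x : E2} (hx : x ∈ φ.target) :
    ∃ F : E2 →L[ℝ] E3, HasFDerivAt (fun x => Γ.symm (graphMap h x)) F x ∧
      ∀ w, F w = Γ.symm.linearIsometryEquiv (graphDeriv h x w) := by
  obtain ⟨h1, h2⟩ := fderiv_graphMap ((H.smooth x hx).differentiableAt (by norm_num))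
  refine ⟨_, (hasFDerivAt_affineIsometry Γ.symm (graphMap h x)).comp x h1.hasFDerivAt, fun w => ?_⟩
  rw [ContinuousLinearMap.comp_apply, h2]
  rfl

lemma immersion_eventuallyEq (H : IsGraphChart α φ Γ h) {q : M} (hq : q ∈ φ.source) :
    α =ᶠ[𝓝 q] (fun x => Γ.symm (graphMap h x)) ∘ φ := by
  filter_upwards [φ.open_source.mem_nhds hq] with y hy
  rw [Function.comp_apply, ← H.graph _ (φ.map_source hy), φ.left_inv hy, Γ.symm_apply_apply]

lemma mfderiv_comp_chart (H : IsGraphChart α φ Γ h) {q : M} (hq : q ∈ φ.source) {f : M → E3}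
    {g : E2 → E3} (hfg : f =ᶠ[𝓝 q] g ∘ φ) {F : E2 →L[ℝ] E3} (hg : HasFDerivAt g F (φ q))
    (v : TangentSpace (𝓡 2) q) :
    mfderiv (𝓡 2) (𝓡 3) f q v = F (mfderiv (𝓡 2) (𝓡 2) φ q v) := by
  rw [hfg.mfderiv_eq]
  have h1 : HasMFDerivAt (𝓡 2) (𝓡 3) g (φ q) F := hg.hasMFDerivAt
  have h2 := h1.comp q (H.mdifferentiable.mdifferentiableAt hq).hasMFDerivAt
  rw [h2.mfderiv]
  rfl

lemma dImm_eq (H : IsGraphChart α φ Γ h) {q : M} (hq : q ∈ φ.source)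
    (v : TangentSpace (𝓡 2) q) :
    dImm α q v = Γ.symm.linearIsometryEquiv (graphDeriv h (φ q) (pushVec φ q v)) := by
  obtain ⟨F, hF, hw⟩ := H.hasFDerivAt_param (φ.map_source hq)
  rw [dImm, H.mfderiv_comp_chart hq (H.immersion_eventuallyEq hq) hF]
  exact hw _

lemma pushVec_injective (H : IsGraphChart α φ Γ h) {q : M} (hq : q ∈ φ.source)
    {v : TangentSpace (𝓡 2) q} (hv : pushVec φ q v = 0) : v = 0 :=
  H.mdifferentiable.mfderiv_injective hq (Eq.trans hv (map_zero _).symm)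

lemma pushVec_zero (q : M) : pushVec φ q (0 : TangentSpace (𝓡 2) q) = 0 :=
  map_zero (mfderiv (𝓡 2) (𝓡 2) φ q)

lemma pushVec_surjective (H : IsGraphChart α φ Γ h) {q : M} (hq : q ∈ φ.source) (w : E2) :
    ∃ v : TangentSpace (𝓡 2) q, pushVec φ q v = w :=
  H.mdifferentiable.mfderiv_surjective hq w

/-- The Jacobian determinant of the chart relative to the preferred chart at `q`. -/
noncomputable def chartDet (φ : OpenPartialHomeomorph M E2) (q : M) : ℝ :=
  let J : E2 → E2 := fun v => mfderiv (𝓡 2) (𝓡 2) φ q v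
  J !₂[1, 0] 0 * J !₂[0, 1] 1 - J !₂[1, 0] 1 * J !₂[0, 1] 0

lemma det_e2 (F : E2 →L[ℝ] E2) :
    F.det = F !₂[1, 0] 0 * F !₂[0, 1] 1 - F !₂[1, 0] 1 * F !₂[0, 1] 0 := by
  have e0 : EuclideanSpace.single (0 : Fin 2) (1 : ℝ) = !₂[1, 0] := by
    ext i; fin_cases i <;> simp
  have e1 : EuclideanSpace.single (1 : Fin 2) (1 : ℝ) = !₂[0, 1] := by
    ext i; fin_cases i <;> simp
  rw [ContinuousLinearMap.det, ← LinearMap.det_toMatrix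
    (EuclideanSpace.basisFun (Fin 2) ℝ).toBasis, Matrix.det_fin_two]
  simp [LinearMap.toMatrix_apply, e0, e1]
  ring

lemma gaussMap_eq (H : IsGraphChart α φ Γ h) {δ ε₀ : ℝ} (hδ : |δ| = 1)
    (hw : ∀ x y, wedge (Γ.symm.linearIsometryEquiv x) (Γ.symm.linearIsometryEquiv y) =
      δ • Γ.symm.linearIsometryEquiv (wedge x y)) {q : M} (hq : q ∈ φ.source)
    (hε₀ : |ε₀| = 1) (hdet : 0 < ε₀ * chartDet φ q) :
    gaussMap α q = (ε₀ * δ) • Γ.symm.linearIsometryEquiv (unitNormal h (φ q)) := by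
  set J : E2 → E2 := fun v => mfderiv (𝓡 2) (𝓡 2) φ q v with hJ
  set d := chartDet φ q with hd
  have hd' : d = J !₂[1, 0] 0 * J !₂[0, 1] 1 - J !₂[1, 0] 1 * J !₂[0, 1] 0 := rfl
  have e : ∀ w, graphDeriv h (φ q) w = w 0 • graphDeriv h (φ q) !₂[1, 0] +
      w 1 • graphDeriv h (φ q) !₂[0, 1] := fun w => by
    ext i; fin_cases i <;> simp [graphDeriv]; ring
  have h1 : wedge (dImm α q (!₂[1, 0] : E2)) (dImm α q (!₂[0, 1] : E2)) =
      (d * δ) • Γ.symm.linearIsometryEquiv (graphNormal h (φ q)) := by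
    have e1 : dImm α q (!₂[1, 0] : E2) =
      Γ.symm.linearIsometryEquiv (graphDeriv h (φ q) (J !₂[1, 0])) := H.dImm_eq hq _
    have e2 : dImm α q (!₂[0, 1] : E2) =
      Γ.symm.linearIsometryEquiv (graphDeriv h (φ q) (J !₂[0, 1])) := H.dImm_eq hq _
    rw [e1, e2, hw, e (J !₂[1, 0]), e (J !₂[0, 1]), wedge_comb, wedge_graphDeriv, ← hd', map_smul,
      smul_smul, mul_comm]
  have hW : ‖graphNormal h (φ q)‖ = √(areaSq h (φ q)) := by
    rw [← norm_unitNormal_inner, real_inner_self_eq_norm_sq, Real.sqrt_sq (norm_nonneg _)]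
  have hd0 : |d| = ε₀ * d := by
    rw [← abs_of_pos hdet, abs_mul, hε₀, one_mul]
  have hd1 : d ≠ 0 := fun h => by simp [h] at hdet
  have hε1 := mul_self_of_abs_eq_one hε₀
  have hW0 : √(areaSq h (φ q)) ≠ 0 := (Real.sqrt_pos.2 (areaSq_pos h _)).ne'
  have h2 : gaussMap α q = (fun n : E3 => ‖n‖⁻¹ • n)
    (wedge (dImm α q (!₂[1, 0] : E2)) (dImm α q (!₂[0, 1] : E2))) := rfl
  rw [h2, h1]
  beta_reduce
  rw [norm_smul, LinearIsometryEquiv.norm_map, hW, Real.norm_eq_abs, abs_mul, hδ, mul_one, hd0,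
    smul_smul, unitNormal, map_smul, smul_smul]
  congr 1
  have : ε₀ ≠ 0 := fun h => by simp [h] at hε₀
  field_simp
  linear_combination -δ * hε1

lemma dGauss_eq (H : IsGraphChart α φ Γ h) {q : M} (hq : q ∈ φ.source) {ε : ℝ}
    (hN : ∀ᶠ y in 𝓝 q, gaussMap α y = ε • Γ.symm.linearIsometryEquiv (unitNormal h (φ y)))
    (v : TangentSpace (𝓡 2) q) :
    dGauss α q v = ε • Γ.symm.linearIsometryEquiv
      (fderiv ℝ (unitNormal h) (φ q) (pushVec φ q v)) := by
  have h1 : HasFDerivAt (fun x => ε • Γ.symm.linearIsometryEquiv (unitNormal h x))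
      (ε • (Γ.symm.linearIsometryEquiv.toContinuousLinearEquiv : E3 →L[ℝ] E3).comp
        (fderiv ℝ (unitNormal h) (φ q))) (φ q) :=
    HasFDerivAt.const_smul (((Γ.symm.linearIsometryEquiv.toContinuousLinearEquiv :
      E3 →L[ℝ] E3).hasFDerivAt).comp (φ q)
      (fderiv_unitNormal (H.smooth _ (φ.map_source hq))).1.hasFDerivAt) ε
  rw [dGauss, H.mfderiv_comp_chart hq (g := fun x => ε • Γ.symm.linearIsometryEquiv
    (unitNormal h x)) hN h1]
  rfl

/-- In an oriented atlas the sign of the Jacobian determinant of a chart is locally constant. -/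
lemma exists_sign_chartDet [IsManifold (𝓡 2) 1 M] (hM : OrientedAtlas M)
    (hφ : φ ∈ IsManifold.maximalAtlas (𝓡 2) 1 M) {p : M} (hp : p ∈ φ.source) :
    ∃ ε₀ : ℝ, |ε₀| = 1 ∧ ∀ᶠ q in 𝓝 p, 0 < ε₀ * chartDet φ q := by
  have hφd : φ.MDifferentiable (𝓡 2) (𝓡 2) :=
    ⟨(contMDiffOn_of_mem_maximalAtlas hφ).mdifferentiableOn one_ne_zero,
      (contMDiffOn_symm_of_mem_maximalAtlas hφ).mdifferentiableOn one_ne_zero⟩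
  set e := chartAt E2 p with he
  have hed : e.MDifferentiable (𝓡 2) (𝓡 2) := mdifferentiable_chart p
  set g : E2 → E2 := fun x => φ (e.symm x) with hg
  have hgC : ContDiffAt ℝ 1 g (e p) := by
    have h1 : ContMDiffAt (𝓡 2) (𝓡 2) 1 φ p := contMDiffAt_of_mem_maximalAtlas hφ hp
    have h2 : ContMDiffAt (𝓡 2) (𝓡 2) 1 e.symm (e p) :=
      contMDiffAt_symm_of_mem_maximalAtlas (IsManifold.chart_mem_maximalAtlas p)
        (e.map_source (mem_chart_source E2 p))
    have h3 : e.symm (e p) = p := e.left_inv (mem_chart_source E2 p)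
    rw [← h3] at h1
    exact (h1.comp (e p) h2).contDiffAt
  have hkey : ∀ q ∈ φ.source ∩ e.source, ∃ d > 0, chartDet φ q = (fderiv ℝ g (e q)).det * d := by
    rintro q ⟨hq, hqe⟩
    let G : E2 →L[ℝ] E2 := mfderiv (𝓡 2) (𝓡 2) e q
    have hG : 0 < G.det := by
      have h1 := hM (chartAt E2 q) (chart_mem_atlas E2 q) e (chart_mem_atlas E2 p) q
        ⟨mem_chart_source E2 q, hqe⟩
      have h2 : G = fderiv ℝ (fun x => e ((chartAt E2 q).symm x)) (chartAt E2 q q) := by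
        have h3 := mfderiv_chartAt_eq_tangentCoordChange (I := 𝓡 2) hqe
        rw [tangentCoordChange_def] at h3
        simp only [mfld_simps, fderivWithin_univ] at h3
        exact h3
      rwa [h2]
    refine ⟨G.det, hG, ?_⟩
    have hd1 : MDifferentiableAt (𝓡 2) (𝓡 2) g (e q) := by
      have h1 := hφd.mdifferentiableAt hq
      have h3 : e.symm (e q) = q := e.left_inv hqe
      rw [← h3] at h1
      exact h1.comp (e q) (hed.mdifferentiableAt_symm (e.map_source hqe))
    have hJ : (mfderiv (𝓡 2) (𝓡 2) φ q : E2 →L[ℝ] E2) = (fderiv ℝ g (e q)).comp G := by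
      have h1 : (φ : M → E2) =ᶠ[𝓝 q] g ∘ e := by
        filter_upwards [e.open_source.mem_nhds hqe] with y hy
        simp only [hg, Function.comp_apply, e.left_inv hy]
      rw [← mfderiv_eq_fderiv]
      have h2 := mfderiv_comp q hd1 (hed.mdifferentiableAt hqe)
      rw [← h1.mfderiv_eq] at h2
      exact h2
    have h4 : chartDet φ q = (mfderiv (𝓡 2) (𝓡 2) φ q : E2 →L[ℝ] E2).det := (det_e2 _).symm
    rw [h4, hJ]
    exact LinearMap.det_comp _ _
  have hpe : p ∈ φ.source ∩ e.source := ⟨hp, mem_chart_source E2 p⟩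
  have hne : (fderiv ℝ g (e p)).det ≠ 0 := by
    obtain ⟨d, -, hd⟩ := hkey p hpe
    intro h0
    rw [h0, zero_mul] at hd
    have h4 : chartDet φ p = (mfderiv (𝓡 2) (𝓡 2) φ p : E2 →L[ℝ] E2).det := (det_e2 _).symm
    rw [h4] at hd
    have h5 : Function.Injective (mfderiv (𝓡 2) (𝓡 2) φ p) := hφd.mfderiv_injective hp
    have h6 := LinearMap.bot_lt_ker_of_det_eq_zero hd
    rw [bot_lt_iff_ne_bot] at h6
    exact h6 (LinearMap.ker_eq_bot.2 h5)
  have hcont : ContinuousAt (fun q => (fderiv ℝ g (e q)).det) p := by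
    have h1 : ContinuousAt (fderiv ℝ g) (e p) := (hgC.fderiv_right (m := 0) (by norm_num)).continuousAt
    have h2 : ContinuousAt e p := e.continuousAt (mem_chart_source E2 p)
    exact ContinuousLinearMap.continuous_det.continuousAt.comp
      (ContinuousAt.comp (g := fderiv ℝ g) h1 h2)
  have hmem : ∀ᶠ q in 𝓝 p, q ∈ φ.source ∩ e.source :=
    (φ.open_source.inter e.open_source).mem_nhds hpe
  obtain ⟨ε₀, hε₀, hpos⟩ : ∃ ε₀ : ℝ, |ε₀| = 1 ∧ 0 < ε₀ * (fderiv ℝ g (e p)).det := by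
    rcases lt_or_gt_of_ne hne with h | h
    · exact ⟨-1, by norm_num, by linarith⟩
    · exact ⟨1, by norm_num, by linarith⟩
  refine ⟨ε₀, hε₀, ?_⟩
  filter_upwards [hmem, (hcont.tendsto.const_mul ε₀).eventually (lt_mem_nhds hpos)] with q h1 h2
  obtain ⟨d, hd, hdq⟩ := hkey q h1
  rw [hdq, ← mul_assoc]
  exact mul_pos h2 hd

end IsGraphChart

/-- A graph chart around the umbilic, where the Gauss map is the upward normal of the graph up to a
constant sign. -/
structure IsMongeFrame {M : Type*} [TopologicalSpace M] [ChartedSpace E2 M] (α : M → E3)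
    (φ : OpenPartialHomeomorph M E2) (Γ : E3 ≃ᵃⁱ[ℝ] E3) (h : E2 → ℝ) (p : M) (ε b c B K : ℝ) :
    Prop extends IsGraphChart α φ Γ h, IsMongeUmbilic h φ.target b c B K where
  mem_source : p ∈ φ.source
  apply_eq : φ p = 0
  sign : ε * ε = 1
  gauss : ∀ᶠ q in 𝓝 p, gaussMap α q = ε • Γ.symm.linearIsometryEquiv (unitNormal h (φ q))

namespace IsMongeFrame

variable {M : Type*} [TopologicalSpace M] [ChartedSpace E2 M] {α : M → E3}
  {φ : OpenPartialHomeomorph M E2} {Γ : E3 ≃ᵃⁱ[ℝ] E3} {h : E2 → ℝ} {p : M} {ε b c B K : ℝ}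

lemma eventually_mem (H : IsMongeFrame α φ Γ h p ε b c B K) : ∀ᶠ q in 𝓝 p, q ∈ φ.source ∧
    ∀ᶠ y in 𝓝 q, gaussMap α y = ε • Γ.symm.linearIsometryEquiv (unitNormal h (φ y)) :=
  Eventually.and (φ.open_source.mem_nhds H.mem_source) (eventually_eventually_nhds.2 H.gauss)

lemma principal_iff (H : IsMongeFrame α φ Γ h p ε b c B K) {q : M} (hq : q ∈ φ.source)
    (hN : ∀ᶠ y in 𝓝 q, gaussMap α y = ε • Γ.symm.linearIsometryEquiv (unitNormal h (φ y)))
    (κ : ℝ) (v : TangentSpace (𝓡 2) q) :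
    dGauss α q v + κ • dImm α q v = 0 ↔
      IsCurvatureVector h (φ q) (ε * √(areaSq h (φ q)) * κ) (pushVec φ q v) := by
  rw [← isCurvatureVector_iff (H.toIsGraphChart.smooth _ (φ.map_source hq)) H.sign,
    H.dGauss_eq hq hN, H.dImm_eq hq, ← LinearIsometryEquiv.map_smul,
    ← LinearIsometryEquiv.map_smul, ← LinearIsometryEquiv.map_add,
    LinearIsometryEquiv.map_eq_zero_iff]

lemma mem_principalCurvatures (H : IsMongeFrame α φ Γ h p ε b c B K) {q : M} (hq : q ∈ φ.source)
    (hN : ∀ᶠ y in 𝓝 q, gaussMap α y = ε • Γ.symm.linearIsometryEquiv (unitNormal h (φ y)))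
    (κ : ℝ) : κ ∈ principalCurvatures α q ↔
      ∃ w, w ≠ 0 ∧ IsCurvatureVector h (φ q) (ε * √(areaSq h (φ q)) * κ) w := by
  constructor
  · rintro ⟨v, hv, hκ⟩
    exact ⟨pushVec φ q v, fun h0 => hv (H.pushVec_injective hq h0), (H.principal_iff hq hN κ v).1 hκ⟩
  · rintro ⟨w, hw, hκ⟩
    obtain ⟨v, rfl⟩ := H.pushVec_surjective hq w
    exact ⟨v, fun h0 => hw (by rw [h0, IsGraphChart.pushVec_zero]), (H.principal_iff hq hN κ v).2 hκ⟩

lemma torsion_eq (H : IsMongeFrame α φ Γ h p ε b c B K) {δ : ℝ}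
    (hw : ∀ x y, wedge (Γ.symm.linearIsometryEquiv x) (Γ.symm.linearIsometryEquiv y) =
      δ • Γ.symm.linearIsometryEquiv (wedge x y)) {q : M} (hq : q ∈ φ.source)
    (hN : ∀ᶠ y in 𝓝 q, gaussMap α y = ε • Γ.symm.linearIsometryEquiv (unitNormal h (φ y)))
    (v : TangentSpace (𝓡 2) q) w (hv : pushVec φ q v = w) :
    geodesicTorsion α q v = δ * ((areaSq h (φ q) * firstForm h (φ q) w)⁻¹ *
      principalForm h (φ q) w) := by
  have hW2 : √(areaSq h (φ q)) ^ 2 = areaSq h (φ q) := Real.sq_sqrt (areaSq_pos h _).le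
  obtain ⟨t, ht⟩ := (fderiv_unitNormal (H.toIsGraphChart.smooth _ (φ.map_source hq))).2 w
  have hg : dGauss α q v = ε • Γ.symm.linearIsometryEquiv
      (fderiv ℝ (unitNormal h) (φ q) w) := by
    rw [H.dGauss_eq hq hN, hv]
  have hi : dImm α q v = Γ.symm.linearIsometryEquiv (graphDeriv h (φ q) w) := by
    rw [H.dImm_eq hq, hv]
  have hsm : ∀ x y : E3, wedge (ε • x) y = ε • wedge x y := fun x y => by
    have := wedge_comb x y ε 0 0 1
    simpa using this
  rw [geodesicTorsion, hg, hi, hN.self_of_nhds, hsm, hw, ht, real_inner_smul_left,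
    real_inner_smul_left, real_inner_smul_right, LinearIsometryEquiv.inner_map_map,
    LinearIsometryEquiv.inner_map_map, unitNormal, torsion_graph, inner_graphDeriv, inv_pow, hW2,
    mul_inv, div_eq_mul_inv]
  linear_combination (δ * (areaSq h (φ q))⁻¹ * principalForm h (φ q) w *
    (firstForm h (φ q) w)⁻¹) * H.sign

lemma torsionInChart_eventuallyEq (H : IsMongeFrame α φ Γ h p ε b c B K) {δ : ℝ}
    (hw : ∀ x y, wedge (Γ.symm.linearIsometryEquiv x) (Γ.symm.linearIsometryEquiv y) =
      δ • Γ.symm.linearIsometryEquiv (wedge x y)) (ℓ : OnePoint ℝ) :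
    torsionInChart α φ ℓ =ᶠ[𝓝 (0, 0)] fun y => δ * graphTorsion h ℓ y := by
  have ht : Tendsto (fun y : E2 × ℝ => φ.symm y.1) (𝓝 (0, 0)) (𝓝 p) := by
    have h0 : (0 : E2) ∈ φ.target := H.zero_mem
    have h1 : φ.symm 0 = p := by rw [← H.apply_eq, φ.left_inv H.mem_source]
    have h2 := (φ.continuousAt_symm h0).tendsto
    rw [h1] at h2
    exact h2.comp (continuous_fst.tendsto ((0 : E2), (0 : ℝ)))
  filter_upwards [ht.eventually H.eventually_mem, H.toIsMongeUmbilic.eventually_mem]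
    with y ⟨h1, h2⟩ h3
  have h4 : φ (φ.symm y.1) = y.1 := φ.right_inv h3
  have h5 : pushVec φ (φ.symm y.1)
      (mfderiv (𝓡 2) (𝓡 2) φ.symm y.1 (affineDirection ℓ y.2 : E2)) =
      (affineDirection ℓ y.2 : E2) := by
    have := H.mdifferentiable.comp_symm_deriv h3
    exact congrArg (fun F : E2 →L[ℝ] E2 => F (affineDirection ℓ y.2)) this
  have h6 := H.torsion_eq hw h1 h2 _ _ h5
  rw [h4] at h6
  exact h6

theorem isTypeD23 (H : IsMongeFrame α φ Γ h p ε b c B K) :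
    (transversalityFailure α φ p).ncard = 2 ∧
      ∀ ℓ ∈ transversalityFailure α φ p, IsMorseCone (torsionInChart α φ ℓ) (φ p, 0) := by
  obtain ⟨δ, hδ, hw⟩ := exists_wedge_isometry Γ.symm.linearIsometryEquiv
  have hδ0 : δ ≠ 0 := fun h => by simp [h] at hδ
  have key := fun ℓ => H.torsion_critical hδ0 (H.torsionInChart_eventuallyEq hw ℓ)
  have hset : transversalityFailure α φ p =
      {ℓ : OnePoint ℝ | ∃ m : ℝ, ℓ = m ∧ b * (1 - m ^ 2) + c * m = 0} := by
    ext ℓ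
    have := (key ℓ).1
    rw [← H.apply_eq] at this
    exact this
  refine ⟨by rw [hset]; exact IsMongeUmbilic.ncard_critical_slopes H.b_ne, fun ℓ hℓ => ?_⟩
  have hℓ' : fderiv ℝ (torsionInChart α φ ℓ) (φ p, 0) = 0 := hℓ
  rw [H.apply_eq] at hℓ' ⊢
  exact (key ℓ).2 hℓ'

lemma sign_sqrt_ne (H : IsMongeFrame α φ Γ h p ε b c B K) (x : E2) :
    ε * √(areaSq h x) ≠ 0 :=
  mul_ne_zero (fun h => by have := H.sign; simp [h] at this)
    (Real.sqrt_pos.2 (areaSq_pos h x)).ne'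

lemma isUmbilic (H : IsMongeFrame α φ Γ h p ε b c B K) : IsUmbilic α p := by
  obtain ⟨κ₀, hκ₀⟩ := H.exists_isCurvatureVector_zero
  obtain ⟨h1, h2⟩ := H.eventually_mem.self_of_nhds
  have hne := H.sign_sqrt_ne (φ p)
  refine ⟨κ₀ / (ε * √(areaSq h (φ p))), ?_⟩
  ext κ
  rw [H.mem_principalCurvatures h1 h2, H.apply_eq, hκ₀, mem_singleton_iff, ← H.apply_eq,
    eq_div_iff hne, mul_comm]

/-- The principal line fields near the umbilic, in normalized coordinates. -/
theorem exists_line_fields (H : IsMongeFrame α φ Γ h p ε b c B K) :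
    ∃ τ r L A : ℝ, ∃ m n : ℝ → ℝ → ℝ, ∃ 𝓛s 𝓛p : ∀ q : M, Set (TangentSpace (𝓡 2) q),
      |τ| = 1 ∧ IsLocalPair m n r L A ∧
      ((𝓛s = minimalField α ∧ 𝓛p = maximalField α) ∨
        (𝓛s = maximalField α ∧ 𝓛p = minimalField α)) ∧
      ∀ᶠ q in 𝓝 p, q ∈ φ.source ∧ |τ * φ q 0| ≤ r ∧ |φ q 1| ≤ r ∧
        (q ≠ p → ¬IsUmbilic α q ∧
        (∀ v w, pushVec φ q v = w →
          (v ∈ 𝓛s q ↔ w 1 = m (τ * φ q 0) (φ q 1) * (τ * w 0)) ∧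
          (v ∈ 𝓛p q ↔ τ * w 0 = n (τ * φ q 0) (φ q 1) * w 1))) := by
  obtain ⟨s, τ, r, L, A, m, n, hs, hτ, hloc, hbox⟩ := H.exists_principal_fields
  have hττ := mul_self_of_abs_eq_one hτ
  have hτ0 : τ ≠ 0 := fun h => by simp [h] at hτ
  have hsmall : ∀ᶠ q in 𝓝 p, |τ * φ q 0| ≤ r ∧ |φ q 1| ≤ r := by
    have h1 : Tendsto φ (𝓝 p) (𝓝 0) := by
      have := (φ.continuousAt H.mem_source).tendsto
      rwa [H.apply_eq] at this
    have h2 : ∀ᶠ x : E2 in 𝓝 0, |τ * x 0| ≤ r ∧ |x 1| ≤ r := by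
      have e : ∀ f : E2 → ℝ, Continuous f → f 0 = 0 → ∀ᶠ x : E2 in 𝓝 0, |f x| ≤ r := by
        intro f hf h0
        have h3 : Tendsto (fun x => |f x|) (𝓝 0) (𝓝 0) := by
          have := hf.abs.tendsto 0
          rwa [h0, abs_zero] at this
        exact h3.eventually (eventually_le_nhds hloc.r_pos)
      exact (e (fun x => τ * x 0) (by fun_prop) (by simp)).and
        (e (fun x => x 1) (by fun_prop) (by simp))
    exact h1.eventually h2
  set D : ℝ → ∀ q : M, Set (TangentSpace (𝓡 2) q) := fun σ q =>
    if 0 < σ then minimalField α q else maximalField α q with hD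
  refine ⟨τ, r, L, A, m, n, D (ε * s), D (-(ε * s)), hτ, hloc, ?_, ?_⟩
  · have hεs : ε * s ≠ 0 := mul_ne_zero (fun h => by have := H.sign; simp [h] at this)
      fun h => by simp [h] at hs
    rcases lt_or_gt_of_ne hεs with h | h
    · right
      have h' : 0 < -(ε * s) := by linarith
      simp [hD, h', h.not_gt]
    · left
      have h' : ¬(0 < -(ε * s)) := by linarith
      simp [hD, h', h]
  filter_upwards [H.eventually_mem, hsmall] with q ⟨hq, hN⟩ ⟨h1, h2⟩
  refine ⟨hq, h1, h2, fun hne => ?_⟩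
  have hX : (!₂[τ * (τ * φ q 0), φ q 1] : E2) = φ q := by
    rw [← mul_assoc, hττ, one_mul, e2_eta]
  have h0 : τ * φ q 0 ≠ 0 ∨ φ q 1 ≠ 0 := by
    have : φ q ≠ 0 := fun h => hne (φ.injOn hq H.mem_source (by rw [h, H.apply_eq]))
    rcases e2_ne_zero_iff.1 this with h | h
    · exact Or.inl (mul_ne_zero hτ0 h)
    · exact Or.inr h
  obtain ⟨κ₁, κ₂, hgap, hκ, hm, hn⟩ := (hbox _ _ h1 h2).2 h0
  rw [hX] at hκ hm hn
  set W := √(areaSq h (φ q)) with hW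
  have hWpos : 0 < W := Real.sqrt_pos.2 (areaSq_pos h (φ q))
  have hsign := H.sign
  have hss := mul_self_of_abs_eq_one hs
  have hconv : ∀ κ k, ε * W * κ = k ↔ κ = ε * k / W := fun κ k => by
    rw [eq_div_iff hWpos.ne']
    constructor
    · rintro rfl; linear_combination (-(W * κ)) * hsign
    · intro h; linear_combination ε * h + k * hsign
  have hpc : principalCurvatures α q = {ε * κ₁ / W, ε * κ₂ / W} := by
    ext κ
    rw [H.mem_principalCurvatures hq hN, hκ, hconv, hconv]
    rfl
  have hgap' : 0 < (ε * s) * (ε * κ₂ / W - ε * κ₁ / W) := by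
    have e : (ε * s) * (ε * κ₂ / W - ε * κ₁ / W) = s * (κ₂ - κ₁) / W := by
      field_simp
      linear_combination (s * (κ₂ - κ₁)) * hsign
    rw [e]
    positivity
  have hpr : ∀ k v, dGauss α q v + (ε * k / W) • dImm α q v = 0 ↔
      IsCurvatureVector h (φ q) k (pushVec φ q v) := fun k v => by
    rw [H.principal_iff hq hN, (hconv _ _).2 rfl]
  have hmin : ∀ k₁ k₂, principalCurvatures α q = {ε * k₁ / W, ε * k₂ / W} →
      ε * k₁ / W < ε * k₂ / W → ∀ v, v ∈ minimalField α q ↔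
        IsCurvatureVector h (φ q) k₁ (pushVec φ q v) := by
    intro k₁ k₂ hk hlt v
    have hl : IsLeast (principalCurvatures α q) (ε * k₁ / W) := by
      rw [hk]
      refine ⟨Or.inl rfl, ?_⟩
      rintro x (rfl | rfl)
      exacts [le_rfl, hlt.le]
    rw [← hpr]
    constructor
    · rintro ⟨κ, h3, h4⟩
      rwa [h3.unique hl] at h4
    · exact fun h3 => ⟨_, hl, h3⟩
  have hmax : ∀ k₁ k₂, principalCurvatures α q = {ε * k₁ / W, ε * k₂ / W} →
      ε * k₁ / W < ε * k₂ / W → ∀ v, v ∈ maximalField α q ↔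
        IsCurvatureVector h (φ q) k₂ (pushVec φ q v) := by
    intro k₁ k₂ hk hlt v
    have hl : IsGreatest (principalCurvatures α q) (ε * k₂ / W) := by
      rw [hk]
      refine ⟨Or.inr rfl, ?_⟩
      rintro x (rfl | rfl)
      exacts [hlt.le, le_rfl]
    rw [← hpr]
    constructor
    · rintro ⟨κ, h3, h4⟩
      rwa [h3.unique hl] at h4
    · exact fun h3 => ⟨_, hl, h3⟩
  refine ⟨?_, fun v w hv => ?_⟩
  · rintro ⟨κ, hu⟩
    rw [hpc] at hu
    have e1 : ε * κ₁ / W = κ := by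
      have : ε * κ₁ / W ∈ ({κ} : Set ℝ) := by rw [← hu]; exact Or.inl rfl
      exact this
    have e2 : ε * κ₂ / W = κ := by
      have : ε * κ₂ / W ∈ ({κ} : Set ℝ) := by rw [← hu]; exact Or.inr rfl
      exact this
    rw [e1, e2] at hgap'
    simp at hgap'
  have key : (v ∈ D (ε * s) q ↔ IsCurvatureVector h (φ q) κ₁ w) ∧
      (v ∈ D (-(ε * s)) q ↔ IsCurvatureVector h (φ q) κ₂ w) := by
    rw [← hv]
    rcases lt_or_ge 0 (ε * s) with hpos | hneg
    · have hlt : ε * κ₁ / W < ε * κ₂ / W := by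
        have := (mul_pos_iff_of_pos_left hpos).1 hgap'
        linarith
      have h3 : ¬(0 < -(ε * s)) := by linarith
      simp only [hD, hpos, if_true, h3, if_false]
      exact ⟨hmin _ _ hpc hlt v, hmax _ _ hpc hlt v⟩
    · have hlt : ε * κ₂ / W < ε * κ₁ / W := by
        by_contra hc
        have := mul_nonpos_of_nonpos_of_nonneg hneg (sub_nonneg.2 (not_lt.1 hc))
        linarith
      have hεs : ε * s ≠ 0 := fun h => by rw [h, zero_mul] at hgap'; exact lt_irrefl _ hgap'
      have h3 : 0 < -(ε * s) := by have := lt_of_le_of_ne hneg hεs; linarith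
      simp only [hD, hneg.not_gt, h3, if_true, if_false]
      have hpc' := hpc.trans (pair_comm _ _)
      exact ⟨hmax _ _ hpc' hlt v, hmin _ _ hpc' hlt v⟩
  exact ⟨key.1.trans (hm w), key.2.trans (hn w)⟩

end IsMongeFrame

/-- The plane with its first axis reflected or not. -/
noncomputable def signedCoords (τ : ℝ) (hτ : |τ| = 1) : E2 ≃L[ℝ] ℝ × ℝ where
  toFun x := (τ * x 0, x 1)
  invFun z := !₂[τ * z.1, z.2]
  map_add' x y := by ext <;> simp [mul_add]
  map_smul' c x := by ext <;> simp [mul_left_comm]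
  left_inv x := by
    have := mul_self_of_abs_eq_one hτ
    ext i; fin_cases i <;> simp [← mul_assoc, this]
  right_inv z := by
    have := mul_self_of_abs_eq_one hτ
    ext <;> simp [← mul_assoc, this]
  continuous_toFun := by fun_prop
  continuous_invFun := by
    refine (PiLp.continuous_toLp 2 _).comp (continuous_pi fun i => ?_)
    fin_cases i <;> simp <;> fun_prop

section Transport

variable {M : Type*} [TopologicalSpace M] [ChartedSpace E2 M] {φ : OpenPartialHomeomorph M E2}

lemma deriv_chart_curve (hφ : φ.MDifferentiable (𝓡 2) (𝓡 2)) {L : E2 ≃L[ℝ] ℝ × ℝ} {γ : ℝ → M}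
    {t : ℝ} (hγ : MDifferentiableAt 𝓘(ℝ, ℝ) (𝓡 2) γ t) (ht : γ t ∈ φ.source) :
    HasDerivAt (fun t => L (φ (γ t))) (L (pushVec φ (γ t) (mfderiv 𝓘(ℝ, ℝ) (𝓡 2) γ t (1 : ℝ)))) t := by
  have h1 := (hφ.mdifferentiableAt ht).hasMFDerivAt.comp t hγ.hasMFDerivAt
  have h2 := hasMFDerivAt_iff_hasFDerivAt.1 h1
  exact ((L : E2 →L[ℝ] ℝ × ℝ).hasFDerivAt.comp t h2).hasDerivAt

/-- Leaves correspond to leaves in a chart. -/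
theorem onCommonLine_iff [IsManifold (𝓡 2) 1 M]
    (hφ : φ ∈ IsManifold.maximalAtlas (𝓡 2) 1 M) (L : E2 ≃L[ℝ] ℝ × ℝ)
    {𝓛 : ∀ q : M, Set (TangentSpace (𝓡 2) q)} {ℓ : ℝ × ℝ → Set (ℝ × ℝ)} {W : Set M}
    (hW : W ⊆ φ.source)
    (h : ∀ q ∈ W, ∀ v : TangentSpace (𝓡 2) q, v ∈ 𝓛 q ↔ L (pushVec φ q v) ∈ ℓ (L (φ q)))
    {x y : M} (hx : x ∈ W) (hy : y ∈ W) :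
    OnCommonLine 𝓛 W x y ↔
      PlanarLine ℓ ((fun q => L (φ q)) '' W) (L (φ x)) (L (φ y)) := by
  have hφd : φ.MDifferentiable (𝓡 2) (𝓡 2) :=
    ⟨(contMDiffOn_of_mem_maximalAtlas hφ).mdifferentiableOn one_ne_zero,
      (contMDiffOn_symm_of_mem_maximalAtlas hφ).mdifferentiableOn one_ne_zero⟩
  have hinj : ∀ q ∈ W, ∀ v : TangentSpace (𝓡 2) q, L (pushVec φ q v) = 0 → v = 0 := by
    intro q hq v hv
    have h1 : pushVec φ q v = 0 := by simpa using hv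
    exact hφd.mfderiv_injective (hW hq) (Eq.trans h1 (map_zero _).symm)
  constructor
  · rintro ⟨γ, hγ, hγW, ⟨a, rfl⟩, ⟨b, rfl⟩⟩
    have hd : ∀ t, HasDerivAt (fun t => L (φ (γ t)))
        (L (pushVec φ (γ t) (mfderiv 𝓘(ℝ, ℝ) (𝓡 2) γ t (1 : ℝ)))) t := fun t =>
      deriv_chart_curve hφd (hγ.mdifferentiableAt one_ne_zero) (hW (hγW t).1)
    refine ⟨fun t => L (φ (γ t)), ?_, fun t => ⟨⟨γ t, (hγW t).1, rfl⟩, ?_, ?_⟩, ⟨a, rfl⟩,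
      ⟨b, rfl⟩⟩
    · refine L.contDiff.comp (contDiff_iff_contDiffAt.2 fun t => ?_)
      have h1 := (contMDiffAt_of_mem_maximalAtlas hφ (hW (hγW t).1)).comp t hγ.contMDiffAt
      exact h1.contDiffAt
    · rw [(hd t).deriv]
      exact fun h0 => (hγW t).2.1 (hinj _ (hγW t).1 _ h0)
    · rw [(hd t).deriv]
      exact (h _ (hγW t).1 _).1 (hγW t).2.2
  · rintro ⟨g, hg, hgW, ⟨a, ha⟩, ⟨b, hb⟩⟩
    have hgt : ∀ t, L.symm (g t) ∈ φ.target ∧ φ.symm (L.symm (g t)) ∈ W := by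
      intro t
      obtain ⟨q, hq, hqt⟩ := (hgW t).1
      simp only at hqt
      rw [← hqt, L.symm_apply_apply, φ.left_inv (hW hq)]
      exact ⟨φ.map_source (hW hq), hq⟩
    set γ : ℝ → M := fun t => φ.symm (L.symm (g t)) with hγ
    have hγC : ContMDiff 𝓘(ℝ, ℝ) (𝓡 2) 1 γ := fun t => by
      have h1 : ContMDiffAt 𝓘(ℝ, ℝ) (𝓡 2) 1 (fun t => L.symm (g t)) t :=
        (L.symm.contDiff.comp hg).contMDiff.contMDiffAt
      exact (contMDiffAt_symm_of_mem_maximalAtlas hφ (hgt t).1).comp t h1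
    have hLg : (fun t => L (φ (γ t))) = g := by
      funext t
      simp only [hγ]
      rw [φ.right_inv (hgt t).1, L.apply_symm_apply]
    have hd : ∀ t, L (pushVec φ (γ t) (mfderiv 𝓘(ℝ, ℝ) (𝓡 2) γ t (1 : ℝ))) = deriv g t := fun t => by
      have := deriv_chart_curve (L := L) hφd (hγC.mdifferentiableAt one_ne_zero (x := t))
        (hW (hgt t).2)
      rw [hLg] at this
      exact this.deriv.symm
    refine ⟨γ, hγC, fun t => ⟨(hgt t).2, fun h0 => (hgW t).2.1 ?_, ?_⟩, ⟨a, ?_⟩, ⟨b, ?_⟩⟩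
    · rw [← hd t, h0]
      have : pushVec φ (γ t) 0 = 0 := IsGraphChart.pushVec_zero _
      rw [this, map_zero]
    · rw [h _ (hgt t).2, hd t]
      have : L (φ (γ t)) = g t := congrFun hLg t
      rw [this]
      exact (hgW t).2.2
    · simp only [hγ]
      rw [ha, L.symm_apply_apply, φ.left_inv (hW hx)]
    · simp only [hγ]
      rw [hb, L.symm_apply_apply, φ.left_inv (hW hy)]

end Transport

namespace IsMongeFrame

variable {M : Type*} [TopologicalSpace M] [ChartedSpace E2 M] {α : M → E3}
  {φ : OpenPartialHomeomorph M E2} {Γ : E3 ≃ᵃⁱ[ℝ] E3} {h : E2 → ℝ} {p : M} {ε b c B K : ℝ}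

theorem hasD23Configuration [IsManifold (𝓡 2) 1 M] (H : IsMongeFrame α φ Γ h p ε b c B K)
    (hφ : φ ∈ IsManifold.maximalAtlas (𝓡 2) 1 M) :
    HasD23Configuration α p (minimalField α) (maximalField α) ∨
      HasD23Configuration α p (maximalField α) (minimalField α) := by
  obtain ⟨τ, r, L, A, m, n, 𝓛s, 𝓛p, hτ, hloc, h𝓛, hev⟩ := H.exists_line_fields
  suffices hmain : HasD23Configuration α p 𝓛s 𝓛p by
    rcases h𝓛 with ⟨h1, h2⟩ | ⟨h1, h2⟩
    · left; rwa [h1, h2] at hmain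
    · right; rwa [h1, h2] at hmain
  set S := signedCoords τ hτ with hS
  have hSapp : ∀ x : E2, S x = (τ * x 0, x 1) := fun x => rfl
  set ψ : OpenPartialHomeomorph M (ℝ × ℝ) :=
    φ.trans S.toHomeomorph.toOpenPartialHomeomorph with hψ
  have hψapp : ∀ q, ψ q = S (φ q) := fun q => rfl
  have hψs : ψ.source = φ.source := by simp [hψ]
  have hp' : p ∈ ψ.source := by rw [hψs]; exact H.mem_source
  have hψp : ψ p = (0, 0) := by rw [hψapp, H.apply_eq, hSapp]; simp
  obtain ⟨O, hO, hOo, hpO⟩ := eventually_nhds_iff.1 hev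
  have himg : ψ '' (ψ.source ∩ O) ∈ 𝓝 ((0, 0) : ℝ × ℝ) := by
    rw [← hψp]
    refine (ψ.isOpen_image_of_subset_source (ψ.open_source.inter hOo) inter_subset_left).mem_nhds
      ⟨p, ⟨hp', hpO⟩, rfl⟩
  obtain ⟨Φ₀, hΦO, hΦ0, hΦ00, hΦt, hΦl⟩ := hloc.isPrincipalPair.exists_local_model himg
  set Φ : OpenPartialHomeomorph M (ℝ × ℝ) := ψ.trans Φ₀ with hΦ
  have hΦapp : ∀ q, Φ q = Φ₀ (ψ q) := fun q => rfl
  have hsrc : ∀ q, q ∈ Φ.source ↔ q ∈ ψ.source ∧ ψ q ∈ Φ₀.source := fun q => by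
    simp [hΦ]
  have hsO : ∀ q ∈ Φ.source, q ∈ O := fun q hq => by
    obtain ⟨h1, h2⟩ := (hsrc q).1 hq
    obtain ⟨q', ⟨hq's, hq'O⟩, hqq⟩ := hΦO h2
    rwa [← ψ.injOn hq's h1 hqq]
  have hpΦ : p ∈ Φ.source := (hsrc p).2 ⟨hp', by rw [hψp]; exact hΦ0⟩
  have hΦp : Φ p = (0, 0) := by rw [hΦapp, hψp, hΦ00]
  have himage : ψ '' (Φ.source \ {p}) = Φ₀.source \ {(0, 0)} := by
    ext z
    constructor
    · rintro ⟨q, ⟨hq, hqp⟩, rfl⟩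
      refine ⟨((hsrc q).1 hq).2, fun h0 => hqp ?_⟩
      exact ψ.injOn ((hsrc q).1 hq).1 hp' (Eq.trans h0 hψp.symm)
    · rintro ⟨hz, hz0⟩
      obtain ⟨q, ⟨hqs, -⟩, rfl⟩ := hΦO hz
      exact ⟨q, ⟨(hsrc q).2 ⟨hqs, hz⟩, fun h0 => hz0 (by rw [mem_singleton_iff.1 h0, hψp]; rfl)⟩,
        rfl⟩
  have htarget : Φ.target = squareOf 1 := by
    rw [hΦ, OpenPartialHomeomorph.trans_target, hΦt]
    refine inter_eq_left.2 fun z hz => ?_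
    have h1 : Φ₀.symm z ∈ Φ₀.source := Φ₀.map_target (by rw [hΦt]; exact hz)
    obtain ⟨q, ⟨hqs, -⟩, hqz⟩ := hΦO h1
    change Φ₀.symm z ∈ ψ.target
    rw [← hqz]
    exact ψ.map_source hqs
  have hWs : Φ.source \ {p} ⊆ φ.source := fun q hq => (hO q (hsO q hq.1)).1
  have hleaf : ∀ x ∈ Φ.source \ {p}, ∀ y ∈ Φ.source \ {p},
      (OnCommonLine 𝓛s (Φ.source \ {p}) x y ↔ SameSaddleNodeLeaf (Φ x) (Φ y)) ∧
      (OnCommonLine 𝓛p (Φ.source \ {p}) x y ↔ SameParallelLeaf (Φ x) (Φ y)) := by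
    intro x hx y hy
    have hzx : ψ x ∈ Φ₀.source \ {(0, 0)} := himage ▸ mem_image_of_mem _ hx
    have hzy : ψ y ∈ Φ₀.source \ {(0, 0)} := himage ▸ mem_image_of_mem _ hy
    obtain ⟨h1, h2⟩ := hΦl _ hzx _ hzy
    have h3 := onCommonLine_iff hφ S (𝓛 := 𝓛s) (ℓ := slopeField (IsLocalPair.extend r m)) hWs (fun q hq v => by
      obtain ⟨-, h4, h5, h6⟩ := hO q (hsO q hq.1)
      rw [((h6 hq.2).2 v _ rfl).1, hSapp, hSapp, slopeField, mem_ofPred_eq,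
        hloc.extend_eq h4 h5]) hx hy
    have h3' := onCommonLine_iff hφ S (𝓛 := 𝓛p)
      (ℓ := coslopeField (fun u v => IsLocalPair.extend r (fun v u => n u v) v u)) hWs (fun q hq v => by
      obtain ⟨-, h4, h5, h6⟩ := hO q (hsO q hq.1)
      rw [((h6 hq.2).2 v _ rfl).2, hSapp, hSapp, coslopeField, mem_ofPred_eq,
        hloc.extend_eq h5 h4]) hx hy
    have e : (fun q => S (φ q)) '' (Φ.source \ {p}) = Φ₀.source \ {(0, 0)} := himage
    rw [e] at h3 h3'
    exact ⟨h3.trans h1, h3'.trans h2⟩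
  refine ⟨Φ, hpΦ, hΦp, htarget, fun q hq => ⟨fun hu => ?_, ?_⟩, hleaf, ?_, ?_⟩
  · by_contra hne
    exact ((hO q (hsO q hq)).2.2.2 hne).1 hu
  · rintro rfl
    exact H.isUmbilic
  · exact ncard_separatrices_saddleNode Φ hpΦ hΦp htarget fun x hx y hy => (hleaf x hx y hy).1
  · exact ncard_separatrices_parallel Φ hpΦ hΦp htarget fun x hx y hy => (hleaf x hx y hy).2

end IsMongeFrame

lemma contDiffAt_of_graph {M : Type*} [TopologicalSpace M] [ChartedSpace E2 M]
    {n : WithTop ℕ∞} [IsManifold (𝓡 2) n M] {α : M → E3}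
    (hα : ContMDiff (𝓡 2) (𝓡 3) n α) {φ : OpenPartialHomeomorph M E2}
    (hφ : φ ∈ IsManifold.maximalAtlas (𝓡 2) n M) {Γ : E3 ≃ᵃⁱ[ℝ] E3} {h : E2 → ℝ}
    (hgraph : ∀ x ∈ φ.target, Γ (α (φ.symm x)) = graphMap h x) {x : E2} (hx : x ∈ φ.target) :
    ContDiffAt ℝ n h x := by
  have h1 : ContDiffAt ℝ n (fun x => α (φ.symm x)) x :=
    (hα.contMDiffAt.comp x (contMDiffAt_symm_of_mem_maximalAtlas hφ hx)).contDiffAt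
  have h2 : ContDiffAt ℝ n (fun x => Γ (α (φ.symm x)) 2) x :=
    (EuclideanSpace.proj (𝕜 := ℝ) (2 : Fin 3)).contDiff.contDiffAt.comp x
      ((contDiff_affineIsometry Γ).contDiffAt.comp x h1)
  refine h2.congr_of_eventuallyEq ?_
  filter_upwards [φ.open_target.mem_nhds hx] with y hy
  rw [hgraph y hy]
  rfl

theorem mainTheorem7 {M : Type*} [TopologicalSpace M] [ChartedSpace E2 M]
    [IsManifold (𝓡 2) ∞ M] (hM : OrientedAtlas M)
    (r : ℕ∞) (hr : 5 ≤ r) (α : M → E3) (hα : IsSurfaceImmersion r α) (p : M)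
    -- a Monge chart at `p`: after an isometry of space, the surface is the graph of `h`
    (φ : OpenPartialHomeomorph M E2) (hφ : φ ∈ IsManifold.maximalAtlas (𝓡 2) r M)
    (hp : p ∈ φ.source) (hp0 : φ p = 0)
    (Γ : E3 ≃ᵃⁱ[ℝ] E3) (h : E2 → ℝ)
    (hgraph : ∀ x ∈ φ.target, Γ (α (φ.symm x)) = !₂[x 0, x 1, h x])
    (k a b c A B C D E : ℝ)
    (htaylor : (fun x : E2 => h x -
        (k / 2 * (x 0 ^ 2 + x 1 ^ 2) + a / 6 * x 0 ^ 3 + b / 2 * (x 0 * x 1 ^ 2)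
          + c / 6 * x 1 ^ 3 + A / 24 * x 0 ^ 4 + B / 6 * (x 0 ^ 3 * x 1)
          + C / 4 * (x 0 ^ 2 * x 1 ^ 2) + D / 6 * (x 0 * x 1 ^ 3) + E / 24 * x 1 ^ 4))
      =O[𝓝 0] (fun x : E2 => ‖x‖ ^ 5))
    (hab : a = b) (hb : b ≠ 0) (hχ : b * (C - A + 2 * k ^ 3) - c * B ≠ 0) :
    -- `p` is of type `D¹₂,₃`, and the two Morse points of the surface over `p` are cones
    IsTypeD23 α φ p ∧
    (∀ ℓ ∈ transversalityFailure α φ p, IsMorseCone (torsionInChart α φ ℓ) (φ p, 0)) ∧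
    -- the Lie–Cartan field has a saddle-node at `p₀ = (0, 0, 0)`, whose center manifold is
    -- transversal to the projective line `u = v = 0` over `p`
    IsSaddleNode (lieCartan h) (curvT h) (0, 0) ∧
    (∀ γ g, IsCenterCurve (lieCartan h) (curvT h) (0, 0) γ g → (deriv γ 0).1 ≠ 0) ∧
    -- the local principal configuration
    (HasD23Configuration α p (minimalField α) (maximalField α) ∨
      HasD23Configuration α p (maximalField α) (minimalField α)) := by
  have hr' : ((5 : ℕ) : WithTop ℕ∞) ≤ (r : WithTop ℕ∞) :=
    WithTop.coe_le_coe.2 (show ((5 : ℕ) : ℕ∞) ≤ r from hr)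
  have : IsManifold (𝓡 2) r M := IsManifold.of_le (n := ∞) (by exact_mod_cast le_top)
  have : IsManifold (𝓡 2) 1 M := IsManifold.of_le (n := ∞) (by exact_mod_cast le_top)
  have hφ1 : φ ∈ IsManifold.maximalAtlas (𝓡 2) 1 M :=
    IsManifold.maximalAtlas_subset_of_le (le_trans (by norm_cast) hr') hφ
  have hgraph' : ∀ x ∈ φ.target, Γ (α (φ.symm x)) = graphMap h x := hgraph
  have h0 : (0 : E2) ∈ φ.target := hp0 ▸ φ.map_source hp
  have hsm : ∀ x ∈ φ.target, ContDiffAt ℝ (5 : ℕ) h x := fun x hx =>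
    (contDiffAt_of_graph hα.contMDiff hφ hgraph' hx).of_le hr'
  obtain ⟨jL, jM, jN⟩ := hasCoeffJet_coeff φ.open_target h0 hsm
    (isMongeJet_of_isBigO φ.open_target h0 hsm htaylor) hab
  have HU : IsMongeUmbilic h φ.target b c B (C - A + 2 * k ^ 3) :=
    ⟨φ.open_target, h0, hsm, jL, jM, jN, hb, hχ⟩
  have HG : IsGraphChart α φ Γ h :=
    ⟨⟨(contMDiffOn_of_mem_maximalAtlas hφ1).mdifferentiableOn one_ne_zero,
      (contMDiffOn_symm_of_mem_maximalAtlas hφ1).mdifferentiableOn one_ne_zero⟩, hgraph', hsm⟩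
  obtain ⟨δ, hδ, hw⟩ := exists_wedge_isometry Γ.symm.linearIsometryEquiv
  obtain ⟨ε₀, hε₀, hev⟩ := IsGraphChart.exists_sign_chartDet hM hφ1 hp
  have HF : IsMongeFrame α φ Γ h p (ε₀ * δ) b c B (C - A + 2 * k ^ 3) :=
    { HG, HU with
      mem_source := hp
      apply_eq := hp0
      sign := mul_self_of_abs_eq_one (by rw [abs_mul, hε₀, hδ, one_mul])
      gauss := by
        filter_upwards [hev, φ.open_source.mem_nhds hp] with q h1 h2
        exact HG.gaussMap_eq hδ hw h2 hε₀ h1 }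
  obtain ⟨h1, h2⟩ := HF.isTypeD23
  refine ⟨⟨HF.isUmbilic, h1, fun ℓ hℓ => (h2 ℓ hℓ).toIsMorseZero⟩, h2, HU.isSaddleNode,
    fun γ g hγ h3 => (HU.deriv_centerCurve hγ).2 (by rw [h3]; rfl), HF.hasD23Configuration hφ1⟩
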